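/- Let $\Bbbk$ be a commutative ring of characteristic not equal to two and let $z\in\Bbbk$ be invertible. Let $\mathcal{AQ}(z)$ be the quantum affine isomeric supercategory: the strict monoidal $\Bbbk$-linear supercategory generated by objects $\uparrow,\downarrow$, even morphisms $T,T'\colon \uparrow\otimes\uparrow\to\uparrow\otimes\uparrow$ (the positive and the negative upward crossing), $S'\colon \uparrow\otimes\downarrow\to\downarrow\otimes\uparrow$ (the negative right crossing), $\mathrm{ev}\colon \downarrow\otimes\uparrow\to\mathbf 1$ (left cap), $\mathrm{coev}\colon \mathbf 1\to\uparrow\otimes\downarrow$ (left cup), and odd morphisms $c,d\colon \uparrow\to\uparrow$ (the closed and the open Clifford token). Put $L=(\mathrm{ev}\otimes 1_{\uparrow\downarrow})(1_\downarrow\otimes T\otimes 1_\downarrow)(1_{\downarrow\uparrow}\otimes\mathrm{coev})$ (positive left crossing), $D=(\mathrm{ev}\otimes 1_{\downarrow\downarrow})(1_\downarrow\otimes L\otimes 1_\downarrow)(1_{\downarrow\downarrow}\otimes\mathrm{coev})$ (positive downward crossing), $\mathrm{ev}'=\mathrm{ev}\,S'$ (right cap), $\mathrm{coev}'=S'\,\mathrm{coev}$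 (right cup), and $S=S'+z\,\mathrm{coev}'\mathrm{ev}'$ (positive right crossing). The defining relations are: $TT'=T'T=1$, $LS'=1$, $S'L=1$, the braid relation $(T\otimes1)(1\otimes T)(T\otimes 1)=(1\otimes T)(T\otimes1)(1\otimes T)$, the skein relation $T-T'=z$, the zigzag relations $(1_\uparrow\otimes\mathrm{ev})(\mathrm{coev}\otimes1_\uparrow)=1_\uparrow$ and $(\mathrm{ev}\otimes1_\downarrow)(1_\downarrow\otimes\mathrm{coev})=1_\downarrow$, the relations $\mathrm{ev}'\mathrm{coev}=0$, $c^2=d^2=-1$, $T(c\otimes1)=(1\otimes c)T$, $T(1\otimes d)=(d\otimes1)T$, and $\mathrm{ev}'(c\otimes1_\downarrow)\mathrm{coev}=\mathrm{ev}'(d\otimes1_\downarrow)\mathrm{coev}=0$. The super interchange law is $(f'\otimes g)(f\otimes g')=(-1)^{\bar f\bar g}f'f\otimes gg'$; $f\otimes g$ is drawn with $f$ to the left of $g$, and $fg$ with $f$ above $g$. For $m\in\mathbb Z$, the zebra with label $m$ on an upward strand is the composite $\zeta_m\colon\uparrow\to\uparrow$ of $|m|$ alternating tokens, whose bottom token is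 open if $m>0$ and closed if $m<0$ (so $\zeta_0=1_\uparrow$); on a downward strand it is $(\mathrm{ev}\otimes1_\downarrow)(1_\downarrow\otimes\zeta_m\otimes1_\downarrow)(1_\downarrow\otimes\mathrm{coev})$. The zebra bubbles are $R_m=\mathrm{ev}'(\zeta_m\otimes 1_\downarrow)\mathrm{coev}$ and $L_m=\mathrm{ev}(1_\downarrow\otimes\zeta_m)\mathrm{coev}'$. Let $X=X_1\otimes\cdots\otimes X_r$ and $Y=Y_1\otimes\cdots\otimes Y_s$ be objects, with $X_i,Y_j\in\{\uparrow,\downarrow\}$. An $(X,Y)$-matching is a bijection from $\{i:X_i={\uparrow}\}\sqcup\{j:Y_j={\downarrow}\}$ to $\{i:X_i={\downarrow}\}\sqcup\{j:Y_j={\uparrow}\}$. A positive reduced lift of a matching is a string diagram representing a morphism $X\to Y$, built from crossings, cups and caps, in which the endpoints of each string correspond under the matching, there are no Clifford tokens and no closed strings, no string crosses itself, no two strings cross more than once, and all crossings are positive (one of $T,S,D,L$). For all $X,Y$, fix a set $B(X,Y)$ consisting of one positive reduced lift for each $(X,Y)$-matching, and let $B_{\mathrm{zebra}}(X,Y)$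 be the set of all morphisms obtained from elements of $B(X,Y)$ by adding a zebra, labelled by an arbitrary integer (possibly zero), near the terminus of each string. Here all zebras on strings terminating at the top are at the same height, all zebras on strings terminating at the bottom are at the same height and below the former, and among zebras at the same height those further to the left are considered to be above those further to the right. Let $\mathrm{Sym}$ be the $\Bbbk$-algebra of symmetric functions over $\Bbbk$, with elementary and complete homogeneous symmetric functions $e_r$ and $h_r$. **Proposition.** There is a homomorphism of $\Bbbk$-algebras $\beta\colon\mathrm{Sym}\to\mathrm{End}_{\mathcal{AQ}(z)}(\mathbf 1)$ with $\beta(e_r)=(-1)^{r-1}z\,L_{2r}$ and $\beta(h_r)=z\,R_{2r}$ for all $r\ge1$; and for all objects $X,Y$ of $\mathcal{AQ}(z)$, the set $B_{\mathrm{zebra}}(X,Y)$ spans $\mathrm{Hom}_{\mathcal{AQ}(z)}(X,Y)$ as a right $\mathrm{Sym}$-supermodule with respect to the action $f\cdot a=f\otimes\beta(a)$. -/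

import Mathlib

open CategoryTheory

noncomputable section

namespace QuantumIsomeric

universe u

/-! ## The free data: objects, generating morphisms, monomial diagrams -/

/-- The two generating objects. -/
inductive Arrow : Type
  | up : Arrow
  | down : Arrow

/-- The dual generating object. -/
def Arrow.dual : Arrow → Arrow
  | .up => .down
  | .down => .up

/-- Objects: tensor products of generating objects; the unit object is the empty word and the
tensor product is concatenation. -/
abbrev Word : Type := List Arrow

open Arrow

/-- The generating morphisms of the quantum affine isomeric supercategory. The crossings
`posUp`, `negUp` are the two crossings of two upward strands; in `posUp` the strand going from the
bottom left to the top right is the over-strand, in `negUp` the other one. In `negRight` the upward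
strand (from the bottom left to the top right) is the over-strand. `leftCap` and `leftCup` are
oriented to the left, `closedTok` and `openTok` are the closed and the open Clifford token. -/
inductive Gen : Word → Word → Type
  | posUp : Gen [up, up] [up, up]
  | negUp : Gen [up, up] [up, up]
  | negRight : Gen [up, down] [down, up]
  | leftCap : Gen [down, up] []
  | leftCup : Gen [] [up, down]
  | closedTok : Gen [up] [up]
  | openTok : Gen [up] [up]

/-- The number of Clifford tokens in a generator; its class modulo two is the parity. -/
def Gen.tokens : {X Y : Word} → Gen X Y → ℕ
  | _, _, .closedTok => 1
  | _, _, .openTok => 1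
  | _, _, _ => 0

/-- Formal monomials in the generators. `comp f g` is the vertical composite `f ∘ g` (`f` is drawn
above `g`); `tensor f g` is the horizontal composite `f ⊗ g` (`f` is drawn to the left of `g`). -/
inductive Diag : Word → Word → Type
  | gen {X Y : Word} (g : Gen X Y) : Diag X Y
  | id (X : Word) : Diag X X
  | comp {X Y Z : Word} (f : Diag Y Z) (g : Diag X Y) : Diag X Z
  | tensor {X Y X' Y' : Word} (f : Diag X Y) (g : Diag X' Y') : Diag (X ++ X') (Y ++ Y')

namespace Diag

/-- The number of Clifford tokens; its class modulo two is the parity of the monomial. -/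
def tokens : {X Y : Word} → Diag X Y → ℕ
  | _, _, .gen g => g.tokens
  | _, _, .id _ => 0
  | _, _, .comp f g => f.tokens + g.tokens
  | _, _, .tensor f g => f.tokens + g.tokens

/-- Transport along equalities of words (needed since concatenation of words is associative and
unital only up to propositional equality). -/
def cast {X Y X' Y' : Word} (hX : X = X') (hY : Y = Y') (d : Diag X Y) : Diag X' Y' :=
  hX ▸ hY ▸ d

/-- Positive upward crossing. -/
def posUp : Diag [up, up] [up, up] := .gen .posUp
/-- Negative upward crossing. -/
def negUp : Diag [up, up] [up, up] := .gen .negUp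
/-- Negative right crossing. -/
def negRight : Diag [up, down] [down, up] := .gen .negRight
/-- Left cap. -/
def leftCap : Diag [down, up] [] := .gen .leftCap
/-- Left cup. -/
def leftCup : Diag [] [up, down] := .gen .leftCup
/-- Closed Clifford token on an upward strand. -/
def closedTok : Diag [up] [up] := .gen .closedTok
/-- Open Clifford token on an upward strand. -/
def openTok : Diag [up] [up] := .gen .openTok

/-- Identity of the upward strand. -/
abbrev idUp : Diag [up] [up] := .id [up]
/-- Identity of the downward strand. -/
abbrev idDown : Diag [down] [down] := .id [down]

/-- Positive left crossing: the upward strand (from the bottom right to the top left) is over;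
it is the positive upward crossing with one strand bent by a left cup and a left cap. -/
def posLeft : Diag [down, up] [up, down] :=
  comp (tensor leftCap (.id [up, down]) :)
    (comp (tensor (tensor idDown posUp) idDown :) (tensor (.id [down, up]) leftCup :) :)

/-- Positive downward crossing: the positive left crossing with one strand bent. -/
def posDown : Diag [down, down] [down, down] :=
  comp (tensor leftCap (.id [down, down]) :)
    (comp (tensor (tensor idDown posLeft) idDown :) (tensor (.id [down, down]) leftCup :) :)

/-- Right cap. -/
def rightCap : Diag [up, down] [] := comp leftCap negRight

/-- Right cup. -/
def rightCup : Diag [] [down, up] := comp negRight leftCup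

end Diag

/-! ## The relations -/

variable {k : Type u} [CommRing k]

open Diag in
/-- The defining relations: each constructor says that the displayed linear combination of monomial
diagrams is zero. -/
inductive DefRel (z : k) : {X Y : Word} → (Diag X Y →₀ k) → Prop
  -- inverse crossings
  | neg_pos : DefRel z (.single (comp negUp posUp) 1 - .single (.id [up, up]) 1)
  | pos_neg : DefRel z (.single (comp posUp negUp) 1 - .single (.id [up, up]) 1)
  | left_right : DefRel z (.single (comp posLeft negRight) 1 - .single (.id [up, down]) 1)
  | right_left : DefRel z (.single (comp negRight posLeft) 1 - .single (.id [down, up]) 1)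
  -- braid relation
  | braid : DefRel z
      (.single (comp (tensor posUp idUp :) (comp (tensor idUp posUp :) (tensor posUp idUp :))) 1
        - .single (comp (tensor idUp posUp :)
            (comp (tensor posUp idUp :) (tensor idUp posUp :))) 1)
  -- skein relation
  | skein : DefRel z (.single posUp 1 - .single negUp 1 - .single (.id [up, up]) z)
  -- closed Clifford tokens, and vanishing of the clockwise bubble
  | closed_sq : DefRel z (.single (comp closedTok closedTok) 1 + .single idUp 1)
  | closed_slide : DefRel z
      (.single (comp posUp (tensor closedTok idUp :)) 1
        - .single (comp (tensor idUp closedTok :) posUp) 1)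
  | closed_bubble : DefRel z
      (.single (comp rightCap (comp (tensor closedTok idDown :) leftCup)) 1)
  | bubble : DefRel z (.single (comp rightCap leftCup) 1)
  -- left adjunction
  | zigzag_up : DefRel z
      (.single (comp (tensor idUp leftCap :) (tensor leftCup idUp :)) 1 - .single idUp 1)
  | zigzag_down : DefRel z
      (.single (comp (tensor leftCap idDown :) (tensor idDown leftCup :)) 1 - .single idDown 1)
  -- open Clifford tokens
  | open_sq : DefRel z (.single (comp openTok openTok) 1 + .single idUp 1)
  | open_slide : DefRel z
      (.single (comp posUp (tensor idUp openTok :)) 1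
        - .single (comp (tensor openTok idUp :) posUp) 1)
  | open_bubble : DefRel z
      (.single (comp rightCap (comp (tensor openTok idDown :) leftCup)) 1)

/-- The relations that hold in the strict monoidal `k`-linear supercategory with the above
generators and defining relations: axioms of a strict monoidal supercategory (with the super
interchange law), the defining relations, and closure under composition and tensor product with
arbitrary diagrams on either side. -/
inductive Rel (z : k) : {X Y : Word} → (Diag X Y →₀ k) → Prop
  -- category axioms
  | id_comp {X Y : Word} (f : Diag X Y) :
      Rel z (.single (.comp (.id Y) f) 1 - .single f 1)
  | comp_id {X Y : Word} (f : Diag X Y) :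
      Rel z (.single (.comp f (.id X)) 1 - .single f 1)
  | comp_assoc {W X Y Z : Word} (f : Diag Y Z) (g : Diag X Y) (h : Diag W X) :
      Rel z (.single (.comp (.comp f g) h) 1 - .single (.comp f (.comp g h)) 1)
  -- strict monoidal structure
  | tensor_id (X Y : Word) :
      Rel z (.single (.tensor (.id X) (.id Y)) 1 - .single (.id (X ++ Y)) 1)
  | interchange {X Y Z X' Y' Z' : Word} (f' : Diag Y Z) (g : Diag Y' Z') (f : Diag X Y)
      (g' : Diag X' Y') :
      Rel z (.single (.comp (.tensor f' g) (.tensor f g')) 1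
        - .single (.tensor (.comp f' f) (.comp g g')) ((-1) ^ (f.tokens * g.tokens)))
  | tensor_assoc {X Y X' Y' X'' Y'' : Word} (f : Diag X Y) (g : Diag X' Y') (h : Diag X'' Y'') :
      Rel z (.single ((Diag.tensor (.tensor f g) h).cast
          (List.append_assoc X X' X'') (List.append_assoc Y Y' Y'')) 1
        - .single (.tensor f (.tensor g h)) 1)
  | unit_tensor {X Y : Word} (f : Diag X Y) :
      Rel z (.single ((Diag.tensor (.id []) f).cast (List.nil_append X) (List.nil_append Y)) 1
        - .single f 1)
  | tensor_unit {X Y : Word} (f : Diag X Y) :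
      Rel z (.single ((Diag.tensor f (.id [])).cast (List.append_nil X) (List.append_nil Y)) 1
        - .single f 1)
  -- defining relations
  | of {X Y : Word} {r : Diag X Y →₀ k} (h : DefRel z r) : Rel z r
  -- closure
  | comp_left {X Y Z : Word} (d : Diag Y Z) {r : Diag X Y →₀ k} (h : Rel z r) :
      Rel z (r.mapDomain fun e => Diag.comp d e)
  | comp_right {X Y Z : Word} {r : Diag Y Z →₀ k} (h : Rel z r) (d : Diag X Y) :
      Rel z (r.mapDomain fun e => Diag.comp e d)
  | tensor_left {X Y X' Y' : Word} (d : Diag X Y) {r : Diag X' Y' →₀ k} (h : Rel z r) :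
      Rel z (r.mapDomain fun e => Diag.tensor d e)
  | tensor_right {X Y X' Y' : Word} {r : Diag X Y →₀ k} (h : Rel z r) (d : Diag X' Y') :
      Rel z (r.mapDomain fun e => Diag.tensor e d)

/-! ## The supercategory -/

/-- The submodule of all linear combinations of monomial diagrams that are zero in the
supercategory. -/
def relSub (z : k) (X Y : Word) : Submodule k (Diag X Y →₀ k) :=
  Submodule.span k {r | Rel z r}

/-- The morphism space `Hom(X, Y)`. -/
abbrev HomSpace (z : k) (X Y : Word) : Type u := (Diag X Y →₀ k) ⧸ relSub z X Y

/-- The morphism represented by a monomial diagram. -/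
def ofDiag (z : k) {X Y : Word} (d : Diag X Y) : HomSpace z X Y :=
  (relSub z X Y).mkQ (.single d 1)

/-- An operation on basis elements that respects relations extends to a bilinear operation on the
quotients. -/
def bilift {D₁ D₂ D₃ : Type} (S₁ : Set (D₁ →₀ k)) (S₂ : Set (D₂ →₀ k)) (S₃ : Set (D₃ →₀ k))
    (op : D₁ → D₂ → D₃)
    (h₁ : ∀ r ∈ S₁, ∀ d, r.mapDomain (fun e => op e d) ∈ S₃)
    (h₂ : ∀ r ∈ S₂, ∀ d, r.mapDomain (fun e => op d e) ∈ S₃) :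
    ((D₁ →₀ k) ⧸ Submodule.span k S₁) →ₗ[k] ((D₂ →₀ k) ⧸ Submodule.span k S₂) →ₗ[k]
      ((D₃ →₀ k) ⧸ Submodule.span k S₃) :=
  Submodule.liftQ _
    (Finsupp.linearCombination k fun d =>
      Submodule.mapQ (Submodule.span k S₂) (Submodule.span k S₃)
        (Finsupp.lmapDomain k k fun e => op d e)
        (Submodule.span_le.2 fun r hr => Submodule.subset_span (h₂ r hr d)))
    (Submodule.span_le.2 fun r hr => by
      refine LinearMap.mem_ker.2 (Submodule.linearMap_qext _ (Finsupp.lhom_ext' fun d => ?_))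
      refine LinearMap.ext_ring ?_
      have key : ∀ s : D₁ →₀ k,
          (Finsupp.linearCombination k (fun d =>
            Submodule.mapQ (Submodule.span k S₂) (Submodule.span k S₃)
              (Finsupp.lmapDomain k k fun e => op d e)
              (Submodule.span_le.2 fun r hr => Submodule.subset_span (h₂ r hr d))) s)
            ((Submodule.span k S₂).mkQ (Finsupp.single d 1)) =
          (Submodule.span k S₃).mkQ (s.mapDomain fun e => op e d) := by
        intro s
        induction s using Finsupp.induction_linear with
        | zero => simp
        | add f g hf hg => simp only [map_add, LinearMap.add_apply, hf, hg, Finsupp.mapDomain_add]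
        | single a b =>
          rw [Finsupp.linearCombination_single, LinearMap.smul_apply, Submodule.mkQ_apply,
            Submodule.mapQ_apply, Finsupp.lmapDomain_apply, Finsupp.mapDomain_single,
            Finsupp.mapDomain_single, Submodule.mkQ_apply, ← Submodule.Quotient.mk_smul,
            Finsupp.smul_single, smul_eq_mul, mul_one]
      simpa using (key r).trans ((Submodule.Quotient.mk_eq_zero _).2
        (Submodule.subset_span (h₁ r hr d))))

theorem bilift_mk {D₁ D₂ D₃ : Type} (S₁ : Set (D₁ →₀ k)) (S₂ : Set (D₂ →₀ k))
    (S₃ : Set (D₃ →₀ k)) (op : D₁ → D₂ → D₃)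
    (h₁ : ∀ r ∈ S₁, ∀ d, r.mapDomain (fun e => op e d) ∈ S₃)
    (h₂ : ∀ r ∈ S₂, ∀ d, r.mapDomain (fun e => op d e) ∈ S₃) (d : D₁) (e : D₂) :
    bilift S₁ S₂ S₃ op h₁ h₂ ((Submodule.span k S₁).mkQ (.single d 1))
      ((Submodule.span k S₂).mkQ (.single e 1)) =
      (Submodule.span k S₃).mkQ (.single (op d e) 1) := by
  simp [bilift, Finsupp.mapDomain_single]

/-- Vertical composition `f ∘ g`. -/
def compHom (z : k) {X Y Z : Word} :
    HomSpace z Y Z →ₗ[k] HomSpace z X Y →ₗ[k] HomSpace z X Z :=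
  bilift _ _ _ Diag.comp (fun _ hr d => Rel.comp_right hr d) (fun _ hr d => Rel.comp_left d hr)

/-- Horizontal composition `f ⊗ g`. -/
def tensorHom (z : k) {X Y X' Y' : Word} :
    HomSpace z X Y →ₗ[k] HomSpace z X' Y' →ₗ[k] HomSpace z (X ++ X') (Y ++ Y') :=
  bilift _ _ _ Diag.tensor (fun _ hr d => Rel.tensor_right hr d)
    (fun _ hr d => Rel.tensor_left d hr)

theorem compHom_ofDiag (z : k) {X Y Z : Word} (f : Diag Y Z) (g : Diag X Y) :
    compHom z (ofDiag z f) (ofDiag z g) = ofDiag z (.comp f g) :=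
  bilift_mk _ _ _ _ _ _ f g

theorem tensorHom_ofDiag (z : k) {X Y X' Y' : Word} (f : Diag X Y) (g : Diag X' Y') :
    tensorHom z (ofDiag z f) (ofDiag z g) = ofDiag z (.tensor f g) :=
  bilift_mk _ _ _ _ _ _ f g

theorem homSpace_ext {z : k} {X Y : Word} {M : Type*} [AddCommGroup M] [Module k M]
    {F G : HomSpace z X Y →ₗ[k] M} (h : ∀ d, F (ofDiag z d) = G (ofDiag z d)) : F = G :=
  Submodule.linearMap_qext _ (Finsupp.lhom_ext' fun d => LinearMap.ext_ring (h d))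

theorem ofDiag_eq_of_rel {z : k} {X Y : Word} {d e : Diag X Y}
    (h : Rel z (.single d 1 - .single e 1)) : ofDiag z d = ofDiag z e := by
  have := (Submodule.Quotient.mk_eq_zero (relSub z X Y)).2 (Submodule.subset_span h)
  rw [Submodule.Quotient.mk_sub, sub_eq_zero] at this
  exact this

theorem id_compHom (z : k) {X Y : Word} (f : HomSpace z X Y) :
    compHom z (ofDiag z (.id Y)) f = f := by
  refine LinearMap.congr_fun (f := compHom z (ofDiag z (.id Y))) (g := LinearMap.id)
    (homSpace_ext fun d => ?_) f
  rw [compHom_ofDiag]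
  exact ofDiag_eq_of_rel (.id_comp d)

theorem compHom_id (z : k) {X Y : Word} (f : HomSpace z X Y) :
    compHom z f (ofDiag z (.id X)) = f := by
  refine LinearMap.congr_fun (f := (compHom z).flip (ofDiag z (.id X))) (g := LinearMap.id)
    (homSpace_ext fun d => ?_) f
  rw [LinearMap.flip_apply, compHom_ofDiag]
  exact ofDiag_eq_of_rel (.comp_id d)

theorem homSpace_induction {z : k} {X Y : Word} {P : HomSpace z X Y → Prop}
    (f : HomSpace z X Y) (h0 : P 0) (hadd : ∀ a b, P a → P b → P (a + b))
    (hsmul : ∀ (c : k) d, P (c • ofDiag z d)) : P f := by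
  obtain ⟨s, rfl⟩ := Submodule.mkQ_surjective _ f
  induction s using Finsupp.induction_linear with
  | zero => simpa using h0
  | add a b ha hb => rw [map_add]; exact hadd _ _ ha hb
  | single a b =>
    have : (Finsupp.single a b : Diag X Y →₀ k) = b • Finsupp.single a 1 := by simp
    rw [this, map_smul]
    exact hsmul b a

theorem compHom_assoc (z : k) {W X Y Z : Word} (f : HomSpace z Y Z) (g : HomSpace z X Y)
    (h : HomSpace z W X) :
    compHom z (compHom z f g) h = compHom z f (compHom z g h) := by
  induction f using homSpace_induction with
  | h0 => simp only [map_zero, LinearMap.zero_apply]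
  | hadd a b ha hb => simp only [map_add, LinearMap.add_apply, ha, hb]
  | hsmul c f =>
  induction g using homSpace_induction with
  | h0 => simp only [map_zero, LinearMap.zero_apply]
  | hadd a b ha hb => simp only [map_add, LinearMap.add_apply, ha, hb]
  | hsmul c' g =>
  induction h using homSpace_induction with
  | h0 => simp only [map_zero]
  | hadd a b ha hb => simp only [map_add, ha, hb]
  | hsmul c'' h =>
  simp only [map_smul, LinearMap.smul_apply, compHom_ofDiag, ofDiag_eq_of_rel (.comp_assoc f g h)]

/-- The quantum affine isomeric supercategory with parameter `z` (its objects). -/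
def AQ (_z : k) : Type := Word

/-- The underlying `k`-linear category; `f ≫ g` is the vertical composite `g ∘ f`. -/
instance (z : k) : Category (AQ z) where
  Hom X Y := HomSpace z X Y
  id X := ofDiag z (.id X)
  comp f g := compHom z g f
  id_comp f := compHom_id z f
  comp_id f := id_compHom z f
  assoc f g h := (compHom_assoc z h g f).symm

section
variable (z : k) {X Y Z : Word}
theorem compHom_add (g : HomSpace z Y Z) (f f' : HomSpace z X Y) :
    compHom z g (f + f') = compHom z g f + compHom z g f' := map_add _ _ _
theorem add_compHom (g g' : HomSpace z Y Z) (f : HomSpace z X Y) :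
    compHom z (g + g') f = compHom z g f + compHom z g' f := LinearMap.map_add₂ _ _ _ _
theorem compHom_smul (c : k) (g : HomSpace z Y Z) (f : HomSpace z X Y) :
    compHom z g (c • f) = c • compHom z g f := map_smul _ _ _
theorem smul_compHom (c : k) (g : HomSpace z Y Z) (f : HomSpace z X Y) :
    compHom z (c • g) f = c • compHom z g f := LinearMap.map_smul₂ _ _ _ _
end

instance (z : k) : Preadditive (AQ z) where
  homGroup X Y := inferInstanceAs (AddCommGroup (HomSpace z X Y))
  add_comp _ _ _ f f' g := compHom_add z g f f'
  comp_add _ _ _ f g g' := add_compHom z g g' f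

instance (z : k) : Linear k (AQ z) where
  homModule X Y := inferInstanceAs (Module k (HomSpace z X Y))
  smul_comp _ _ _ c f g := compHom_smul z c g f
  comp_smul _ _ _ f c g := smul_compHom z c g f

namespace AQ

/-- The object given by a word. -/
def obj (z : k) (X : Word) : AQ z := X

/-- The unit object. -/
abbrev unit (z : k) : AQ z := obj z []

/-- The morphism represented by a monomial diagram. -/
def mor (z : k) {X Y : Word} (d : Diag X Y) : obj z X ⟶ obj z Y := ofDiag z d

/-- The tensor product of morphisms. -/
def tens (z : k) {X Y X' Y' : Word} (f : obj z X ⟶ obj z Y) (g : obj z X' ⟶ obj z Y') :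
    obj z (X ++ X') ⟶ obj z (Y ++ Y') := tensorHom z f g

/-- The identity morphism between equal words. -/
abbrev eqMor (z : k) {X Y : Word} (h : X = Y) : obj z X ⟶ obj z Y := eqToHom (congrArg (obj z) h)

end AQ

open AQ

/-! ## Zebras and zebra bubbles -/

namespace Diag

/-- `n` alternating Clifford tokens on an upward strand; the bottom one is open if `b` is `true` and
closed if `b` is `false`. -/
def alternating : Bool → ℕ → Diag [up] [up]
  | _, 0 => idUp
  | true, n + 1 => comp (alternating false n) openTok
  | false, n + 1 => comp (alternating true n) closedTok

/-- The zebra with label `m` on an upward strand: `|m|` alternating tokens, starting at the bottom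
with an open one if `m ≥ 0` and with a closed one if `m < 0`. -/
def zebraUp (m : ℤ) : Diag [up] [up] :=
  if 0 ≤ m then alternating true m.natAbs else alternating false m.natAbs

/-- The zebra with label `m` on a downward strand: the rotation of the zebra on an upward strand. -/
def zebraDown (m : ℤ) : Diag [down] [down] :=
  comp (tensor leftCap idDown :)
    (comp (tensor (tensor idDown (zebraUp m)) idDown :) (tensor idDown leftCup :) :)

/-- The clockwise bubble carrying a zebra with label `m` (on its upward, left-hand side). -/
def rightBubble (m : ℤ) : Diag [] [] :=
  comp rightCap (comp (tensor (zebraUp m) idDown :) leftCup)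

/-- The counterclockwise bubble carrying a zebra with label `m` (on its upward, right-hand side). -/
def leftBubble (m : ℤ) : Diag [] [] :=
  comp leftCap (comp (tensor idDown (zebraUp m) :) rightCup)

/-- The identity of a word with a zebra added on every upward strand, all at the same height; the
`i`-th strand (from the left) gets the label `l i` if it is upward. -/
def zebrasOnUp : (X : Word) → (ℕ → ℤ) → Diag X X
  | [], _ => .id []
  | up :: X, l => tensor (zebraUp (l 0)) (zebrasOnUp X fun i => l (i + 1))
  | down :: X, l => tensor idDown (zebrasOnUp X fun i => l (i + 1))

/-- The identity of a word with a zebra added on every downward strand, all at the same height. -/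
def zebrasOnDown : (X : Word) → (ℕ → ℤ) → Diag X X
  | [], _ => .id []
  | up :: X, l => tensor idUp (zebrasOnDown X fun i => l (i + 1))
  | down :: X, l => tensor (zebraDown (l 0)) (zebrasOnDown X fun i => l (i + 1))

end Diag

/-! ## Symmetric functions -/

/-- The algebra of symmetric functions over `k`: power series of bounded degree in countably many
variables that are invariant under all permutations of the variables. -/
def SymFun (k : Type u) [CommRing k] : Subalgebra k (MvPowerSeries ℕ k) where
  carrier := {f | (∃ n : ℕ, ∀ m : ℕ →₀ ℕ, MvPowerSeries.coeff m f ≠ 0 → m.degree ≤ n) ∧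
    ∀ σ : Equiv.Perm ℕ, MvPowerSeries.renameEquiv k σ f = f}
  mul_mem' := by
    classical
    rintro f g ⟨⟨a, ha⟩, hf⟩ ⟨⟨b, hb⟩, hg⟩
    refine ⟨⟨a + b, fun m hm => ?_⟩, fun σ => by rw [map_mul, hf, hg]⟩
    rw [MvPowerSeries.coeff_mul] at hm
    obtain ⟨p, hp, hne⟩ := Finset.exists_ne_zero_of_sum_ne_zero hm
    rw [← Finset.HasAntidiagonal.mem_antidiagonal.1 hp, map_add]
    exact add_le_add (ha _ (left_ne_zero_of_mul hne)) (hb _ (right_ne_zero_of_mul hne))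
  add_mem' := by
    rintro f g ⟨⟨a, ha⟩, hf⟩ ⟨⟨b, hb⟩, hg⟩
    refine ⟨⟨max a b, fun m hm => ?_⟩, fun σ => by rw [map_add, hf, hg]⟩
    rw [map_add] at hm
    by_cases h : MvPowerSeries.coeff m f = 0
    · rw [h, zero_add] at hm
      exact (hb m hm).trans (le_max_right a b)
    · exact (ha m h).trans (le_max_left a b)
  algebraMap_mem' := by
    classical
    intro c
    refine ⟨⟨0, fun m hm => ?_⟩, fun σ => AlgEquiv.commutes _ c⟩
    rw [MvPowerSeries.algebraMap_apply, MvPowerSeries.coeff_C] at hm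
    split_ifs at hm with h
    · simp [h]
    · exact absurd rfl hm


theorem mem_symFun_of_invariant (r : ℕ) (P : (ℕ →₀ ℕ) → Prop) [DecidablePred P]
    (hP : ∀ (σ : Equiv.Perm ℕ) m, P (m.embDomain σ.toEmbedding) ↔ P m) :
    (fun m => if m.degree = r ∧ P m then 1 else 0 : MvPowerSeries ℕ k) ∈ SymFun k := by
  refine ⟨⟨r, fun m hm => ?_⟩, fun σ => ?_⟩
  · change (if m.degree = r ∧ P m then (1 : k) else 0) ≠ 0 at hm
    by_contra h
    exact hm (if_neg fun h' => h h'.1.le)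
  · ext m
    obtain ⟨x, rfl⟩ : ∃ x : ℕ →₀ ℕ, x.embDomain σ.toEmbedding = m :=
      ⟨m.embDomain σ.symm.toEmbedding, by
        ext i
        obtain ⟨j, rfl⟩ := σ.surjective i
        obtain ⟨l, rfl⟩ := σ.symm.surjective j
        have h1 := Finsupp.embDomain_apply_self σ.toEmbedding
          (m.embDomain σ.symm.toEmbedding) (σ.symm l)
        have h2 := Finsupp.embDomain_apply_self σ.symm.toEmbedding m l
        simp only [Equiv.coe_toEmbedding] at h1 h2
        rw [h1, h2, Equiv.apply_symm_apply]⟩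
    have := MvPowerSeries.coeff_embDomain_rename σ.toEmbedding
      (fun m => if m.degree = r ∧ P m then 1 else 0 : MvPowerSeries ℕ k) x
    refine this.trans ?_
    change (if x.degree = r ∧ P x then (1 : k) else 0) =
      if (x.embDomain σ.toEmbedding).degree = r ∧ P (x.embDomain σ.toEmbedding) then 1 else 0
    simp only [hP]
    rw [Finsupp.embDomain_eq_mapDomain, Finsupp.degree_mapDomain]

namespace SymFun

/-- The elementary symmetric function of degree `r`: the sum of all squarefree monomials of
degree `r`. -/
def e (k : Type u) [CommRing k] (r : ℕ) : SymFun k := by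
  classical
  exact ⟨fun m => if m.degree = r ∧ ∀ i, m i ≤ 1 then 1 else 0,
    mem_symFun_of_invariant r (fun m => ∀ i, m i ≤ 1) fun σ m => by
      rw [← σ.forall_congr_right]
      exact forall_congr' fun i => by
        rw [show σ i = σ.toEmbedding i from rfl, Finsupp.embDomain_apply_self]⟩

/-- The complete homogeneous symmetric function of degree `r`: the sum of all monomials of
degree `r`. -/
def h (k : Type u) [CommRing k] (r : ℕ) : SymFun k :=
  ⟨fun m => if m.degree = r then 1 else 0, by
    have := mem_symFun_of_invariant (k := k) r (fun _ => True) fun _ _ => Iff.rfl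
    simp only [and_true] at this
    exact this⟩

end SymFun

/-! ## The action of symmetric functions on morphism spaces -/

theorem mor_cast (z : k) {X Y X' Y' : Word} (hX : X = X') (hY : Y = Y') (d : Diag X Y) :
    mor z (d.cast hX hY) = eqMor z hX.symm ≫ mor z d ≫ eqMor z hY := by
  subst hX hY
  simp [Diag.cast]

theorem tens_eqMor (z : k) {X Y X' Y' A B : Word} (hX : X = X') (hY : Y = Y')
    (f : obj z X' ⟶ obj z Y') (a : obj z A ⟶ obj z B) :
    tens z (eqMor z hX ≫ f ≫ eqMor z hY.symm) a =
      eqMor z (congrArg (· ++ A) hX) ≫ tens z f a ≫ eqMor z (congrArg (· ++ B) hY.symm) := by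
  subst hX hY
  simp

theorem mor_induction {z : k} {X Y : Word} {P : (obj z X ⟶ obj z Y) → Prop}
    (f : obj z X ⟶ obj z Y) (h0 : P 0) (hadd : ∀ a b, P a → P b → P (a + b))
    (hsmul : ∀ (c : k) d, P (c • mor z d)) : P f :=
  homSpace_induction (P := P) f h0 hadd hsmul

section
variable (z : k) {X Y X' Y' : Word}
theorem tens_add (f : obj z X ⟶ obj z Y) (g g' : obj z X' ⟶ obj z Y') :
    tens z f (g + g') = tens z f g + tens z f g' := map_add (tensorHom z f) g g'
theorem add_tens (f f' : obj z X ⟶ obj z Y) (g : obj z X' ⟶ obj z Y') :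
    tens z (f + f') g = tens z f g + tens z f' g := LinearMap.map_add₂ (tensorHom z) f f' g
theorem tens_smul (c : k) (f : obj z X ⟶ obj z Y) (g : obj z X' ⟶ obj z Y') :
    tens z f (c • g) = c • tens z f g := map_smul (tensorHom z f) c g
theorem smul_tens (c : k) (f : obj z X ⟶ obj z Y) (g : obj z X' ⟶ obj z Y') :
    tens z (c • f) g = c • tens z f g := LinearMap.map_smul₂ (tensorHom z) c f g
theorem tens_zero (f : obj z X ⟶ obj z Y) :
    tens z f (0 : obj z X' ⟶ obj z Y') = 0 := map_zero (tensorHom z f)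
theorem zero_tens (g : obj z X' ⟶ obj z Y') :
    tens z (0 : obj z X ⟶ obj z Y) g = 0 := LinearMap.map_zero₂ (tensorHom z) g
theorem tens_mor (f : Diag X Y) (g : Diag X' Y') :
    tens z (mor z f) (mor z g) = mor z (.tensor f g) := tensorHom_ofDiag z f g
theorem mor_comp {X Y Z : Word} (f : Diag Y Z) (g : Diag X Y) :
    mor z g ≫ mor z f = mor z (.comp f g) := compHom_ofDiag z f g
end

theorem tens_unit (z : k) {X Y : Word} (f : obj z X ⟶ obj z Y) :
    eqMor z (List.append_nil X).symm ≫ tens z f (𝟙 (unit z)) ≫ eqMor z (List.append_nil Y) = f := by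
  induction f using mor_induction with
  | h0 => simp only [zero_tens, Limits.zero_comp, Limits.comp_zero]
  | hadd a b ha hb =>
    simp only [add_tens, Preadditive.add_comp, Preadditive.comp_add, ha, hb]
  | hsmul c d =>
    simp only [smul_tens, Linear.smul_comp, Linear.comp_smul]
    congr 1
    refine Eq.trans ?_ (ofDiag_eq_of_rel (.tensor_unit d))
    refine Eq.trans ?_
      (mor_cast z (List.append_nil X) (List.append_nil Y) (.tensor d (.id []))).symm
    exact congrArg (fun t => _ ≫ t ≫ _) (tens_mor z d (.id []))

theorem unit_tens (z : k) {X Y : Word} (f : obj z X ⟶ obj z Y) :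
    tens z (𝟙 (unit z)) f = f := by
  induction f using mor_induction with
  | h0 => exact tens_zero z _
  | hadd a b ha hb => exact (tens_add z _ a b).trans (congrArg₂ _ ha hb)
  | hsmul c d =>
    refine (tens_smul z c _ _).trans (congrArg (fun t => c • t) ?_)
    refine (tens_mor z (.id []) d).trans ?_
    exact ofDiag_eq_of_rel (.unit_tensor d)

theorem tens_assoc (z : k) {X Y X' Y' X'' Y'' : Word} (f : obj z X ⟶ obj z Y)
    (g : obj z X' ⟶ obj z Y') (h : obj z X'' ⟶ obj z Y'') :
    eqMor z (List.append_assoc X X' X'').symm ≫ tens z (tens z f g) h ≫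
      eqMor z (List.append_assoc Y Y' Y'') = tens z f (tens z g h) := by
  induction f using mor_induction with
  | h0 => simp only [zero_tens, Limits.zero_comp, Limits.comp_zero]
  | hadd a b ha hb => simp only [add_tens, Preadditive.add_comp, Preadditive.comp_add, ha, hb]
  | hsmul c f =>
  induction g using mor_induction with
  | h0 => simp only [zero_tens, tens_zero, Limits.zero_comp, Limits.comp_zero]
  | hadd a b ha hb =>
    simp only [add_tens, tens_add, Preadditive.add_comp, Preadditive.comp_add, ha, hb]
  | hsmul c' g =>
  induction h using mor_induction with
  | h0 => simp only [tens_zero, Limits.zero_comp, Limits.comp_zero]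
  | hadd a b ha hb => simp only [tens_add, Preadditive.add_comp, Preadditive.comp_add, ha, hb]
  | hsmul c'' h =>
    simp only [smul_tens, tens_smul, Linear.smul_comp, Linear.comp_smul, tens_mor]
    rw [← mor_cast z (List.append_assoc X X' X'') (List.append_assoc Y Y' Y'')]
    refine congrArg (fun t => c'' • c' • c • t) ?_
    exact ofDiag_eq_of_rel (.tensor_assoc f g h)

/-- The tensor product of endomorphisms of the unit object is their composite. -/
theorem tens_unit_unit (z : k) (a b : unit z ⟶ unit z) :
    tens z a b = b ≫ a := by
  have key : ∀ a b : unit z ⟶ unit z,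
      tens z (𝟙 (unit z)) b ≫ tens z a (𝟙 (unit z)) = tens z a b := by
    intro a b
    induction a using mor_induction with
    | h0 => simp only [zero_tens, Limits.comp_zero]
    | hadd x y hx hy => simp only [add_tens, Preadditive.comp_add, hx, hy]
    | hsmul c d =>
    induction b using mor_induction with
    | h0 => simp only [tens_zero, Limits.zero_comp]
    | hadd x y hx hy => simp only [tens_add, Preadditive.add_comp, hx, hy]
    | hsmul c' d' =>
      simp only [smul_tens, tens_smul, Linear.smul_comp, Linear.comp_smul]
      rw [smul_comm]
      refine congrArg (fun t => c' • c • t) ?_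
      have h : (Finsupp.single (Diag.comp (.tensor d (.id [])) (.tensor (.id []) d')) (1 : k) -
          .single (.tensor (.comp d (.id [])) (.comp (.id []) d')) 1) ∈ relSub z [] [] := by
        have := Rel.interchange (z := z) d (.id []) (.id []) d'
        simp only [Diag.tokens, zero_mul, pow_zero] at this
        exact Submodule.subset_span this
      have h1 : compHom z (tensorHom z (ofDiag z d) (ofDiag z (.id [])))
          (tensorHom z (ofDiag z (.id [])) (ofDiag z d')) =
          tensorHom z (compHom z (ofDiag z d) (ofDiag z (.id [])))
            (compHom z (ofDiag z (.id [])) (ofDiag z d')) := by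
        simp only [tensorHom_ofDiag, compHom_ofDiag]
        have h2 := (Submodule.Quotient.mk_eq_zero _).2 h
        rw [Submodule.Quotient.mk_sub, sub_eq_zero] at h2
        exact h2
      rw [compHom_id, id_compHom] at h1
      exact h1
  have h1 := tens_unit z a
  simp only [eqToHom_refl, Category.id_comp, Category.comp_id] at h1
  rw [← key, unit_tens, h1]

/-- The operation `f ↦ f ⊗ a` on morphisms, for an endomorphism `a` of the unit object. -/
def act (z : k) {X Y : Word} (f : obj z X ⟶ obj z Y) (a : unit z ⟶ unit z) : obj z X ⟶ obj z Y :=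
  eqMor z (List.append_nil X).symm ≫ tens z f a ≫ eqMor z (List.append_nil Y)

theorem act_act (z : k) {X Y : Word} (f : obj z X ⟶ obj z Y) (a b : unit z ⟶ unit z) :
    act z (act z f a) b = act z f (b ≫ a) := by
  unfold act
  rw [← tens_unit_unit, ← tens_assoc z f a b]
  rw [tens_eqMor z (List.append_nil X).symm (List.append_nil Y).symm]

/-- The right `SymFun`-module structure `f · a = f ⊗ β(a)` on a morphism space, for an algebra
homomorphism `β` from `SymFun` to the endomorphism algebra of the unit object. (The product `a * b` in
the endomorphism algebra is the composite `a ∘ b`.) -/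
abbrev rightSymModule {z : k} (β : SymFun k →ₐ[k] End (unit z)) (X Y : Word) :
    Module (SymFun k)ᵐᵒᵖ (obj z X ⟶ obj z Y) where
  smul a f := act z f (β a.unop)
  one_smul f := by
    change act z f (β 1) = f
    rw [map_one]
    exact tens_unit z f
  mul_smul a b f := by
    change act z f (β (b.unop * a.unop)) = act z (act z f (β b.unop)) (β a.unop)
    rw [act_act, map_mul, End.mul_def]
  smul_zero a := by
    change act z 0 (β a.unop) = 0
    simp only [act, zero_tens, Limits.zero_comp, Limits.comp_zero]
  smul_add a f g := by
    change act z (f + g) (β a.unop) = act z f (β a.unop) + act z g (β a.unop)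
    simp only [act, add_tens, Preadditive.add_comp, Preadditive.comp_add]
  add_smul a b f := by
    change act z f (β (a.unop + b.unop)) = act z f (β a.unop) + act z f (β b.unop)
    rw [map_add]
    refine Eq.trans (congrArg (fun t => _ ≫ t ≫ _) (tens_add z f (β a.unop) (β b.unop))) ?_
    simp only [act, Preadditive.add_comp, Preadditive.comp_add]
  zero_smul f := by
    change act z f (β 0) = 0
    rw [map_zero]
    refine Eq.trans (congrArg (fun t => _ ≫ t ≫ _) (tens_zero z f)) ?_
    simp only [Limits.zero_comp, Limits.comp_zero]

/-! ## Matchings and positive reduced lifts -/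

/-- The endpoints at which strings start: upward letters of the source `X` (at the bottom of a
diagram) and downward letters of the target `Y` (at the top). -/
abbrev Sources (X Y : Word) : Type :=
  {i : Fin X.length // X.get i = up} ⊕ {j : Fin Y.length // Y.get j = down}

/-- The endpoints at which strings terminate: downward letters of the source `X` and upward letters
of the target `Y`. -/
abbrev Targets (X Y : Word) : Type :=
  {i : Fin X.length // X.get i = down} ⊕ {j : Fin Y.length // Y.get j = up}

/-- An `(X, Y)`-matching. -/
abbrev Matching (X Y : Word) : Type := Sources X Y ≃ Targets X Y

/-- The elementary pieces of token-free oriented string diagrams with positive crossings only: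
positive crossings of strands of arbitrary orientations, and cups and caps in both directions. -/
inductive Piece : Word → Word → Type
  | cross (a b : Arrow) : Piece [a, b] [b, a]
  | cup (a : Arrow) : Piece [] [a, a.dual]
  | cap (a : Arrow) : Piece [a, a.dual] []

/-- The morphism represented by a piece. The positive right crossing is the negative right crossing
plus `z` times the right cup on top of the right cap. -/
def Piece.eval (z : k) : {P Q : Word} → Piece P Q → (obj z P ⟶ obj z Q)
  | _, _, .cross up up => mor z .posUp
  | _, _, .cross up down => mor z .negRight + z • mor z (.comp .rightCup .rightCap)
  | _, _, .cross down up => mor z .posLeft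
  | _, _, .cross down down => mor z .posDown
  | _, _, .cup up => mor z .leftCup
  | _, _, .cup down => mor z .rightCup
  | _, _, .cap up => mor z .rightCap
  | _, _, .cap down => mor z .leftCap

/-- Token-free oriented string diagrams from `X` to `Y` all of whose crossings are positive, sliced
into layers, each containing a single piece. In `layer t A p B`, the piece `p` is put on top of the
diagram `t`, with vertical strands `A` to its left and `B` to its right. -/
inductive StringDiagram (X : Word) : Word → Type
  | id : StringDiagram X X
  | layer {Y Z P Q : Word} (t : StringDiagram X Y) (A : Word) (p : Piece P Q) (B : Word)
      (hY : Y = A ++ P ++ B) (hZ : Z = A ++ Q ++ B) : StringDiagram X Z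

namespace StringDiagram

/-- The morphism represented by a string diagram. -/
def eval (z : k) {X : Word} : {Y : Word} → StringDiagram X Y → (obj z X ⟶ obj z Y)
  | _, .id => 𝟙 _
  | _, .layer t A p B hY hZ =>
    t.eval z ≫ eqMor z hY ≫ tens z (tens z (𝟙 (obj z A)) (p.eval z)) (𝟙 (obj z B)) ≫
      eqMor z hZ.symm

/-- The number of layers. -/
def height {X : Word} : {Y : Word} → StringDiagram X Y → ℕ
  | _, .id => 0
  | _, .layer t _ _ _ _ _ => t.height + 1

/-- `t.IsPoint (i, j)`: the diagram has a `j`-th point (from the left, starting with `0`) at level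
`i`. Level `0` is the bottom, and level `i + 1` is the top of the layer number `i`. -/
def IsPoint {X : Word} : {Y : Word} → StringDiagram X Y → ℕ × ℕ → Prop
  | _, .id, x => x.1 = 0 ∧ x.2 < X.length
  | Z, .layer t _ _ _ _ _, x => t.IsPoint x ∨ (x.1 = t.height + 1 ∧ x.2 < Z.length)

/-- The elementary segments of the strings in a layer: `Segment n a p b x y` says that the points
`x` and `y` are joined in layer number `n`, which consists of the piece `p` with `a` vertical strands
to its left and `b` vertical strands to its right. -/
inductive Segment (n a : ℕ) : {P Q : Word} → Piece P Q → ℕ → ℕ × ℕ → ℕ × ℕ → Prop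
  | left {P Q : Word} (p : Piece P Q) (b i : ℕ) (hi : i < a) : Segment n a p b (n, i) (n + 1, i)
  | right {P Q : Word} (p : Piece P Q) (b i : ℕ) (hi : i < b) :
      Segment n a p b (n, a + P.length + i) (n + 1, a + Q.length + i)
  | cross_ne (c d : Arrow) (b : ℕ) : Segment n a (.cross c d) b (n, a) (n + 1, a + 1)
  | cross_nw (c d : Arrow) (b : ℕ) : Segment n a (.cross c d) b (n, a + 1) (n + 1, a)
  | cup (c : Arrow) (b : ℕ) : Segment n a (.cup c) b (n + 1, a) (n + 1, a + 1)
  | cap (c : Arrow) (b : ℕ) : Segment n a (.cap c) b (n, a) (n, a + 1)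

/-- Two points are joined by an elementary segment of some layer. -/
def Joined {X : Word} : {Y : Word} → StringDiagram X Y → ℕ × ℕ → ℕ × ℕ → Prop
  | _, .id, _, _ => False
  | _, .layer t A p B _ _, x, y =>
    t.Joined x y ∨ Segment t.height A.length p B.length x y

/-- Two points lie on the same string. -/
def SameString {X Y : Word} (t : StringDiagram X Y) : ℕ × ℕ → ℕ × ℕ → Prop :=
  Relation.EqvGen t.Joined

/-- `Piece.IsCross p`: the piece is a crossing. -/
def _root_.QuantumIsomeric.Piece.IsCross : {P Q : Word} → Piece P Q → Prop
  | _, _, .cross _ _ => True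
  | _, _, .cup _ => False
  | _, _, .cap _ => False

/-- `t.CrossingAt (i, j)`: layer number `i` contains a crossing of the strands starting at its
bottom in the positions `j` and `j + 1`. -/
def CrossingAt {X : Word} : {Y : Word} → StringDiagram X Y → ℕ × ℕ → Prop
  | _, .id, _ => False
  | _, .layer t A p _ _ _, x => t.CrossingAt x ∨ (p.IsCross ∧ x = (t.height, A.length))

/-- The point of a diagram at which a string starts. -/
def sourcePoint {X Y : Word} (t : StringDiagram X Y) : Sources X Y → ℕ × ℕ
  | .inl i => (0, i.1)
  | .inr j => (t.height, j.1)

/-- The point of a diagram at which a string terminates. -/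
def targetPoint {X Y : Word} (t : StringDiagram X Y) : Targets X Y → ℕ × ℕ
  | .inl i => (0, i.1)
  | .inr j => (t.height, j.1)

/-- Positive reduced lifts of a matching. (That there are no Clifford tokens and that all crossings
are positive is built into the type `StringDiagram`.) -/
structure IsPositiveReducedLift {X Y : Word} (m : Matching X Y) (t : StringDiagram X Y) : Prop where
  /-- the endpoints of each string correspond under the matching -/
  endpoints : ∀ s, t.SameString (t.sourcePoint s) (t.targetPoint (m s))
  /-- there are no closed strings -/
  no_closed : ∀ x, t.IsPoint x → ∃ s, t.SameString (t.sourcePoint s) x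
  /-- there are no self-intersections of strings -/
  no_self_crossing : ∀ i j, t.CrossingAt (i, j) → ¬ t.SameString (i, j) (i, j + 1)
  /-- no two strings cross each other more than once -/
  no_double_crossing : ∀ i j i' j', t.CrossingAt (i, j) → t.CrossingAt (i', j') →
    (i, j) ≠ (i', j') →
    ¬ (t.SameString (i, j) (i', j') ∧ t.SameString (i, j + 1) (i', j' + 1)) ∧
    ¬ (t.SameString (i, j) (i', j' + 1) ∧ t.SameString (i, j + 1) (i', j'))

end StringDiagram

/-- For a family `B` of string diagrams (one for each matching), the set of all morphisms obtained
from its members by adding a zebra labelled by some integer near the terminus of each string: the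
zebras at the top of the diagram sit on the upward letters of `Y`, the zebras at the bottom on the
downward letters of `X`. -/
def zebraSet (z : k) {X Y : Word} (B : Matching X Y → StringDiagram X Y) :
    Set (obj z X ⟶ obj z Y) :=
  {f | ∃ (m : Matching X Y) (l l' : ℕ → ℤ),
    f = mor z (.zebrasOnDown X l) ≫ (B m).eval z ≫ mor z (.zebrasOnUp Y l')}

end QuantumIsomeric

end

open CategoryTheory

noncomputable section

namespace QuantumIsomeric

open Arrow AQ

universe u

variable {k : Type u} [CommRing k]

/-! ## Interchange laws and parity -/

/-! Spanning is a straightening argument, filtered by the number of crossings: `Low z n` is spanned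
by diagrams with fewer than `n` crossings. By the skein relation a positive crossing agrees with the
negative one modulo lower terms. Hence, modulo lower terms, braid moves and slides of cups and caps
hold for all orientations, both kinds of tokens slide through every crossing, and double crossings
disappear; curls can be removed as well. Orientations can then be forgotten: the sum `opT` of all
positive crossings, with the cups `opu` and the caps `opn`, obeys a Brauer-type calculus in which
diagrams that are not reduced are discarded. In this calculus (`NilBrauer`) the lemmas
`NilBrauer.normal_T`, `NilBrauer.normal_u` and `NilBrauer.normal_n` straighten diagrams to normal
forms indexed by a `Code`, and a valid code is determined by its matching (`Code.eq_of_mate_eq`).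

To put sources and targets on the same footing, a morphism from `X` to `Y` is bent to a morphism out
of the unit object; this is injective (`bend_injective`). Morphisms from the unit object to all
words are collected in one module `Vec z`, on which a morphism `f` acts at position `a` by `op a f`.
Relations between diagrams become identities between operators indexed by natural numbers, without
transport along equalities of words.

When a cap closes a chord, a bubble with tokens splits off. Bubbles move across strands at the cost
of terms of the same shape (`bubR_left_mem`, `bubR_right_mem`, `op_bub_mem`), and counterclockwise
bubbles are polynomials in clockwise ones (`bubL_mem`). So every diagram is a combination of normal
forms with tokens at their endpoints and bubbles on the left (`low_le_nSpan`). A reduced lift agrees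
modulo lower terms with the normal form of its matching (`StringDiagram.Reduced.exists_code`,
`exists_code_of_lift`); that it is not discarded is certified by colouring its strings, which is
what `Shadow` keeps track of. Tokens slide to the termini of strings and can be put into alternating
order there, and induction on the number of crossings gives `low_le_bendSubmodule` and
`span_zebraSet`.

For the homomorphism, symmetric functions form a polynomial ring in the elementary ones
(`SymFun.ofPoly_injective`, `SymFun.ofPoly_surjective`), so the images of the `e r` may be
prescribed. The relation `grassmannian` says that the series with constant term `1` and coefficients
`-z • zebL z n`, respectively `z • zebR z n`, are inverse to each other. The series of the `(-1) ^ r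
• e r` and of the `h r` are inverse as well, which forces the images of the `h r` (`exists_symHom`).
Since `z` is a unit, the image contains all bubbles (`bubAlg_le_range`). -/

theorem interchange_mor (z : k) {X Y Z X' Y' Z' : Word} (f' : Diag Y Z) (g : Diag Y' Z')
    (f : Diag X Y) (g' : Diag X' Y') :
    tens z (mor z f) (mor z g') ≫ tens z (mor z f') (mor z g) =
      ((-1 : k) ^ (f.tokens * g.tokens)) •
        tens z (mor z f ≫ mor z f') (mor z g' ≫ mor z g) := by
  rw [tens_mor, tens_mor, mor_comp, mor_comp, mor_comp, tens_mor]
  have h := (Submodule.Quotient.mk_eq_zero (relSub z _ _)).2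
    (Submodule.subset_span (Rel.interchange (z := z) f' g f g'))
  rw [Submodule.Quotient.mk_sub, sub_eq_zero] at h
  refine Eq.trans h ?_
  rw [show ∀ (d : Diag (X ++ X') (Z ++ Z')) (c : k), (Finsupp.single d c : _ →₀ k) =
    c • Finsupp.single d 1 from fun d c => by simp, Submodule.Quotient.mk_smul]
  rfl

theorem mor_id (z : k) (X : Word) : mor z (.id X) = 𝟙 (obj z X) := rfl

theorem tens_id (z : k) (X Y : Word) : tens z (𝟙 (obj z X)) (𝟙 (obj z Y)) = 𝟙 (obj z (X ++ Y)) := by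
  rw [← mor_id, ← mor_id, tens_mor]
  exact ofDiag_eq_of_rel (.tensor_id X Y)

/-- An identity carries no tokens, so no sign occurs and the rule extends bilinearly to morphisms
without a parity. -/
theorem tens_comp_id_right (z : k) {X Y Z X' Y' : Word} (f : obj z X ⟶ obj z Y)
    (f' : obj z Y ⟶ obj z Z) (g : obj z X' ⟶ obj z Y') :
    tens z f g ≫ tens z f' (𝟙 _) = tens z (f ≫ f') g := by
  induction f using mor_induction with
  | h0 => simp only [zero_tens, Limits.zero_comp]
  | hadd a b ha hb => simp only [add_tens, Preadditive.add_comp, ha, hb]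
  | hsmul c f =>
  induction f' using mor_induction with
  | h0 => simp only [zero_tens, Limits.comp_zero]
  | hadd a b ha hb => simp only [add_tens, Preadditive.comp_add, ha, hb]
  | hsmul c' f' =>
  induction g using mor_induction with
  | h0 => simp only [tens_zero, Limits.zero_comp]
  | hadd a b ha hb => simp only [tens_add, Preadditive.add_comp, ha, hb]
  | hsmul c'' g =>
    simp only [smul_tens, tens_smul, Linear.smul_comp, Linear.comp_smul]
    rw [← mor_id, interchange_mor]
    simp only [Diag.tokens, mor_id, mul_zero, pow_zero, one_smul,
      Category.comp_id]
    module

theorem tens_comp_id_left (z : k) {X Y X' Y' Z' : Word} (f : obj z X ⟶ obj z Y)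
    (g : obj z X' ⟶ obj z Y') (g' : obj z Y' ⟶ obj z Z') :
    tens z (𝟙 _) g ≫ tens z f g' = tens z f (g ≫ g') := by
  induction f using mor_induction with
  | h0 => simp only [zero_tens, Limits.comp_zero]
  | hadd a b ha hb => simp only [add_tens, Preadditive.comp_add, ha, hb]
  | hsmul c f =>
  induction g' using mor_induction with
  | h0 => simp only [tens_zero, Limits.comp_zero]
  | hadd a b ha hb => simp only [tens_add, Preadditive.comp_add, ha, hb]
  | hsmul c' g' =>
  induction g using mor_induction with
  | h0 => simp only [tens_zero, Limits.zero_comp]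
  | hadd a b ha hb => simp only [tens_add, Preadditive.add_comp, ha, hb]
  | hsmul c'' g =>
    simp only [smul_tens, tens_smul, Linear.smul_comp, Linear.comp_smul]
    rw [← mor_id, interchange_mor]
    simp only [Diag.tokens, mor_id, zero_mul, pow_zero, one_smul,
      Category.id_comp]
    module

/-- The morphisms that are linear combinations of diagrams whose number of tokens has the same
parity as `n`. -/
def parityPart (z : k) (X Y : Word) (n : ℕ) : Submodule k (obj z X ⟶ obj z Y) :=
  Submodule.span k {f | ∃ d : Diag X Y, d.tokens % 2 = n % 2 ∧ f = mor z d}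

theorem mor_mem_parityPart (z : k) {X Y : Word} (d : Diag X Y) {n : ℕ} (h : d.tokens % 2 = n % 2) :
    mor z d ∈ parityPart z X Y n := Submodule.subset_span ⟨d, h, rfl⟩

theorem neg_one_pow_mod_two {m n : ℕ} (h : m % 2 = n % 2) : (-1 : k) ^ m = (-1) ^ n := by
  rw [neg_one_pow_eq_pow_mod_two, h, ← neg_one_pow_eq_pow_mod_two]

/-- With `f` below `g` the interchange law costs a sign, which depends only on the parities; with
`f` above `g` there is none. -/
theorem tens_comp_swap (z : k) {X Y X' Y' : Word} {m n : ℕ} {f : obj z X ⟶ obj z Y}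
    {g : obj z X' ⟶ obj z Y'} (hf : f ∈ parityPart z X Y m) (hg : g ∈ parityPart z X' Y' n) :
    tens z f (𝟙 _) ≫ tens z (𝟙 _) g = ((-1 : k) ^ (m * n)) • tens z f g := by
  induction hf using Submodule.span_induction with
  | zero => simp only [zero_tens, Limits.zero_comp, smul_zero]
  | add a b _ _ ha hb => simp only [add_tens, Preadditive.add_comp, ha, hb, smul_add]
  | smul c a _ ha => simp only [smul_tens, Linear.smul_comp, ha]; rw [smul_comm]
  | mem f hf =>
  induction hg using Submodule.span_induction with
  | zero => simp only [tens_zero, Limits.comp_zero, smul_zero]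
  | add a b _ _ ha hb => simp only [tens_add, Preadditive.comp_add, ha, hb, smul_add]
  | smul c a _ ha => simp only [tens_smul, Linear.comp_smul, ha]; rw [smul_comm]
  | mem g hg =>
    obtain ⟨d, hd, rfl⟩ := hf
    obtain ⟨e, he, rfl⟩ := hg
    rw [← mor_id, ← mor_id, interchange_mor, mor_id, mor_id, Category.id_comp, Category.comp_id]
    congr 1
    exact neg_one_pow_mod_two (by rw [Nat.mul_mod, hd, he, ← Nat.mul_mod])

theorem comp_mem_parityPart {z : k} {X Y Z : Word} {m n : ℕ} {f : obj z X ⟶ obj z Y}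
    {g : obj z Y ⟶ obj z Z} (hf : f ∈ parityPart z X Y m) (hg : g ∈ parityPart z Y Z n) :
    f ≫ g ∈ parityPart z X Z (m + n) := by
  induction hf using Submodule.span_induction with
  | zero => rw [Limits.zero_comp]; exact zero_mem _
  | add a b _ _ ha hb => rw [Preadditive.add_comp]; exact add_mem ha hb
  | smul c a _ ha => rw [Linear.smul_comp]; exact Submodule.smul_mem _ _ ha
  | mem f hf =>
  induction hg using Submodule.span_induction with
  | zero => rw [Limits.comp_zero]; exact zero_mem _
  | add a b _ _ ha hb => rw [Preadditive.comp_add]; exact add_mem ha hb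
  | smul c a _ ha => rw [Linear.comp_smul]; exact Submodule.smul_mem _ _ ha
  | mem g hg =>
    obtain ⟨d, hd, rfl⟩ := hf
    obtain ⟨e, he, rfl⟩ := hg
    rw [mor_comp]
    exact mor_mem_parityPart z _ (by simp only [Diag.tokens]; omega)

theorem tens_mem_parityPart {z : k} {X Y X' Y' : Word} {m n : ℕ} {f : obj z X ⟶ obj z Y}
    {g : obj z X' ⟶ obj z Y'} (hf : f ∈ parityPart z X Y m) (hg : g ∈ parityPart z X' Y' n) :
    tens z f g ∈ parityPart z (X ++ X') (Y ++ Y') (m + n) := by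
  induction hf using Submodule.span_induction with
  | zero => rw [zero_tens]; exact zero_mem _
  | add a b _ _ ha hb => rw [add_tens]; exact add_mem ha hb
  | smul c a _ ha => rw [smul_tens]; exact Submodule.smul_mem _ _ ha
  | mem f hf =>
  induction hg using Submodule.span_induction with
  | zero => rw [tens_zero]; exact zero_mem _
  | add a b _ _ ha hb => rw [tens_add]; exact add_mem ha hb
  | smul c a _ ha => rw [tens_smul]; exact Submodule.smul_mem _ _ ha
  | mem g hg =>
    obtain ⟨d, hd, rfl⟩ := hf
    obtain ⟨e, he, rfl⟩ := hg
    rw [tens_mor]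
    exact mor_mem_parityPart z _ (by simp only [Diag.tokens]; omega)

theorem id_mem_parityPart (z : k) (X : Word) : 𝟙 (obj z X) ∈ parityPart z X X 0 :=
  mor_mem_parityPart z (.id X) rfl

/-! ## Strictness, up to heterogeneous equality -/

theorem tens_heq {z : k} {X Y X' Y' A B A' B' : Word} (hX : X = X') (hY : Y = Y') (hA : A = A')
    (hB : B = B') {f : obj z X ⟶ obj z Y} {f' : obj z X' ⟶ obj z Y'} {g : obj z A ⟶ obj z B}
    {g' : obj z A' ⟶ obj z B'} (hf : f ≍ f') (hg : g ≍ g') : tens z f g ≍ tens z f' g' := by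
  subst hX hY hA hB
  cases hf
  cases hg
  rfl

theorem comp_heq' {z : k} {X Y Z X' Y' Z' : Word} (hX : X = X') (hY : Y = Y') (hZ : Z = Z')
    {f : obj z X ⟶ obj z Y} {f' : obj z X' ⟶ obj z Y'} {g : obj z Y ⟶ obj z Z}
    {g' : obj z Y' ⟶ obj z Z'} (hf : f ≍ f') (hg : g ≍ g') : f ≫ g ≍ f' ≫ g' := by
  subst hX hY hZ
  cases hf
  cases hg
  rfl

theorem comp_eqMor_heq {z : k} {X Y Z : Word} (f : obj z X ⟶ obj z Y) (h : Y = Z) :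
    f ≫ eqMor z h ≍ f := by
  subst h
  simp

theorem eqMor_comp_heq {z : k} {X Y Z : Word} (h : X = Y) (f : obj z Y ⟶ obj z Z) :
    eqMor z h ≫ f ≍ f := by
  subst h
  simp

theorem tens_assoc_heq {z : k} {X Y X' Y' X'' Y'' : Word} (f : obj z X ⟶ obj z Y)
    (g : obj z X' ⟶ obj z Y') (h : obj z X'' ⟶ obj z Y'') :
    tens z (tens z f g) h ≍ tens z f (tens z g h) := by
  rw [← tens_assoc]
  exact ((eqMor_comp_heq _ _).trans (comp_eqMor_heq _ _)).symm

theorem tens_unit_heq {z : k} {X Y : Word} (f : obj z X ⟶ obj z Y) :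
    tens z f (𝟙 (unit z)) ≍ f := by
  conv_rhs => rw [← tens_unit z f]
  exact ((eqMor_comp_heq _ _).trans (comp_eqMor_heq _ _)).symm

/-- The morphism `f` with identities of words on both sides. -/
def whisker (z : k) {P Q : Word} (A : Word) (f : obj z P ⟶ obj z Q) (B : Word) :
    obj z (A ++ (P ++ B)) ⟶ obj z (A ++ (Q ++ B)) :=
  tens z (𝟙 (obj z A)) (tens z f (𝟙 (obj z B)))

section whisker
variable {z : k} {P Q R P' Q' : Word} (A B : Word)

theorem whisker_add (f g : obj z P ⟶ obj z Q) :
    whisker z A (f + g) B = whisker z A f B + whisker z A g B := by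
  simp only [whisker, add_tens, tens_add]

theorem whisker_smul (c : k) (f : obj z P ⟶ obj z Q) :
    whisker z A (c • f) B = c • whisker z A f B := by
  simp only [whisker, smul_tens, tens_smul]

theorem whisker_comp (f : obj z P ⟶ obj z Q) (g : obj z Q ⟶ obj z R) :
    whisker z A (f ≫ g) B = whisker z A f B ≫ whisker z A g B := by
  simp only [whisker, tens_comp_id_left, tens_comp_id_right]

theorem whisker_id : whisker z A (𝟙 (obj z P)) B = 𝟙 _ := by
  simp only [whisker, tens_id]

/-- This is the sign-free factorisation, with `g` below `f`. The two sides bracket the words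
differently, hence the heterogeneous equality. -/
theorem whisker_tens_heq (f : obj z P ⟶ obj z Q) (g : obj z P' ⟶ obj z Q') :
    whisker z A (tens z f g) B ≍
      (whisker z (A ++ P) g B ≫ eqMor z (by simp)) ≫ whisker z A f (Q' ++ B) := by
  have h1 : whisker z A (tens z f g) B ≍
      tens z (𝟙 (obj z A)) (tens z f (tens z g (𝟙 (obj z B)))) :=
    tens_heq rfl rfl (by simp) (by simp) HEq.rfl (tens_assoc_heq f g _)
  have h2 : tens z (𝟙 (obj z A)) (tens z f (tens z g (𝟙 (obj z B)))) =
      tens z (𝟙 (obj z A)) (tens z (𝟙 (obj z P)) (tens z g (𝟙 (obj z B)))) ≫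
        whisker z A f (Q' ++ B) := by
    rw [whisker, tens_comp_id_left, ← tens_id, tens_id, tens_comp_id_left, Category.comp_id]
  refine h1.trans ((heq_of_eq h2).trans (comp_heq' (by simp) (by simp) rfl ?_ HEq.rfl))
  refine HEq.trans ?_ (comp_eqMor_heq _ _).symm
  rw [whisker, ← tens_id]
  exact (tens_assoc_heq _ _ _).symm

end whisker

/-! ## Local operators on vectors -/

/-- Families of morphisms from the unit object, one for each word. -/
abbrev Vec (z : k) : Type u := ∀ W : Word, unit z ⟶ obj z W

theorem vec_heq {z : k} (v : Vec z) {W W' : Word} (h : W = W') : v W ≍ v W' := by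
  subst h
  rfl

/-- The action of a morphism `f` on the letters from position `a` onwards. -/
def op {z : k} {P Q : Word} (a : ℕ) (f : obj z P ⟶ obj z Q) : Module.End k (Vec z) where
  toFun v W :=
    open Classical in
    -- The bound on `a` matters when `Q` is empty: past the end of `W` the truncated `take` and
    -- `drop` would satisfy the equation anyway.
    if h : W = W.take a ++ (Q ++ W.drop (a + Q.length)) ∧ a ≤ W.length then
      v (W.take a ++ (P ++ W.drop (a + Q.length))) ≫ whisker z _ f _ ≫ eqMor z h.1.symm
    else 0
  map_add' v w := by
    funext W
    by_cases h : W = W.take a ++ (Q ++ W.drop (a + Q.length)) ∧ a ≤ W.length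
    · simp only [Pi.add_apply, dif_pos h, Preadditive.add_comp]
    · simp only [Pi.add_apply, dif_neg h, add_zero]
  map_smul' c v := by
    funext W
    by_cases h : W = W.take a ++ (Q ++ W.drop (a + Q.length)) ∧ a ≤ W.length
    · simp only [Pi.smul_apply, dif_pos h, Linear.smul_comp, RingHom.id_apply]
    · simp only [Pi.smul_apply, dif_neg h, smul_zero, RingHom.id_apply]

section op
variable {z : k} {P Q R P' Q' : Word}

theorem op_apply {a : ℕ} (f : obj z P ⟶ obj z Q) (v : Vec z) {A : Word} (B : Word)
    (ha : A.length = a) : op a f v (A ++ (Q ++ B)) = v (A ++ (P ++ B)) ≫ whisker z A f B := by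
  subst ha
  -- The words produced by `take` and `drop` become variables here, so that they can be substituted
  -- despite the dependent types.
  have aux : ∀ (A' B' : Word) (hA : A' = A) (hB : B' = B)
      (h : A ++ (Q ++ B) = A' ++ (Q ++ B')),
      v (A' ++ (P ++ B')) ≫ whisker z A' f B' ≫ eqMor z h.symm =
        v (A ++ (P ++ B)) ≫ whisker z A f B := by
    rintro _ _ rfl rfl h
    simp
  have hA : (A ++ (Q ++ B)).take A.length = A := by simp
  have hB : (A ++ (Q ++ B)).drop (A.length + Q.length) = B := by
    rw [← List.append_assoc, ← List.length_append, List.drop_left]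
  refine (dif_pos ⟨?_, by simp⟩).trans (aux _ _ hA hB ?_)
  all_goals rw [hA, hB]

theorem op_apply_eq_zero {a : ℕ} (f : obj z P ⟶ obj z Q) (v : Vec z) {W : Word}
    (h : ¬ ∃ A B, A.length = a ∧ W = A ++ (Q ++ B)) : op a f v W = 0 := by
  refine dif_neg fun h' => h ⟨W.take a, W.drop (a + Q.length), ?_, h'.1⟩
  rw [List.length_take, min_eq_left h'.2]

theorem op_ext {F G : Module.End k (Vec z)} (h : ∀ v W, F v W = G v W) : F = G :=
  LinearMap.ext fun v => funext fun W => h v W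

theorem op_add (a : ℕ) (f g : obj z P ⟶ obj z Q) : op a (f + g) = op a f + op a g := by
  refine op_ext fun v W => ?_
  by_cases h : ∃ A B, A.length = a ∧ W = A ++ (Q ++ B)
  · obtain ⟨A, B, ha, rfl⟩ := h
    simp only [LinearMap.add_apply, Pi.add_apply, op_apply _ _ _ ha, whisker_add,
      Preadditive.comp_add]
  · simp only [LinearMap.add_apply, Pi.add_apply, op_apply_eq_zero _ _ h, add_zero]

theorem op_smul (a : ℕ) (c : k) (f : obj z P ⟶ obj z Q) : op a (c • f) = c • op a f := by
  refine op_ext fun v W => ?_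
  by_cases h : ∃ A B, A.length = a ∧ W = A ++ (Q ++ B)
  · obtain ⟨A, B, ha, rfl⟩ := h
    simp only [LinearMap.smul_apply, Pi.smul_apply, op_apply _ _ _ ha, whisker_smul,
      Linear.comp_smul]
  · simp only [LinearMap.smul_apply, Pi.smul_apply, op_apply_eq_zero _ _ h, smul_zero]

theorem op_zero (a : ℕ) : op a (0 : obj z P ⟶ obj z Q) = 0 := by
  simpa using op_smul a (0 : k) (0 : obj z P ⟶ obj z Q)

theorem op_neg (a : ℕ) (f : obj z P ⟶ obj z Q) : op a (-f) = -op a f := by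
  refine eq_neg_of_add_eq_zero_right ?_
  rw [← op_add, add_neg_cancel, op_zero]

theorem op_sub (a : ℕ) (f g : obj z P ⟶ obj z Q) : op a (f - g) = op a f - op a g := by
  rw [sub_eq_add_neg, op_add, op_neg, sub_eq_add_neg]

theorem op_comp (a : ℕ) (f : obj z P ⟶ obj z Q) (g : obj z Q ⟶ obj z R) :
    op a (f ≫ g) = op a g * op a f := by
  refine op_ext fun v W => ?_
  by_cases h : ∃ A B, A.length = a ∧ W = A ++ (R ++ B)
  · obtain ⟨A, B, ha, rfl⟩ := h
    simp only [Module.End.mul_apply, op_apply _ _ _ ha, whisker_comp, Category.assoc]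
  · simp only [Module.End.mul_apply, op_apply_eq_zero _ _ h]

/-- Two different words of equal length cannot occupy the same positions. Mismatched orientations
thus compose to zero, and operators for different orientations can be added and composed freely. -/
theorem op_mul_eq_zero (a : ℕ) (f : obj z P ⟶ obj z Q) (g : obj z Q' ⟶ obj z R)
    (hl : Q.length = Q'.length) (hne : Q ≠ Q') : op a g * op a f = 0 := by
  refine op_ext fun v W => ?_
  by_cases h : ∃ A B, A.length = a ∧ W = A ++ (R ++ B)
  · obtain ⟨A, B, ha, rfl⟩ := h
    rw [Module.End.mul_apply, op_apply _ _ _ ha, op_apply_eq_zero, Limits.zero_comp]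
    · rfl
    · rintro ⟨A', B', ha', h⟩
      obtain ⟨-, h⟩ := List.append_inj h (ha.trans ha'.symm)
      exact hne (List.append_inj h hl.symm).1.symm
  · rw [Module.End.mul_apply, op_apply_eq_zero _ _ h]
    rfl

/-- The factor `g` acts first, while the letters on its left are still those of `P`; this is why its
position is shifted by the length of `P` and not of `Q`. -/
theorem op_tens (a : ℕ) {b : ℕ} (f : obj z P ⟶ obj z Q) (g : obj z P' ⟶ obj z Q')
    (hb : b = a + P.length) : op a (tens z f g) = op a f * op b g := by
  subst hb
  refine op_ext fun v W => ?_
  by_cases h : ∃ A B, A.length = a ∧ W = A ++ (Q ++ B)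
  · obtain ⟨A, B, ha, rfl⟩ := h
    rw [Module.End.mul_apply, op_apply _ _ _ ha]
    by_cases h' : ∃ C, B = Q' ++ C
    · obtain ⟨C, rfl⟩ := h'
      apply eq_of_heq
      have h1 := op_apply (tens z f g) v (A := A) C ha
      have h2 := op_apply g v (a := a + P.length) (A := A ++ P) C (by simp [ha])
      refine (vec_heq (op a (tens z f g) v) (by simp)).trans ((heq_of_eq h1).trans ?_)
      refine HEq.trans ?_ (comp_heq' rfl rfl rfl
        ((heq_of_eq h2.symm).trans (vec_heq (op (a + P.length) g v)
          (W' := A ++ (P ++ (Q' ++ C))) (by simp)) |>.symm.trans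
            (comp_eqMor_heq _ (by simp)).symm).symm HEq.rfl)
      rw [Category.assoc, Category.assoc]
      refine comp_heq' rfl (by simp) (by simp) (vec_heq v (by simp)) ?_
      rw [← Category.assoc]
      exact whisker_tens_heq A C f g
    · rw [op_apply_eq_zero g, Limits.zero_comp, op_apply_eq_zero]
      · rintro ⟨A', C, ha', h⟩
        rw [List.append_assoc] at h
        obtain ⟨-, h⟩ := List.append_inj h (ha.trans ha'.symm)
        exact h' ⟨C, List.append_cancel_left h⟩
      · rintro ⟨A', C, ha', h⟩
        rw [← List.append_assoc] at h
        obtain ⟨-, h⟩ := List.append_inj h (by simp [ha, ha'])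
        exact h' ⟨C, h⟩
  · rw [Module.End.mul_apply, op_apply_eq_zero _ _ h, op_apply_eq_zero]
    rintro ⟨A, B, ha, h'⟩
    exact h ⟨A, Q' ++ B, ha, by rw [h', List.append_assoc]⟩

theorem op_congr {a : ℕ} (f : obj z P ⟶ obj z Q) {v w : Vec z} {W : Word}
    (h : ∀ A B, A.length = a → W = A ++ (Q ++ B) → v (A ++ (P ++ B)) = w (A ++ (P ++ B))) :
    op a f v W = op a f w W := by
  by_cases h' : ∃ A B, A.length = a ∧ W = A ++ (Q ++ B)
  · obtain ⟨A, B, ha, rfl⟩ := h'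
    rw [op_apply _ _ _ ha, op_apply _ _ _ ha, h A B ha rfl]
  · rw [op_apply_eq_zero _ _ h', op_apply_eq_zero _ _ h']

theorem op_id_apply {a : ℕ} (v : Vec z) {W : Word} (A B : Word) (ha : A.length = a)
    (hW : W = A ++ (P ++ B)) : op a (𝟙 (obj z P)) v W = v W := by
  subst hW
  rw [op_apply _ _ _ ha, whisker_id, Category.comp_id]

/-- The two composites are the two ways of factoring `f ⊗ g` through identities. An identity of a
word acts as a projection and not as `1`, so it has to be inserted or removed on the words where it
acts trivially. -/
theorem op_swap_aux (a : ℕ) {b : ℕ} {m n : ℕ} {f : obj z P ⟶ obj z Q} {g : obj z P' ⟶ obj z Q'}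
    (hf : f ∈ parityPart z P Q m) (hg : g ∈ parityPart z P' Q' n) (hb : b = a + Q.length) :
    op b g * op a f = ((-1 : k) ^ (m * n)) • (op a f * op (a + P.length) g) := by
  rw [← op_tens a f g rfl, ← op_smul, ← tens_comp_swap z hf hg, op_comp, op_tens a _ _ hb,
    op_tens a f _ rfl, mul_assoc]
  refine op_ext fun v W => ?_
  rw [Module.End.mul_apply, Module.End.mul_apply, Module.End.mul_apply, Module.End.mul_apply]
  have h1 : op b g (op a f v) W = op b g (op a f (op (a + P.length) (𝟙 (obj z P')) v)) W := by
    refine op_congr g fun A B hA hW => op_congr f fun A' B' hA' hW' => ?_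
    rw [← List.append_assoc A' Q B'] at hW'
    obtain ⟨rfl, rfl⟩ := List.append_inj hW' (by simp [hA, hA', hb])
    exact (op_id_apply v (A' ++ P) B (by simp [hA']) (by simp)).symm
  rw [h1]
  by_cases h : ∃ A B, A.length = b ∧ W = A ++ (Q' ++ B)
  · obtain ⟨A, B, hA, rfl⟩ := h
    rw [op_apply _ _ _ hA]
    by_cases h' : ∃ A', A'.length = a ∧ A = A' ++ Q
    · obtain ⟨A', ha', rfl⟩ := h'
      rw [op_id_apply _ A' (Q' ++ B) ha' (by simp), op_apply _ _ _ hA]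
    · rw [op_apply_eq_zero f, Limits.zero_comp, op_apply_eq_zero]
      all_goals
        rintro ⟨A', B', ha', h''⟩
        rw [← List.append_assoc A' Q B'] at h''
        exact h' ⟨A', ha', (List.append_inj h'' (by simp [hA, ha', hb])).1⟩
  · rw [op_apply_eq_zero _ _ h]
    refine Eq.trans ?_ (op_congr _ (w := 0) fun A B hA hW => ?_).symm
    · rw [map_zero]; rfl
    · rw [← hW, op_apply_eq_zero _ _ h]; rfl

theorem op_swap {a b b' : ℕ} {m n : ℕ} {f : obj z P ⟶ obj z Q} {g : obj z P' ⟶ obj z Q'}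
    (hf : f ∈ parityPart z P Q m) (hg : g ∈ parityPart z P' Q' n) (h : a + P.length ≤ b)
    (hb : b + Q.length = b' + P.length) :
    op b' g * op a f = ((-1 : k) ^ (m * n)) • (op a f * op b g) := by
  refine op_ext fun v W => ?_
  -- The letters between the two morphisms are made part of the right one: `𝟙 C ⊗ g` is adjacent to
  -- `f` and has the parity of `g`.
  have key : ∀ C : Word, C.length = b - (a + P.length) →
      op (a + Q.length) (𝟙 (obj z C)) * (op b' g * op a f) =
        ((-1 : k) ^ (m * n)) • (op a f * (op (a + P.length) (𝟙 (obj z C)) * op b g)) := by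
    intro C hC
    have h2 : tens z (𝟙 (obj z C)) g ∈ parityPart z _ _ n := by
      simpa using tens_mem_parityPart (id_mem_parityPart z C) hg
    rw [← op_tens (a + P.length) _ g (by omega), ← op_swap_aux a hf h2 rfl,
      op_tens (a + Q.length) _ g (b := b') (by omega), mul_assoc]
  by_cases hC : ∃ A C B : Word, A.length = a + Q.length ∧ C.length = b - (a + P.length) ∧
      W = A ++ (C ++ B)
  · obtain ⟨A, C, B, hA, hC, hW⟩ := hC
    have h3 := congrFun (LinearMap.congr_fun (key C hC) v) W
    rw [Module.End.mul_apply, op_id_apply _ A B hA hW] at h3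
    rw [h3]
    simp only [LinearMap.smul_apply, Pi.smul_apply, Module.End.mul_apply]
    congr 1
    refine op_congr f fun A' B' hA' hW' => ?_
    rw [hW, ← List.append_assoc A' Q B'] at hW'
    obtain ⟨rfl, rfl⟩ := List.append_inj hW' (by simp [hA, hA'])
    exact op_id_apply _ (A' ++ P) B (by simp [hA']) (by simp)
  -- Without room for the intermediate letters, the word is too short for `g` and both sides vanish.
  · have hlen : W.length < b' := by
      by_contra hlt
      refine hC ⟨W.take (a + Q.length), (W.drop (a + Q.length)).take (b - (a + P.length)),
        (W.drop (a + Q.length)).drop (b - (a + P.length)), ?_, ?_, ?_⟩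
      · simp; omega
      · simp; omega
      · rw [List.take_append_drop, List.take_append_drop]
    rw [Module.End.mul_apply, op_apply_eq_zero, LinearMap.smul_apply, Pi.smul_apply,
      Module.End.mul_apply]
    · refine Eq.trans ?_ (congrArg _ (op_congr _ (w := 0) fun A B hA hW => ?_).symm)
      · rw [map_zero]; simp
      · rw [op_apply_eq_zero]
        · rfl
        · rintro ⟨A', B', hA', h''⟩
          have := congrArg List.length hW
          have := congrArg List.length h''
          simp at *
          omega
    · rintro ⟨A, B, hA, rfl⟩
      simp at hlen
      omega

end op

/-! ## Families of local operators -/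

/-- The families of operators given by morphisms with `p` letters in the source and `q` letters in
the target, of parity `n`. -/
class IsLocal {z : k} (F : ℕ → Module.End k (Vec z)) (p q n : outParam ℕ) : Prop where
  mem : F ∈ Submodule.span k {G | ∃ (P Q : Word) (f : obj z P ⟶ obj z Q), P.length = p ∧
    Q.length = q ∧ f ∈ parityPart z P Q n ∧ G = fun a => op a f}

section IsLocal
variable {z : k} {F G : ℕ → Module.End k (Vec z)} {p q n p' q' n' r : ℕ}

theorem IsLocal.of_mor {P Q : Word} (d : Diag P Q) (hp : P.length = p) (hq : Q.length = q)
    (hn : d.tokens % 2 = n % 2) : IsLocal (fun a => op (z := z) a (mor z d)) p q n :=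
  ⟨Submodule.subset_span ⟨P, Q, _, hp, hq, mor_mem_parityPart z d hn, rfl⟩⟩

theorem IsLocal.add (hF : IsLocal F p q n) (hG : IsLocal G p q n) : IsLocal (F + G) p q n :=
  ⟨add_mem hF.mem hG.mem⟩

theorem IsLocal.smul (c : k) (hF : IsLocal F p q n) : IsLocal (c • F) p q n :=
  ⟨Submodule.smul_mem _ _ hF.mem⟩

theorem IsLocal.comp (hF : IsLocal F p q n) (hG : IsLocal G q r n') :
    IsLocal (fun a => G a * F a) p r (n + n') := by
  obtain ⟨hF⟩ := hF
  obtain ⟨hG⟩ := hG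
  constructor
  induction hF using Submodule.span_induction with
  | zero => simp only [Pi.zero_apply, mul_zero]; exact zero_mem _
  | add a b _ _ ha hb => simp only [Pi.add_apply, mul_add]; exact add_mem ha hb
  | smul c a _ ha => simp only [Pi.smul_apply, mul_smul_comm]; exact Submodule.smul_mem _ _ ha
  | mem F hF =>
  induction hG using Submodule.span_induction with
  | zero => simp only [Pi.zero_apply, zero_mul]; exact zero_mem _
  | add a b _ _ ha hb => simp only [Pi.add_apply, add_mul]; exact add_mem ha hb
  | smul c a _ ha => simp only [Pi.smul_apply, smul_mul_assoc]; exact Submodule.smul_mem _ _ ha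
  | mem G hG =>
  obtain ⟨P, Q, f, rfl, hq, hf, rfl⟩ := hF
  obtain ⟨Q', R, g, hq', rfl, hg, rfl⟩ := hG
  by_cases hQ : Q = Q'
  · subst hQ
    simp only [← op_comp]
    exact Submodule.subset_span ⟨P, R, _, rfl, rfl, comp_mem_parityPart hf hg, rfl⟩
  · simp only [op_mul_eq_zero _ f g (hq.trans hq'.symm) hQ]
    exact zero_mem _

theorem IsLocal.swap (hF : IsLocal F p q n) (hG : IsLocal G p' q' n') {a b b' : ℕ}
    (h : a + p ≤ b) (hb : b + q = b' + p) :
    G b' * F a = ((-1 : k) ^ (n * n')) • (F a * G b) := by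
  obtain ⟨hF⟩ := hF
  obtain ⟨hG⟩ := hG
  induction hF using Submodule.span_induction with
  | zero => simp
  | add x y _ _ hx hy => simp only [Pi.add_apply, mul_add, add_mul, hx, hy, smul_add]
  | smul c x _ hx =>
    simp only [Pi.smul_apply, mul_smul_comm, smul_mul_assoc, hx]
    rw [smul_comm]
  | mem F hF =>
  induction hG using Submodule.span_induction with
  | zero => simp
  | add x y _ _ hx hy => simp only [Pi.add_apply, mul_add, add_mul, hx, hy, smul_add]
  | smul c x _ hx =>
    simp only [Pi.smul_apply, mul_smul_comm, smul_mul_assoc, hx]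
    rw [smul_comm]
  | mem G hG =>
    obtain ⟨P, Q, f, rfl, rfl, hf, rfl⟩ := hF
    obtain ⟨P', Q', g, rfl, rfl, hg, rfl⟩ := hG
    exact op_swap hf hg h hb

/-- `b` and `b'` are the position of `G` below and above `F`, which replaces `p` letters by `q`. One
of the two families is even, so there is no sign. -/
theorem far (F G : ℕ → Module.End k (Vec z)) [hF : IsLocal F p q n] [hG : IsLocal G p' q' n']
    (a b b' : ℕ) (v : Vec z) (h : a + p ≤ b := by omega) (hb : b + q = b' + p := by omega)
    (hn : n * n' = 0 := by simp) :
    G b' (F a v) = F a (G b v) := by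
  have := LinearMap.congr_fun (hF.swap hG h hb) v
  rwa [hn, pow_zero, one_smul] at this

theorem far_odd (F G : ℕ → Module.End k (Vec z)) [hF : IsLocal F p q 1] [hG : IsLocal G p' q' 1]
    (a b b' : ℕ) (v : Vec z) (h : a + p ≤ b := by omega) (hb : b + q = b' + p := by omega) :
    G b' (F a v) = -F a (G b v) := by
  have := LinearMap.congr_fun (hF.swap hG h hb) v
  rw [mul_one, pow_one, LinearMap.smul_apply] at this
  exact this.trans (neg_one_smul k _)

end IsLocal

/-! ## The oriented operators -/

section defs
variable (z : k)

/-- Projection to the words with letter `x` in position `a`. -/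
def pr (x : Arrow) (a : ℕ) : Module.End k (Vec z) := op a (mor z (.id [x]))
/-- Positive upward crossing. -/
def opX (a : ℕ) : Module.End k (Vec z) := op a (mor z .posUp)
/-- Negative upward crossing. -/
def opXn (a : ℕ) : Module.End k (Vec z) := op a (mor z .negUp)
/-- Positive left crossing. -/
def opL (a : ℕ) : Module.End k (Vec z) := op a (mor z .posLeft)
/-- Negative right crossing. -/
def opSn (a : ℕ) : Module.End k (Vec z) := op a (mor z .negRight)
/-- Positive downward crossing. -/
def opD (a : ℕ) : Module.End k (Vec z) := op a (mor z .posDown)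
/-- Left cap. -/
def opE (a : ℕ) : Module.End k (Vec z) := op a (mor z .leftCap)
/-- Left cup. -/
def opQ (a : ℕ) : Module.End k (Vec z) := op a (mor z .leftCup)
/-- Right cap. -/
def opE' (a : ℕ) : Module.End k (Vec z) := op a (mor z .rightCap)
/-- Right cup. -/
def opQ' (a : ℕ) : Module.End k (Vec z) := op a (mor z .rightCup)
/-- A token on an upward strand: the closed one for `true`, the open one for `false`. -/
def tokDiag : Bool → Diag [up] [up]
  | true => .closedTok
  | false => .openTok
open Diag in
/-- A diagram on an upward strand, rotated. -/
def rotateUp (f : Diag [up] [up]) : Diag [down] [down] :=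
  comp (tensor leftCap idDown :)
    (comp (tensor (tensor idDown f) idDown :) (tensor idDown leftCup :) :)
open Diag in
/-- A crossing of a strand with an upward strand, rotated. -/
def rotateCross {x y : Arrow} (f : Diag [x, up] [up, y]) : Diag [down, x] [y, down] :=
  comp (tensor leftCap (.id [y, down]) :)
    (comp (tensor (tensor idDown f) idDown :) (tensor (.id [down, x]) leftCup :) :)
/-- A token on a downward strand. -/
def tokDiagDown (s : Bool) : Diag [down] [down] :=
  rotateUp (tokDiag s)
/-- A token on an upward strand. -/
def opU (s : Bool) (a : ℕ) : Module.End k (Vec z) := op a (mor z (tokDiag s))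
/-- A token on a downward strand. -/
def opN (s : Bool) (a : ℕ) : Module.End k (Vec z) := op a (mor z (tokDiagDown s))

instance (x : Arrow) : IsLocal (pr z x) 1 1 0 := .of_mor _ rfl rfl rfl
instance : IsLocal (opX z) 2 2 0 := .of_mor _ rfl rfl rfl
instance : IsLocal (opXn z) 2 2 0 := .of_mor _ rfl rfl rfl
instance : IsLocal (opL z) 2 2 0 := .of_mor _ rfl rfl rfl
instance : IsLocal (opSn z) 2 2 0 := .of_mor _ rfl rfl rfl
instance : IsLocal (opD z) 2 2 0 := .of_mor _ rfl rfl rfl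
instance : IsLocal (opE z) 2 0 0 := .of_mor _ rfl rfl rfl
instance : IsLocal (opQ z) 0 2 0 := .of_mor _ rfl rfl rfl
instance : IsLocal (opE' z) 2 0 0 := .of_mor _ rfl rfl rfl
instance : IsLocal (opQ' z) 0 2 0 := .of_mor _ rfl rfl rfl
instance (s : Bool) : IsLocal (opU z s) 1 1 1 := .of_mor _ rfl rfl (by cases s <;> rfl)
instance (s : Bool) : IsLocal (opN z s) 1 1 1 := .of_mor _ rfl rfl (by cases s <;> rfl)

end defs

/-! ### Projections to letters and their absorption -/

section absorb
variable {z : k} {P Q : Word}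

theorem pr_apply_of_get {x : Arrow} {a : ℕ} {W : Word} (v : Vec z) (h : W[a]? = some x) :
    pr z x a v W = v W := by
  obtain ⟨ha, hx⟩ := List.getElem?_eq_some_iff.1 h
  refine op_id_apply v (W.take a) (W.drop (a + 1)) (by simp; omega) ?_
  rw [← hx]
  simp

theorem pr_apply_of_ne {x : Arrow} {a : ℕ} {W : Word} (v : Vec z) (h : W[a]? ≠ some x) :
    pr z x a v W = 0 := by
  refine op_apply_eq_zero _ _ ?_
  rintro ⟨A, B, rfl, rfl⟩
  simp at h

theorem pr_out (f : obj z P ⟶ obj z Q) {a b i : ℕ} {x : Arrow} (v : Vec z) (hb : b = a + i)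
    (h : Q[i]? = some x) : pr z x b (op a f v) = op a f v := by
  subst hb
  funext W
  by_cases h' : ∃ A B, A.length = a ∧ W = A ++ (Q ++ B)
  · obtain ⟨A, B, rfl, rfl⟩ := h'
    refine pr_apply_of_get _ ?_
    rw [List.getElem?_append_right (by omega), Nat.add_sub_cancel_left,
      List.getElem?_append_left (List.getElem?_eq_some_iff.1 h).1, h]
  · rw [op_apply_eq_zero _ _ h']
    by_cases hw : W[a + i]? = some x
    · rw [pr_apply_of_get _ hw, op_apply_eq_zero _ _ h']
    · exact pr_apply_of_ne _ hw

theorem pr_in (f : obj z P ⟶ obj z Q) {a b i : ℕ} {x : Arrow} (v : Vec z) (hb : b = a + i)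
    (h : P[i]? = some x) : op a f (pr z x b v) = op a f v := by
  subst hb
  funext W
  refine op_congr f fun A B hA hW => pr_apply_of_get v ?_
  subst hA
  rw [List.getElem?_append_right (by omega), Nat.add_sub_cancel_left,
    List.getElem?_append_left (List.getElem?_eq_some_iff.1 h).1, h]

theorem pr_op_eq_zero (f : obj z P ⟶ obj z Q) {a b i : ℕ} {x y : Arrow} (v : Vec z)
    (hb : b = a + i) (h : Q[i]? = some y) (hne : y ≠ x) : pr z x b (op a f v) = 0 := by
  rw [← pr_out f v hb h]
  funext W
  by_cases hw : W[b]? = some x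
  · rw [pr_apply_of_get _ hw, pr_apply_of_ne]
    · rfl
    · rw [hw]; simpa using hne.symm
  · rw [pr_apply_of_ne _ hw]; rfl

theorem pr_comm (x y : Arrow) (a b : ℕ) (v : Vec z) :
    pr z x a (pr z y b v) = pr z y b (pr z x a v) := by
  funext W
  by_cases h1 : W[a]? = some x <;> by_cases h2 : W[b]? = some y <;>
    simp [pr_apply_of_get, pr_apply_of_ne, h1, h2]

end absorb

/-! ### Operators of composite and rotated diagrams -/

section expand
variable (z : k) (a : ℕ) (v : Vec z)

theorem op_mor_comp {P Q R : Word} (f : Diag Q R) (g : Diag P Q) :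
    op a (mor z (.comp f g)) v = op a (mor z f) (op a (mor z g) v) := by
  rw [← mor_comp, op_comp, Module.End.mul_apply]

theorem op_mor_tensor {P Q P' Q' : Word} (f : Diag P Q) (g : Diag P' Q') :
    op a (mor z (.tensor f g)) v = op a (mor z f) (op (a + P.length) (mor z g) v) := by
  rw [← tens_mor, op_tens a _ _ rfl, Module.End.mul_apply]

theorem op_mor_id_pair (x y : Arrow) :
    op a (mor z (.id [x, y])) v = pr z x a (pr z y (a + 1) v) := by
  rw [pr, pr, ← Module.End.mul_apply,
    ← op_tens a (b := a + 1) (mor z (.id [x])) (mor z (.id [y])) rfl, tens_mor]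
  congr 2
  exact (ofDiag_eq_of_rel (.tensor_id [x] [y])).symm

theorem mor_eq_of_defRel {P Q : Word} {d e : Diag P Q}
    (h : DefRel z (.single d 1 - .single e 1)) : mor z d = mor z e :=
  ofDiag_eq_of_rel (.of h)

/-- A morphism from `x ↑` to `↑ y`, rotated. -/
theorem op_rotate {x y : Arrow} (f : Diag [x, up] [up, y]) (hf : f.tokens = 0) :
    op a (mor z (rotateCross f)) v =
    opE z a (op (a + 1) (mor z f) (opQ z (a + 2) v)) := by
  have : IsLocal (fun a => op (z := z) a (mor z f)) 2 2 0 := .of_mor _ rfl rfl (by rw [hf])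
  have hfar : ∀ w, pr z down (a + 3) (op (a + 1) (mor z f) w) =
      op (a + 1) (mor z f) (pr z down (a + 3) w) := fun w =>
    far (fun a => op (z := z) a (mor z f)) (pr z down) _ _ _ w
  have hfar' : ∀ w, op (a + 1) (mor z f) (pr z down a w) =
      pr z down a (op (a + 1) (mor z f) w) := fun w =>
    far (pr z down) (fun a => op (z := z) a (mor z f)) _ _ _ w
  simp only [rotateCross, op_mor_comp, op_mor_tensor, op_mor_id_pair, List.length_append, List.length_cons,
    List.length_nil, Nat.zero_add, Nat.reduceAdd, Nat.add_assoc]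
  change opE z a (pr z y (a + 2) (pr z down (a + 3) (pr z down a (op (a + 1) (mor z f)
    (pr z down (a + 3) (pr z down a (pr z x (a + 1) (opQ z (a + 2) v)))))))) = _
  rw [pr_comm _ _ (a + 3) a, hfar, pr_comm y down (a + 2) a, opE, pr_in (b := a) (i := 0) _ _ rfl rfl,
    pr_comm _ _ (a + 3) a, pr_comm _ _ (a + 3) a, hfar', pr_comm y down (a + 2) a,
    pr_in (b := a) (i := 0) _ _ rfl rfl, pr_comm _ _ (a + 3) (a + 1), pr_comm _ _ (a + 3) (a + 1),
    pr_in (b := a + 1) (i := 0) _ _ rfl rfl, pr_out (i := 1) _ _ rfl rfl, opQ, pr_out (i := 1) _ _ rfl rfl,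
    pr_out (i := 1) _ _ rfl rfl]

/-- An endomorphism of the upward strand, rotated. -/
theorem op_rotate_one (f : Diag [up] [up]) :
    op a (mor z (rotateUp f)) v =
    opE z a (op (a + 1) (mor z f) (opQ z (a + 1) v)) := by
  have : IsLocal (fun a => op (z := z) a (mor z f)) 1 1 f.tokens := .of_mor _ rfl rfl rfl
  have hfar : ∀ w, pr z down (a + 2) (op (a + 1) (mor z f) w) =
      op (a + 1) (mor z f) (pr z down (a + 2) w) := fun w =>
    far (fun a => op (z := z) a (mor z f)) (pr z down) _ _ _ w
  have hfar' : ∀ w, op (a + 1) (mor z f) (pr z down a w) =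
      pr z down a (op (a + 1) (mor z f) w) := fun w =>
    far (pr z down) (fun a => op (z := z) a (mor z f)) _ _ _ w
  simp only [rotateUp, op_mor_comp, op_mor_tensor, List.length_append, List.length_cons,
    List.length_nil, Nat.zero_add, Nat.reduceAdd]
  change opE z a (pr z down (a + 2) (pr z down a (op (a + 1) (mor z f)
    (pr z down (a + 2) (pr z down a (opQ z (a + 1) v)))))) = _
  rw [pr_comm _ _ (a + 2) a, opE, pr_in (b := a) (i := 0) _ _ rfl rfl, hfar, pr_comm _ _ (a + 2) a,
    pr_comm _ _ (a + 2) a, hfar', pr_in (b := a) (i := 0) _ _ rfl rfl, opQ, pr_out (i := 1) _ _ rfl rfl,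
    pr_out (i := 1) _ _ rfl rfl]

end expand
/-- Downward token as a rotated upward token. -/
theorem opN_eq (z : k) (s : Bool) (a : ℕ) (v : Vec z) :
    opN z s a v = opE z a (opU z s (a + 1) (opQ z (a + 1) v)) :=
  op_rotate_one z a v (tokDiag s)

section absorb
variable (z : k) (a : ℕ) (v : Vec z) (s : Bool)

theorem opX_pr : pr z up a (opX z a v) = opX z a v ∧ pr z up (a + 1) (opX z a v) = opX z a v ∧
    opX z a (pr z up a v) = opX z a v ∧ opX z a (pr z up (a + 1) v) = opX z a v :=
  ⟨pr_out (i := 0) _ _ rfl rfl, pr_out (i := 1) _ _ rfl rfl, pr_in (i := 0) _ _ rfl rfl,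
    pr_in (i := 1) _ _ rfl rfl⟩
theorem opXn_pr : pr z up a (opXn z a v) = opXn z a v ∧
    pr z up (a + 1) (opXn z a v) = opXn z a v ∧
    opXn z a (pr z up a v) = opXn z a v ∧ opXn z a (pr z up (a + 1) v) = opXn z a v :=
  ⟨pr_out (i := 0) _ _ rfl rfl, pr_out (i := 1) _ _ rfl rfl, pr_in (i := 0) _ _ rfl rfl,
    pr_in (i := 1) _ _ rfl rfl⟩
theorem opL_pr : pr z up a (opL z a v) = opL z a v ∧ pr z down (a + 1) (opL z a v) = opL z a v ∧
    opL z a (pr z down a v) = opL z a v ∧ opL z a (pr z up (a + 1) v) = opL z a v :=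
  ⟨pr_out (i := 0) _ _ rfl rfl, pr_out (i := 1) _ _ rfl rfl, pr_in (i := 0) _ _ rfl rfl,
    pr_in (i := 1) _ _ rfl rfl⟩
theorem opSn_pr : pr z down a (opSn z a v) = opSn z a v ∧
    pr z up (a + 1) (opSn z a v) = opSn z a v ∧
    opSn z a (pr z up a v) = opSn z a v ∧ opSn z a (pr z down (a + 1) v) = opSn z a v :=
  ⟨pr_out (i := 0) _ _ rfl rfl, pr_out (i := 1) _ _ rfl rfl, pr_in (i := 0) _ _ rfl rfl,
    pr_in (i := 1) _ _ rfl rfl⟩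
theorem opD_pr : pr z down a (opD z a v) = opD z a v ∧ pr z down (a + 1) (opD z a v) = opD z a v ∧
    opD z a (pr z down a v) = opD z a v ∧ opD z a (pr z down (a + 1) v) = opD z a v :=
  ⟨pr_out (i := 0) _ _ rfl rfl, pr_out (i := 1) _ _ rfl rfl, pr_in (i := 0) _ _ rfl rfl,
    pr_in (i := 1) _ _ rfl rfl⟩
theorem opE_pr : opE z a (pr z down a v) = opE z a v ∧ opE z a (pr z up (a + 1) v) = opE z a v :=
  ⟨pr_in (i := 0) _ _ rfl rfl, pr_in (i := 1) _ _ rfl rfl⟩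
theorem opE'_pr : opE' z a (pr z up a v) = opE' z a v ∧
    opE' z a (pr z down (a + 1) v) = opE' z a v :=
  ⟨pr_in (i := 0) _ _ rfl rfl, pr_in (i := 1) _ _ rfl rfl⟩
theorem opQ_pr : pr z up a (opQ z a v) = opQ z a v ∧ pr z down (a + 1) (opQ z a v) = opQ z a v :=
  ⟨pr_out (i := 0) _ _ rfl rfl, pr_out (i := 1) _ _ rfl rfl⟩
theorem opQ'_pr : pr z down a (opQ' z a v) = opQ' z a v ∧
    pr z up (a + 1) (opQ' z a v) = opQ' z a v :=
  ⟨pr_out (i := 0) _ _ rfl rfl, pr_out (i := 1) _ _ rfl rfl⟩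
theorem opU_pr : pr z up a (opU z s a v) = opU z s a v ∧ opU z s a (pr z up a v) = opU z s a v :=
  ⟨pr_out (i := 0) _ _ rfl rfl, pr_in (i := 0) _ _ rfl rfl⟩
theorem opN_pr : pr z down a (opN z s a v) = opN z s a v ∧
    opN z s a (pr z down a v) = opN z s a v :=
  ⟨pr_out (i := 0) _ _ rfl rfl, pr_in (i := 0) _ _ rfl rfl⟩

end absorb

/-! ## Relations between the oriented operators -/

section basic
variable (z : k) (a : ℕ) (v : Vec z) (s : Bool)

/-- Operators see words of all orientations, so an identity of strands becomes a product of
projections; this is the form that all invertibility relations take. -/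
theorem opXn_opX : opXn z a (opX z a v) = pr z up a (pr z up (a + 1) v) := by
  rw [← op_mor_id_pair, ← mor_eq_of_defRel z .neg_pos, op_mor_comp]; rfl
theorem opX_opXn : opX z a (opXn z a v) = pr z up a (pr z up (a + 1) v) := by
  rw [← op_mor_id_pair, ← mor_eq_of_defRel z .pos_neg, op_mor_comp]; rfl
theorem opL_opSn : opL z a (opSn z a v) = pr z up a (pr z down (a + 1) v) := by
  rw [← op_mor_id_pair, ← mor_eq_of_defRel z .left_right, op_mor_comp]; rfl
theorem opSn_opL : opSn z a (opL z a v) = pr z down a (pr z up (a + 1) v) := by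
  rw [← op_mor_id_pair, ← mor_eq_of_defRel z .right_left, op_mor_comp]; rfl
theorem opE'_eq : opE' z a v = opE z a (opSn z a v) := op_mor_comp _ _ _ _ _
theorem opQ'_eq : opQ' z a v = opSn z a (opQ z a v) := op_mor_comp _ _ _ _ _

theorem opE_opQ : opE z (a + 1) (opQ z a v) = pr z up a v := by
  have h := mor_eq_of_defRel z .zigzag_up
  have h2 : op a (mor z (.id [up])) v = pr z up a (opE z (a + 1) (opQ z a (pr z up a v))) := by
    rw [← h, op_mor_comp, op_mor_tensor, op_mor_tensor]; rfl
  change pr z up a v = _ at h2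
  rw [h2, ← far (opQ z) (pr z up) a a (a + 2), ← far (pr z up) (opE z) a (a + 1) (a + 1),
    pr_comm, (opQ_pr z a v).1]
  exact (opE_pr z (a + 1) _).2.symm

theorem opE_opQ' : opE z a (opQ z (a + 1) v) = pr z down a v := by
  have h := mor_eq_of_defRel z .zigzag_down
  have h2 : op a (mor z (.id [down])) v =
      opE z a (pr z down (a + 2) (pr z down a (opQ z (a + 1) v))) := by
    rw [← h, op_mor_comp, op_mor_tensor, op_mor_tensor]; rfl
  change pr z down a v = _ at h2
  rw [h2, pr_comm, (opE_pr z a _).1, (opQ_pr z (a + 1) v).2]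

theorem mor_of_skein : mor z .posUp - mor z .negUp - z • mor z (.id [up, up]) = 0 := by
  have h := (Submodule.Quotient.mk_eq_zero (relSub z _ _)).2 (Submodule.subset_span
    (Rel.of (DefRel.skein (z := z))))
  rw [Submodule.Quotient.mk_sub, Submodule.Quotient.mk_sub] at h
  rw [show (Finsupp.single (Diag.id [up, up]) z : _ →₀ k) =
    z • Finsupp.single (Diag.id [up, up]) 1 by simp, Submodule.Quotient.mk_smul] at h
  exact h

theorem opX_skein : opX z a v = opXn z a v + z • pr z up a (pr z up (a + 1) v) := by
  have h : op a (mor z .posUp - mor z .negUp - z • mor z (.id [up, up])) v = 0 := by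
    rw [mor_of_skein, op_zero]; rfl
  rw [op_sub, op_sub, op_smul] at h
  change opX z a v - opXn z a v - z • op a (mor z (.id [up, up])) v = 0 at h
  rw [op_mor_id_pair, sub_sub, sub_eq_zero] at h
  exact h

theorem opU_opU : opU z s a (opU z s a v) = -pr z up a v := by
  have h : ∀ d : Diag [up] [up], DefRel z (.single (d.comp d) 1 + .single Diag.idUp 1) →
      op a (mor z d) (op a (mor z d) v) = -pr z up a v := by
    intro d hd
    have h := (Submodule.Quotient.mk_eq_zero (relSub z _ _)).2 (Submodule.subset_span (Rel.of hd))
    rw [Submodule.Quotient.mk_add] at h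
    have h' : mor z (d.comp d) + mor z (.id [up]) = 0 := h
    rw [← op_mor_comp, eq_neg_of_add_eq_zero_left h', op_neg]
    rfl
  cases s
  · exact h _ .open_sq
  · exact h _ .closed_sq

theorem opX_closed : opX z a (opU z true a v) = opU z true (a + 1) (opX z a v) := by
  have h := op_mor_comp z a v Diag.posUp (Diag.tensor .closedTok .idUp)
  rw [mor_eq_of_defRel z .closed_slide, op_mor_comp, op_mor_tensor, op_mor_tensor] at h
  change pr z up a (opU z true (a + 1) (opX z a v)) =
    opX z a (opU z true a (pr z up (a + 1) v)) at h
  rw [← far (opU z true) (pr z up) a (a + 1) (a + 1), (opX_pr z a _).2.2.2,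
    ← far (pr z up) (opU z true) a (a + 1) (a + 1), (opX_pr z a _).1] at h
  exact h.symm

theorem opX_open : opX z a (opU z false (a + 1) v) = opU z false a (opX z a v) := by
  have h := op_mor_comp z a v Diag.posUp (Diag.tensor .idUp .openTok)
  rw [mor_eq_of_defRel z .open_slide, op_mor_comp, op_mor_tensor, op_mor_tensor] at h
  change opU z false a (pr z up (a + 1) (opX z a v)) =
    opX z a (pr z up a (opU z false (a + 1) v)) at h
  rw [(opX_pr z a _).2.1, (opX_pr z a _).2.2.1] at h
  exact h.symm

theorem opE'_opQ : opE' z a (opQ z a v) = 0 := by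
  have h := (Submodule.Quotient.mk_eq_zero (relSub z _ _)).2 (Submodule.subset_span
    (Rel.of (DefRel.bubble (z := z))))
  have h' : mor z (Diag.comp Diag.rightCap Diag.leftCup) = 0 := h
  rw [opE', opQ, ← op_mor_comp, h', op_zero]
  rfl

theorem opE'_opU_opQ : opE' z a (opU z s a (opQ z a v)) = 0 := by
  have h : ∀ d : Diag [up] [up], DefRel z (.single (Diag.comp Diag.rightCap
      (Diag.comp (Diag.tensor d Diag.idDown :) Diag.leftCup)) 1) →
      opE' z a (op a (mor z d) (opQ z a v)) = 0 := by
    intro d hd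
    have h := (Submodule.Quotient.mk_eq_zero (relSub z _ _)).2 (Submodule.subset_span (Rel.of hd))
    have h' : mor z (Diag.comp Diag.rightCap (Diag.comp (Diag.tensor d Diag.idDown :)
      Diag.leftCup)) = 0 := h
    have h2 := op_mor_comp z a v Diag.rightCap (Diag.comp (Diag.tensor d Diag.idDown :)
      Diag.leftCup)
    rw [h', op_zero, op_mor_comp, op_mor_tensor] at h2
    change 0 = opE' z a (op a (mor z d) (pr z down (a + 1) (opQ z a v))) at h2
    rw [(opQ_pr z a v).2] at h2
    exact h2.symm
  cases s
  · exact h _ .open_bubble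
  · exact h _ .closed_bubble

theorem opX_braid : opX z a (opX z (a + 1) (opX z a v)) = opX z (a + 1) (opX z a (opX z (a + 1) v)) := by
  have h := congrArg (fun f => op a f v) (mor_eq_of_defRel z .braid)
  simp only [op_mor_comp, op_mor_tensor] at h
  change opX z a (pr z up (a + 2) (pr z up a (opX z (a + 1) (opX z a (pr z up (a + 2) v))))) =
    pr z up a (opX z (a + 1) (opX z a (pr z up (a + 2) (pr z up a (opX z (a + 1) v))))) at h
  rw [pr_comm, (opX_pr z a _).2.2.1, (opX_pr z (a + 1) _).2.1,
    ← far (opX z) (pr z up) a (a + 2) (a + 2), (opX_pr z (a + 1) _).2.2.2,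
    pr_comm _ _ (a + 2), (opX_pr z a _).2.2.1, (opX_pr z (a + 1) _).2.1,
    ← far (pr z up) (opX z) a (a + 1) (a + 1), (opX_pr z a _).1] at h
  exact h

theorem opL_eq : opL z a v = opE z a (opX z (a + 1) (opQ z (a + 2) v)) :=
  op_rotate z a v .posUp rfl
theorem opD_eq : opD z a v = opE z a (opL z (a + 1) (opQ z (a + 2) v)) :=
  op_rotate z a v .posLeft rfl

end basic

/-! ### Rotation -/

section rotate
variable {z : k} {f rf : ℕ → Module.End k (Vec z)} [IsLocal f 2 2 0]
  (hf : ∀ a v, rf a v = opE z a (f (a + 1) (opQ z (a + 2) v)))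
include hf

/-- Expanding `rf`, its cup and the outer cap form a zigzag, which straightens to a projection that
`f` absorbs. -/
theorem rotate_cap (hpr : ∀ a v, f a (pr z up (a + 1) v) = f a v) (a : ℕ) (v : Vec z) :
    opE z a (f (a + 1) v) = opE z (a + 1) (rf a v) := by
  rw [hf, far (opE z) (opE z) a (a + 3) (a + 1), far f (opE z) (a + 1) (a + 3) (a + 3), opE_opQ,
    hpr]

theorem rotate_cup (hpr : ∀ a v, pr z up a (f a v) = f a v) (a : ℕ) (v : Vec z) :
    rf (a + 1) (opQ z a v) = f a (opQ z (a + 1) v) := by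
  rw [hf, far (opQ z) (opQ z) a (a + 1) (a + 3), far (opQ z) f a a (a + 2), opE_opQ, hpr]

omit [IsLocal f 2 2 0] in
theorem rotate_token_fst {t : ℕ → Module.End k (Vec z)} {n : ℕ} [IsLocal t 1 1 n]
    (ht : ∀ a v, f a (t a v) = t (a + 1) (f a v)) (a : ℕ) (v : Vec z) :
    rf a (t (a + 1) v) = t a (rf a v) := by
  rw [hf, hf, far t (opQ z) (a + 1) (a + 2) (a + 2), ht,
    ← far (opE z) t a (a + 2) a]

end rotate

section left
variable (z : k) (a : ℕ) (v : Vec z) (s : Bool)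

theorem opE_opX : opE z a (opX z (a + 1) v) = opE z (a + 1) (opL z a v) :=
  rotate_cap (opL_eq z) (fun a v => (opX_pr z a v).2.2.2) a v
theorem opE_opL : opE z a (opL z (a + 1) v) = opE z (a + 1) (opD z a v) :=
  rotate_cap (opD_eq z) (fun a v => (opL_pr z a v).2.2.2) a v
theorem opL_opQ : opL z (a + 1) (opQ z a v) = opX z a (opQ z (a + 1) v) :=
  rotate_cup (opL_eq z) (fun a v => (opX_pr z a v).1) a v
theorem opD_opQ : opD z (a + 1) (opQ z a v) = opL z a (opQ z (a + 1) v) :=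
  rotate_cup (opD_eq z) (fun a v => (opL_pr z a v).1) a v

theorem opU_opQ : opU z s a (opQ z a v) = opN z s (a + 1) (opQ z a v) := by
  rw [opN_eq, far (opQ z) (opQ z) a a (a + 2), far (opQ z) (opU z s) a a (a + 2), opE_opQ,
    (opU_pr z a _ s).1]

theorem opE_opN : opE z a (opN z s a v) = opE z a (opU z s (a + 1) v) := by
  rw [opN_eq, far (opE z) (opE z) a (a + 2) a, far (opU z s) (opE z) (a + 1) (a + 2) (a + 2),
    opE_opQ, (opU_pr z (a + 1) _ s).2]

end left

section rotate
variable {z : k} {f rf : ℕ → Module.End k (Vec z)} [IsLocal f 2 2 0]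
  (hf : ∀ a v, rf a v = opE z a (f (a + 1) (opQ z (a + 2) v)))
include hf

/-- The token travels around the bent strand: over the cap, through `f`, and back along the cup. -/
theorem rotate_token_snd {s : Bool}
    (ht : ∀ a v, f a (opU z s (a + 1) v) = opU z s a (f a v)) (a : ℕ) (v : Vec z) :
    rf a (opN z s a v) = opN z s (a + 1) (rf a v) := by
  rw [hf, hf, far (opN z s) (opQ z) a (a + 2) (a + 2), far (opN z s) f a (a + 1) (a + 1), opE_opN,
    ← ht, opU_opQ, ← far f (opN z s) (a + 1) (a + 2 + 1) (a + 2 + 1),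
    ← far (opE z) (opN z s) a (a + 2 + 1) (a + 1)]

/-- Bend the strand that passes through both `f` and `f'` in the given braid relation; `rotate_cap`
pulls the cap through the two crossings. -/
theorem rotate_braid {f' rf' g : ℕ → Module.End k (Vec z)} [IsLocal rf 2 2 0] [IsLocal f' 2 2 0]
    [IsLocal rf' 2 2 0] [IsLocal g 2 2 0]
    (hf' : ∀ a v, rf' a v = opE z a (f' (a + 1) (opQ z (a + 2) v)))
    (hpr : ∀ a v, f a (pr z up (a + 1) v) = f a v)
    (hpr' : ∀ a v, f' a (pr z up (a + 1) v) = f' a v)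
    (hb : ∀ a v, f' a (f (a + 1) (g a v)) = g (a + 1) (f a (f' (a + 1) v))) (a : ℕ) (v : Vec z) :
    g a (rf' (a + 1) (rf a v)) = rf (a + 1) (rf' a (g (a + 1) v)) := by
  have h := congrArg (opE z a) (hb (a + 1) (opQ z (a + 3) v))
  rw [rotate_cap hf' hpr', ← far g (opQ z) (a + 1) (a + 3) (a + 3),
    ← far rf' f a (a + 2) (a + 2), ← far rf' (opQ z) a (a + 3) (a + 3), ← hf (a + 1),
    ← far (opE z) g a (a + 2) a, rotate_cap hf hpr, ← far rf f' a (a + 2) (a + 2),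
    ← far rf (opQ z) a (a + 3) (a + 3), ← hf' (a + 1)] at h
  exact h.symm

end rotate

/-! ### Braid relations with downward strands on the left -/

section braid
variable (z : k) (a : ℕ) (v : Vec z)

theorem braid_duu : opX z a (opL z (a + 1) (opL z a v)) = opL z (a + 1) (opL z a (opX z (a + 1) v)) :=
  rotate_braid (opL_eq z) (opL_eq z) (fun a v => (opX_pr z a v).2.2.2)
    (fun a v => (opX_pr z a v).2.2.2) (opX_braid z) a v
theorem braid_ddu : opL z a (opL z (a + 1) (opD z a v)) = opD z (a + 1) (opL z a (opL z (a + 1) v)) :=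
  rotate_braid (opD_eq z) (opL_eq z) (fun a v => (opL_pr z a v).2.2.2)
    (fun a v => (opX_pr z a v).2.2.2) (braid_duu z) a v
theorem braid_ddd : opD z a (opD z (a + 1) (opD z a v)) = opD z (a + 1) (opD z a (opD z (a + 1) v)) :=
  rotate_braid (opD_eq z) (opD_eq z) (fun a v => (opL_pr z a v).2.2.2)
    (fun a v => (opL_pr z a v).2.2.2) (braid_ddu z) a v

end braid

/-! ### Inverses of the oriented crossings -/

section inverse
variable (z : k) (a : ℕ) (v : Vec z) (s : Bool)

theorem opX_opX : opX z a (opX z a v) = pr z up a (pr z up (a + 1) v) + z • opX z a v := by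
  conv_lhs => rw [opX_skein z a v]
  rw [map_add, map_smul, opX_opXn, (opX_pr z a _).2.2.1, (opX_pr z a _).2.2.2]

/-- A crossing of the two upward legs of nested cups travels around to the two downward legs. -/
theorem opX_cup_cup : opX z a (opQ z (a + 1) (opQ z a v)) =
    opD z (a + 2) (opQ z (a + 1) (opQ z a v)) := by
  rw [← opL_opQ, ← far (opQ z) (opQ z) a a (a + 2)]
  exact (opD_opQ z (a + 1) _).symm

/-- The quadratic relation for upward strands is carried around two nested cups and straightened by
two caps. -/
theorem opD_opD : opD z a (opD z a v) = pr z down a (pr z down (a + 1) v) + z • opD z a v := by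
  have key : ∀ b w, opD z (b + 2) (opD z (b + 2) (opQ z (b + 1) (opQ z b w))) =
      opQ z (b + 1) (opQ z b w) + z • opD z (b + 2) (opQ z (b + 1) (opQ z b w)) := by
    intro b w
    rw [← opX_cup_cup, far (opX z) (opD z) b (b + 2) (b + 2), ← opX_cup_cup, opX_opX,
      (opQ_pr z (b + 1) _).1, ← far (pr z up) (opQ z) b (b + 1) (b + 1), (opQ_pr z b _).1]
  have h := congrArg (fun w => opE z a (opE z (a + 1) w)) (key (a + 2) v)
  have far1 : ∀ w, opE z a (opE z (a + 1) (opD z (a + 2 + 2) w)) =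
      opD z a (opE z a (opE z (a + 1) w)) := fun w => by
    rw [← far (opE z) (opD z) (a + 1) (a + 4) (a + 2), ← far (opE z) (opD z) a (a + 2) a]
  have far2 : opE z a (opE z (a + 1) (opQ z (a + 2 + 1) (opQ z (a + 2) v))) =
      pr z down a (pr z down (a + 1) v) := by
    rw [← far (opE z) (opQ z) (a + 1) (a + 3) (a + 1), opE_opQ']
    exact congrArg _ (opE_opQ' z (a + 1) v)
  simp only [map_add, map_smul, far1, far2] at h
  rwa [(opD_pr z a _).2.2.1, (opD_pr z a _).2.2.2] at h

/-- Negative downward crossing. -/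
def opDn (a : ℕ) : Module.End k (Vec z) := opD z a - z • (pr z down a * pr z down (a + 1))
/-- Negative left crossing. -/
def opLn (a : ℕ) : Module.End k (Vec z) := opL z a - z • (opQ z a * opE z a)
/-- Positive right crossing. -/
def opSp (a : ℕ) : Module.End k (Vec z) := opSn z a + z • (opQ' z a * opE' z a)

theorem opDn_apply : opDn z a v = opD z a v - z • pr z down a (pr z down (a + 1) v) := rfl
theorem opLn_apply : opLn z a v = opL z a v - z • opQ z a (opE z a v) := rfl
theorem opSp_apply : opSp z a v = opSn z a v + z • opQ' z a (opE' z a v) := rfl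

theorem pr_pr (x : Arrow) : pr z x a (pr z x a v) = pr z x a v := pr_out (i := 0) _ _ rfl rfl

theorem opD_opDn : opD z a (opDn z a v) = pr z down a (pr z down (a + 1) v) := by
  rw [opDn_apply, map_sub, map_smul, opD_opD, (opD_pr z a _).2.2.1, (opD_pr z a _).2.2.2,
    add_sub_cancel_right]
theorem opDn_opD : opDn z a (opD z a v) = pr z down a (pr z down (a + 1) v) := by
  rw [opDn_apply, opD_opD, (opD_pr z a _).2.1, (opD_pr z a _).1, add_sub_cancel_right]

theorem opL_opQ' : opL z a (opQ' z a v) = opQ z a v := by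
  rw [opQ'_eq, opL_opSn, (opQ_pr z a _).2, (opQ_pr z a _).1]
theorem opE'_opL : opE' z a (opL z a v) = opE z a v := by
  rw [opE'_eq, opSn_opL, (opE_pr z a _).1, (opE_pr z a _).2]
theorem opE_opQ'_self : opE z a (opQ' z a v) = 0 := by
  rw [opQ'_eq, ← opE'_eq, opE'_opQ]
theorem opSp_opQ : opSp z a (opQ z a v) = opQ' z a v := by
  rw [opSp_apply, opE'_opQ, map_zero, smul_zero, add_zero, opQ'_eq]
theorem opE_opSp : opE z a (opSp z a v) = opE' z a v := by
  rw [opSp_apply, map_add, map_smul, opE_opQ'_self, smul_zero, add_zero, opE'_eq]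

theorem opSp_opL : opSp z a (opL z a v) =
    pr z down a (pr z up (a + 1) v) + z • opQ' z a (opE z a v) := by
  rw [opSp_apply, opSn_opL, opE'_opL]
theorem opL_opSp : opL z a (opSp z a v) =
    pr z up a (pr z down (a + 1) v) + z • opQ z a (opE' z a v) := by
  rw [opSp_apply, map_add, map_smul, opL_opSn, opL_opQ']
-- The correction terms in the two crossings cancel because bubbles without tokens vanish.
theorem opSp_opLn : opSp z a (opLn z a v) = pr z down a (pr z up (a + 1) v) := by
  rw [opLn_apply, map_sub, map_smul, opSp_opL, opSp_opQ, add_sub_cancel_right]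
theorem opLn_opSp : opLn z a (opSp z a v) = pr z up a (pr z down (a + 1) v) := by
  rw [opLn_apply, opL_opSp, opE_opSp, add_sub_cancel_right]

instance : IsLocal (fun a => opQ' z a * opE' z a) 2 2 0 :=
  IsLocal.comp (F := opE' z) (G := opQ' z) inferInstance inferInstance
instance : IsLocal (fun a => pr z down a * pr z down (a + 1)) 2 2 0 := by
  have : (fun a => pr z down a * pr z down (a + 1)) =
      fun a => op a (mor z (.id [down, down])) :=
    funext fun a => LinearMap.ext fun v => (op_mor_id_pair z a v down down).symm
  rw [this]
  exact .of_mor _ rfl rfl rfl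
instance : IsLocal (opSp z) 2 2 0 :=
  IsLocal.add (F := opSn z) (G := z • fun a => opQ' z a * opE' z a) inferInstance
    (IsLocal.smul z inferInstance)
instance : IsLocal (opDn z) 2 2 0 := by
  have h := IsLocal.add (F := opD z) (G := (-z) • fun a => pr z down a * pr z down (a + 1))
    inferInstance (IsLocal.smul (-z) inferInstance)
  have e : opDn z = opD z + (-z) • fun a => pr z down a * pr z down (a + 1) := by
    funext a
    ext1 v
    exact (sub_eq_add_neg (opD z a v) _).trans (congrArg _ (neg_smul z _).symm)
  rwa [e]

/-- The term `z • cup * cap` in `opLn` is the rotation of the identity term of the skein relation.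
As a rotation of `opXn`, the crossing `opLn` inherits the token slides of `opXn`. -/
theorem opLn_eq : opLn z a v = opE z a (opXn z (a + 1) (opQ z (a + 2) v)) := by
  have h := opX_skein z (a + 1) (opQ z (a + 2) v)
  rw [opLn_apply, opL_eq, h, map_add, map_smul, (opE_pr z a _).2]
  have h2 := (opQ_pr z (a + 2) v).1
  rw [show a + 1 + 1 = a + 2 from rfl, h2, ← far (opE z) (opQ z) a (a + 2) a, add_sub_cancel_right]

end inverse

/-- The families `f` and `g` of crossings are inverse to each other; the strands at the bottom of
`f` are oriented by `x` and `y`. -/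
structure CrossInv {z : k} (f g : ℕ → Module.End k (Vec z)) (x y : Arrow) : Prop where
  inv_left : ∀ a v, g a (f a v) = pr z x a (pr z y (a + 1) v)
  inv_right : ∀ a v, f a (g a v) = pr z y a (pr z x (a + 1) v)
  out_zero : ∀ a v, pr z y a (f a v) = f a v
  out_one : ∀ a v, pr z x (a + 1) (f a v) = f a v
  out_zero' : ∀ a v, pr z x a (g a v) = g a v
  out_one' : ∀ a v, pr z y (a + 1) (g a v) = g a v
  in_zero : ∀ a v, f a (pr z x a v) = f a v
  in_one : ∀ a v, f a (pr z y (a + 1) v) = f a v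
  in_zero' : ∀ a v, g a (pr z y a v) = g a v
  in_one' : ∀ a v, g a (pr z x (a + 1) v) = g a v

theorem crossInv_X (z : k) : CrossInv (opX z) (opXn z) up up :=
  ⟨opXn_opX z, opX_opXn z, fun a v => (opX_pr z a v).1, fun a v => (opX_pr z a v).2.1,
    fun a v => (opXn_pr z a v).1, fun a v => (opXn_pr z a v).2.1, fun a v => (opX_pr z a v).2.2.1,
    fun a v => (opX_pr z a v).2.2.2, fun a v => (opXn_pr z a v).2.2.1,
    fun a v => (opXn_pr z a v).2.2.2⟩
theorem crossInv_L (z : k) : CrossInv (opL z) (opSn z) down up :=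
  ⟨opSn_opL z, opL_opSn z, fun a v => (opL_pr z a v).1, fun a v => (opL_pr z a v).2.1,
    fun a v => (opSn_pr z a v).1, fun a v => (opSn_pr z a v).2.1, fun a v => (opL_pr z a v).2.2.1,
    fun a v => (opL_pr z a v).2.2.2, fun a v => (opSn_pr z a v).2.2.1,
    fun a v => (opSn_pr z a v).2.2.2⟩
theorem crossInv_D (z : k) : CrossInv (opD z) (opDn z) down down where
  inv_left := opDn_opD z
  inv_right := opD_opDn z
  out_zero a v := (opD_pr z a v).1
  out_one a v := (opD_pr z a v).2.1
  out_zero' a v := by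
    rw [opDn_apply, map_sub, map_smul, (opD_pr z a v).1, pr_pr]
  out_one' a v := by
    rw [opDn_apply, map_sub, map_smul, (opD_pr z a v).2.1, pr_comm, pr_pr]
  in_zero a v := (opD_pr z a v).2.2.1
  in_one a v := (opD_pr z a v).2.2.2
  in_zero' a v := by
    rw [opDn_apply, opDn_apply, (opD_pr z a v).2.2.1, pr_comm, pr_pr, pr_comm]
  in_one' a v := by
    rw [opDn_apply, opDn_apply, (opD_pr z a v).2.2.2, pr_pr]

/-- Inverting a braid relation. -/
theorem CrossInv.braid {z : k} {f f' g g' h h' : ℕ → Module.End k (Vec z)} [IsLocal f 2 2 0]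
    [IsLocal f' 2 2 0] [IsLocal g 2 2 0] [IsLocal g' 2 2 0] [IsLocal h 2 2 0] [IsLocal h' 2 2 0]
    {x y w : Arrow} (hf : CrossInv f f' y w) (hg : CrossInv g g' x w) (hh : CrossInv h h' x y)
    (hb : ∀ a v, f a (g (a + 1) (h a v)) = h (a + 1) (g a (f (a + 1) v))) (a : ℕ) (v : Vec z) :
    h' a (g' (a + 1) (f' a v)) = f' (a + 1) (g' a (h' (a + 1) v)) := by
  have h1 : ∀ u, h' a (g' (a + 1) (f' a (f a (g (a + 1) (h a u))))) =
      pr z x a (pr z y (a + 1) (pr z w (a + 2) u)) := by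
    intro u
    rw [hf.inv_left, hg.out_zero, ← far (pr z y) g a (a + 1) (a + 1), hh.out_zero,
      hg.inv_left, far h (pr z w) a (a + 1 + 1) (a + 1 + 1), hh.out_one, hh.inv_left]
  have h2 : ∀ u, h (a + 1) (g a (f (a + 1) (f' (a + 1) (g' a (h' (a + 1) u))))) =
      pr z w a (pr z y (a + 1) (pr z x (a + 2) u)) := by
    intro u
    rw [hf.inv_right, far g' (pr z y) a (a + 1 + 1) (a + 1 + 1), hh.out_one', hg.out_one',
      hg.inv_right, hh.out_zero', ← far (pr z w) h' a (a + 1) (a + 1),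
      hh.inv_right, pr_comm x w, pr_comm y w]
  -- Both words are cancelled against their inverses in the same expression; the braid relation `hb`
  -- links the two cancellations and only projections remain.
  have h3 := h1 (f' (a + 1) (g' a (h' (a + 1) v)))
  rw [hb, h2] at h3
  rw [show a + 2 = a + 1 + 1 from rfl, hf.out_one', hf.out_zero',
    ← far (pr z x) f' a (a + 1) (a + 1), hg.out_zero'] at h3
  rw [← h3, hf.in_zero', hf.in_one', ← far f' (pr z x) a (a + 1 + 1) (a + 1 + 1), hg.in_one']

/-! ### Right cups and caps, and the right adjunction -/

section right
variable (z : k) (a : ℕ) (v : Vec z) (s : Bool)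

theorem braid_uud_neg : opSn z a (opSn z (a + 1) (opXn z a v)) =
    opXn z (a + 1) (opSn z a (opSn z (a + 1) v)) :=
  CrossInv.braid (crossInv_X z) (crossInv_L z) (crossInv_L z) (braid_duu z) a v
theorem braid_udd_neg : opDn z a (opSn z (a + 1) (opSn z a v)) =
    opSn z (a + 1) (opSn z a (opDn z (a + 1) v)) :=
  CrossInv.braid (crossInv_L z) (crossInv_L z) (crossInv_D z) (braid_ddu z) a v

/-- The right cap is the left cap on top of `opSn`. The slide of the left cap, applied above two
right crossings, becomes the slide of the right cap after the negative braid relation has cancelled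
the extra crossings. Only negative crossings slide exactly. -/
theorem opE'_opXn : opE' z (a + 1) (opXn z a v) = opE' z a (opSn z (a + 1) v) := by
  have h := opE_opX z a (opSn z a (opSn z (a + 1) (opXn z a v)))
  rw [opL_opSn, (opSn_pr z (a + 1) _).1, ← far (pr z up) (opSn z) a (a + 1) (a + 1),
    (opXn_pr z a _).1, braid_uud_neg, opX_opXn, far (opSn z) (pr z up) a (a + 1 + 1) (a + 1 + 1),
    (opSn_pr z (a + 1) _).2.1, (opSn_pr z a _).2.1] at h
  rw [opE'_eq, opE'_eq, h]
theorem opE'_opDn : opE' z a (opDn z (a + 1) v) = opE' z (a + 1) (opSn z a v) := by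
  have h := opE_opL z a (opSn z (a + 1) (opSn z a (opDn z (a + 1) v)))
  rw [opL_opSn, far (opSn z) (pr z down) a (a + 1 + 1) (a + 1 + 1), (crossInv_D z).out_one',
    (opSn_pr z a _).2.1, ← braid_udd_neg, opD_opDn, (opSn_pr z (a + 1) _).1,
    ← far (pr z down) (opSn z) a (a + 1) (a + 1), (opSn_pr z a _).1] at h
  rw [opE'_eq, opE'_eq, h]
theorem opSn_opQ' : opSn z a (opQ' z (a + 1) v) = opXn z (a + 1) (opQ' z a v) := by
  have h := congrArg (fun w => opXn z (a + 1) (opSn z a (opSn z (a + 1) w))) (opL_opQ z a v)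
  simp only [opSn_opL] at h
  rw [← braid_uud_neg, opXn_opX, (opQ_pr z (a + 1) _).1, far (pr z up) (opSn z) a (a + 1) (a + 1),
    (opSn_pr z a _).2.2.1, pr_comm, (opQ_pr z a _).2, ← far (opSn z) (pr z up) a (a + 2) (a + 2)] at h
  rw [opQ'_eq, opQ'_eq]; symm
  exact ((opXn_pr z (a + 1) _).2.2.2).symm.trans h
theorem opDn_opQ' : opDn z a (opQ' z (a + 1) v) = opSn z (a + 1) (opQ' z a v) := by
  have h := congrArg (fun w => opSn z (a + 1) (opSn z a (opDn z (a + 1) w))) (opD_opQ z a v)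
  simp only [opDn_opD] at h
  rw [← braid_udd_neg, opSn_opL, (opQ_pr z (a + 1) _).1, far (pr z down) (opSn z) a (a + 1) (a + 1),
    (crossInv_D z).in_zero', pr_comm, (opQ_pr z a _).2,
    ← far (opSn z) (pr z down) a (a + 2) (a + 2)] at h
  rw [opQ'_eq, opQ'_eq]; symm
  exact ((opSn_pr z (a + 1) _).2.2.2).symm.trans h

/-- By the slides, the right zigzag and the left zigzag become the same diagram with a negative and
a positive crossing. By the skein relation they differ by a multiple of a bubble without tokens,
which is zero. -/
theorem opE'_opQ'_left : opE' z a (opQ' z (a + 1) v) = pr z up a v := by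
  have h := opX_skein z (a + 1) (opQ' z a v)
  rw [opE'_eq, opSn_opQ', ← opE_opQ, ← opL_opQ', ← opE_opX, h, map_add, map_smul,
    pr_comm, (opQ'_pr z a _).2, far (opQ' z) (pr z up) a a (a + 1 + 1), opE_opQ'_self, smul_zero,
    add_zero]
theorem opE'_opQ'_right : opE' z (a + 1) (opQ' z a v) = pr z down a v := by
  rw [opE'_eq, ← opDn_opQ', ← opE_opQ', ← opL_opQ', opE_opL, opDn_apply, map_sub, map_smul,
    (opQ'_pr z (a + 1) _).1, ← far (pr z down) (opQ' z) a (a + 1) (a + 1), opE_opQ'_self,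
    smul_zero, sub_zero]

end right

section token_inv
variable {z : k} {f g t : ℕ → Module.End k (Vec z)} {x y : Arrow} {n : ℕ}

theorem CrossInv.token_fst [IsLocal t 1 1 n] (h : CrossInv f g x y) (ht : ∀ a v, pr z y a (t a v) = t a v)
    (ht' : ∀ a v, t a (pr z y a v) = t a v) (hs : ∀ a v, f a (t (a + 1) v) = t a (f a v)) (a : ℕ)
    (v : Vec z) : g a (t a v) = t (a + 1) (g a v) := by
  have h1 := congrArg (g a) (hs a (g a v))
  rw [h.inv_left, h.inv_right, ht, ← far (pr z x) t a (a + 1) (a + 1), h.out_zero', ht',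
    ← far t (pr z x) a (a + 1) (a + 1), h.in_one'] at h1
  exact h1.symm

theorem CrossInv.token_snd [IsLocal t 1 1 n] (h : CrossInv f g x y) (ht : ∀ a v, pr z x a (t a v) = t a v)
    (ht' : ∀ a v, t a (pr z x a v) = t a v) (hs : ∀ a v, f a (t a v) = t (a + 1) (f a v)) (a : ℕ)
    (v : Vec z) : g a (t (a + 1) v) = t a (g a v) := by
  have h1 := congrArg (g a) (hs a (g a v))
  rw [h.inv_left, h.inv_right, far t (pr z y) a (a + 1) (a + 1), h.out_one', ht,
    far (pr z y) t a (a + 1) (a + 1), h.in_zero', ht'] at h1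
  exact h1.symm

end token_inv

/-! ### Token slides in all orientations -/

section tokens
variable (z : k) (a : ℕ) (v : Vec z) (s : Bool)

theorem opXn_closed : opXn z a (opU z true (a + 1) v) = opU z true a (opXn z a v) :=
  (crossInv_X z).token_snd (fun a v => (opU_pr z a v _).1) (fun a v => (opU_pr z a v _).2)
    (opX_closed z) a v
theorem opXn_open : opXn z a (opU z false a v) = opU z false (a + 1) (opXn z a v) :=
  (crossInv_X z).token_fst (fun a v => (opU_pr z a v _).1) (fun a v => (opU_pr z a v _).2)
    (opX_open z) a v

theorem opL_closed : opL z a (opU z true (a + 1) v) = opU z true a (opL z a v) :=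
  rotate_token_fst (opL_eq z) (opX_closed z) a v
theorem opL_open : opL z a (opN z false a v) = opN z false (a + 1) (opL z a v) :=
  rotate_token_snd (opL_eq z) (opX_open z) a v
theorem opD_open : opD z a (opN z false (a + 1) v) = opN z false a (opD z a v) :=
  rotate_token_fst (opD_eq z) (opL_open z) a v
theorem opD_closed : opD z a (opN z true a v) = opN z true (a + 1) (opD z a v) :=
  rotate_token_snd (opD_eq z) (opL_closed z) a v
theorem opLn_open : opLn z a (opU z false (a + 1) v) = opU z false a (opLn z a v) :=
  rotate_token_fst (opLn_eq z) (opXn_open z) a v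
theorem opLn_closed : opLn z a (opN z true a v) = opN z true (a + 1) (opLn z a v) :=
  rotate_token_snd (opLn_eq z) (opXn_closed z) a v

theorem opSn_closed : opSn z a (opU z true a v) = opU z true (a + 1) (opSn z a v) :=
  (crossInv_L z).token_fst (fun a v => (opU_pr z a v _).1) (fun a v => (opU_pr z a v _).2)
    (opL_closed z) a v
theorem opSn_open : opSn z a (opN z false (a + 1) v) = opN z false a (opSn z a v) :=
  (crossInv_L z).token_snd (fun a v => (opN_pr z a v _).1) (fun a v => (opN_pr z a v _).2)
    (opL_open z) a v

theorem opSp_pr : pr z down a (opSp z a v) = opSp z a v ∧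
    pr z up (a + 1) (opSp z a v) = opSp z a v ∧
    opSp z a (pr z up a v) = opSp z a v ∧ opSp z a (pr z down (a + 1) v) = opSp z a v := by
  simp only [opSp_apply, map_add, map_smul, opSn_pr, opE'_pr, opQ'_pr, and_self]
theorem opLn_pr : pr z up a (opLn z a v) = opLn z a v ∧
    pr z down (a + 1) (opLn z a v) = opLn z a v ∧
    opLn z a (pr z down a v) = opLn z a v ∧ opLn z a (pr z up (a + 1) v) = opLn z a v := by
  simp only [opLn_apply, map_sub, map_smul, opL_pr, opE_pr, opQ_pr, and_self]
theorem crossInv_Ln : CrossInv (opLn z) (opSp z) down up :=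
  ⟨opSp_opLn z, opLn_opSp z, fun a v => (opLn_pr z a v).1, fun a v => (opLn_pr z a v).2.1,
    fun a v => (opSp_pr z a v).1, fun a v => (opSp_pr z a v).2.1, fun a v => (opLn_pr z a v).2.2.1,
    fun a v => (opLn_pr z a v).2.2.2, fun a v => (opSp_pr z a v).2.2.1,
    fun a v => (opSp_pr z a v).2.2.2⟩

theorem opSp_open : opSp z a (opU z false a v) = opU z false (a + 1) (opSp z a v) :=
  (crossInv_Ln z).token_fst (fun a v => (opU_pr z a v _).1) (fun a v => (opU_pr z a v _).2)
    (opLn_open z) a v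
theorem opSp_closed : opSp z a (opN z true (a + 1) v) = opN z true a (opSp z a v) :=
  (crossInv_Ln z).token_snd (fun a v => (opN_pr z a v _).1) (fun a v => (opN_pr z a v _).2)
    (opLn_closed z) a v

/-- The right cup is a left cup followed by either of the right crossings. The open token passes
through `opSp`, the closed one through `opSn`, and a clockwise bubble with one token remains. -/
theorem opE_opU_opQ' : opE z a (opU z s (a + 1) (opQ' z a v)) = 0 := by
  cases s
  · rw [← opSp_opQ, ← opSp_open, opE_opSp, opE'_opU_opQ]
  · rw [opQ'_eq, ← opSn_closed, ← opE'_eq, opE'_opU_opQ]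

/-- The right cap contains a crossing, which the token has to pass once on its upward and once on
its downward strand. For a given token these slides are available for crossings of opposite sign;
exchanging the sign costs a counterclockwise bubble with one token, which vanishes. -/
theorem opE'_opU : opE' z a (opU z s a v) = opE' z a (opN z s (a + 1) v) := by
  have h : opE z a (opU z s (a + 1) (opSp z a v)) = opE z a (opU z s (a + 1) (opSn z a v)) := by
    rw [opSp_apply, map_add, map_smul, map_add, map_smul, opE_opU_opQ', smul_zero, add_zero]
  cases s
  · rw [opE'_eq z a (opN z false (a + 1) v), opSn_open, opE_opN, ← h, ← opSp_open, opE_opSp]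
  · rw [opE'_eq z a (opU z true a v), opSn_closed, ← h, ← opE_opN, ← opSp_closed, opE_opSp]

theorem opU_opQ' : opU z s (a + 1) (opQ' z a v) = opN z s a (opQ' z a v) := by
  have h : opSp z a (opU z s a (opQ z a v)) = opSn z a (opU z s a (opQ z a v)) := by
    rw [opSp_apply, opE'_opU_opQ, map_zero, smul_zero, add_zero]
  cases s
  · rw [← opSp_opQ, ← opSp_open, h, opU_opQ, opSn_open, ← opQ'_eq, opSp_opQ]
  · rw [opQ'_eq, ← opSn_closed, ← h, opU_opQ, opSp_closed, opSp_opQ, opQ'_eq]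

end tokens

/-! ## Unoriented operators -/

section braids
variable {z : k} {f f' g g' h h' : ℕ → Module.End k (Vec z)} [IsLocal g 2 2 0] {x y w : Arrow}

/-- Multiplying a braid relation by the inverse of an outer crossing gives the versions with one
negative crossing. These supply the orientations for which neither the all-positive nor the
all-negative relation has been derived. -/
theorem CrossInv.braid_fst (hf : CrossInv f f' y w) (hg : CrossInv g g' x w)
    (hh : CrossInv h h' x y)
    (hb : ∀ a v, f a (g (a + 1) (h a v)) = h (a + 1) (g a (f (a + 1) v))) (a : ℕ) (v : Vec z) :
    h' (a + 1) (f a (g (a + 1) v)) = g a (f (a + 1) (h' a v)) := by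
  have h1 := congrArg (h' (a + 1)) (hb a (h' a v))
  rw [hh.inv_right, hh.inv_left, far (pr z y) g a (a + 1) (a + 1), hf.in_zero, hg.in_zero,
    far g (pr z y) a (a + 1 + 1) (a + 1 + 1), hf.out_one, hg.out_one] at h1
  exact h1

theorem CrossInv.braid_snd (hf : CrossInv f f' y w) (hg : CrossInv g g' x w)
    (hh : CrossInv h h' x y)
    (hb : ∀ a v, f a (g (a + 1) (h a v)) = h (a + 1) (g a (f (a + 1) v))) (a : ℕ) (v : Vec z) :
    g (a + 1) (h a (f' (a + 1) v)) = f' a (h (a + 1) (g a v)) := by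
  have h1 := congrArg (f' a) (hb a (f' (a + 1) v))
  rw [hf.inv_right, hf.inv_left, pr_comm, ← far (pr z y) g a (a + 1) (a + 1), hh.out_zero,
    hg.out_zero, hg.in_one, ← far g (pr z y) a (a + 1 + 1) (a + 1 + 1), hh.in_one] at h1
  exact h1

end braids

section defs
variable (z : k)

/-- The sum of the positive crossings of all orientations. -/
def opT (a : ℕ) : Module.End k (Vec z) := opX z a + opSp z a + opL z a + opD z a
/-- The sum of both cups. -/
def opu (a : ℕ) : Module.End k (Vec z) := opQ z a + opQ' z a
/-- The sum of both caps. -/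
def opn (a : ℕ) : Module.End k (Vec z) := opE z a + opE' z a
/-- A token on a strand of any orientation. -/
def tok (s : Bool) (a : ℕ) : Module.End k (Vec z) := opU z s a + opN z s a
/-- The projection to words that have a letter in position `a`. -/
def prLen (a : ℕ) : Module.End k (Vec z) := pr z up a + pr z down a

instance : IsLocal (opT z) 2 2 0 :=
  IsLocal.add (F := opX z + opSp z + opL z) (G := opD z)
    (IsLocal.add (F := opX z + opSp z) (G := opL z)
      (IsLocal.add (F := opX z) (G := opSp z) inferInstance inferInstance) inferInstance)
    inferInstance
instance : IsLocal (opu z) 0 2 0 :=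
  IsLocal.add (F := opQ z) (G := opQ' z) inferInstance inferInstance
instance : IsLocal (opn z) 2 0 0 :=
  IsLocal.add (F := opE z) (G := opE' z) inferInstance inferInstance
instance (s : Bool) : IsLocal (tok z s) 1 1 1 :=
  IsLocal.add (F := opU z s) (G := opN z s) inferInstance inferInstance
instance : IsLocal (prLen z) 1 1 0 :=
  IsLocal.add (F := pr z up) (G := pr z down) inferInstance inferInstance

/-- The positive crossing with given orientations at the bottom. -/
def opTc : Arrow → Arrow → ℕ → Module.End k (Vec z)
  | up, up => opX z
  | up, down => opSp z
  | down, up => opL z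
  | down, down => opD z
/-- The negative crossing with given orientations at the bottom. -/
def opTn : Arrow → Arrow → ℕ → Module.End k (Vec z)
  | up, up => opXn z
  | up, down => opSn z
  | down, up => opLn z
  | down, down => opDn z

instance (x y : Arrow) : IsLocal (opTc z x y) 2 2 0 := by
  cases x <;> cases y <;> (simp only [opTc]; infer_instance)

variable (a : ℕ) (v : Vec z)

theorem opu_apply : opu z a v = opQ z a v + opQ' z a v := rfl
theorem opn_apply : opn z a v = opE z a v + opE' z a v := rfl
theorem tok_apply (s : Bool) : tok z s a v = opU z s a v + opN z s a v := rfl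
theorem prLen_apply : prLen z a v = pr z up a v + pr z down a v := rfl

theorem opTc_pr (x y : Arrow) : pr z y a (opTc z x y a v) = opTc z x y a v ∧
    pr z x (a + 1) (opTc z x y a v) = opTc z x y a v ∧
    opTc z x y a (pr z x a v) = opTc z x y a v ∧ opTc z x y a (pr z y (a + 1) v) = opTc z x y a v := by
  cases x <;> cases y
  · exact opX_pr z a v
  · exact opSp_pr z a v
  · exact opL_pr z a v
  · exact opD_pr z a v

theorem pr_pr_ne {x y : Arrow} (h : x ≠ y) : pr z x a (pr z y a v) = 0 :=
  pr_op_eq_zero (i := 0) _ _ rfl rfl h.symm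

theorem opT_eq_sum : opT z a v = opTc z up up a v + opTc z up down a v + opTc z down up a v +
    opTc z down down a v := rfl

theorem opTc_pr_ne {x y x' y' : Arrow} (h : x' ≠ x ∨ y' ≠ y) :
    opTc z x' y' a (pr z x a (pr z y (a + 1) v)) = 0 := by
  rcases h with h | h
  · rw [← (opTc_pr z a _ x' y').2.2.1, pr_pr_ne z a _ h, map_zero]
  · rw [← (opTc_pr z a _ x' y').2.2.2, pr_comm, pr_pr_ne z (a + 1) _ h, map_zero, map_zero]

/-- The crossing on given orientations. -/
theorem opT_pr (x y : Arrow) : opT z a (pr z x a (pr z y (a + 1) v)) = opTc z x y a v := by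
  have h : opTc z x y a (pr z x a (pr z y (a + 1) v)) = opTc z x y a v := by
    rw [(opTc_pr z a _ x y).2.2.1, (opTc_pr z a _ x y).2.2.2]
  rw [← h, opT_eq_sum]
  cases x <;> cases y <;> simp [opTc_pr_ne]

theorem opn_pr_du : opn z a (pr z down a v) = opE z a v := by
  rw [opn_apply, (opE_pr z a _).1, ← (opE'_pr z a _).1, pr_pr_ne z a _ (by simp), map_zero, add_zero]
theorem opn_pr_ud : opn z a (pr z up a v) = opE' z a v := by
  rw [opn_apply, (opE'_pr z a _).1, ← (opE_pr z a _).1, pr_pr_ne z a _ (by simp), map_zero, zero_add]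
theorem pr_up_opu : pr z up a (opu z a v) = opQ z a v := by
  rw [opu_apply, map_add, (opQ_pr z a _).1, ← (opQ'_pr z a _).1, pr_pr_ne z a _ (by simp), add_zero]
theorem pr_down_opu : pr z down a (opu z a v) = opQ' z a v := by
  rw [opu_apply, map_add, (opQ'_pr z a _).1, ← (opQ_pr z a _).1, pr_pr_ne z a _ (by simp), zero_add]
theorem tok_pr_up (s : Bool) : tok z s a (pr z up a v) = opU z s a v := by
  rw [tok_apply, (opU_pr z a _ s).2, ← (opN_pr z a _ s).2, pr_pr_ne z a _ (by simp), map_zero,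
    add_zero]
theorem tok_pr_down (s : Bool) : tok z s a (pr z down a v) = opN z s a v := by
  rw [tok_apply, (opN_pr z a _ s).2, ← (opU_pr z a _ s).2, pr_pr_ne z a _ (by simp), map_zero,
    zero_add]

theorem opT_prLen : opT z a (prLen z a v) = opT z a v := by
  have h : ∀ x y, opTc z x y a (prLen z a v) = opTc z x y a v := by
    intro x y
    rw [prLen_apply, map_add, ← (opTc_pr z a _ x y).2.2.1,
      ← (opTc_pr z a (pr z down a v) x y).2.2.1]
    cases x
    · rw [pr_pr, pr_pr_ne z a _ (by simp), map_zero, add_zero, (opTc_pr z a _ _ _).2.2.1]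
    · rw [pr_pr, pr_pr_ne z a _ (by simp), map_zero, zero_add, (opTc_pr z a _ _ _).2.2.1]
  simp only [opT_eq_sum, h]
theorem opT_prLen_succ : opT z a (prLen z (a + 1) v) = opT z a v := by
  have h : ∀ x y, opTc z x y a (prLen z (a + 1) v) = opTc z x y a v := by
    intro x y
    rw [prLen_apply, map_add, ← (opTc_pr z a _ x y).2.2.2,
      ← (opTc_pr z a (pr z down (a + 1) v) x y).2.2.2]
    cases y
    · rw [pr_pr, pr_pr_ne z (a + 1) _ (by simp), map_zero, add_zero, (opTc_pr z a _ _ _).2.2.2]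
    · rw [pr_pr, pr_pr_ne z (a + 1) _ (by simp), map_zero, zero_add, (opTc_pr z a _ _ _).2.2.2]
  simp only [opT_eq_sum, h]
theorem opn_prLen : opn z a (prLen z a v) = opn z a v := by
  rw [prLen_apply, map_add, opn_pr_du, opn_pr_ud, opn_apply, add_comm]
theorem opn_prLen_succ : opn z a (prLen z (a + 1) v) = opn z a v := by
  rw [prLen_apply, map_add, opn_apply, opn_apply, opn_apply, (opE_pr z a _).2, (opE'_pr z a _).2,
    ← (opE_pr z a (pr z down (a + 1) v)).2, ← (opE'_pr z a (pr z up (a + 1) v)).2,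
    pr_pr_ne z (a + 1) _ (by simp), pr_pr_ne z (a + 1) _ (by simp)]
  simp
theorem tok_prLen (s : Bool) : tok z s a (prLen z a v) = tok z s a v := by
  rw [prLen_apply, map_add, tok_pr_up, tok_pr_down, tok_apply]

theorem opT_opT_opT_pr (x y w : Arrow) :
    opT z a (opT z (a + 1) (opT z a (pr z x a (pr z y (a + 1) (pr z w (a + 1 + 1) v))))) =
      opTc z y w a (opTc z x w (a + 1) (opTc z x y a v)) := by
  rw [opT_pr z a _ x y, ← far (opTc z x y) (pr z w) a (a + 1 + 1) (a + 1 + 1),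
    ← (opTc_pr z a v x y).2.1, pr_comm w, opT_pr z (a + 1) _ x w, (opTc_pr z a v x y).2.1,
    ← (opTc_pr z (a + 1) _ x w).1, ← (opTc_pr z a v x y).1,
    far (pr z y) (opTc z x w) a (a + 1) (a + 1), pr_comm w, opT_pr z a _ y w,
    (opTc_pr z a _ y w).2.2.1, (opTc_pr z a _ y w).2.2.2]
theorem opT_opT_opT_pr' (x y w : Arrow) :
    opT z (a + 1) (opT z a (opT z (a + 1) (pr z x a (pr z y (a + 1) (pr z w (a + 1 + 1) v))))) =
      opTc z x y (a + 1) (opTc z x w a (opTc z y w (a + 1) v)) := by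
  rw [far (pr z x) (opT z) a (a + 1) (a + 1), opT_pr z (a + 1) _ y w]
  obtain ⟨X, hX⟩ : ∃ X, X = opTc z y w (a + 1) v := ⟨_, rfl⟩
  have h1 : pr z w (a + 1) X = X := hX ▸ (opTc_pr z (a + 1) v y w).1
  have h2 : pr z y (a + 1 + 1) X = X := hX ▸ (opTc_pr z (a + 1) v y w).2.1
  rw [← hX]
  conv_lhs => rw [← h1, opT_pr z a _ x w, ← h2, ← far (opTc z x w) (pr z y) a (a + 1 + 1) (a + 1 + 1),
    ← (opTc_pr z a _ x w).2.1, pr_comm y, opT_pr z (a + 1) _ x y]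

end defs

/-! ## The filtration by the number of crossings -/

section low
variable (z : k)

/-- The vector given by the identity of the unit object. -/
def vac : Vec z
  | [] => 𝟙 (unit z)
  | _ :: _ => 0

/-- Monomials with `n` positive crossings, applied to the vacuum. -/
inductive Mon : ℕ → Vec z → Prop
  | vac : Mon 0 (vac z)
  | opT {n : ℕ} {v : Vec z} (a : ℕ) (h : Mon n v) : Mon (n + 1) (opT z a v)
  | opu {n : ℕ} {v : Vec z} (a : ℕ) (h : Mon n v) : Mon n (opu z a v)
  | opn {n : ℕ} {v : Vec z} (a : ℕ) (h : Mon n v) : Mon n (opn z a v)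
  | tok {n : ℕ} {v : Vec z} (s : Bool) (a : ℕ) (h : Mon n v) : Mon n (tok z s a v)
  | pr {n : ℕ} {v : Vec z} (x : Arrow) (a : ℕ) (h : Mon n v) : Mon n (pr z x a v)

/-- The span of the monomials with fewer than `n` crossings. -/
def Low (n : ℕ) : Submodule k (Vec z) := Submodule.span k {v | ∃ m < n, Mon z m v}

variable {z} {n : ℕ} {v w : Vec z}

theorem Mon.mem_low {m : ℕ} (h : Mon z m v) (hm : m < n) : v ∈ Low z n :=
  Submodule.subset_span ⟨m, hm, h⟩

theorem low_mono {m : ℕ} (h : m ≤ n) : Low z m ≤ Low z n :=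
  Submodule.span_mono fun _ ⟨i, hi, h'⟩ => ⟨i, hi.trans_le h, h'⟩

theorem low_map {m : ℕ} (F : Module.End k (Vec z)) (hF : ∀ i < n, ∀ v, Mon z i v → F v ∈ Low z m)
    (hv : v ∈ Low z n) : F v ∈ Low z m := by
  have : Low z n ≤ (Low z m).comap F := Submodule.span_le.2 fun v ⟨i, hi, h⟩ => hF i hi v h
  exact this hv

theorem low_opT (a : ℕ) (hv : v ∈ Low z n) : opT z a v ∈ Low z (n + 1) :=
  low_map _ (fun _ hi _ h => (h.opT a).mem_low (by omega)) hv
theorem low_opu (a : ℕ) (hv : v ∈ Low z n) : opu z a v ∈ Low z n :=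
  low_map _ (fun _ hi _ h => (h.opu a).mem_low hi) hv
theorem low_opn (a : ℕ) (hv : v ∈ Low z n) : opn z a v ∈ Low z n :=
  low_map _ (fun _ hi _ h => (h.opn a).mem_low hi) hv
theorem low_tok (s : Bool) (a : ℕ) (hv : v ∈ Low z n) : tok z s a v ∈ Low z n :=
  low_map _ (fun _ hi _ h => (h.tok s a).mem_low hi) hv
theorem low_pr (x : Arrow) (a : ℕ) (hv : v ∈ Low z n) : pr z x a v ∈ Low z n :=
  low_map _ (fun _ hi _ h => (h.pr x a).mem_low hi) hv
theorem low_prLen (a : ℕ) (hv : v ∈ Low z n) : prLen z a v ∈ Low z n :=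
  add_mem (low_pr up a hv) (low_pr down a hv)
theorem low_opTc (x y : Arrow) (a : ℕ) (hv : v ∈ Low z n) : opTc z x y a v ∈ Low z (n + 1) := by
  rw [← opT_pr]
  exact low_opT a (low_pr x a (low_pr y _ hv))
theorem low_opQ (a : ℕ) (hv : v ∈ Low z n) : opQ z a v ∈ Low z n :=
  pr_up_opu z a v ▸ low_pr up a (low_opu a hv)
theorem low_opQ' (a : ℕ) (hv : v ∈ Low z n) : opQ' z a v ∈ Low z n :=
  pr_down_opu z a v ▸ low_pr down a (low_opu a hv)
theorem low_opE (a : ℕ) (hv : v ∈ Low z n) : opE z a v ∈ Low z n :=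
  opn_pr_du z a v ▸ low_opn a (low_pr down a hv)
theorem low_opE' (a : ℕ) (hv : v ∈ Low z n) : opE' z a v ∈ Low z n :=
  opn_pr_ud z a v ▸ low_opn a (low_pr up a hv)
theorem low_opU (s : Bool) (a : ℕ) (hv : v ∈ Low z n) : opU z s a v ∈ Low z n :=
  tok_pr_up z a v s ▸ low_tok s a (low_pr up a hv)

theorem low_smul (c : k) (hv : v ∈ Low z n) : c • v ∈ Low z n := Submodule.smul_mem _ c hv

/-- Two operators that increase the number of crossings by at most one, and whose difference does
not increase it. -/
def Near (f g : Module.End k (Vec z)) : Prop :=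
  ∀ n v, v ∈ Low z n → f v ∈ Low z (n + 1) ∧ f v - g v ∈ Low z n

theorem near_refl (x y : Arrow) (a : ℕ) : Near (opTc z x y a) (opTc z x y a) := fun _ _ h =>
  ⟨low_opTc x y a h, by rw [sub_self]; exact zero_mem _⟩

/-- For each orientation the two crossings differ by `z` times a diagram without crossings. This is
the only source of lower terms for the slides and braid moves, and it allows choosing the sign for
which a relation is exact. -/
theorem near_opTn (x y : Arrow) (a : ℕ) : Near (opTc z x y a) (opTn z x y a) := by
  refine fun n v h => ⟨low_opTc x y a h, ?_⟩
  cases x <;> cases y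
  · change opX z a v - opXn z a v ∈ _
    rw [opX_skein, add_sub_cancel_left]
    exact low_smul z (low_pr _ _ (low_pr _ _ h))
  · change opSp z a v - opSn z a v ∈ _
    rw [opSp_apply, add_sub_cancel_left]
    exact low_smul z (low_opQ' _ (low_opE' _ h))
  · change opL z a v - opLn z a v ∈ _
    rw [opLn_apply, sub_sub_cancel]
    exact low_smul z (low_opQ _ (low_opE _ h))
  · change opD z a v - opDn z a v ∈ _
    rw [opDn_apply, sub_sub_cancel]
    exact low_smul z (low_pr _ _ (low_pr _ _ h))

theorem Near.right {f g : Module.End k (Vec z)} (h : Near f g) (hv : v ∈ Low z n) :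
    g v ∈ Low z (n + 1) := by
  have := sub_mem (h n v hv).1 (low_mono (Nat.le_succ n) (h n v hv).2)
  rwa [sub_sub_cancel] at this

theorem Near.comp {f f' : Module.End k (Vec z)} (h : Near f f')
    (hv : v ∈ Low z (n + 1) ∧ v - w ∈ Low z n) :
    f v ∈ Low z (n + 2) ∧ f v - f' w ∈ Low z (n + 1) := by
  refine ⟨(h _ _ hv.1).1, ?_⟩
  have := add_mem (h _ _ hv.1).2 (h.right hv.2)
  rwa [map_sub, sub_add_sub_cancel] at this

theorem near_eq {f₁ f₂ f₃ g₁ g₂ g₃ f₁' f₂' f₃' g₁' g₂' g₃' : Module.End k (Vec z)}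
    (h₁ : Near f₁ f₁') (h₂ : Near f₂ f₂') (h₃ : Near f₃ f₃') (h₁' : Near g₁ g₁')
    (h₂' : Near g₂ g₂') (h₃' : Near g₃ g₃') (h : f₁' (f₂' (f₃' v)) = g₁' (g₂' (g₃' v)))
    (hv : v ∈ Low z n) : f₁ (f₂ (f₃ v)) - g₁ (g₂ (g₃ v)) ∈ Low z (n + 2) := by
  have h4 := (h₁.comp (h₂.comp (h₃ n v hv))).2
  have h5 := (h₁'.comp (h₂'.comp (h₃' n v hv))).2
  rw [h] at h4
  have := sub_mem h4 h5
  rwa [sub_sub_sub_cancel_right] at this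

/-- For each of the eight orientations some choice of signs makes the braid relation exact; changing
all signs to positive costs terms with fewer crossings. -/
theorem low_braid_opTc (x y w : Arrow) (a : ℕ) (hv : v ∈ Low z n) :
    opTc z y w a (opTc z x w (a + 1) (opTc z x y a v)) -
      opTc z x y (a + 1) (opTc z x w a (opTc z y w (a + 1) v)) ∈ Low z (n + 2) := by
  cases x <;> cases y <;> cases w
  · exact near_eq (near_refl _ _ _) (near_refl _ _ _) (near_refl _ _ _) (near_refl _ _ _)
      (near_refl _ _ _) (near_refl _ _ _) (opX_braid z a v) hv
  · exact near_eq (near_opTn _ _ _) (near_opTn _ _ _) (near_opTn _ _ _) (near_opTn _ _ _)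
      (near_opTn _ _ _) (near_opTn _ _ _) (braid_uud_neg z a v) hv
  · exact near_eq (near_refl _ _ _) (near_refl _ _ _) (near_opTn _ _ _) (near_opTn _ _ _)
      (near_refl _ _ _) (near_refl _ _ _)
      (CrossInv.braid_fst (crossInv_X z) (crossInv_L z) (crossInv_L z) (braid_duu z) a v).symm hv
  · exact near_eq (near_opTn _ _ _) (near_opTn _ _ _) (near_opTn _ _ _) (near_opTn _ _ _)
      (near_opTn _ _ _) (near_opTn _ _ _) (braid_udd_neg z a v) hv
  · exact near_eq (near_refl _ _ _) (near_refl _ _ _) (near_refl _ _ _) (near_refl _ _ _)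
      (near_refl _ _ _) (near_refl _ _ _) (braid_duu z a v) hv
  · exact near_eq (near_opTn _ _ _) (near_refl _ _ _) (near_refl _ _ _) (near_refl _ _ _)
      (near_refl _ _ _) (near_opTn _ _ _)
      (CrossInv.braid_snd (crossInv_L z) (crossInv_L z) (crossInv_D z) (braid_ddu z) a v).symm hv
  · exact near_eq (near_refl _ _ _) (near_refl _ _ _) (near_refl _ _ _) (near_refl _ _ _)
      (near_refl _ _ _) (near_refl _ _ _) (braid_ddu z a v) hv
  · exact near_eq (near_refl _ _ _) (near_refl _ _ _) (near_refl _ _ _) (near_refl _ _ _)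
      (near_refl _ _ _) (near_refl _ _ _) (braid_ddd z a v) hv

/-- An operator on three strands is determined by its restrictions to all orientations. -/
theorem mem_of_orient₃ {m : ℕ} (F : Module.End k (Vec z)) (a : ℕ)
    (hF : F (prLen z a (prLen z (a + 1) (prLen z (a + 1 + 1) v))) = F v)
    (h : ∀ x y w, F (pr z x a (pr z y (a + 1) (pr z w (a + 1 + 1) v))) ∈ Low z m) :
    F v ∈ Low z m := by
  rw [← hF]
  simp only [prLen_apply, map_add]
  repeat' apply add_mem
  all_goals exact h _ _ _
theorem mem_of_orient₂ {m : ℕ} (F : Module.End k (Vec z)) (a : ℕ)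
    (hF : F (prLen z a (prLen z (a + 1) v)) = F v)
    (h : ∀ x y, F (pr z x a (pr z y (a + 1) v)) ∈ Low z m) : F v ∈ Low z m := by
  rw [← hF]
  simp only [prLen_apply, map_add]
  repeat' apply add_mem
  all_goals exact h _ _
theorem mem_of_orient₁ {m : ℕ} (F : Module.End k (Vec z)) (a : ℕ)
    (hF : F (prLen z a v) = F v) (h : ∀ x, F (pr z x a v) ∈ Low z m) : F v ∈ Low z m := by
  rw [← hF, prLen_apply, map_add]
  exact add_mem (h _) (h _)

theorem low_braid (a : ℕ) (hv : v ∈ Low z n) :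
    opT z a (opT z (a + 1) (opT z a v)) - opT z (a + 1) (opT z a (opT z (a + 1) v)) ∈
      Low z (n + 2) := by
  refine mem_of_orient₃
    (opT z a * opT z (a + 1) * opT z a - opT z (a + 1) * opT z a * opT z (a + 1)) a ?_ ?_
  · simp only [LinearMap.sub_apply, Module.End.mul_apply]
    rw [opT_prLen, opT_prLen_succ, ← far (opT z) (prLen z) a (a + 1 + 1) (a + 1 + 1),
      opT_prLen_succ, far (prLen z) (opT z) a (a + 1) (a + 1), opT_prLen, opT_prLen, opT_prLen_succ]
  · intro x y w
    simp only [LinearMap.sub_apply, Module.End.mul_apply]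
    rw [opT_opT_opT_pr, opT_opT_opT_pr']
    exact low_braid_opTc x y w a hv

/-- Parallel strands satisfy the quadratic relation. For antiparallel strands the square is an
identity plus a multiple of a cup on a cap, with no crossing left. -/
theorem low_opT_opT (a : ℕ) (hv : v ∈ Low z n) : opT z a (opT z a v) ∈ Low z (n + 1) := by
  refine mem_of_orient₂ (opT z a * opT z a) a ?_ ?_
  · rw [Module.End.mul_apply, opT_prLen, opT_prLen_succ, Module.End.mul_apply]
  · intro x y
    rw [Module.End.mul_apply, opT_pr, ← (opTc_pr z a v x y).1, ← (opTc_pr z a v x y).2.1, opT_pr]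
    cases x <;> cases y
    · change opX z a (opX z a v) ∈ _
      rw [opX_opX]
      exact add_mem (low_mono (Nat.le_succ n) (low_pr _ _ (low_pr _ _ hv)))
        (low_smul z (low_opTc up up a hv))
    · change opL z a (opSp z a v) ∈ _
      rw [opL_opSp]
      exact low_mono (Nat.le_succ n) (add_mem (low_pr _ _ (low_pr _ _ hv))
        (low_smul z (low_opQ _ (low_opE' _ hv))))
    · change opSp z a (opL z a v) ∈ _
      rw [opSp_opL]
      exact low_mono (Nat.le_succ n) (add_mem (low_pr _ _ (low_pr _ _ hv))
        (low_smul z (low_opQ' _ (low_opE _ hv))))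
    · change opD z a (opD z a v) ∈ _
      rw [opD_opD]
      exact add_mem (low_mono (Nat.le_succ n) (low_pr _ _ (low_pr _ _ hv)))
        (low_smul z (low_opTc down down a hv))

theorem opT_opu (a : ℕ) (v : Vec z) : opT z a (opu z a v) = opu z a v := by
  rw [opu_apply, map_add, ← (opQ_pr z a v).1, ← (opQ_pr z a v).2, opT_pr, ← (opQ'_pr z a v).1,
    ← (opQ'_pr z a v).2, opT_pr]
  simp only [opQ_pr, opQ'_pr]
  rw [add_comm]
  exact congrArg₂ _ (opL_opQ' z a v) (opSp_opQ z a v)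

theorem opn_opT (a : ℕ) (v : Vec z) : opn z a (opT z a v) = opn z a v := by
  have h : ∀ x y, opn z a (opTc z x y a v) = opn z a (pr z x a (pr z y (a + 1) v)) := by
    intro x y
    rw [← (opTc_pr z a v x y).1]
    cases y
    · rw [opn_pr_ud]
      cases x
      · rw [opn_pr_ud, ← (opE'_pr z a _).2, ← (opE'_pr z a (pr z up _ _)).2,
          ← (opTc_pr z a v up up).2.1, pr_pr_ne z (a + 1) _ (by simp),
          pr_pr_ne z (a + 1) _ (by simp)]
      · rw [opn_pr_du, (opE_pr z a _).2]
        exact opE'_opL z a v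
    · rw [opn_pr_du]
      cases x
      · rw [opn_pr_ud, (opE'_pr z a _).2]
        exact opE_opSp z a v
      · rw [opn_pr_du, ← (opE_pr z a _).2, ← (opE_pr z a (pr z down _ _)).2,
          ← (opTc_pr z a v down down).2.1, pr_pr_ne z (a + 1) _ (by simp),
          pr_pr_ne z (a + 1) _ (by simp)]
  have h2 : opn z a v = opn z a (prLen z a (prLen z (a + 1) v)) := by
    rw [opn_prLen, opn_prLen_succ]
  rw [h2, opT_eq_sum]
  simp only [map_add, h, prLen_apply]
  abel

end low

section low
variable {z : k} {n : ℕ} {v w : Vec z}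

theorem near_eq₁ {f g f' g' : Module.End k (Vec z)} (hf : Near f f') (hg : Near g g')
    (h : f' v = g' w) (hv : v ∈ Low z n) (hw : w ∈ Low z n) : f v - g w ∈ Low z n := by
  have := sub_mem (hf n v hv).2 (hg n w hw).2
  rwa [h, sub_sub_sub_cancel_right] at this

/-- The slide is exact for left cups and positive crossings, but for right cups only with negative
crossings, hence the lower terms. -/
theorem low_opT_opu_succ (a : ℕ) (hv : v ∈ Low z n) :
    opT z (a + 1) (opu z a v) - opT z a (opu z (a + 1) v) ∈ Low z n := by
  refine mem_of_orient₁ (opT z (a + 1) * opu z a - opT z a * opu z (a + 1)) a ?_ ?_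
  · simp only [LinearMap.sub_apply, Module.End.mul_apply]
    rw [← far (opu z) (prLen z) a a (a + 1 + 1), opT_prLen_succ,
      far (prLen z) (opu z) a (a + 1) (a + 1), opT_prLen]
  · intro x
    simp only [LinearMap.sub_apply, Module.End.mul_apply]
    rw [← far (opu z) (pr z x) a a (a + 1 + 1), far (pr z x) (opu z) a (a + 1) (a + 1),
      opu_apply, opu_apply, map_add, map_add, map_add, map_add]
    have h1 : opT z (a + 1) (pr z x (a + 1 + 1) (opQ z a v)) = opTc z down x (a + 1) (opQ z a v) := by
      rw [← (opQ_pr z a v).2, pr_comm, opT_pr, (opQ_pr z a v).2]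
    have h2 : opT z (a + 1) (pr z x (a + 1 + 1) (opQ' z a v)) = opTc z up x (a + 1) (opQ' z a v) := by
      rw [← (opQ'_pr z a v).2, pr_comm, opT_pr, (opQ'_pr z a v).2]
    have h3 : opT z a (pr z x a (opQ z (a + 1) v)) = opTc z x up a (opQ z (a + 1) v) := by
      rw [← (opQ_pr z (a + 1) v).1, opT_pr, (opQ_pr z (a + 1) v).1]
    have h4 : opT z a (pr z x a (opQ' z (a + 1) v)) = opTc z x down a (opQ' z (a + 1) v) := by
      rw [← (opQ'_pr z (a + 1) v).1, opT_pr, (opQ'_pr z (a + 1) v).1]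
    rw [h1, h2, h3, h4, add_sub_add_comm]
    refine add_mem ?_ (near_eq₁ (near_opTn _ _ _) (near_opTn _ _ _) ?_ (low_opQ' _ hv)
      (low_opQ' _ hv))
    · have : opTc z down x (a + 1) (opQ z a v) = opTc z x up a (opQ z (a + 1) v) := by
        cases x
        · exact opL_opQ z a v
        · exact opD_opQ z a v
      rw [this, sub_self]
      exact zero_mem _
    · cases x
      · exact (opSn_opQ' z a v).symm
      · exact (opDn_opQ' z a v).symm

theorem opn_pr_succ_up (a : ℕ) (v : Vec z) : opn z a (pr z up (a + 1) v) = opE z a v := by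
  rw [opn_apply, (opE_pr z a _).2, ← (opE'_pr z a _).2, pr_pr_ne z (a + 1) _ (by simp), map_zero,
    add_zero]
theorem opn_pr_succ_down (a : ℕ) (v : Vec z) : opn z a (pr z down (a + 1) v) = opE' z a v := by
  rw [opn_apply, (opE'_pr z a _).2, ← (opE_pr z a _).2, pr_pr_ne z (a + 1) _ (by simp), map_zero,
    zero_add]

theorem low_opn_opT_succ (a : ℕ) (hv : v ∈ Low z n) :
    opn z a (opT z (a + 1) v) - opn z (a + 1) (opT z a v) ∈ Low z n := by
  refine mem_of_orient₃ (opn z a * opT z (a + 1) - opn z (a + 1) * opT z a) a ?_ ?_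
  · simp only [LinearMap.sub_apply, Module.End.mul_apply]
    rw [opT_prLen, opT_prLen_succ, ← far (opT z) (prLen z) a (a + 1 + 1) (a + 1 + 1),
      opn_prLen_succ, far (prLen z) (opT z) a (a + 1) (a + 1), opn_prLen, opT_prLen,
      opT_prLen_succ]
  · intro x y w
    simp only [LinearMap.sub_apply, Module.End.mul_apply]
    rw [far (pr z x) (opT z) a (a + 1) (a + 1), opT_pr z (a + 1) _ y w, opT_pr z a _ x y,
      ← far (opTc z x y) (pr z w) a (a + 1 + 1) (a + 1 + 1)]
    cases x
    · rw [opn_pr_ud]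
      cases w
      -- The ends to be capped both belong to upward strands, so both terms vanish.
      · rw [← (opE'_pr z a _).2, ← (opTc_pr z (a + 1) v _ _).1, pr_pr_ne z (a + 1) _ (by simp),
          opn_pr_succ_up, ← (opE_pr z (a + 1) _).1, ← (opTc_pr z a v _ _).2.1,
          pr_pr_ne z (a + 1) _ (by simp), map_zero, map_zero, sub_zero]
        exact zero_mem _
      · rw [opn_pr_succ_down]
        have h1 := near_opTn (z := z) y down (a + 1) n v hv
        have h2 := near_opTn (z := z) up y a n v hv
        have h3 : opE' z a (opTn z y down (a + 1) v) = opE' z (a + 1) (opTn z up y a v) := by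
          cases y
          · exact (opE'_opXn z a v).symm
          · exact opE'_opDn z a v
        have := sub_mem (low_opE' a h1.2) (low_opE' (a + 1) h2.2)
        rwa [map_sub, map_sub, h3, sub_sub_sub_cancel_right] at this
    · rw [opn_pr_du]
      cases w
      · have : opE z a (opTc z y up (a + 1) v) = opE z (a + 1) (opTc z down y a v) := by
          cases y
          · exact opE_opX z a v
          · exact opE_opL z a v
        rw [opn_pr_succ_up, this, sub_self]
        exact zero_mem _
      · rw [← (opE_pr z a _).2, ← (opTc_pr z (a + 1) v _ _).1, pr_pr_ne z (a + 1) _ (by simp),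
          opn_pr_succ_down, ← (opE'_pr z (a + 1) _).1, ← (opTc_pr z a v _ _).2.1,
          pr_pr_ne z (a + 1) _ (by simp), map_zero, map_zero, sub_zero]
        exact zero_mem _

theorem opn_opu_succ (a : ℕ) (v : Vec z) : opn z a (opu z (a + 1) v) = prLen z a v := by
  rw [opu_apply, map_add, ← (opQ_pr z (a + 1) v).1, opn_pr_succ_up, opE_opQ',
    ← (opQ'_pr z (a + 1) v).1, opn_pr_succ_down, opE'_opQ'_left, prLen_apply, add_comm]
theorem opn_succ_opu (a : ℕ) (v : Vec z) : opn z (a + 1) (opu z a v) = prLen z a v := by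
  rw [opu_apply, map_add, ← (opQ_pr z a v).2, opn_pr_du, opE_opQ,
    ← (opQ'_pr z a v).2, opn_pr_ud, opE'_opQ'_right, prLen_apply]

/-! ### Tokens -/

/-- A token on a strand of given orientation. -/
def tokc (z : k) : Arrow → Bool → ℕ → Module.End k (Vec z)
  | up => opU z
  | down => opN z

theorem tok_pr (x : Arrow) (s : Bool) (a : ℕ) (v : Vec z) :
    tok z s a (pr z x a v) = tokc z x s a v := by
  cases x
  · exact tok_pr_up z a v s
  · exact tok_pr_down z a v s
theorem tokc_pr (x : Arrow) (s : Bool) (a : ℕ) (v : Vec z) :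
    pr z x a (tokc z x s a v) = tokc z x s a v ∧ tokc z x s a (pr z x a v) = tokc z x s a v := by
  cases x
  · exact opU_pr z a v s
  · exact opN_pr z a v s
theorem pr_tok (x : Arrow) (s : Bool) (a : ℕ) (v : Vec z) :
    pr z x a (tok z s a v) = tokc z x s a v := by
  rw [tok_apply, map_add, ← (opU_pr z a v s).1, ← (opN_pr z a v s).1]
  cases x
  · rw [pr_pr, pr_pr_ne z a _ (by simp), add_zero, (opU_pr z a v s).1]; rfl
  · rw [pr_pr, pr_pr_ne z a _ (by simp), zero_add, (opN_pr z a v s).1]; rfl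
theorem low_tokc (x : Arrow) (s : Bool) (a : ℕ) (hv : v ∈ Low z n) : tokc z x s a v ∈ Low z n :=
  tok_pr (z := z) x s a v ▸ low_tok s a (low_pr x a hv)

theorem Near.token {f f' t t' : Module.End k (Vec z)} (hf : Near f f') (h : f' (t v) = t' (f' v))
    (ht : t v ∈ Low z n) (ht' : ∀ w ∈ Low z n, t' w ∈ Low z n) (hv : v ∈ Low z n) :
    f (t v) - t' (f v) ∈ Low z n := by
  have := sub_mem (hf n _ ht).2 (ht' _ (hf n _ hv).2)
  rwa [map_sub, h, sub_sub_sub_cancel_right] at this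

theorem opDn_open (a : ℕ) (v : Vec z) :
    opDn z a (opN z false a v) = opN z false (a + 1) (opDn z a v) :=
  (crossInv_D z).token_fst (fun a v => (opN_pr z a v _).1) (fun a v => (opN_pr z a v _).2)
    (opD_open z) a v
theorem opDn_closed (a : ℕ) (v : Vec z) :
    opDn z a (opN z true (a + 1) v) = opN z true a (opDn z a v) :=
  (crossInv_D z).token_snd (fun a v => (opN_pr z a v _).1) (fun a v => (opN_pr z a v _).2)
    (opD_closed z) a v

/-- For each orientation and each kind of token one of the two signs of the crossing allows an exact
slide. -/
theorem low_opTc_tokc (x y : Arrow) (s : Bool) (a : ℕ) (hv : v ∈ Low z n) :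
    opTc z x y a (tokc z x s a v) - tokc z x s (a + 1) (opTc z x y a v) ∈ Low z n := by
  have h1 := low_tokc x s a hv
  have h2 := fun w hw => low_tokc (z := z) (n := n) (v := w) x s (a + 1) hw
  cases s <;> cases x <;> cases y
  · exact (near_opTn _ _ _).token (opXn_open z a v) h1 h2 hv
  · exact (near_refl _ _ _).token (opSp_open z a v) h1 h2 hv
  · exact (near_refl _ _ _).token (opL_open z a v) h1 h2 hv
  · exact (near_opTn _ _ _).token (opDn_open a v) h1 h2 hv
  · exact (near_refl _ _ _).token (opX_closed z a v) h1 h2 hv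
  · exact (near_opTn _ _ _).token (opSn_closed z a v) h1 h2 hv
  · exact (near_opTn _ _ _).token (opLn_closed z a v) h1 h2 hv
  · exact (near_refl _ _ _).token (opD_closed z a v) h1 h2 hv

theorem low_opTc_tokc' (x y : Arrow) (s : Bool) (a : ℕ) (hv : v ∈ Low z n) :
    opTc z x y a (tokc z y s (a + 1) v) - tokc z y s a (opTc z x y a v) ∈ Low z n := by
  have h1 := low_tokc y s (a + 1) hv
  have h2 := fun w hw => low_tokc (z := z) (n := n) (v := w) y s a hw
  cases s <;> cases x <;> cases y
  · exact (near_refl _ _ _).token (opX_open z a v) h1 h2 hv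
  · exact (near_opTn _ _ _).token (opSn_open z a v) h1 h2 hv
  · exact (near_opTn _ _ _).token (opLn_open z a v) h1 h2 hv
  · exact (near_refl _ _ _).token (opD_open z a v) h1 h2 hv
  · exact (near_opTn _ _ _).token (opXn_closed z a v) h1 h2 hv
  · exact (near_refl _ _ _).token (opSp_closed z a v) h1 h2 hv
  · exact (near_refl _ _ _).token (opL_closed z a v) h1 h2 hv
  · exact (near_opTn _ _ _).token (opDn_closed a v) h1 h2 hv

theorem low_opT_tok (s : Bool) (a : ℕ) (hv : v ∈ Low z n) :
    opT z a (tok z s a v) - tok z s (a + 1) (opT z a v) ∈ Low z n := by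
  refine mem_of_orient₂ (opT z a * tok z s a - tok z s (a + 1) * opT z a) a ?_ ?_
  · simp only [LinearMap.sub_apply, Module.End.mul_apply]
    rw [opT_prLen, opT_prLen_succ, tok_prLen, ← far (tok z s) (prLen z) a (a + 1) (a + 1),
      opT_prLen_succ]
  · intro x y
    simp only [LinearMap.sub_apply, Module.End.mul_apply]
    rw [opT_pr, tok_pr, ← (tokc_pr x s a _).1, ← tok_pr, pr_comm,
      ← far (tok z s) (pr z y) a (a + 1) (a + 1), tok_pr, opT_pr, ← (opTc_pr z a v x y).2.1, tok_pr]
    exact low_opTc_tokc x y s a hv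

theorem low_opT_tok' (s : Bool) (a : ℕ) (hv : v ∈ Low z n) :
    opT z a (tok z s (a + 1) v) - tok z s a (opT z a v) ∈ Low z n := by
  refine mem_of_orient₂ (opT z a * tok z s (a + 1) - tok z s a * opT z a) a ?_ ?_
  · simp only [LinearMap.sub_apply, Module.End.mul_apply]
    rw [opT_prLen, opT_prLen_succ, far (prLen z) (tok z s) a (a + 1) (a + 1), opT_prLen, tok_prLen]
  · intro x y
    simp only [LinearMap.sub_apply, Module.End.mul_apply]
    rw [opT_pr, far (pr z x) (tok z s) a (a + 1) (a + 1), tok_pr, ← (tokc_pr y s (a + 1) _).1,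
      opT_pr, ← (opTc_pr z a v x y).1, tok_pr]
    exact low_opTc_tokc' x y s a hv

theorem tok_opu (s : Bool) (a : ℕ) (v : Vec z) : tok z s a (opu z a v) = tok z s (a + 1) (opu z a v) := by
  simp only [opu_apply, map_add]
  congr 1
  · rw [← (opQ_pr z a v).1, tok_pr_up, (opQ_pr z a v).1, ← (opQ_pr z a v).2, tok_pr_down,
      (opQ_pr z a v).2, opU_opQ]
  · rw [← (opQ'_pr z a v).1, tok_pr_down, (opQ'_pr z a v).1, ← (opQ'_pr z a v).2, tok_pr_up,
      (opQ'_pr z a v).2, opU_opQ']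

end low

/-! ## Lengths -/

section length
variable {z : k} {N : ℕ} {v : Vec z}

/-- Vectors that live on words of length `N`. -/
def IsLen (N : ℕ) (v : Vec z) : Prop := ∀ W : Word, W.length ≠ N → v W = 0

theorem IsLen.prLen (h : IsLen N v) {a : ℕ} (ha : a < N) : prLen z a v = v := by
  funext W
  rw [prLen_apply, Pi.add_apply]
  by_cases hW : W.length = N
  · have : a < W.length := by omega
    have h1 : W[a]? = some W[a] := List.getElem?_eq_getElem this
    rcases hx : W[a] with - | -
    · rw [pr_apply_of_get _ (by rw [h1, hx]), pr_apply_of_ne _ (by rw [h1, hx]; simp), add_zero]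
    · rw [pr_apply_of_ne _ (by rw [h1, hx]; simp), pr_apply_of_get _ (by rw [h1, hx]), zero_add]
  · have h1 : ∀ x, pr z x a v W = 0 := by
      intro x
      by_cases hx : W[a]? = some x
      · rw [pr_apply_of_get _ hx, h W hW]
      · rw [pr_apply_of_ne _ hx]
    rw [h1, h1, h W hW, add_zero]

theorem IsLen.local {F : ℕ → Module.End k (Vec z)} {p q n : ℕ} [hF : IsLocal F p q n] {M : ℕ}
    (h : IsLen (M + p) v) (a : ℕ) : IsLen (M + q) (F a v) := by
  obtain ⟨hF⟩ := hF
  induction hF using Submodule.span_induction with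
  | zero => intro W _; rfl
  | add f g _ _ hf hg =>
    intro W hW
    rw [Pi.add_apply, LinearMap.add_apply, Pi.add_apply, hf W hW, hg W hW, add_zero]
  | smul c f _ hf =>
    intro W hW
    rw [Pi.smul_apply, LinearMap.smul_apply, Pi.smul_apply, hf W hW, smul_zero]
  | mem F hF =>
    obtain ⟨P, Q, f, rfl, rfl, -, rfl⟩ := hF
    intro W hW
    by_cases h' : ∃ A B, A.length = a ∧ W = A ++ (Q ++ B)
    · obtain ⟨A, B, hA, rfl⟩ := h'
      dsimp only
      rw [op_apply _ _ _ hA, h _ (by simp at hW ⊢; omega), Limits.zero_comp]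
    · exact op_apply_eq_zero _ _ h'

theorem IsLen.local_eq_zero {F : ℕ → Module.End k (Vec z)} {p q n : ℕ} [hF : IsLocal F p q n]
    (h : IsLen N v) {a : ℕ} (ha : N < a + p) : F a v = 0 := by
  obtain ⟨hF⟩ := hF
  induction hF using Submodule.span_induction with
  | zero => rfl
  | add f g _ _ hf hg => rw [Pi.add_apply, LinearMap.add_apply, hf, hg, add_zero]
  | smul c f _ hf => rw [Pi.smul_apply, LinearMap.smul_apply, hf, smul_zero]
  | mem F hF =>
    obtain ⟨P, Q, f, rfl, rfl, -, rfl⟩ := hF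
    funext W
    by_cases h' : ∃ A B, A.length = a ∧ W = A ++ (Q ++ B)
    · obtain ⟨A, B, hA, rfl⟩ := h'
      dsimp only
      rw [op_apply _ _ _ hA, h _ (by simp; omega), Limits.zero_comp]
      rfl
    · exact op_apply_eq_zero _ _ h'

theorem isLen_vac : IsLen 0 (vac z) := by
  intro W hW
  cases W
  · exact absurd rfl hW
  · rfl

end length

/-! ## Normal forms of unoriented diagrams without double crossings -/

/-- Operators `T` (crossings), `u` (cups) and `n` (caps) that satisfy the relations of unoriented
diagrams up to diagrams that are not reduced. -/
structure NilBrauer (M : Type*) where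
  /-- crossings -/
  T : ℕ → M → M
  /-- cups -/
  u : ℕ → M → M
  /-- caps -/
  n : ℕ → M → M
  /-- the empty diagram -/
  vac : M
  /-- diagrams that are not reduced -/
  Bad : M → Prop
  /-- the number of endpoints -/
  Len : ℕ → M → Prop
  T_T : ∀ {a b : ℕ} (v : M), a + 2 ≤ b → T b (T a v) = T a (T b v)
  T_u : ∀ {a b : ℕ} (v : M), a ≤ b → T (b + 2) (u a v) = u a (T b v)
  u_T : ∀ {a b : ℕ} (v : M), b + 2 ≤ a → T b (u a v) = u a (T b v)
  u_u : ∀ {a b : ℕ} (v : M), a ≤ b → u (b + 2) (u a v) = u a (u b v)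
  n_T : ∀ {a b : ℕ} (v : M), a + 2 ≤ b → n b (T a v) = T a (n b v)
  T_n : ∀ {a b : ℕ} (v : M), b ≤ a → n b (T (a + 2) v) = T a (n b v)
  n_u : ∀ {a b : ℕ} (v : M), a ≤ b → n (b + 2) (u a v) = u a (n b v)
  u_n : ∀ {a b : ℕ} (v : M), b ≤ a → n b (u (a + 2) v) = u a (n b v)
  braid : ∀ (a : ℕ) (v : M), T a (T (a + 1) (T a v)) = T (a + 1) (T a (T (a + 1) v))
  cup_slide : ∀ (a : ℕ) (v : M), T (a + 1) (u a v) = T a (u (a + 1) v)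
  cap_slide : ∀ (a : ℕ) (v : M), n a (T (a + 1) v) = n (a + 1) (T a v)
  zigzag : ∀ {N a : ℕ} {v : M}, Len N v → a < N → n a (u (a + 1) v) = v
  zigzag' : ∀ {N a : ℕ} {v : M}, Len N v → a < N → n (a + 1) (u a v) = v
  bad_T_T : ∀ (a : ℕ) (v : M), Bad (T a (T a v))
  bad_T_u : ∀ (a : ℕ) (v : M), Bad (T a (u a v))
  bad_n_T : ∀ (a : ℕ) (v : M), Bad (n a (T a v))
  bad_T : ∀ (a : ℕ) {v : M}, Bad v → Bad (T a v)
  bad_u : ∀ (a : ℕ) {v : M}, Bad v → Bad (u a v)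
  bad_n : ∀ (a : ℕ) {v : M}, Bad v → Bad (n a v)
  bad_T_of_lt : ∀ {N a : ℕ} {v : M}, Len N v → N < a + 2 → Bad (T a v)
  bad_u_of_lt : ∀ {N a : ℕ} {v : M}, Len N v → N < a → Bad (u a v)
  bad_n_of_lt : ∀ {N a : ℕ} {v : M}, Len N v → N < a + 2 → Bad (n a v)
  len_vac : Len 0 vac
  len_T : ∀ {N : ℕ} {v : M} (a : ℕ), Len N v → Len N (T a v)
  len_u : ∀ {N : ℕ} {v : M} (a : ℕ), Len N v → Len (N + 2) (u a v)

/-- A code for a matching of `2 * length` points: in `(i, m) :: ν`, the points `i` and `i + 1 + m`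
are matched, and the other points are matched according to `ν`. -/
abbrev Code : Type := List (ℕ × ℕ)

/-- The right ends of the chords are increasing, starting at `b` or later. -/
def Code.Valid : ℕ → Code → Prop
  | _, [] => True
  -- The bound for `ν` refers to positions before the chord is inserted: a point at `i + m` or later
  -- ends up to the right of the new right end `i + 1 + m`. The head of a valid code is thus the
  -- chord with the leftmost right end.
  | b, (i, m) :: ν => b ≤ i + 1 + m ∧ Code.Valid (i + m) ν

/-- The chords have their ends in the range of the matched points. -/
def Code.InRange : Code → Prop
  | [] => True
  | (i, m) :: ν => i + m ≤ 2 * ν.length ∧ Code.InRange ν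

theorem Code.Valid.mono {b b' : ℕ} (h : b' ≤ b) : {ν : Code} → ν.Valid b → ν.Valid b'
  | [], _ => trivial
  | _ :: _, hv => ⟨h.trans hv.1, hv.2⟩

namespace NilBrauer
variable {M : Type*} (S : NilBrauer M)

/-- A chord from `i` to `i + 1 + m`, crossing the `m` strands in between. -/
def I (i : ℕ) : ℕ → M → M
  | 0, v => S.u i v
  | m + 1, v => S.T (i + 1 + m) (I i m v)

/-- The diagram given by a code. -/
def NF : Code → M
  | [] => S.vac
  | (i, m) :: ν => S.I i m (NF ν)

variable {i m a N : ℕ} {v : M}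

theorem I_succ (i m : ℕ) (v : M) : S.I i (m + 1) v = S.T (i + 1 + m) (S.I i m v) := rfl

/-- A chord can equally well be lengthened at its left end; the base case is the cup slide. -/
theorem I_succ' (i m : ℕ) (v : M) : S.I i (m + 1) v = S.T i (S.I (i + 1) m v) := by
  induction m with
  | zero => exact S.cup_slide i v
  | succ m ih =>
    rw [I_succ, ih, S.T_T _ (by omega), I_succ, show i + 1 + (m + 1) = i + 1 + 1 + m by omega]

theorem len_I (h : S.Len N v) : S.Len (N + 2) (S.I i m v) := by
  induction m with
  | zero => exact S.len_u i h
  | succ m ih => exact S.len_T _ ih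

theorem len_NF (ν : Code) : S.Len (2 * ν.length) (S.NF ν) := by
  induction ν with
  | nil => exact S.len_vac
  | cons c ν ih => exact S.len_I ih

theorem bad_I (h : S.Bad v) : S.Bad (S.I i m v) := by
  induction m with
  | zero => exact S.bad_u i h
  | succ m ih => exact S.bad_T _ ih

theorem bad_I_of_lt (h : S.Len N v) (hN : N < i + m) : S.Bad (S.I i m v) := by
  cases m with
  | zero => exact S.bad_u_of_lt h hN
  | succ m => exact S.bad_T_of_lt (S.len_I h) (by omega)

theorem bad_or_inRange (ν : Code) : S.Bad (S.NF ν) ∨ ν.InRange := by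
  induction ν with
  | nil => exact Or.inr trivial
  | cons c ν ih =>
    rcases ih with h | h
    · exact Or.inl (S.bad_I h)
    · by_cases hc : c.1 + c.2 ≤ 2 * ν.length
      · exact Or.inr ⟨hc, h⟩
      · exact Or.inl (S.bad_I_of_lt (S.len_NF ν) (by omega))

theorem T_I_of_gt (h : i + m ≤ a) (v : M) : S.T (a + 2) (S.I i m v) = S.I i m (S.T a v) := by
  induction m with
  | zero => exact S.T_u v h
  | succ m ih => rw [I_succ, S.T_T _ (by omega), ih (by omega), I_succ]

theorem T_I_of_lt (h : a + 2 ≤ i) (v : M) : S.T a (S.I i m v) = S.I i m (S.T a v) := by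
  induction m with
  | zero => exact S.u_T v h
  | succ m ih => rw [I_succ, ← S.T_T _ (by omega), ih, I_succ]

theorem u_I_of_gt (h : i + m ≤ a) (v : M) : S.u (a + 2) (S.I i m v) = S.I i m (S.u a v) := by
  induction m with
  | zero => exact S.u_u v h
  | succ m ih => rw [I_succ, ← S.u_T _ (by omega), ih (by omega), I_succ]

theorem I_u_of_le (h : a ≤ i) (v : M) : S.I (i + 2) m (S.u a v) = S.u a (S.I i m v) := by
  induction m with
  | zero => exact S.u_u v h
  | succ m ih =>
    rw [I_succ, ih, show i + 2 + 1 + m = i + 1 + m + 2 by omega, S.T_u _ (by omega), I_succ]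

theorem n_I_of_gt (h : i + m ≤ a) (v : M) : S.n (a + 2) (S.I i m v) = S.I i m (S.n a v) := by
  induction m with
  | zero => exact S.n_u v h
  | succ m ih => rw [I_succ, S.n_T _ (by omega), ih (by omega), I_succ]

theorem n_I_of_le (h : a ≤ i) (v : M) : S.n a (S.I (i + 2) m v) = S.I i m (S.n a v) := by
  induction m with
  | zero => exact S.u_n v h
  | succ m ih =>
    rw [I_succ, show i + 2 + 1 + m = i + 1 + m + 2 by omega, S.T_n _ (by omega), ih, I_succ]

/-- A crossing of two strands that both cross a chord. -/
theorem T_I_of_mem (h : i ≤ a) (h' : a + 1 < i + m) (v : M) :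
    S.T (a + 1) (S.I i m v) = S.I i m (S.T a v) := by
  induction m with
  | zero => omega
  | succ m ih =>
    by_cases h2 : a + 1 < i + m
    · rw [I_succ, ← S.T_T _ (by omega), ih h2, I_succ]
    · obtain ⟨m, rfl⟩ : ∃ m', m = m' + 1 := ⟨m - 1, by omega⟩
      obtain rfl : a = i + m := by omega
      rw [I_succ, I_succ, show i + 1 + (m + 1) = i + m + 2 by omega,
        show i + 1 + m = i + m + 1 by omega, S.braid, S.T_I_of_gt le_rfl, I_succ, I_succ,
        show i + 1 + (m + 1) = i + m + 2 by omega, show i + 1 + m = i + m + 1 by omega]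

theorem bad_T_I_left (h : 0 < m) (v : M) : S.Bad (S.T i (S.I i m v)) := by
  obtain ⟨m, rfl⟩ : ∃ m', m = m' + 1 := ⟨m - 1, by omega⟩
  rw [I_succ']
  exact S.bad_T_T _ _

theorem bad_T_I_right (v : M) : S.Bad (S.T (i + m) (S.I i m v)) := by
  cases m with
  | zero => exact S.bad_T_u _ _
  | succ m =>
    rw [I_succ, show i + (m + 1) = i + 1 + m by omega]
    exact S.bad_T_T _ _

/-- On the left the chord inserted last has its right end just after that of the chord inserted
before it, against the order of valid codes. As the chords cross, they can be inserted in the other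
order. -/
theorem I_I {i' m' : ℕ} (h : i' + 1 + m' = i + 1 + m) (hi : i' ≤ i) (v : M) :
    S.I (i + 1) (m + 1) (S.I i' m' v) = S.I i' (m' + 1) (S.I i m v) := by
  induction m generalizing i with
  | zero =>
    rw [I_succ', show i + 1 + 1 = i + 2 from rfl]
    change S.T (i + 1) (S.u (i + 2) _) = _
    rw [S.u_I_of_gt (by omega), I_succ, h]
    rfl
  | succ m ih =>
    rw [I_succ', ih (by omega) (by omega), S.T_I_of_mem (by omega) (by omega), ← I_succ']

/-- Both ends of the inner chord lie between the ends of the outer one, which nevertheless crosses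
both legs. -/
theorem bad_I_I {i' m' : ℕ} (h : i' + 1 + m' = i + m) (hi : i ≤ i') (v : M) :
    S.Bad (S.I i (m + 1) (S.I i' m' v)) := by
  induction m generalizing i with
  | zero => omega
  | succ m ih =>
    rcases hi.eq_or_lt with rfl | hi
    · obtain rfl : m' = m := by omega
      rw [I_succ', S.I_I (by omega) le_rfl, I_succ']
      exact S.bad_T_T _ _
    · rw [I_succ']
      exact S.bad_T _ (ih (by omega) (by omega))

/-- Diagrams that are not reduced or are given by a valid code of length `l`. -/
def Normal (b l : ℕ) (v : M) : Prop :=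
  S.Bad v ∨ ∃ ν : Code, ν.length = l ∧ ν.Valid b ∧ v = S.NF ν

/-- The position of the crossing relative to the ends of the first chord decides. Away from the ends
it passes to the remaining code, at an inner side of an end it repeats a crossing, and at an outer
side it lengthens the chord. Lengthening to the right may break the order of right ends, which `I_I`
repairs unless the chords already form a bigon (`bad_I_I`). -/
theorem normal_T (a : ℕ) : ∀ {b : ℕ} {ν : Code}, ν.Valid b → S.Normal b ν.length (S.T a (S.NF ν))
  | _, [], _ => Or.inl (S.bad_T_of_lt S.len_vac (by omega))
  | b, (i, m) :: ν, ⟨hb, hν⟩ => by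
    change S.Normal b (ν.length + 1) (S.T a (S.I i m (S.NF ν)))
    rcases lt_trichotomy a (i + 1 + m) with h | rfl | h
    · rcases (show a = i + m ∨ a < i + m by omega) with rfl | h
      · exact Or.inl (S.bad_T_I_right _)
      · rcases lt_trichotomy a i with h' | rfl | h'
        · rcases (show a + 1 = i ∨ a + 2 ≤ i by omega) with rfl | h'
          · rw [← I_succ']
            exact Or.inr ⟨(a, m + 1) :: ν, rfl, ⟨by omega, hν.mono (by omega)⟩, rfl⟩
          · rw [S.T_I_of_lt h']
            rcases normal_T a hν with h3 | ⟨ν', h1, h2, h3⟩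
            · exact Or.inl (S.bad_I h3)
            · rw [h3]
              exact Or.inr ⟨(i, m) :: ν', by simp [h1], ⟨hb, h2⟩, rfl⟩
        · exact Or.inl (S.bad_T_I_left (by omega) _)
        · obtain ⟨a, rfl⟩ : ∃ a', a = a' + 1 := ⟨a - 1, by omega⟩
          rw [S.T_I_of_mem (by omega) h]
          rcases normal_T a hν with h3 | ⟨ν', h1, h2, h3⟩
          · exact Or.inl (S.bad_I h3)
          · rw [h3]
            exact Or.inr ⟨(i, m) :: ν', by simp [h1], ⟨hb, h2⟩, rfl⟩
    · rw [← I_succ]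
      match ν, hν with
      | [], _ => exact Or.inr ⟨[(i, m + 1)], rfl, ⟨by omega, trivial⟩, rfl⟩
      | (i', m') :: ν, ⟨h1, h2⟩ =>
        -- Equality is exactly the case in which the lengthened chord overtakes the next right end.
        rcases h1.eq_or_lt with h1 | h1
        · rcases Nat.lt_or_ge i' i with h3 | h3
          · obtain ⟨i, rfl⟩ : ∃ i'', i = i'' + 1 := ⟨i - 1, by omega⟩
            refine Or.inr ⟨(i', m' + 1) :: (i, m) :: ν, by simp, ⟨by omega, by omega, ?_⟩, ?_⟩
            · exact h2.mono (by omega)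
            · exact S.I_I (by omega) (by omega) _
          · exact Or.inl (S.bad_I_I h1.symm h3 _)
        · exact Or.inr ⟨(i, m + 1) :: (i', m') :: ν, by simp, ⟨by omega, by omega, h2⟩, rfl⟩
    · obtain ⟨a, rfl⟩ : ∃ a', a = a' + 2 := ⟨a - 2, by omega⟩
      rw [S.T_I_of_gt (by omega)]
      rcases normal_T a hν with h3 | ⟨ν', h1, h2, h3⟩
      · exact Or.inl (S.bad_I h3)
      · rw [h3]
        exact Or.inr ⟨(i, m) :: ν', by simp [h1], ⟨hb, h2⟩, rfl⟩

/-- A cup is moved past all chords whose right ends lie to its left, and is then inserted as a chord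
without crossings. -/
theorem normal_u (a : ℕ) : ∀ {b : ℕ} {ν : Code}, ν.Valid b → b ≤ a + 1 →
    S.Normal b (ν.length + 1) (S.u a (S.NF ν))
  | _, [], _, h => Or.inr ⟨[(a, 0)], rfl, ⟨h, trivial⟩, rfl⟩
  | b, (i, m) :: ν, ⟨hb, hν⟩, h => by
    by_cases ha : a ≤ i + 1 + m
    · exact Or.inr ⟨(a, 0) :: (i, m) :: ν, rfl, ⟨h, ha, hν⟩, rfl⟩
    · obtain ⟨a, rfl⟩ : ∃ a', a = a' + 2 := ⟨a - 2, by omega⟩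
      change S.Normal b _ (S.u (a + 2) (S.I i m (S.NF ν)))
      rw [S.u_I_of_gt (by omega)]
      rcases normal_u a hν (by omega) with h3 | ⟨ν', h1, h2, h3⟩
      · exact Or.inl (S.bad_I h3)
      · rw [h3]
        exact Or.inr ⟨(i, m) :: ν', by simp [h1], ⟨hb, h2⟩, rfl⟩

variable {S} {b l : ℕ}

theorem Normal.T (h : S.Normal b l v) (a : ℕ) : S.Normal b l (S.T a v) := by
  rcases h with h | ⟨ν, rfl, h2, rfl⟩
  · exact Or.inl (S.bad_T a h)
  · exact S.normal_T a h2

theorem Normal.u (h : S.Normal 0 l v) (a : ℕ) : S.Normal 0 (l + 1) (S.u a v) := by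
  rcases h with h | ⟨ν, rfl, h2, rfl⟩
  · exact Or.inl (S.bad_u a h)
  · exact S.normal_u a h2 (Nat.zero_le _)

theorem Normal.I (h : S.Normal 0 l v) (i m : ℕ) : S.Normal 0 (l + 1) (S.I i m v) := by
  induction m with
  | zero => exact h.u i
  | succ m ih => exact ih.T _

variable (S)

theorem normal_vac : S.Normal 0 0 S.vac := Or.inr ⟨[], rfl, trivial, rfl⟩

/-- The cap joins the right end of the chord to the next strand. Shortening the chord by a cap slide
turns each of its crossings into a crossing on `v`, until a zigzag remains. -/
theorem normal_n_I_right (hN : S.Len N v) (h : S.Normal 0 l v) :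
    S.Normal 0 l (S.n (i + 1 + m) (S.I i m v)) := by
  induction m generalizing v with
  | zero =>
    by_cases hi : i < N
    · have := S.zigzag' hN hi
      rw [show S.n (i + 1 + 0) (S.I i 0 v) = v from this]
      exact h
    · exact Or.inl (S.bad_n_of_lt (S.len_I hN) (by omega))
  | succ m ih =>
    rw [I_succ, show i + 1 + (m + 1) = i + 1 + m + 1 by omega, ← S.cap_slide,
      show i + 1 + m + 1 = i + m + 2 by omega, S.T_I_of_gt le_rfl]
    exact ih (S.len_T _ hN) (h.T _)

theorem normal_n_I_left (hN : S.Len N v) (h : S.Normal 0 l v) :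
    S.Normal 0 l (S.n i (S.I (i + 1) m v)) := by
  induction m with
  | zero =>
    by_cases hi : i < N
    · have := S.zigzag hN hi
      rw [show S.n i (S.I (i + 1) 0 v) = v from this]
      exact h
    · exact Or.inl (S.bad_n (i) (S.bad_u_of_lt hN (by omega)))
  | succ m ih =>
    rw [I_succ, show i + 1 + 1 + m = i + m + 2 by omega, S.T_n _ (by omega)]
    exact ih.T _

/-- The capped strands both cross the chord, so the cap can be slid to expose a double crossing. -/
theorem bad_n_I (h : i ≤ a) (h' : a + 1 < i + m) (v : M) : S.Bad (S.n (a + 1) (S.I i m v)) := by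
  induction m with
  | zero => omega
  | succ m ih =>
    by_cases h2 : a + 1 < i + m
    · rw [I_succ, show i + 1 + m = i + m - 1 + 2 by omega, S.T_n _ (by omega)]
      exact S.bad_T _ (ih h2)
    · obtain ⟨m, rfl⟩ : ∃ m', m = m' + 1 := ⟨m - 1, by omega⟩
      obtain rfl : a = i + m := by omega
      rw [I_succ, I_succ, show i + 1 + (m + 1) = i + m + 1 + 1 by omega, S.cap_slide,
        show i + 1 + m = i + m + 1 by omega]
      exact S.bad_n _ (S.bad_T_T _ _)

/-- Capping a normal form: the result is a normal form again, unless the cap closes a chord. -/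
theorem normal_n (a : ℕ) : ∀ {b : ℕ} {ν : Code}, ν.Valid b →
    S.Normal 0 (ν.length - 1) (S.n a (S.NF ν)) ∨ (∃ ν' : Code, ν'.length + 1 = ν.length ∧
      ν'.Valid 0 ∧ S.NF ν = S.u a (S.NF ν')) ∨ S.Bad (S.NF ν)
  | _, [], _ => Or.inl (Or.inl (S.bad_n_of_lt S.len_vac (by omega)))
  | b, (i, m) :: ν, ⟨hb, hν⟩ => by
    have hl := S.len_NF ν
    have hn : S.Normal 0 ν.length (S.NF ν) := Or.inr ⟨ν, rfl, hν.mono (Nat.zero_le _), rfl⟩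
    change S.Normal 0 ν.length (S.n a (S.I i m (S.NF ν))) ∨ (∃ ν' : Code,
      ν'.length + 1 = ν.length + 1 ∧ ν'.Valid 0 ∧ S.I i m (S.NF ν) = S.u a (S.NF ν')) ∨
      S.Bad (S.I i m (S.NF ν))
    -- The empty code needs separate treatment, because `ν.length - 1` is truncated there; a cap on
    -- the empty diagram is bad.
    have hcons : ∀ {a'}, S.Normal 0 (ν.length - 1) (S.n a' (S.NF ν)) → ∀ i',
        S.Normal 0 ν.length (S.I i' m (S.n a' (S.NF ν))) := by
      intro a' h3 i'
      rcases Nat.eq_zero_or_pos ν.length with h0 | h0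
      · obtain rfl := List.length_eq_zero_iff.1 h0
        exact Or.inl (S.bad_I (S.bad_n_of_lt S.len_vac (by omega)))
      · have := h3.I i' m
        rwa [show ν.length - 1 + 1 = ν.length by omega] at this
    have hcup : ∀ {w : M}, S.Normal 0 ν.length w → S.I i m (S.NF ν) = S.u a w →
        (∃ ν' : Code, ν'.length + 1 = ν.length + 1 ∧ ν'.Valid 0 ∧
          S.I i m (S.NF ν) = S.u a (S.NF ν')) ∨ S.Bad (S.I i m (S.NF ν)) := by
      rintro w (h | ⟨ν', h1, h2, rfl⟩) hw
      · exact Or.inr (hw ▸ S.bad_u a h)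
      · exact Or.inl ⟨ν', by omega, h2, hw⟩
    rcases lt_trichotomy a (i + 1 + m) with h | rfl | h
    · rcases (show a = i + m ∨ a < i + m by omega) with rfl | h
      · cases m with
        | zero => exact Or.inr (Or.inl ⟨ν, rfl, hν.mono (Nat.zero_le _), rfl⟩)
        | succ m =>
          rw [I_succ, show i + (m + 1) = i + 1 + m by omega]
          exact Or.inl (Or.inl (S.bad_n_T _ _))
      · rcases lt_trichotomy a i with h' | rfl | h'
        · rcases (show a + 1 = i ∨ a + 2 ≤ i by omega) with rfl | h'
          · exact Or.inl (S.normal_n_I_left hl hn)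
          · obtain ⟨i, rfl⟩ : ∃ i', i = i' + 2 := ⟨i - 2, by omega⟩
            rw [S.n_I_of_le (by omega)]
            rcases normal_n a hν with h3 | ⟨ν', h1, h2, h3⟩ | h3
            · exact Or.inl (hcons h3 _)
            · refine Or.inr (hcup (w := S.I i m (S.NF ν')) ?_ ?_)
              · rw [← h1]
                exact Normal.I (Or.inr ⟨ν', rfl, h2, rfl⟩) i m
              · rw [h3, S.I_u_of_le (by omega)]
            · exact Or.inr (Or.inr (S.bad_I h3))
        · obtain ⟨m, rfl⟩ : ∃ m', m = m' + 1 := ⟨m - 1, by omega⟩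
          rw [I_succ']
          exact Or.inl (Or.inl (S.bad_n_T _ _))
        · obtain ⟨a, rfl⟩ : ∃ a', a = a' + 1 := ⟨a - 1, by omega⟩
          exact Or.inl (Or.inl (S.bad_n_I (by omega) h _))
    · exact Or.inl (S.normal_n_I_right hl hn)
    · obtain ⟨a, rfl⟩ : ∃ a', a = a' + 2 := ⟨a - 2, by omega⟩
      rw [S.n_I_of_gt (by omega)]
      rcases normal_n a hν with h3 | ⟨ν', h1, h2, h3⟩ | h3
      · exact Or.inl (hcons h3 _)
      · refine Or.inr (hcup (w := S.I i m (S.NF ν')) ?_ ?_)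
        · rw [← h1]
          exact Normal.I (Or.inr ⟨ν', rfl, h2, rfl⟩) i m
        · rw [h3, S.u_I_of_gt (by omega)]
      · exact Or.inr (Or.inr (S.bad_I h3))

end NilBrauer

/-! ## Diagrams modulo diagrams with fewer crossings -/

/-- Exchange `a` and `a + 1`. -/
def sw (a p : ℕ) : ℕ := if p = a then a + 1 else if p = a + 1 then a else p
/-- Skip `a` and `a + 1`. -/
def sk (a p : ℕ) : ℕ := if p < a then p else p + 2

section
variable {a b p : ℕ}

theorem sw_left : sw a a = a + 1 := by simp [sw]
theorem sw_right : sw a (a + 1) = a := by simp [sw]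
theorem sw_of_lt (h : p < a) : sw a p = p := by
  unfold sw; split_ifs <;> omega
theorem sw_of_gt (h : a + 1 < p) : sw a p = p := by
  unfold sw; split_ifs <;> omega
theorem sk_of_lt (h : p < a) : sk a p = p := if_pos h
theorem sk_of_ge (h : a ≤ p) : sk a p = p + 2 := if_neg (by omega)

theorem sw_comp_sw (a : ℕ) : sw a ∘ sw a = id := by
  funext p; simp only [Function.comp, sw, id]; split_ifs <;> omega
theorem sw_comm (h : a + 2 ≤ b) : sw b ∘ sw a = sw a ∘ sw b := by
  funext p; simp only [Function.comp, sw]; split_ifs <;> omega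
theorem sw_sk_of_le (h : a ≤ b) : sw (b + 2) ∘ sk a = sk a ∘ sw b := by
  funext p; simp only [Function.comp, sw, sk]; split_ifs <;> omega
theorem sw_sk_of_lt (h : b + 2 ≤ a) : sw b ∘ sk a = sk a ∘ sw b := by
  funext p; simp only [Function.comp, sw, sk]; split_ifs <;> omega
theorem sk_sk (h : a ≤ b) : sk (b + 2) ∘ sk a = sk a ∘ sk b := by
  funext p; simp only [Function.comp, sk]; split_ifs <;> omega
theorem sw_braid (a : ℕ) : sw a ∘ sw (a + 1) ∘ sw a = sw (a + 1) ∘ sw a ∘ sw (a + 1) := by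
  funext p; simp only [Function.comp, sw]; split_ifs <;> omega
theorem sw_sk_succ (a : ℕ) : sw (a + 1) ∘ sk a = sw a ∘ sk (a + 1) := by
  funext p; simp only [Function.comp, sw, sk]; split_ifs <;> omega
end

/-- The dual label. -/
def flip {α : Type} (x : α × Arrow) : α × Arrow := (x.1, x.2.dual)

theorem flip_flip {α : Type} (x : α × Arrow) : flip (flip x) = x := by
  obtain ⟨x, y⟩ := x
  cases y <;> rfl

/-- A set of labelled colourings of the endpoints of a diagram that are constant on strings, together
with the pairs of colours of strings that cross each other. -/
abbrev Shadow (α : Type) : Type := (ℕ → α × Arrow) → Multiset (Sym2 α) → Prop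

namespace Shadow
variable {α : Type} {a b : ℕ} (N : ℤ) (φ : Shadow α)

/-- The effect of a crossing. -/
def T (a : ℕ) : Shadow α := fun c A => ((a : ℤ) + 2 ≤ N) ∧
  ∃ B, A = s((c a).1, (c (a + 1)).1) ::ₘ B ∧ φ (c ∘ sw a) B
/-- The effect of a cup. -/
def u (a : ℕ) : Shadow α := fun c A => (a : ℤ) ≤ N ∧ c (a + 1) = flip (c a) ∧ φ (c ∘ sk a) A
/-- The effect of a cap. -/
def n (a : ℕ) : Shadow α := fun c A => ((a : ℤ) + 2 ≤ N) ∧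
  ∃ c', c = c' ∘ sk a ∧ c' (a + 1) = flip (c' a) ∧ φ c' A

theorem ext' {φ φ' : Shadow α} (h : ∀ c A, φ c A ↔ φ' c A) : φ = φ' :=
  funext fun c => funext fun A => propext (h c A)

/-- Shadows satisfy the isotopy relations exactly, crossing records included. They can therefore be
carried along with a class of vectors modulo lower terms. -/
theorem T_T (h : a + 2 ≤ b) : T N (T N φ a) b = T N (T N φ b) a := by
  have e1 : ∀ c : ℕ → α × Arrow, (c ∘ sw b) a = c a ∧ (c ∘ sw b) (a + 1) = c (a + 1) ∧
      (c ∘ sw a) b = c b ∧ (c ∘ sw a) (b + 1) = c (b + 1) := fun c => by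
    simp only [Function.comp]
    rw [sw_of_lt (by omega), sw_of_lt (by omega), sw_of_gt (by omega), sw_of_gt (by omega)]
    exact ⟨rfl, rfl, rfl, rfl⟩
  refine ext' fun c A => ⟨?_, ?_⟩
  · rintro ⟨h1, A', rfl, h2, A'', rfl, h3⟩
    obtain ⟨e1, e2, e3, e4⟩ := e1 c
    refine ⟨h2, _, ?_, h1, A'', rfl, ?_⟩
    · rw [e1, e2, e3, e4, Multiset.cons_swap]
    · rwa [Function.comp_assoc, ← sw_comm h]
  · rintro ⟨h1, A', rfl, h2, A'', rfl, h3⟩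
    obtain ⟨e1, e2, e3, e4⟩ := e1 c
    refine ⟨h2, _, ?_, h1, A'', rfl, ?_⟩
    · rw [e1, e2, e3, e4, Multiset.cons_swap]
    · rwa [Function.comp_assoc, sw_comm h]

theorem T_u (h : a ≤ b) : T (N + 2) (u N φ a) (b + 2) = u N (T N φ b) a := by
  refine ext' fun c A => ?_
  simp only [T, u, Function.comp_assoc, sw_sk_of_le h, Function.comp_apply]
  rw [sw_of_lt (by omega), sw_of_lt (by omega), sk_of_ge (by omega), sk_of_ge (by omega)]
  constructor
  · rintro ⟨h1, A', rfl, h2, h3, h4⟩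
    exact ⟨h2, h3, by push_cast at h1; omega, A', by rw [show b + 1 + 2 = b + 2 + 1 by omega], h4⟩
  · rintro ⟨h1, h2, h3, A', rfl, h4⟩
    exact ⟨by push_cast; omega, A', by rw [show b + 1 + 2 = b + 2 + 1 by omega], h1, h2, h4⟩

theorem u_T (h : b + 2 ≤ a) : T (N + 2) (u N φ a) b = u N (T N φ b) a := by
  refine ext' fun c A => ?_
  simp only [T, u, Function.comp_assoc, sw_sk_of_lt h, Function.comp_apply]
  rw [sw_of_gt (by omega), sw_of_gt (by omega), sk_of_lt (by omega), sk_of_lt (by omega)]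
  constructor
  · rintro ⟨h1, A', rfl, h2, h3, h4⟩
    exact ⟨h2, h3, by omega, A', rfl, h4⟩
  · rintro ⟨h1, h2, h3, A', rfl, h4⟩
    exact ⟨by omega, A', rfl, h1, h2, h4⟩

theorem u_u (h : a ≤ b) : u (N + 2) (u N φ a) (b + 2) = u (N + 2) (u N φ b) a := by
  refine ext' fun c A => ?_
  simp only [u, Function.comp_assoc, sk_sk h, Function.comp_apply]
  rw [sk_of_lt (by omega), sk_of_lt (by omega), sk_of_ge (by omega), sk_of_ge (by omega),
    show b + 1 + 2 = b + 2 + 1 by omega]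
  constructor
  · rintro ⟨h1, h2, h3, h4, h5⟩
    exact ⟨by omega, h4, by push_cast at h1; omega, h2, h5⟩
  · rintro ⟨h1, h2, h3, h4, h5⟩
    exact ⟨by push_cast; omega, h4, by omega, h2, h5⟩

theorem n_T (h : a + 2 ≤ b) : n N (T N φ a) b = T (N - 2) (n N φ b) a := by
  refine ext' fun c A => ⟨?_, ?_⟩
  · rintro ⟨h1, c', rfl, h2, h3, A', rfl, h4⟩
    refine ⟨by omega, A', ?_, h1, c' ∘ sw a, ?_, ?_, h4⟩
    · simp only [Function.comp_apply]
      rw [sk_of_lt (by omega), sk_of_lt (by omega)]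
    · rw [Function.comp_assoc, Function.comp_assoc, sw_sk_of_lt h]
    · simp only [Function.comp_apply]
      rwa [sw_of_gt (by omega), sw_of_gt (by omega)]
  · rintro ⟨h1, A', rfl, h2, c', h3, h4, h5⟩
    have h6 : c = c' ∘ sw a ∘ sk b := by
      have := congrArg (· ∘ sw a) h3
      simp only [Function.comp_assoc, sw_comp_sw] at this
      rw [sw_sk_of_lt h]
      exact this
    refine ⟨h2, c' ∘ sw a, h6, ?_, by omega, A', ?_, ?_⟩
    · simp only [Function.comp_apply]
      rwa [sw_of_gt (by omega), sw_of_gt (by omega)]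
    · rw [h6]
      simp only [Function.comp_apply]
      rw [sk_of_lt (by omega), sk_of_lt (by omega)]
    · rw [Function.comp_assoc, sw_comp_sw]
      exact h5

theorem T_n (h : b ≤ a) : n N (T N φ (a + 2)) b = T (N - 2) (n N φ b) a := by
  refine ext' fun c A => ⟨?_, ?_⟩
  · rintro ⟨h1, c', rfl, h2, h3, A', rfl, h4⟩
    push_cast at h3
    refine ⟨by omega, A', ?_, h1, c' ∘ sw (a + 2), ?_, ?_, h4⟩
    · simp only [Function.comp_apply]
      rw [sk_of_ge (by omega), sk_of_ge (by omega), show a + 1 + 2 = a + 2 + 1 by omega]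
    · rw [Function.comp_assoc, Function.comp_assoc, sw_sk_of_le h]
    · simp only [Function.comp_apply]
      rwa [sw_of_lt (by omega), sw_of_lt (by omega)]
  · rintro ⟨h1, A', rfl, h2, c', h3, h4, h5⟩
    have h6 : c = c' ∘ sw (a + 2) ∘ sk b := by
      have := congrArg (· ∘ sw a) h3
      simp only [Function.comp_assoc, sw_comp_sw] at this
      rw [sw_sk_of_le h]
      exact this
    refine ⟨h2, c' ∘ sw (a + 2), h6, ?_, by push_cast; omega, A', ?_, ?_⟩
    · simp only [Function.comp_apply]
      rwa [sw_of_lt (by omega), sw_of_lt (by omega)]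
    · rw [h6]
      simp only [Function.comp_apply]
      rw [sk_of_ge (by omega), sk_of_ge (by omega), show a + 1 + 2 = a + 2 + 1 by omega]
    · rw [Function.comp_assoc, sw_comp_sw]
      exact h5

/-- Insert a pair of labels. -/
def ins (c : ℕ → α × Arrow) (b : ℕ) (x : α × Arrow) : ℕ → α × Arrow := fun p =>
  if p < b then c p else if p = b then x else if p = b + 1 then flip x else c (p - 2)

theorem ins_sk (c : ℕ → α × Arrow) (b : ℕ) (x : α × Arrow) : ins c b x ∘ sk b = c := by
  funext p
  simp only [Function.comp, ins, sk]
  split_ifs <;> first | omega | rfl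
theorem ins_self (c : ℕ → α × Arrow) (b : ℕ) (x : α × Arrow) : ins c b x b = x := by
  simp [ins]
theorem ins_succ (c : ℕ → α × Arrow) (b : ℕ) (x : α × Arrow) : ins c b x (b + 1) = flip x := by
  simp [ins]
theorem ins_lt (c : ℕ → α × Arrow) {p : ℕ} (x : α × Arrow) (h : p < b) : ins c b x p = c p :=
  if_pos h
theorem ins_gt (c : ℕ → α × Arrow) {p : ℕ} (x : α × Arrow) (h : b ≤ p) :
    ins c b x (p + 2) = c p := by
  unfold ins
  rw [if_neg (by omega), if_neg (by omega), if_neg (by omega)]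
  rfl

theorem eq_ins {c c' : ℕ → α × Arrow} (h : c = c' ∘ sk b) (h' : c' (b + 1) = flip (c' b)) :
    c' = ins c b (c' b) := by
  subst h
  funext p
  simp only [Function.comp, ins, sk]
  split_ifs with h1 h2 h3 h4
  · rfl
  · rw [h2]
  · rw [h3, h']
  · omega
  · congr 1; omega

/-- The effect of a cap in terms of a label for the cap. -/
theorem n_iff (c : ℕ → α × Arrow) (A : Multiset (Sym2 α)) :
    n N φ b c A ↔ ((b : ℤ) + 2 ≤ N) ∧ ∃ x, φ (ins c b x) A := by
  refine and_congr_right fun _ => ⟨?_, ?_⟩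
  · rintro ⟨c', h1, h2, h3⟩
    exact ⟨c' b, eq_ins h1 h2 ▸ h3⟩
  · rintro ⟨x, hx⟩
    exact ⟨_, (ins_sk c b x).symm, by rw [ins_succ, ins_self], hx⟩

theorem n_u (h : a ≤ b) : n (N + 2) (u N φ a) (b + 2) = u (N - 2) (n N φ b) a := by
  refine ext' fun c A => ?_
  rw [n_iff]
  simp only [u, n_iff]
  have e : ∀ x, ins c (b + 2) x ∘ sk a = ins (c ∘ sk a) b x := fun x => by
    funext p
    simp only [Function.comp, ins, sk]
    split_ifs <;> first | omega | rfl | (congr 1; omega)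
  simp only [e]
  have e1 : ∀ x, ins c (b + 2) x a = c a := fun x => ins_lt c x (by omega)
  have e2 : ∀ x, ins c (b + 2) x (a + 1) = c (a + 1) := fun x => ins_lt c x (by omega)
  simp only [e1, e2]
  constructor
  · rintro ⟨h1, x, h2, h3, h4⟩
    push_cast at h1
    exact ⟨by omega, h3, by omega, x, h4⟩
  · rintro ⟨h1, h2, h3, x, h4⟩
    exact ⟨by push_cast; omega, x, by omega, h2, h4⟩

theorem u_n (h : b ≤ a) : n (N + 2) (u N φ (a + 2)) b = u (N - 2) (n N φ b) a := by
  refine ext' fun c A => ?_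
  rw [n_iff]
  simp only [u, n_iff]
  have e : ∀ x, ins c b x ∘ sk (a + 2) = ins (c ∘ sk a) b x := fun x => by
    funext p
    simp only [Function.comp, ins, sk]
    split_ifs <;> first | omega | rfl | (congr 1; omega)
  simp only [e]
  have e1 : ∀ x, ins c b x (a + 2) = c a := fun x => ins_gt c x (by omega)
  have e2 : ∀ x, ins c b x (a + 2 + 1) = c (a + 1) := fun x => by
    rw [show a + 2 + 1 = a + 1 + 2 by omega]; exact ins_gt c x (by omega)
  simp only [e1, e2]
  constructor
  · rintro ⟨h1, x, h2, h3, h4⟩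
    push_cast at h2
    exact ⟨by omega, h3, by omega, x, h4⟩
  · rintro ⟨h1, h2, h3, x, h4⟩
    exact ⟨by omega, x, by push_cast; omega, h2, h4⟩

theorem braid (a : ℕ) : T N (T N (T N φ a) (a + 1)) a = T N (T N (T N φ (a + 1)) a) (a + 1) := by
  have v1 : sw a (a + 1 + 1) = a + 1 + 1 := sw_of_gt (by omega)
  have v2 : sw (a + 1) a = a := sw_of_lt (by omega)
  refine ext' fun c A => ?_
  simp only [T, Function.comp_assoc, Function.comp_apply, sw_left, sw_right, v1, v2]
  rw [sw_braid]
  have e : ∀ (x y w : Sym2 α) B, x ::ₘ y ::ₘ w ::ₘ B = w ::ₘ y ::ₘ x ::ₘ B := fun x y w B => by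
    rw [Multiset.cons_swap x y, Multiset.cons_swap x w, Multiset.cons_swap y w]
  constructor
  · rintro ⟨h1, A', rfl, h2, A'', rfl, h3, A''', rfl, h4⟩
    exact ⟨h2, _, e _ _ _ _, h1, _, rfl, h2, A''', rfl, h4⟩
  · rintro ⟨h1, A', rfl, h2, A'', rfl, h3, A''', rfl, h4⟩
    exact ⟨h2, _, e _ _ _ _, h1, _, rfl, h2, A''', rfl, h4⟩

theorem cup_slide (a : ℕ) : T (N + 2) (u N φ a) (a + 1) = T (N + 2) (u N φ (a + 1)) a := by
  have v1 : sw a (a + 1 + 1) = a + 1 + 1 := sw_of_gt (by omega)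
  have v2 : sw (a + 1) a = a := sw_of_lt (by omega)
  refine ext' fun c A => ?_
  simp only [T, u, Function.comp_assoc, Function.comp_apply, sw_left, sw_right, v1, v2, sw_sk_succ]
  -- `flip` changes only the orientation and not the colour, so both legs of the cup give the same
  -- unordered pair of colours.
  have e : c (a + 1 + 1) = flip (c a) →
      s((c (a + 1)).1, (c (a + 1 + 1)).1) = s((c a).1, (c (a + 1)).1) := fun h => by
    rw [h, Sym2.eq_swap]; rfl
  constructor
  · rintro ⟨h1, A', rfl, h2, h3, h4⟩
    push_cast at h1 ⊢
    exact ⟨by omega, A', by rw [e h3], by omega, h3, h4⟩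
  · rintro ⟨h1, A', rfl, h2, h3, h4⟩
    push_cast at h2 ⊢
    exact ⟨by omega, A', by rw [e h3], by omega, h3, h4⟩

theorem cap_slide (a : ℕ) : n N (T N φ (a + 1)) a = n N (T N φ a) (a + 1) := by
  refine ext' fun c A => ?_
  simp only [n_iff, T]
  have e : ∀ x, ins c a x ∘ sw (a + 1) = ins c (a + 1) x ∘ sw a := fun x => by
    funext p
    simp only [Function.comp, ins, sw]
    split_ifs <;> first | omega | rfl
  have e1 : ∀ x, s((ins c a x (a + 1)).1, (ins c a x (a + 1 + 1)).1) =
      s((ins c (a + 1) x a).1, (ins c (a + 1) x (a + 1)).1) := fun x => by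
    rw [ins_succ, ins_self, ins_lt (b := a + 1) (p := a) c x (by omega),
      show a + 1 + 1 = a + 2 from rfl, ins_gt (b := a) c x le_rfl, Sym2.eq_swap]
    rfl
  simp only [e, e1]
  constructor
  · rintro ⟨h1, x, h2, h3⟩
    push_cast at h2 ⊢
    exact ⟨by omega, x, by omega, h3⟩
  · rintro ⟨h1, x, h2, h3⟩
    push_cast at h1 ⊢
    exact ⟨by omega, x, by omega, h3⟩

theorem zigzag (h : (a : ℤ) < N) : n (N + 2) (u N φ (a + 1)) a = φ := by
  refine ext' fun c A => ?_
  simp only [n_iff, u]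
  have e : ∀ x, x = c a → ins c a x ∘ sk (a + 1) = c := fun x hx => by
    subst hx
    funext p
    simp only [Function.comp, ins, sk]
    split_ifs <;> first | omega | rfl | (congr 1; omega)
  have e1 : ∀ x, ins c a x (a + 1 + 1) = c a := fun x => ins_gt c x le_rfl
  simp only [e1, ins_succ, flip_flip]
  constructor
  · rintro ⟨h1, x, h2, h3, h4⟩
    rwa [e x h3.symm] at h4
  · intro h1
    exact ⟨by omega, c a, by push_cast; omega, rfl, by rwa [e _ rfl]⟩

theorem zigzag' (h : (a : ℤ) < N) : n (N + 2) (u N φ a) (a + 1) = φ := by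
  refine ext' fun c A => ?_
  simp only [n_iff, u]
  have e : ∀ x, flip x = c a → ins c (a + 1) x ∘ sk a = c := fun x hx => by
    funext p
    simp only [Function.comp, ins, sk]
    split_ifs with h1 h2 h3 h4 h5 <;> try first | omega | rfl
    obtain rfl : p = a := by omega
    exact hx
  simp only [ins_self, ins_lt c _ (Nat.lt_succ_self a)]
  constructor
  · rintro ⟨h1, x, h2, h3, h4⟩
    rwa [e x (by rw [h3, flip_flip])] at h4
  · intro h1
    exact ⟨by push_cast; omega, flip (c a), by omega, rfl, by rwa [e _ (flip_flip _)]⟩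

end Shadow

/-- Vectors supported on words of length `N`. -/
def HasLen {z : k} (N : ℤ) (v : Vec z) : Prop := ∀ W : Word, (W.length : ℤ) ≠ N → v W = 0

section
variable {z : k} {N : ℤ} {v : Vec z}

theorem HasLen.isLen {N : ℕ} (h : HasLen (N : ℤ) v) : IsLen N v := fun W hW =>
  h W (by exact_mod_cast hW)
theorem IsLen.hasLen {N : ℕ} (h : IsLen N v) : HasLen (N : ℤ) v := fun W hW =>
  h W (by exact_mod_cast hW)

theorem HasLen.local_eq_zero {F : ℕ → Module.End k (Vec z)} {p q n : ℕ} [IsLocal F p q n]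
    (h : HasLen N v) {a : ℕ} (ha : N < a + p) : F a v = 0 := by
  rcases lt_or_ge N 0 with hN | hN
  · have : v = 0 := funext fun W => h W (by omega)
    rw [this, map_zero]
  · lift N to ℕ using hN
    exact h.isLen.local_eq_zero (by omega)

theorem HasLen.local {F : ℕ → Module.End k (Vec z)} {p q n : ℕ} [IsLocal F p q n]
    (h : HasLen N v) (a : ℕ) {M : ℤ} (hM : M + p = N + q) : HasLen M (F a v) := by
  rcases lt_or_ge N p with hN | hN
  · rw [h.local_eq_zero (by omega)]
    exact fun _ _ => rfl
  · obtain ⟨N, rfl⟩ : ∃ N' : ℕ, N = (N' + p : ℕ) := ⟨(N - p).toNat, by omega⟩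
    have := (h.isLen.local (F := F) a).hasLen
    rwa [show M = (N + q : ℕ) by push_cast at hM ⊢; omega]

end

/-- A linear combination of diagrams with at most `deg` crossings and `len` endpoints. -/
structure PreDiagram (z : k) (α : Type) where
  /-- the number of crossings -/
  deg : ℕ
  /-- the number of endpoints -/
  len : ℤ
  /-- the linear combination -/
  vec : Vec z
  /-- the shadow -/
  shadow : Shadow α
  mem : vec ∈ Low z (deg + 1)
  hasLen : HasLen len vec

namespace PreDiagram
variable {z : k} {α : Type}

instance : Setoid (PreDiagram z α) where
  r x y := x.deg = y.deg ∧ x.len = y.len ∧ x.shadow = y.shadow ∧ x.vec - y.vec ∈ Low z x.deg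
  iseqv := by
    refine ⟨fun x => ⟨rfl, rfl, rfl, by rw [sub_self]; exact zero_mem _⟩, ?_, ?_⟩
    · rintro x y ⟨h1, h2, h3, h4⟩
      exact ⟨h1.symm, h2.symm, h3.symm, by rw [← neg_sub, ← h1]; exact neg_mem h4⟩
    · rintro x y w ⟨h1, h2, h3, h4⟩ ⟨h1', h2', h3', h5⟩
      refine ⟨h1.trans h1', h2.trans h2', h3.trans h3', ?_⟩
      rw [← sub_add_sub_cancel _ y.vec]
      exact add_mem h4 (h1 ▸ h5)

/-- Add a crossing. -/
def T (a : ℕ) (x : PreDiagram z α) : PreDiagram z α where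
  deg := x.deg + 1
  len := x.len
  vec := opT z a x.vec
  shadow := x.shadow.T x.len a
  mem := low_opT a x.mem
  hasLen := x.hasLen.local a rfl

/-- Add a cup. -/
def u (a : ℕ) (x : PreDiagram z α) : PreDiagram z α where
  deg := x.deg
  len := x.len + 2
  vec := opu z a x.vec
  shadow := x.shadow.u x.len a
  mem := low_opu a x.mem
  hasLen := x.hasLen.local a (by push_cast; ring)

/-- Add a cap. -/
def n (a : ℕ) (x : PreDiagram z α) : PreDiagram z α where
  deg := x.deg
  len := x.len - 2
  vec := opn z a x.vec
  shadow := x.shadow.n x.len a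
  mem := low_opn a x.mem
  hasLen := x.hasLen.local a (by push_cast; ring)

/-- The empty diagram. -/
def vac (z : k) (α : Type) : PreDiagram z α where
  deg := 0
  len := 0
  vec := QuantumIsomeric.vac z
  shadow := fun _ A => A = 0
  mem := Mon.vac.mem_low Nat.zero_lt_one
  hasLen := isLen_vac.hasLen

/-- No colouring shows that the diagram is reduced. -/
def Bad (x : PreDiagram z α) : Prop := x.vec ∈ Low z x.deg ∧
  ∀ c A, x.shadow c A → ¬ (A.Nodup ∧ ∀ p ∈ A, ¬ p.IsDiag)

end PreDiagram

open PreDiagram in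
/-- Diagrams modulo linear combinations of diagrams with fewer crossings. -/
def nilBrauer (z : k) (α : Type) : NilBrauer (Quotient (α := PreDiagram z α) inferInstance) where
  T a := Quotient.map (T a) fun x y ⟨h1, h2, h3, h4⟩ =>
    ⟨congrArg (· + 1) h1, h2, by simp only [T, h2, h3], by
      have := low_opT a h4
      rwa [map_sub] at this⟩
  u a := Quotient.map (u a) fun x y ⟨h1, h2, h3, h4⟩ =>
    ⟨h1, congrArg (· + 2) h2, by simp only [u, h2, h3], by
      have := low_opu a h4
      rwa [map_sub] at this⟩
  n a := Quotient.map (n a) fun x y ⟨h1, h2, h3, h4⟩ =>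
    ⟨h1, congrArg (· - 2) h2, by simp only [n, h2, h3], by
      have := low_opn a h4
      rwa [map_sub] at this⟩
  vac := ⟦PreDiagram.vac z α⟧
  -- A bad diagram has two properties: its vector lies in the lower filtration step, which is what
  -- makes it negligible, and no colouring separates its crossings, which is how reduced lifts are
  -- seen not to be bad.
  Bad := Quotient.lift Bad fun x y ⟨h1, h2, h3, h4⟩ => by
    unfold Bad
    rw [h3, ← h1, ← sub_add_cancel x.vec y.vec, Submodule.add_mem_iff_right _ h4]
  Len N := Quotient.lift (fun x => x.len = N) fun x y ⟨_, h2, _⟩ => by rw [h2]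
  T_T := by
    rintro a b ⟨v⟩ h
    refine Quotient.sound ⟨rfl, rfl, Shadow.T_T v.len v.shadow h, ?_⟩
    have := far (opT z) (opT z) a b b v.vec h rfl
    simp only [T, this, sub_self, zero_mem]
  T_u := by
    rintro a b ⟨v⟩ h
    refine Quotient.sound ⟨rfl, rfl, Shadow.T_u v.len v.shadow h, ?_⟩
    have := far (opu z) (opT z) a b (b + 2) v.vec h rfl
    simp only [T, u, this, sub_self, zero_mem]
  u_T := by
    rintro a b ⟨v⟩ h
    refine Quotient.sound ⟨rfl, rfl, Shadow.u_T v.len v.shadow h, ?_⟩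
    have := far (opT z) (opu z) b a a v.vec h rfl
    simp only [T, u, this, sub_self, zero_mem]
  u_u := by
    rintro a b ⟨v⟩ h
    refine Quotient.sound ⟨rfl, rfl, Shadow.u_u v.len v.shadow h, ?_⟩
    have := far (opu z) (opu z) a b (b + 2) v.vec h rfl
    simp only [u, this, sub_self, zero_mem]
  n_T := by
    rintro a b ⟨v⟩ h
    refine Quotient.sound ⟨rfl, rfl, Shadow.n_T v.len v.shadow h, ?_⟩
    have := far (opT z) (opn z) a b b v.vec h rfl
    simp only [T, n, this, sub_self, zero_mem]
  T_n := by
    rintro a b ⟨v⟩ h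
    refine Quotient.sound ⟨rfl, rfl, Shadow.T_n v.len v.shadow h, ?_⟩
    have := far (opn z) (opT z) b (a + 2) a v.vec (by omega) (by omega)
    simp only [T, n, this, sub_self, zero_mem]
  n_u := by
    rintro a b ⟨v⟩ h
    refine Quotient.sound ⟨rfl, by simp [n, u], Shadow.n_u v.len v.shadow h, ?_⟩
    have := far (opu z) (opn z) a b (b + 2) v.vec h rfl
    simp only [u, n, this, sub_self, zero_mem]
  u_n := by
    rintro a b ⟨v⟩ h
    refine Quotient.sound ⟨rfl, by simp [n, u], Shadow.u_n v.len v.shadow h, ?_⟩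
    have := far (opn z) (opu z) b (a + 2) a v.vec (by omega) (by omega)
    simp only [u, n, this, sub_self, zero_mem]
  braid := by
    rintro a ⟨v⟩
    exact Quotient.sound ⟨rfl, rfl, Shadow.braid v.len v.shadow a, low_braid a v.mem⟩
  cup_slide := by
    rintro a ⟨v⟩
    exact Quotient.sound ⟨rfl, rfl, Shadow.cup_slide v.len v.shadow a, low_opT_opu_succ a v.mem⟩
  cap_slide := by
    rintro a ⟨v⟩
    exact Quotient.sound ⟨rfl, rfl, Shadow.cap_slide v.len v.shadow a, low_opn_opT_succ a v.mem⟩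
  zigzag := by
    rintro N a ⟨v⟩ h ha
    change v.len = N at h
    have h0 : (a : ℤ) < v.len := by omega
    refine Quotient.sound ⟨rfl, by simp [n, u], Shadow.zigzag v.len v.shadow h0, ?_⟩
    have h1 : opn z a (opu z (a + 1) v.vec) = v.vec := by
      rw [opn_opu_succ, (HasLen.isLen (N := N) (h ▸ v.hasLen)).prLen ha]
    simp only [u, n, h1, sub_self, zero_mem]
  zigzag' := by
    rintro N a ⟨v⟩ h ha
    change v.len = N at h
    have h0 : (a : ℤ) < v.len := by omega
    refine Quotient.sound ⟨rfl, by simp [n, u], Shadow.zigzag' v.len v.shadow h0, ?_⟩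
    have h1 : opn z (a + 1) (opu z a v.vec) = v.vec := by
      rw [opn_succ_opu, (HasLen.isLen (N := N) (h ▸ v.hasLen)).prLen ha]
    simp only [u, n, h1, sub_self, zero_mem]
  bad_T_T := by
    rintro a ⟨v⟩
    refine ⟨low_opT_opT a v.mem, ?_⟩
    -- Both crossings record the same pair of colours, so the record has a repetition.
    rintro c A ⟨-, A', rfl, -, A'', rfl, -⟩ ⟨h, -⟩
    refine (Multiset.nodup_cons.1 h).1 (Multiset.mem_cons.2 (Or.inl ?_))
    simp only [Function.comp_apply, sw_left, sw_right]
    exact Sym2.eq_swap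
  bad_T_u := by
    rintro a ⟨v⟩
    refine ⟨?_, ?_⟩
    · change opT z a (opu z a v.vec) ∈ Low z (v.deg + 1)
      rw [opT_opu]
      exact low_opu a v.mem
    -- The two legs of the cup have one colour, so the recorded pair is diagonal.
    · rintro c A ⟨-, A', rfl, -, h1, -⟩ ⟨-, h⟩
      refine h _ (Multiset.mem_cons_self _ _) ?_
      simp only [Function.comp_apply, sw_left, sw_right] at h1
      rw [h1]
      exact rfl
  bad_n_T := by
    rintro a ⟨v⟩
    refine ⟨?_, ?_⟩
    · change opn z a (opT z a v.vec) ∈ Low z (v.deg + 1)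
      rw [opn_opT]
      exact low_opn a v.mem
    · rintro c A ⟨-, c', rfl, h1, -, A', rfl, -⟩ ⟨-, h⟩
      refine h _ (Multiset.mem_cons_self _ _) ?_
      rw [h1]
      exact rfl
  bad_T := by
    rintro a ⟨v⟩ ⟨h1, h2⟩
    refine ⟨low_opT a h1, ?_⟩
    rintro c A ⟨-, A', rfl, h3⟩ ⟨h4, h5⟩
    exact h2 _ _ h3 ⟨(Multiset.nodup_cons.1 h4).2, fun p hp => h5 p (Multiset.mem_cons_of_mem hp)⟩
  bad_u := by
    rintro a ⟨v⟩ ⟨h1, h2⟩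
    exact ⟨low_opu a h1, fun c A ⟨_, _, h3⟩ => h2 _ _ h3⟩
  bad_n := by
    rintro a ⟨v⟩ ⟨h1, h2⟩
    exact ⟨low_opn a h1, fun c A ⟨_, _, _, _, h3⟩ => h2 _ _ h3⟩
  bad_T_of_lt := by
    rintro N a ⟨v⟩ h ha
    change v.len = N at h
    have h0 : v.len < a + 2 := by omega
    refine ⟨?_, fun c A h1 => absurd h1.1 (by omega)⟩
    change opT z a v.vec ∈ _
    rw [v.hasLen.local_eq_zero (F := opT z) h0]
    exact zero_mem _
  bad_u_of_lt := by
    rintro N a ⟨v⟩ h ha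
    change v.len = N at h
    have h0 : v.len < a := by omega
    refine ⟨?_, fun c A h1 => absurd h1.1 (by omega)⟩
    change opu z a v.vec ∈ _
    rw [v.hasLen.local_eq_zero (F := opu z) (by simpa using h0)]
    exact zero_mem _
  bad_n_of_lt := by
    rintro N a ⟨v⟩ h ha
    change v.len = N at h
    have h0 : v.len < a + 2 := by omega
    refine ⟨?_, fun c A h1 => absurd h1.1 (by omega)⟩
    change opn z a v.vec ∈ _
    rw [v.hasLen.local_eq_zero (F := opn z) h0]
    exact zero_mem _
  len_vac := rfl
  len_T := by rintro N ⟨v⟩ a h; exact h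
  len_u := by
    rintro N ⟨v⟩ a h
    change v.len + 2 = (N + 2 : ℕ)
    change v.len = N at h
    omega

/-! ## Diagrams given by codes -/

/-- The number of crossings of the diagram given by a code. -/
def Code.cross : Code → ℕ
  | [] => 0
  | (_, m) :: ν => m + Code.cross ν

section
variable (z : k)

/-- A chord from `i` to `i + 1 + m`, crossing the `m` strands in between. -/
def chord (i : ℕ) : ℕ → Module.End k (Vec z)
  | 0 => opu z i
  | m + 1 => opT z (i + 1 + m) * chord i m

/-- The diagram given by a code. -/
def nf : Code → Vec z
  | [] => vac z
  | (i, m) :: ν => chord z i m (nf ν)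

end

namespace PreDiagram
variable {z : k} {α : Type}

/-- A chord from `i` to `i + 1 + m`, crossing the `m` strands in between. -/
def I (i : ℕ) : ℕ → PreDiagram z α → PreDiagram z α
  | 0, x => x.u i
  | m + 1, x => (I i m x).T (i + 1 + m)

variable (z α) in
/-- The diagram given by a code. -/
def nf : Code → PreDiagram z α
  | [] => vac z α
  | (i, m) :: ν => I i m (nf ν)

theorem mk_I (i m : ℕ) (x : PreDiagram z α) : (nilBrauer z α).I i m ⟦x⟧ = ⟦I i m x⟧ := by
  induction m with
  | zero => rfl
  | succ m ih => rw [NilBrauer.I_succ, ih]; rfl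

theorem mk_nf (ν : Code) : (nilBrauer z α).NF ν = ⟦nf z α ν⟧ := by
  induction ν with
  | nil => rfl
  | cons c ν ih => exact (congrArg _ ih).trans (mk_I _ _ _)

theorem I_spec (i m : ℕ) (x : PreDiagram z α) : (I i m x).deg = m + x.deg ∧
    (I i m x).len = x.len + 2 ∧ (I i m x).vec = chord z i m x.vec := by
  induction m with
  | zero => exact ⟨(zero_add _).symm, rfl, rfl⟩
  | succ m ih =>
    obtain ⟨h1, h2, h3⟩ := ih
    exact ⟨(congrArg (· + 1) h1).trans (by omega), h2, congrArg (opT z (i + 1 + m)) h3⟩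

theorem nf_spec (ν : Code) : (nf z α ν).deg = ν.cross ∧
    (nf z α ν).len = (2 * ν.length : ℕ) ∧ (nf z α ν).vec = QuantumIsomeric.nf z ν := by
  induction ν with
  | nil => exact ⟨rfl, rfl, rfl⟩
  | cons c ν ih =>
    obtain ⟨h1, h2, h3⟩ := ih
    obtain ⟨h4, h5, h6⟩ := I_spec c.1 c.2 (nf z α ν)
    exact ⟨h4.trans (congrArg _ h1), h5.trans (by rw [h2]; push_cast [List.length_cons]; ring),
      h6.trans (by rw [h3]; rfl)⟩

end PreDiagram

section
variable {z : k} (ν : Code)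

theorem nf_mem : nf z ν ∈ Low z (ν.cross + 1) := by
  obtain ⟨h1, h2, h3⟩ := PreDiagram.nf_spec (z := z) (α := Unit) ν
  rw [← h1, ← h3]
  exact (PreDiagram.nf z Unit ν).mem

theorem nf_isLen : IsLen (2 * ν.length) (nf z ν) := by
  obtain ⟨h1, h2, h3⟩ := PreDiagram.nf_spec (z := z) (α := Unit) ν
  rw [← h3]
  exact HasLen.isLen (h2 ▸ (PreDiagram.nf z Unit ν).hasLen)

/-- A vector is, up to diagrams with less than `l` crossings, zero or given by a code. -/
def IsNormal (l : ℕ) (v : Vec z) : Prop :=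
  v ∈ Low z l ∨ ∃ ν : Code, ν.cross = l ∧ ν.Valid 0 ∧ v - nf z ν ∈ Low z l

/-- Only the vector matters here, so a single colour suffices. -/
theorem NilBrauer.Normal.isNormal {b l : ℕ} {x : PreDiagram z Unit}
    (h : (nilBrauer z Unit).Normal b l ⟦x⟧) : IsNormal x.deg x.vec := by
  rcases h with h | ⟨ν, -, h2, h3⟩
  · exact Or.inl h.1
  · rw [PreDiagram.mk_nf] at h3
    obtain ⟨h4, -, -, h5⟩ := Quotient.exact h3
    obtain ⟨h1, -, h3⟩ := PreDiagram.nf_spec (z := z) (α := Unit) ν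
    exact Or.inr ⟨ν, by rw [h4, h1], h2.mono (Nat.zero_le _), h3 ▸ h5⟩

variable {ν}

theorem isNormal_opT (h : ν.Valid 0) (a : ℕ) : IsNormal (ν.cross + 1) (opT z a (nf z ν)) := by
  have := (nilBrauer z Unit).normal_T a h
  rw [PreDiagram.mk_nf] at this
  obtain ⟨h1, h2, h3⟩ := PreDiagram.nf_spec (z := z) (α := Unit) ν
  have h4 := NilBrauer.Normal.isNormal (x := (PreDiagram.nf z Unit ν).T a) this
  rw [← h1, ← h3]
  exact h4

theorem isNormal_opu (h : ν.Valid 0) (a : ℕ) : IsNormal ν.cross (opu z a (nf z ν)) := by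
  have := (nilBrauer z Unit).normal_u a h (Nat.zero_le _)
  rw [PreDiagram.mk_nf] at this
  obtain ⟨h1, h2, h3⟩ := PreDiagram.nf_spec (z := z) (α := Unit) ν
  have h4 := NilBrauer.Normal.isNormal (x := (PreDiagram.nf z Unit ν).u a) this
  rw [← h1, ← h3]
  exact h4

theorem isNormal_opn (h : ν.Valid 0) (a : ℕ) : IsNormal ν.cross (opn z a (nf z ν)) ∨
    (∃ ν' : Code, ν'.length + 1 = ν.length ∧ ν'.cross = ν.cross ∧ ν'.Valid 0 ∧
      nf z ν - opu z a (nf z ν') ∈ Low z ν.cross) ∨ nf z ν ∈ Low z ν.cross := by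
  have := (nilBrauer z Unit).normal_n a h
  rw [PreDiagram.mk_nf] at this
  obtain ⟨h1, h2, h3⟩ := PreDiagram.nf_spec (z := z) (α := Unit) ν
  rw [← h1, ← h3]
  rcases this with h | ⟨ν', h4, h5, h6⟩ | h
  · exact Or.inl (NilBrauer.Normal.isNormal (x := (PreDiagram.nf z Unit ν).n a) h)
  · rw [PreDiagram.mk_nf] at h6
    obtain ⟨h1', h2', h3'⟩ := PreDiagram.nf_spec (z := z) (α := Unit) ν'
    obtain ⟨h7, -, -, h8⟩ := Quotient.exact h6
    refine Or.inr (Or.inl ⟨ν', h4, ?_, h5, h3' ▸ h8⟩)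
    rw [← h1', h7]
    rfl
  · exact Or.inr (Or.inr h.1)

/-- A chord reaching beyond the endpoints acts on words that are too short, which gives zero. -/
theorem inRange_or_nf_eq_zero (ν : Code) : ν.InRange ∨ nf z ν = 0 := by
  induction ν with
  | nil => exact Or.inl trivial
  | cons c ν ih =>
    rcases ih with h | h
    · by_cases hc : c.1 + c.2 ≤ 2 * ν.length
      · exact Or.inl ⟨hc, h⟩
      · refine Or.inr ?_
        obtain ⟨i, m⟩ := c
        cases m with
        | zero => exact (nf_isLen ν).local_eq_zero (F := opu z) (by simpa using hc)
        | succ m =>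
          have h1 : IsLen (2 * ν.length + 2) (chord z i m (nf z ν)) := nf_isLen ((i, m) :: ν)
          change opT z (i + 1 + m) (chord z i m (nf z ν)) = 0
          exact h1.local_eq_zero (F := opT z) (by simp only [not_le] at hc; omega)
    · exact Or.inr ((congrArg _ h).trans (map_zero _))

end

/-! ## The matching of a code -/

/-- The matching after adding a cup. -/
def cupMate (a : ℕ) (μ : ℕ → ℕ) (p : ℕ) : ℕ :=
  if p < a then sk a (μ p) else if p = a then a + 1 else if p = a + 1 then a else sk a (μ (p - 2))

/-- The matching after adding a crossing. -/
def swMate (a : ℕ) (μ : ℕ → ℕ) : ℕ → ℕ := sw a ∘ μ ∘ sw a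

/-- The matching after adding a chord. -/
def chordMate (i : ℕ) : ℕ → (ℕ → ℕ) → ℕ → ℕ
  | 0, μ => cupMate i μ
  | m + 1, μ => swMate (i + 1 + m) (chordMate i m μ)

/-- The matching of a code. -/
def Code.mate : Code → ℕ → ℕ
  | [] => id
  | (i, m) :: ν => chordMate i m (Code.mate ν)

/-- A matching of the numbers less than `N`. -/
def IsMatching (N : ℕ) (μ : ℕ → ℕ) : Prop := ∀ p < N, μ p < N ∧ μ (μ p) = p ∧ μ p ≠ p

section
variable {N a : ℕ} {μ : ℕ → ℕ}

theorem cupMate_left : cupMate a μ a = a + 1 := by simp [cupMate]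
theorem cupMate_right : cupMate a μ (a + 1) = a := by simp [cupMate]
theorem cupMate_sk (p : ℕ) : cupMate a μ (sk a p) = sk a (μ p) := by
  rcases lt_or_ge p a with h | h
  · rw [sk_of_lt h, cupMate, if_pos h]
  · rw [sk_of_ge h, cupMate, if_neg (by omega), if_neg (by omega), if_neg (by omega)]
    rfl

theorem sw_sw (p : ℕ) : sw a (sw a p) = p := congrFun (sw_comp_sw a) p

theorem eq_or_sk (a p : ℕ) : p = a ∨ p = a + 1 ∨ ∃ q, p = sk a q := by
  rcases lt_trichotomy p a with h | rfl | h
  · exact Or.inr (Or.inr ⟨p, (sk_of_lt h).symm⟩)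
  · exact Or.inl rfl
  · by_cases h' : p = a + 1
    · exact Or.inr (Or.inl h')
    · exact Or.inr (Or.inr ⟨p - 2, by rw [sk_of_ge (by omega)]; omega⟩)

theorem sk_lt_iff {q : ℕ} (ha : a ≤ N) : sk a q < N + 2 ↔ q < N := by
  unfold sk; split_ifs <;> omega

theorem sk_injective (a : ℕ) : Function.Injective (sk a) := by
  intro p q h
  unfold sk at h; split_ifs at h <;> omega

theorem sw_lt_iff {q : ℕ} (ha : a + 2 ≤ N) : sw a q < N ↔ q < N := by
  unfold sw; split_ifs <;> omega

theorem IsMatching.cup (h : IsMatching N μ) (ha : a ≤ N) : IsMatching (N + 2) (cupMate a μ) := by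
  intro p hp
  rcases eq_or_sk a p with rfl | rfl | ⟨q, rfl⟩
  · rw [cupMate_left, cupMate_right]
    exact ⟨by omega, rfl, by omega⟩
  · rw [cupMate_right, cupMate_left]
    exact ⟨by omega, rfl, by omega⟩
  · rw [cupMate_sk, cupMate_sk]
    obtain ⟨h1, h2, h3⟩ := h q ((sk_lt_iff ha).1 hp)
    exact ⟨(sk_lt_iff ha).2 h1, congrArg _ h2, fun h4 => h3 (sk_injective a h4)⟩

theorem IsMatching.sw (h : IsMatching N μ) (ha : a + 2 ≤ N) : IsMatching N (swMate a μ) := by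
  intro p hp
  obtain ⟨h1, h2, h3⟩ := h _ ((sw_lt_iff ha).2 hp)
  simp only [swMate, Function.comp_apply, sw_sw]
  refine ⟨(sw_lt_iff ha).2 h1, by rw [h2, sw_sw], fun h4 => h3 ?_⟩
  have := congrArg (QuantumIsomeric.sw a) h4
  rwa [sw_sw] at this

theorem IsMatching.chord (h : IsMatching N μ) {i m : ℕ} (hi : i + m ≤ N) :
    IsMatching (N + 2) (chordMate i m μ) := by
  induction m with
  | zero => exact h.cup hi
  | succ m ih => exact (ih (by omega)).sw (by omega)

theorem Code.InRange.isMatching : {ν : Code} → ν.InRange → IsMatching (2 * ν.length) ν.mate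
  | [], _ => fun p hp => absurd hp (by simp)
  | (_, _) :: ν, ⟨h1, h2⟩ => (Code.InRange.isMatching h2).chord h1

end

/-! ### Colourings -/

/-- Labelled colourings that are constant on the strings of a matching. -/
def Compat {α : Type} (N : ℕ) (μ : ℕ → ℕ) (c : ℕ → α × Arrow) : Prop := ∀ p < N, c (μ p) = flip (c p)

section
variable {α : Type} {N a : ℕ} {μ : ℕ → ℕ} {c : ℕ → α × Arrow}

theorem compat_cup (ha : a ≤ N) : Compat (N + 2) (cupMate a μ) c ↔
    c (a + 1) = flip (c a) ∧ Compat N μ (c ∘ sk a) := by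
  constructor
  · intro h
    refine ⟨?_, fun q hq => ?_⟩
    · have := h a (by omega)
      rwa [cupMate_left] at this
    · have := h (sk a q) ((sk_lt_iff ha).2 hq)
      rwa [cupMate_sk] at this
  · rintro ⟨h1, h2⟩ p hp
    rcases eq_or_sk a p with rfl | rfl | ⟨q, rfl⟩
    · rw [cupMate_left, h1]
    · rw [cupMate_right, h1, flip_flip]
    · rw [cupMate_sk]
      exact h2 q ((sk_lt_iff ha).1 hp)

theorem compat_sw (ha : a + 2 ≤ N) : Compat N (swMate a μ) c ↔ Compat N μ (c ∘ sw a) := by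
  constructor
  · intro h p hp
    have := h (sw a p) ((sw_lt_iff ha).2 hp)
    simpa only [swMate, Function.comp_apply, sw_sw] using this
  · intro h p hp
    have := h (sw a p) ((sw_lt_iff ha).2 hp)
    simpa only [swMate, Function.comp_apply, sw_sw] using this

theorem PreDiagram.shadow_I {z : k} {x : PreDiagram z α} (hN : x.len = N)
    (h : ∀ c, (∃ A, x.shadow c A) ↔ Compat N μ c) {i m : ℕ} (hi : i + m ≤ N) (c : ℕ → α × Arrow) :
    (∃ A, (I i m x).shadow c A) ↔ Compat (N + 2) (chordMate i m μ) c := by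
  induction m generalizing c with
  | zero =>
    refine Iff.trans ?_ (compat_cup hi).symm
    rw [← h]
    constructor
    · rintro ⟨A, -, h1, h2⟩
      exact ⟨h1, A, h2⟩
    · rintro ⟨h1, A, h2⟩
      exact ⟨A, by rw [hN]; exact_mod_cast hi, h1, h2⟩
  | succ m ih =>
    refine Iff.trans ?_ (compat_sw (by omega)).symm
    rw [← ih (by omega)]
    obtain ⟨-, h2, -⟩ := I_spec i m x
    constructor
    · rintro ⟨A, -, A', -, h1⟩
      exact ⟨A', h1⟩
    · rintro ⟨A, h1⟩
      exact ⟨_, by rw [h2, hN]; push_cast; omega, A, rfl, h1⟩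

/-- Once the crossing record is forgotten, a shadow knows precisely the matching. This is how the
code of a reduced lift is compared with its strings. -/
theorem PreDiagram.shadow_nf (z : k) : {ν : Code} → ν.InRange → ∀ c : ℕ → α × Arrow,
    (∃ A, (nf z α ν).shadow c A) ↔ Compat (2 * ν.length) ν.mate c
  | [], _, c => ⟨fun _ p hp => absurd hp (by simp), fun _ => ⟨0, rfl⟩⟩
  | (i, m) :: ν, ⟨h1, h2⟩, c =>
    shadow_I (nf_spec ν).2.1 (shadow_nf z h2) h1 c

end

/-! ### Tokens slide along strings -/

theorem tok_opT_left {z : k} (x : Arrow) (a : ℕ) (v : Vec z) :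
    pr z x a (opT z a v) = opT z a (pr z x (a + 1) v) ∧
      pr z x (a + 1) (opT z a v) = opT z a (pr z x a v) := by
  have h : ∀ y w, pr z x a (opTc z y w a v) = opTc z y w a (pr z x (a + 1) v) ∧
      pr z x (a + 1) (opTc z y w a v) = opTc z y w a (pr z x a v) := by
    intro y w
    constructor
    · by_cases hx : x = w
      · subst hx
        rw [(opTc_pr z a v y x).1, (opTc_pr z a v y x).2.2.2]
      · rw [← (opTc_pr z a v y w).1, pr_pr_ne z a _ hx, ← (opTc_pr z a _ y w).2.2.2,
          pr_pr_ne z _ _ (Ne.symm hx), map_zero]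
    · by_cases hx : x = y
      · subst hx
        rw [(opTc_pr z a v x w).2.1, (opTc_pr z a v x w).2.2.1]
      · rw [← (opTc_pr z a v y w).2.1, pr_pr_ne z _ _ hx, ← (opTc_pr z a _ y w).2.2.1,
          pr_pr_ne z _ _ (Ne.symm hx), map_zero]
  constructor
  · simp only [opT_eq_sum, map_add, (h _ _).1]
  · simp only [opT_eq_sum, map_add, (h _ _).2]

section
variable {z : k} {N l a : ℕ} {μ : ℕ → ℕ} {v : Vec z}

theorem pr_opT (x : Arrow) (a p : ℕ) (v : Vec z) :
    pr z x p (opT z a v) = opT z a (pr z x (sw a p) v) := by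
  rcases lt_trichotomy p a with h | rfl | h
  · rw [sw_of_lt h]
    exact (far (pr z x) (opT z) p a a v).symm
  · rw [sw_left]
    exact (tok_opT_left x p v).1
  · rcases (show p = a + 1 ∨ a + 2 ≤ p by omega) with rfl | h
    · rw [sw_right]
      exact (tok_opT_left x a v).2
    · rw [sw_of_gt (by omega)]
      exact far (opT z) (pr z x) a p p v

theorem low_tok_opT (s : Bool) (a p : ℕ) (hv : v ∈ Low z l) :
    tok z s p (opT z a v) - opT z a (tok z s (sw a p) v) ∈ Low z l := by
  rcases lt_trichotomy p a with h | rfl | h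
  · rw [sw_of_lt h, far (tok z s) (opT z) p a a v, sub_self]
    exact zero_mem _
  · rw [sw_left, ← neg_sub]
    exact neg_mem (low_opT_tok' s p hv)
  · rcases (show p = a + 1 ∨ a + 2 ≤ p by omega) with rfl | h
    · rw [sw_right, ← neg_sub]
      exact neg_mem (low_opT_tok s a hv)
    · rw [sw_of_gt (by omega), far (opT z) (tok z s) a p p v, sub_self]
      exact zero_mem _

theorem pr_opu_sk (x : Arrow) (a q : ℕ) (v : Vec z) :
    pr z x (sk a q) (opu z a v) = opu z a (pr z x q v) := by
  rcases lt_or_ge q a with h | h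
  · rw [sk_of_lt h]
    exact (far (pr z x) (opu z) q a a v).symm
  · rw [sk_of_ge h]
    exact far (opu z) (pr z x) a q (q + 2) v

theorem tok_opu_sk (s : Bool) (a q : ℕ) (v : Vec z) :
    tok z s (sk a q) (opu z a v) = opu z a (tok z s q v) := by
  rcases lt_or_ge q a with h | h
  · rw [sk_of_lt h]
    exact (far (tok z s) (opu z) q a a v).symm
  · rw [sk_of_ge h]
    exact far (opu z) (tok z s) a q (q + 2) v

theorem Arrow.dual_dual (x : Arrow) : x.dual.dual = x := by cases x <;> rfl
theorem Arrow.dual_ne (x : Arrow) : x.dual ≠ x := by cases x <;> simp [Arrow.dual]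

theorem pr_opu (x : Arrow) (a : ℕ) (v : Vec z) :
    pr z x a (opu z a v) = pr z x.dual (a + 1) (opu z a v) := by
  have h : ∀ y, pr z y (a + 1) (opu z a v) = pr z y (a + 1) (opQ z a v + opQ' z a v) := fun _ => rfl
  cases x
  · rw [pr_up_opu]
    simp only [Arrow.dual, h, map_add]
    rw [(opQ_pr z a v).2, ← (opQ'_pr z a v).2, pr_pr_ne z _ _ (by simp), add_zero]
  · rw [pr_down_opu]
    simp only [Arrow.dual, h, map_add]
    rw [(opQ'_pr z a v).2, ← (opQ_pr z a v).2, pr_pr_ne z _ _ (by simp), zero_add]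

/-- Tokens slide along the strings of a matching, up to diagrams with less than `l` crossings. -/
structure Slides (l N : ℕ) (μ : ℕ → ℕ) (v : Vec z) : Prop where
  tok : ∀ s, ∀ p < N, tok z s p v - QuantumIsomeric.tok z s (μ p) v ∈ Low z l
  pr : ∀ x, ∀ p < N, pr z x p v = QuantumIsomeric.pr z x.dual (μ p) v

theorem Slides.cup (h : Slides l N μ v) (ha : a ≤ N) :
    Slides l (N + 2) (cupMate a μ) (opu z a v) where
  tok := by
    intro s p hp
    rcases eq_or_sk a p with rfl | rfl | ⟨q, rfl⟩
    · rw [cupMate_left, tok_opu, sub_self]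
      exact zero_mem _
    · rw [cupMate_right, tok_opu, sub_self]
      exact zero_mem _
    · rw [cupMate_sk, tok_opu_sk, tok_opu_sk, ← map_sub]
      exact low_opu a (h.tok s q ((sk_lt_iff ha).1 hp))
  pr := by
    intro x p hp
    rcases eq_or_sk a p with rfl | rfl | ⟨q, rfl⟩
    · rw [cupMate_left, pr_opu]
    · rw [cupMate_right, pr_opu, Arrow.dual_dual]
    · rw [cupMate_sk, pr_opu_sk, pr_opu_sk, h.pr x q ((sk_lt_iff ha).1 hp)]

theorem Slides.sw (h : Slides l N μ v) (hv : v ∈ Low z (l + 1)) (ha : a + 2 ≤ N) :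
    Slides (l + 1) N (swMate a μ) (opT z a v) where
  tok := by
    intro s p hp
    have h1 := low_tok_opT s a p hv
    have h2 := low_tok_opT s a (swMate a μ p) hv
    have h3 := low_opT a (h.tok s (QuantumIsomeric.sw a p) ((sw_lt_iff ha).2 hp))
    have h4 := add_mem (sub_mem h1 h2) h3
    rw [map_sub, swMate, Function.comp_apply, sw_sw, Function.comp_apply] at h4
    convert h4 using 1
    simp only [swMate, Function.comp_apply]
    abel
  pr := by
    intro x p hp
    rw [pr_opT, pr_opT, h.pr x _ ((sw_lt_iff ha).2 hp), swMate, Function.comp_apply, sw_sw,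
      Function.comp_apply]

theorem Slides.chord (h : Slides l N μ v) (hv : v ∈ Low z (l + 1)) {i m : ℕ} (hi : i + m ≤ N) :
    Slides (m + l) (N + 2) (chordMate i m μ) (chord z i m v) ∧
      QuantumIsomeric.chord z i m v ∈ Low z (m + l + 1) := by
  induction m with
  | zero => exact ⟨(Nat.zero_add l).symm ▸ h.cup hi, (Nat.zero_add l).symm ▸ low_opu i hv⟩
  | succ m ih =>
    obtain ⟨h1, h2⟩ := ih (by omega)
    rw [show m + 1 + l = m + l + 1 by omega]
    have h3 := h1.sw h2 (a := i + 1 + m) (by omega)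
    have h4 := low_opT (i + 1 + m) h2
    exact ⟨h3, h4⟩

theorem Code.InRange.slides (z : k) : {ν : Code} → ν.InRange →
    Slides ν.cross (2 * ν.length) ν.mate (nf z ν)
  | [], _ => ⟨fun _ p hp => absurd hp (by simp), fun _ p hp => absurd hp (by simp)⟩
  | (i, m) :: ν, ⟨h1, h2⟩ => by
    have h := (Slides.chord (Code.InRange.slides z h2) (nf_mem (z := z) ν) h1).1
    exact h

/-- Diagrams vanish on words that are not compatible with their matching. -/
theorem nf_apply_eq_zero {ν : Code} (hν : ν.InRange) {W : Word} {p : ℕ} {x y : Arrow}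
    (hx : W[p]? = some x) (hy : W[ν.mate p]? = some y) (hxy : y ≠ x.dual) : nf z ν W = 0 := by
  by_cases hW : W.length = 2 * ν.length
  · have hp : p < 2 * ν.length := hW ▸ (List.getElem?_eq_some_iff.1 hx).1
    rw [← pr_apply_of_get (nf z ν) hx, (hν.slides z).pr x p hp, pr_apply_of_ne]
    rw [hy]
    simpa using hxy
  · exact nf_isLen ν W hW

end

/-! ### Valid codes are determined by their matchings -/

/-- The position of a point after inserting a chord. -/
def emb (i m q : ℕ) : ℕ := if q < i then q else if q < i + m then q + 1 else q + 2

section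
variable {i m : ℕ} {μ : ℕ → ℕ}

theorem emb_zero : emb i 0 = sk i := by
  funext q; simp only [emb, sk]; split_ifs <;> omega
theorem emb_succ : emb i (m + 1) = sw (i + 1 + m) ∘ emb i m := by
  funext q; simp only [emb, sw, Function.comp]; split_ifs <;> omega

theorem chordMate_spec (i m : ℕ) (μ : ℕ → ℕ) : chordMate i m μ i = i + 1 + m ∧
    chordMate i m μ (i + 1 + m) = i ∧ ∀ q, chordMate i m μ (emb i m q) = emb i m (μ q) := by
  induction m with
  | zero => exact ⟨cupMate_left, cupMate_right, fun q => by rw [emb_zero]; exact cupMate_sk q⟩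
  | succ m ih =>
    obtain ⟨h1, h2, h3⟩ := ih
    simp only [chordMate, swMate, Function.comp_apply]
    refine ⟨?_, ?_, fun q => ?_⟩
    · rw [sw_of_lt (p := i) (by omega), h1, sw_left]
      rfl
    · rw [show i + 1 + (m + 1) = i + 1 + m + 1 by omega, sw_right, h2, sw_of_lt (p := i) (by omega)]
    · rw [emb_succ, Function.comp_apply, sw_sw, h3, Function.comp_apply]

theorem eq_or_emb (i m p : ℕ) : p = i ∨ p = i + 1 + m ∨ ∃ q, p = emb i m q := by
  by_cases h1 : p < i
  · exact Or.inr (Or.inr ⟨p, by unfold emb; split_ifs; rfl⟩)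
  by_cases h2 : p = i
  · exact Or.inl h2
  by_cases h3 : p < i + 1 + m
  · exact Or.inr (Or.inr ⟨p - 1, by unfold emb; split_ifs <;> omega⟩)
  by_cases h4 : p = i + 1 + m
  · exact Or.inr (Or.inl h4)
  · exact Or.inr (Or.inr ⟨p - 2, by unfold emb; split_ifs <;> omega⟩)

theorem emb_lt_iff {p q : ℕ} : emb i m p < emb i m q ↔ p < q := by
  unfold emb; split_ifs <;> omega

theorem emb_injective (i m : ℕ) : Function.Injective (emb i m) := by
  intro p q h
  unfold emb at h; split_ifs at h <;> omega

/-- A point with `ν.mate p < p` is the right end of a chord, and the first chord has the leftmost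
one. -/
theorem Code.Valid.le_of_mate_lt : {b p : ℕ} → {ν : Code} → ν.Valid b → ν.mate p < p → b ≤ p
  | _, _, [], _, h => absurd h (lt_irrefl _)
  | b, p, (i, m) :: ν, ⟨hb, hν⟩, h => by
    obtain ⟨h1, h2, h3⟩ := chordMate_spec i m (Code.mate ν)
    change chordMate i m (Code.mate ν) p < p at h
    rcases eq_or_emb i m p with rfl | rfl | ⟨q, rfl⟩
    · omega
    · exact hb
    · rw [h3, emb_lt_iff] at h
      have := Code.Valid.le_of_mate_lt hν h
      unfold emb
      split_ifs <;> omega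

theorem Code.Valid.right_le {b i m p : ℕ} {ν : Code} (h : Code.Valid b ((i, m) :: ν))
    (hp : Code.mate ((i, m) :: ν) p < p) : i + 1 + m ≤ p :=
  Code.Valid.le_of_mate_lt (ν := (i, m) :: ν) ⟨le_rfl, h.2⟩ hp

/-- The matching determines the chord with the leftmost right end, which is the head of the code;
removing it leaves the matching of the tail. -/
theorem Code.eq_of_mate_eq : {b : ℕ} → {ν ν' : Code} → ν.Valid b → ν'.Valid b → ν.InRange →
    ν'.InRange → ν.length = ν'.length → (∀ p < 2 * ν.length, ν.mate p = ν'.mate p) → ν = ν'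
  | _, [], [], _, _, _, _, _, _ => rfl
  | b, (i, m) :: ν, (i', m') :: ν', h, h', hr, hr', hl, hm => by
    obtain ⟨h1, h2, h3⟩ := chordMate_spec i m (Code.mate ν)
    obtain ⟨h1', h2', h3'⟩ := chordMate_spec i' m' (Code.mate ν')
    have hr1 := hr.1
    have hr1' := hr'.1
    simp only [List.length_cons] at hl hm
    have e1 : i' + 1 + m' ≤ i + 1 + m := by
      refine h'.right_le ?_
      rw [← hm _ (by omega)]
      exact h2.trans_lt (by omega)
    have e2 : i + 1 + m ≤ i' + 1 + m' := by
      refine h.right_le ?_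
      rw [hm _ (by omega)]
      exact h2'.trans_lt (by omega)
    have e3 : i = i' := by
      rw [← h2, ← h2', ← e2.antisymm e1]
      exact hm _ (by omega)
    obtain rfl := e3
    obtain rfl : m = m' := by omega
    have e4 : ν = ν' := by
      refine Code.eq_of_mate_eq (h.2) (h'.2) hr.2 hr'.2 (by omega) fun p hp => ?_
      have := hm (emb i m p) (by unfold emb; split_ifs <;> omega)
      exact emb_injective i m ((h3 p).symm.trans (this.trans (h3' p)))
    rw [e4]

end

/-! ## Algebras of tokens -/

section
variable {z : k}

/-- The algebra generated by tokens and projections at positions in a given set. -/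
def tokAlg (z : k) (P : Set ℕ) : Subalgebra k (Module.End k (Vec z)) :=
  Algebra.adjoin k ({F | ∃ s, ∃ p ∈ P, F = tok z s p} ∪ {F | ∃ x, ∃ p ∈ P, F = pr z x p})

variable {P Q : Set ℕ}

theorem tok_mem_tokAlg (s : Bool) {p : ℕ} (hp : p ∈ P) : tok z s p ∈ tokAlg z P :=
  Algebra.subset_adjoin (Or.inl ⟨s, p, hp, rfl⟩)
theorem pr_mem_tokAlg (x : Arrow) {p : ℕ} (hp : p ∈ P) : pr z x p ∈ tokAlg z P :=
  Algebra.subset_adjoin (Or.inr ⟨x, p, hp, rfl⟩)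

theorem tokAlg_mono (h : P ⊆ Q) : tokAlg z P ≤ tokAlg z Q := by
  refine Algebra.adjoin_le ?_
  rintro F (⟨s, p, hp, rfl⟩ | ⟨x, p, hp, rfl⟩)
  · exact tok_mem_tokAlg s (h hp)
  · exact pr_mem_tokAlg x (h hp)

theorem low_tokAlg {n : ℕ} {F : Module.End k (Vec z)} (hF : F ∈ tokAlg z P) :
    ∀ {v : Vec z}, v ∈ Low z n → F v ∈ Low z n := by
  induction hF using Algebra.adjoin_induction with
  | mem F hF =>
    intro v hv
    rcases hF with ⟨s, p, -, rfl⟩ | ⟨x, p, -, rfl⟩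
    · exact low_tok s p hv
    · exact low_pr x p hv
  | algebraMap r =>
    intro v hv
    rw [Module.algebraMap_end_apply]
    exact low_smul r hv
  | add F G _ _ hF hG => exact fun hv => add_mem (hF hv) (hG hv)
  | mul F G _ _ hF hG => exact fun hv => hF (hG hv)

/-- Operators that can be moved past an operator `g`. -/
theorem exists_tokAlg_comp {g g' : Module.End k (Vec z)} {A : Subalgebra k (Module.End k (Vec z))}
    (h1 : ∀ s, ∀ p ∈ P, ∃ F' ∈ A, g * tok z s p = F' * g')
    (h2 : ∀ x, ∀ p ∈ P, ∃ F' ∈ A, g * pr z x p = F' * g') (hg : g = g')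
    {F : Module.End k (Vec z)} (hF : F ∈ tokAlg z P) : ∃ F' ∈ A, g * F = F' * g := by
  subst hg
  induction hF using Algebra.adjoin_induction with
  | mem F hF =>
    rcases hF with ⟨s, p, hp, rfl⟩ | ⟨x, p, hp, rfl⟩
    · exact h1 s p hp
    · exact h2 x p hp
  | algebraMap r => exact ⟨_, A.algebraMap_mem r, (Algebra.commutes r g).symm⟩
  | add F G _ _ hF hG =>
    obtain ⟨F', hF', e⟩ := hF
    obtain ⟨G', hG', e'⟩ := hG
    exact ⟨_, add_mem hF' hG', by rw [mul_add, add_mul, e, e']⟩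
  | mul F G _ _ hF hG =>
    obtain ⟨F', hF', e⟩ := hF
    obtain ⟨G', hG', e'⟩ := hG
    exact ⟨_, mul_mem hF' hG', by rw [← mul_assoc, e, mul_assoc, e', mul_assoc]⟩

theorem tok_comm_odd (s s' : Bool) {a b : ℕ} (h : a ≠ b) :
    tok z s a * tok z s' b = -(tok z s' b * tok z s a) := by
  refine LinearMap.ext fun v => ?_
  rcases lt_or_gt_of_ne h with h | h
  · rw [Module.End.mul_apply, LinearMap.neg_apply, Module.End.mul_apply,
      far_odd (tok z s) (tok z s') a b b v, neg_neg]
  · exact far_odd (tok z s') (tok z s) b a a v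

theorem tok_pr_comm (s : Bool) (x : Arrow) (a b : ℕ) :
    tok z s a * pr z x b = pr z x b * tok z s a := by
  refine LinearMap.ext fun v => ?_
  rcases lt_trichotomy a b with h | rfl | h
  · exact (far (tok z s) (pr z x) a b b v).symm
  · rw [Module.End.mul_apply, Module.End.mul_apply, tok_pr, pr_tok]
  · exact far (pr z x) (tok z s) b a a v

theorem pr_comm_mul (x y : Arrow) (a b : ℕ) : pr z x a * pr z y b = pr z y b * pr z x a := by
  refine LinearMap.ext fun v => ?_
  exact pr_comm x y a b v

/-- A token at `b` can be moved past operators at other positions. -/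
theorem exists_tok_comm (s : Bool) {b : ℕ} (hb : b ∉ P) {F : Module.End k (Vec z)}
    (hF : F ∈ tokAlg z P) : ∃ F' ∈ tokAlg z P, tok z s b * F = F' * tok z s b := by
  refine exists_tokAlg_comp (fun s' p hp => ?_) (fun x p hp => ?_) rfl hF
  · refine ⟨_, neg_mem (tok_mem_tokAlg s' hp), ?_⟩
    rw [tok_comm_odd s s' (by rintro rfl; exact hb hp)]
    exact LinearMap.ext fun v => rfl
  · exact ⟨_, pr_mem_tokAlg x hp, tok_pr_comm s x b p⟩

theorem pr_comm_tokAlg (x : Arrow) (b : ℕ) {F : Module.End k (Vec z)} (hF : F ∈ tokAlg z P) :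
    ∃ F' ∈ tokAlg z P, pr z x b * F = F' * pr z x b := by
  refine exists_tokAlg_comp (fun s' p hp => ?_) (fun y p hp => ?_) rfl hF
  · exact ⟨_, tok_mem_tokAlg s' hp, (tok_pr_comm s' x p b).symm⟩
  · exact ⟨_, pr_mem_tokAlg y hp, pr_comm_mul x y b p⟩

theorem exists_opu_comm (a : ℕ) {F : Module.End k (Vec z)} (hF : F ∈ tokAlg z P) :
    ∃ F' ∈ tokAlg z Set.univ, opu z a * F = F' * opu z a := by
  refine exists_tokAlg_comp (fun s p hp => ?_) (fun x p hp => ?_) rfl hF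
  · exact ⟨_, tok_mem_tokAlg s (Set.mem_univ (sk a p)),
      LinearMap.ext fun v => (tok_opu_sk s a p v).symm⟩
  · exact ⟨_, pr_mem_tokAlg x (Set.mem_univ (sk a p)),
      LinearMap.ext fun v => (pr_opu_sk x a p v).symm⟩

theorem opn_tok_sk (s : Bool) (a q : ℕ) (v : Vec z) :
    opn z a (tok z s (sk a q) v) = tok z s q (opn z a v) := by
  rcases lt_or_ge q a with h | h
  · rw [sk_of_lt h]
    exact far (tok z s) (opn z) q a a v
  · rw [sk_of_ge h]
    exact (far (opn z) (tok z s) a (q + 2) q v).symm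

theorem opn_pr_sk (x : Arrow) (a q : ℕ) (v : Vec z) :
    opn z a (pr z x (sk a q) v) = pr z x q (opn z a v) := by
  rcases lt_or_ge q a with h | h
  · rw [sk_of_lt h]
    exact far (pr z x) (opn z) q a a v
  · rw [sk_of_ge h]
    exact (far (opn z) (pr z x) a (q + 2) q v).symm

theorem exists_opn_comm (a : ℕ) {F : Module.End k (Vec z)} (hF : F ∈ tokAlg z {a, a + 1}ᶜ) :
    ∃ F' ∈ tokAlg z Set.univ, opn z a * F = F' * opn z a := by
  have h : ∀ p ∈ ({a, a + 1}ᶜ : Set ℕ), ∃ q, p = sk a q := fun p hp => by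
    simp only [Set.mem_compl_iff, Set.mem_insert_iff, Set.mem_singleton_iff, not_or] at hp
    rcases eq_or_sk a p with h | h | h
    · exact absurd h hp.1
    · exact absurd h hp.2
    · exact h
  refine exists_tokAlg_comp (fun s p hp => ?_) (fun x p hp => ?_) rfl hF
  · obtain ⟨q, rfl⟩ := h p hp
    exact ⟨_, tok_mem_tokAlg s (Set.mem_univ q), LinearMap.ext fun v => opn_tok_sk s a q v⟩
  · obtain ⟨q, rfl⟩ := h p hp
    exact ⟨_, pr_mem_tokAlg x (Set.mem_univ q), LinearMap.ext fun v => opn_pr_sk x a q v⟩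

/-- The operator `F'` is `F` with its positions exchanged by `sw a`. It does not depend on the
vector, but the equality holds only modulo lower terms because tokens slide only so. -/
theorem exists_opT_comm (a : ℕ) {F : Module.End k (Vec z)} (hF : F ∈ tokAlg z Set.univ) :
    ∃ F' ∈ tokAlg z Set.univ, ∀ n v, v ∈ Low z n →
      opT z a (F v) - F' (opT z a v) ∈ Low z n := by
  induction hF using Algebra.adjoin_induction with
  | mem F hF =>
    rcases hF with ⟨s, p, -, rfl⟩ | ⟨x, p, -, rfl⟩
    · refine ⟨_, tok_mem_tokAlg s (Set.mem_univ (sw a p)), fun n v hv => ?_⟩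
      have := low_tok_opT s a (sw a p) hv
      rw [sw_sw] at this
      rw [← neg_sub]
      exact neg_mem this
    · refine ⟨_, pr_mem_tokAlg x (Set.mem_univ (sw a p)), fun n v hv => ?_⟩
      rw [pr_opT, sw_sw, sub_self]
      exact zero_mem _
  | algebraMap r =>
    refine ⟨_, Subalgebra.algebraMap_mem _ r, fun n v hv => ?_⟩
    simp only [Module.algebraMap_end_apply, map_smul, sub_self, zero_mem]
  | add F G _ _ hF hG =>
    obtain ⟨F', hF', e⟩ := hF
    obtain ⟨G', hG', e'⟩ := hG
    refine ⟨_, add_mem hF' hG', fun n v hv => ?_⟩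
    have := add_mem (e n v hv) (e' n v hv)
    simp only [LinearMap.add_apply, map_add]
    convert this using 1
    abel
  | mul F G _ hG0 hF hG =>
    obtain ⟨F', hF', e⟩ := hF
    obtain ⟨G', hG', e'⟩ := hG
    refine ⟨_, mul_mem hF' hG', fun n v hv => ?_⟩
    have := add_mem (e n _ (low_tokAlg hG0 hv)) (low_tokAlg hF' (e' n v hv))
    rw [map_sub] at this
    convert this using 1
    simp only [Module.End.mul_apply]
    abel

/-- Operators on the complement of `P` can be moved to the left of operators on `P`. -/
theorem tokAlg_apply_induction {P : Set ℕ} (M : Submodule k (Vec z)) (v : Vec z)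
    (h : ∀ F ∈ tokAlg z Pᶜ, ∀ G ∈ tokAlg z P, F (G v) ∈ M) {F : Module.End k (Vec z)}
    (hF : F ∈ tokAlg z Set.univ) : F v ∈ M := by
  let S : Submodule k (Vec z) :=
    Submodule.span k {w | ∃ F ∈ tokAlg z Pᶜ, ∃ G ∈ tokAlg z P, w = F (G v)}
  have hS : S ≤ M := Submodule.span_le.2 fun w ⟨F, hF, G, hG, hw⟩ => hw ▸ h F hF G hG
  refine hS ?_
  -- The span `S` of all `F (G v)` is stable under every generator: a generator on `P` passes `F`,
  -- possibly with a sign, and joins `G`; the others join `F`.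
  suffices H : ∀ w ∈ S, F w ∈ S from
    H v (Submodule.subset_span ⟨1, one_mem _, 1, one_mem _, rfl⟩)
  induction hF using Algebra.adjoin_induction with
  | mem g hg =>
    intro w hw
    have : S ≤ S.comap g := by
      refine Submodule.span_le.2 ?_
      rintro w ⟨F, hF, G, hG, rfl⟩
      refine Submodule.subset_span ?_
      rcases hg with ⟨s, p, -, rfl⟩ | ⟨x, p, -, rfl⟩
      · by_cases hp : p ∈ P
        · obtain ⟨F', hF', e⟩ := exists_tok_comm s (P := Pᶜ) (fun h => h hp) hF
          exact ⟨F', hF', _, mul_mem (tok_mem_tokAlg s hp) hG, LinearMap.congr_fun e (G v)⟩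
        · exact ⟨_, mul_mem (tok_mem_tokAlg s hp) hF, G, hG, rfl⟩
      · by_cases hp : p ∈ P
        · obtain ⟨F', hF', e⟩ := pr_comm_tokAlg x p hF
          exact ⟨F', hF', _, mul_mem (pr_mem_tokAlg x hp) hG, LinearMap.congr_fun e (G v)⟩
        · exact ⟨_, mul_mem (pr_mem_tokAlg x hp) hF, G, hG, rfl⟩
    exact this hw
  | algebraMap r => exact fun w hw => S.smul_mem r hw
  | add F G _ _ hF hG => exact fun w hw => add_mem (hF w hw) (hG w hw)
  | mul F G _ _ hF hG => exact fun w hw => hF _ (hG w hw)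

/-- Tokens can be moved from `P` to `Q` along the strings of a matching. -/
theorem tokAlg_transfer {l : ℕ} {μ : ℕ → ℕ} {v : Vec z} {P Q : Set ℕ}
    (htok : ∀ s, ∀ p ∈ P, tok z s p v - tok z s (μ p) v ∈ Low z l)
    (hpr : ∀ x, ∀ p ∈ P, pr z x p v = pr z x.dual (μ p) v)
    (hμ : ∀ p ∈ P, p ∉ Q ∧ μ p ∈ Q) {G : Module.End k (Vec z)} (hG : G ∈ tokAlg z P) :
    ∃ F ∈ tokAlg z Q, G v - F v ∈ Low z l := by
  -- The operator `F` stands for what has already been moved to `Q`. The next generator on `P` first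
  -- passes it, at the cost of replacing `F`, and then slides along its string.
  suffices H : ∀ F ∈ tokAlg z Q, ∃ F' ∈ tokAlg z Q, G (F v) - F' v ∈ Low z l from
    H 1 (one_mem _)
  induction hG using Algebra.adjoin_induction with
  | mem g hg =>
    intro F hF
    rcases hg with ⟨s, p, hp, rfl⟩ | ⟨x, p, hp, rfl⟩
    · obtain ⟨F', hF', e⟩ := exists_tok_comm s (hμ p hp).1 hF
      refine ⟨F' * tok z s (μ p), mul_mem hF' (tok_mem_tokAlg s (hμ p hp).2), ?_⟩
      rw [show tok z s p (F v) = F' (tok z s p v) from LinearMap.congr_fun e v,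
        Module.End.mul_apply, ← map_sub]
      exact low_tokAlg hF' (htok s p hp)
    · obtain ⟨F', hF', e⟩ := pr_comm_tokAlg x p hF
      refine ⟨F' * pr z x.dual (μ p), mul_mem hF' (pr_mem_tokAlg _ (hμ p hp).2), ?_⟩
      rw [show pr z x p (F v) = F' (pr z x p v) from LinearMap.congr_fun e v,
        Module.End.mul_apply, hpr x p hp, sub_self]
      exact zero_mem _
  | algebraMap r =>
    exact fun F hF => ⟨r • F, Subalgebra.smul_mem _ hF r, by
      rw [Module.algebraMap_end_apply, LinearMap.smul_apply, sub_self]; exact zero_mem _⟩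
  | add G G' _ _ h1 h2 =>
    intro F hF
    obtain ⟨F1, hF1, e1⟩ := h1 F hF
    obtain ⟨F2, hF2, e2⟩ := h2 F hF
    refine ⟨_, add_mem hF1 hF2, ?_⟩
    have := add_mem e1 e2
    rwa [sub_add_sub_comm] at this
  | mul G G' hG0 _ h1 h2 =>
    intro F hF
    obtain ⟨F2, hF2, e2⟩ := h2 F hF
    obtain ⟨F1, hF1, e1⟩ := h1 F2 hF2
    refine ⟨F1, hF1, ?_⟩
    have := add_mem (low_tokAlg hG0 e2) e1
    rwa [map_sub, sub_add_sub_cancel] at this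

theorem low_zero : Low z 0 = ⊥ := by
  have : {v : Vec z | ∃ m < 0, Mon z m v} = ∅ :=
    Set.eq_empty_iff_forall_notMem.2 fun v ⟨m, hm, _⟩ => absurd hm (Nat.not_lt_zero m)
  rw [Low, this, Submodule.span_empty]

/-- Tokens move from one leg of a cup to the other. -/
theorem tokAlg_opu_left (a : ℕ) (v : Vec z) {G : Module.End k (Vec z)} (hG : G ∈ tokAlg z {a}) :
    ∃ F ∈ tokAlg z {a + 1}, G (opu z a v) = F (opu z a v) := by
  obtain ⟨F, hF, h⟩ := tokAlg_transfer (l := 0) (μ := fun p => p + 1) (v := opu z a v)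
    (P := {a}) (Q := {a + 1}) (by rintro s _ rfl; rw [tok_opu, sub_self]; exact zero_mem _)
    (by rintro x _ rfl; exact pr_opu x _ v) (by rintro _ rfl; simp) hG
  rw [low_zero, Submodule.mem_bot, sub_eq_zero] at h
  exact ⟨F, hF, h⟩

end

/-! ## Bubbles -/

section
variable (z : k)

/-- A list of tokens on an upward strand; the first one is on top. -/
def tokWord : List Bool → Diag [up] [up]
  | [] => .idUp
  | s :: Z => .comp (tokDiag s) (tokWord Z)

/-- A list of tokens on an upward strand; the first one is on top. -/
def opW : List Bool → ℕ → Module.End k (Vec z)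
  | [], a => pr z up a
  | s :: Z, a => opU z s a * opW Z a

instance (Z : List Bool) : IsLocal (opW z Z) 1 1 Z.length := by
  induction Z with
  | nil => exact inferInstanceAs (IsLocal (pr z up) 1 1 0)
  | cons s Z ih => exact IsLocal.comp (F := opW z Z) (G := opU z s) ih inferInstance

/-- The clockwise bubble with a list of tokens. -/
def bubR (Z : List Bool) : End (unit z) :=
  mor z (.comp .rightCap (.comp (.tensor (tokWord Z) .idDown) .leftCup))
/-- The counterclockwise bubble with a list of tokens. -/
def bubL (Z : List Bool) : End (unit z) :=
  mor z (.comp .leftCap (.comp (.tensor .idDown (tokWord Z)) .rightCup))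

variable (a : ℕ) (v : Vec z)

theorem op_tokWord (Z : List Bool) : op a (mor z (tokWord Z)) = opW z Z a := by
  refine LinearMap.ext fun v => ?_
  induction Z with
  | nil => rfl
  | cons s Z ih => rw [tokWord, op_mor_comp, ih]; rfl

theorem op_bubR (Z : List Bool) : op a (bubR z Z) v = opE' z a (opW z Z a (opQ z a v)) := by
  have h : op a (bubR z Z) v =
      opE' z a (op a (mor z (tokWord Z)) (pr z down (a + 1) (opQ z a v))) := by
    rw [bubR, op_mor_comp, op_mor_comp, op_mor_tensor]; rfl
  rw [h, op_tokWord, (opQ_pr z a v).2]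
theorem op_bubL (Z : List Bool) : op a (bubL z Z) v = opE z a (opW z Z (a + 1) (opQ' z a v)) := by
  have h : op a (bubL z Z) v =
      opE z a (pr z down a (op (a + 1) (mor z (tokWord Z)) (opQ' z a v))) := by
    rw [bubL, op_mor_comp, op_mor_comp, op_mor_tensor]; rfl
  rw [h, op_tokWord, (opE_pr z a _).1]

theorem opW_cons (s : Bool) (Z : List Bool) : opW z (s :: Z) a v = opU z s a (opW z Z a v) := rfl

theorem pr_opW (Z : List Bool) : pr z up a (opW z Z a v) = opW z Z a v := by
  cases Z with
  | nil => exact pr_pr z a v up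
  | cons s Z => exact (opU_pr z a _ s).1
theorem opW_pr (Z : List Bool) : opW z Z a (pr z up a v) = opW z Z a v := by
  induction Z with
  | nil => exact pr_pr z a v up
  | cons s Z ih => rw [opW_cons, ih, opW_cons]
theorem opW_append (Z Z' : List Bool) : opW z (Z ++ Z') a v = opW z Z a (opW z Z' a v) := by
  induction Z with
  | nil => exact (pr_opW z a v Z').symm
  | cons s Z ih => rw [List.cons_append, opW_cons, ih, opW_cons]
theorem opW_concat (Z : List Bool) (s : Bool) :
    opW z (Z ++ [s]) a v = opW z Z a (opU z s a v) := by
  rw [opW_append, opW_cons]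
  exact congrArg _ (opU_pr z a v s).2

theorem opW_single (s : Bool) : opW z [s] a v = opU z s a v := (opU_pr z a v s).2
theorem opW_pair (s : Bool) : opW z [s, s] a v = -pr z up a v := by
  rw [opW_cons, opW_single, opU_opU]

/-- The clockwise bubble depends on its tokens only up to cyclic permutation and sign. -/
theorem bubR_cyclic (s : Bool) (Z : List Bool) : opE' z a (opW z (s :: Z) a (opQ z a v)) =
    ((-1 : k) ^ Z.length) • opE' z a (opW z (Z ++ [s]) a (opQ z a v)) := by
  have h := LinearMap.congr_fun (IsLocal.swap (F := opW z Z) (G := opN z s) inferInstance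
    inferInstance (a := a) (b := a + 1) (b' := a + 1) le_rfl rfl) (opQ z a v)
  rw [mul_one, LinearMap.smul_apply] at h
  rw [opW_cons, opE'_opU, ← Module.End.mul_apply (opN z s (a + 1)), h, map_smul, opW_concat,
    opU_opQ]
  rfl

theorem bubL_cyclic (s : Bool) (Z : List Bool) : opE z a (opW z (s :: Z) (a + 1) (opQ' z a v)) =
    ((-1 : k) ^ Z.length) • opE z a (opW z (Z ++ [s]) (a + 1) (opQ' z a v)) := by
  have h := LinearMap.congr_fun (IsLocal.swap (F := opN z s) (G := opW z Z) inferInstance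
    inferInstance (a := a) (b := a + 1) (b' := a + 1) le_rfl rfl) (opQ' z a v)
  rw [one_mul, LinearMap.smul_apply, Module.End.mul_apply, Module.End.mul_apply] at h
  rw [opW_cons, ← opE_opN, opW_concat, opU_opQ', h, map_smul, smul_smul, ← mul_pow,
    neg_one_mul, neg_neg, one_pow, one_smul]

/-- `n` alternating tokens, the top one of which is `s`. -/
def alt : Bool → ℕ → List Bool
  | _, 0 => []
  | s, n + 1 => s :: alt (!s) n

theorem alt_length (s : Bool) (n : ℕ) : (alt s n).length = n := by
  induction n generalizing s with
  | zero => rfl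
  | succ n ih => exact congrArg (· + 1) (ih _)

/-- Every list of tokens is, up to sign, an alternating list. -/
theorem exists_opW_alt (Z : List Bool) : ∃ s n, n ≤ Z.length ∧ n % 2 = Z.length % 2 ∧
    ((∀ a (v : Vec z), opW z Z a v = opW z (alt s n) a v) ∨
      ∀ a (v : Vec z), opW z Z a v = -opW z (alt s n) a v) := by
  induction Z with
  | nil => exact ⟨true, 0, le_rfl, rfl, Or.inl fun _ _ => rfl⟩
  | cons t Z ih =>
    obtain ⟨s, n, h1, h2, h3⟩ := ih
    rw [List.length_cons]
    cases n with
    | zero =>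
      refine ⟨t, 1, by omega, by omega, ?_⟩
      rcases h3 with h3 | h3
      · exact Or.inl fun a v => by rw [opW_cons, h3]; rfl
      · exact Or.inr fun a v => by rw [opW_cons, h3, map_neg]; rfl
    | succ n =>
      by_cases hs : t = s
      · subst hs
        have h4 : ∀ a v, opU z t a (opW z (alt t (n + 1)) a v) = -opW z (alt (!t) n) a v := by
          intro a v
          rw [alt, opW_cons, opU_opU, pr_opW]
        refine ⟨!t, n, by omega, by omega, ?_⟩
        rcases h3 with h3 | h3
        · exact Or.inr fun a v => by rw [opW_cons, h3, h4]
        · exact Or.inl fun a v => by rw [opW_cons, h3, map_neg, h4, neg_neg]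
      · obtain rfl : s = !t := by cases s <;> cases t <;> simp_all
        refine ⟨t, n + 2, by omega, by omega, ?_⟩
        rcases h3 with h3 | h3
        · exact Or.inl fun a v => by rw [opW_cons, h3]; rfl
        · exact Or.inr fun a v => by rw [opW_cons, h3, map_neg]; rfl

theorem alt_append (s : Bool) (n : ℕ) : alt s (2 * n) ++ [s] = alt s (2 * n + 1) ∧
    alt s (2 * n + 1) ++ [!s] = alt s (2 * n + 2) := by
  induction n with
  | zero => exact ⟨rfl, rfl⟩
  | succ n ih =>
    have h : ∀ m, alt s (m + 2) = s :: (!s) :: alt s m := fun m => by simp [alt]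
    constructor
    · rw [show 2 * (n + 1) = 2 * n + 2 by omega, h, List.cons_append, List.cons_append, ih.1,
        show 2 * n + 2 + 1 = 2 * n + 1 + 2 by omega, h]
    · rw [show 2 * (n + 1) + 1 = 2 * n + 1 + 2 by omega, h, List.cons_append, List.cons_append,
        ih.2, show 2 * (n + 1) + 2 = 2 * n + 2 + 2 by omega, h (2 * n + 2)]

/-- An alternating list of odd length has the same token at both ends. -/
theorem alt_two_mul_succ (s : Bool) (n : ℕ) :
    alt s (2 * n + 3) = s :: (alt (!s) (2 * n + 1) ++ [s]) := by
  have := (alt_append (!s) n).2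
  rw [Bool.not_not] at this
  rw [this]
  rfl

/-- Bubbles with an odd number of tokens vanish. -/
theorem bub_odd (n : ℕ) : ∀ (Z : List Bool), Z.length ≤ n → Z.length % 2 = 1 →
    ∀ (a : ℕ) (v : Vec z), opE' z a (opW z Z a (opQ z a v)) = 0 ∧
      opE z a (opW z Z (a + 1) (opQ' z a v)) = 0 := by
  induction n with
  | zero => intro Z h h'; omega
  | succ n ih =>
    have key : ∀ s m, m ≤ n + 1 → m % 2 = 1 → ∀ (a : ℕ) (v : Vec z),
        opE' z a (opW z (alt s m) a (opQ z a v)) = 0 ∧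
          opE z a (opW z (alt s m) (a + 1) (opQ' z a v)) = 0 := by
      intro s m hm hm' a v
      obtain ⟨m, rfl⟩ : ∃ m', m = 2 * m' + 1 := ⟨m / 2, by omega⟩
      cases m with
      | zero =>
        rw [show alt s (2 * 0 + 1) = [s] from rfl, opW_single, opW_single, opE'_opU_opQ,
          opE_opU_opQ']
        exact ⟨rfl, rfl⟩
      | succ m =>
        rw [show 2 * (m + 1) + 1 = 2 * m + 3 by omega, alt_two_mul_succ]
        have h := ih (alt (!s) (2 * m + 1)) (by rw [alt_length]; omega)
          (by rw [alt_length]; omega) a v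
        -- Rotation brings the two equal end tokens together; their square is `-1`, so a bubble with
        -- two tokens fewer remains.
        rw [bubR_cyclic, bubL_cyclic, List.append_assoc, List.singleton_append,
          opW_append z a _ _ [s, s], opW_append z (a + 1) _ _ [s, s], opW_pair, opW_pair, (opQ_pr z a v).1, (opQ'_pr z a v).2, map_neg, map_neg, map_neg, map_neg,
          h.1, h.2, neg_zero, smul_zero]
        exact ⟨rfl, rfl⟩
    intro Z hZ hZ' a v
    obtain ⟨s, m, h1, h2, h3⟩ := exists_opW_alt z Z
    have := key s m (by omega) (by omega) a v
    rcases h3 with h3 | h3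
    · rwa [h3, h3]
    · rw [h3, h3, map_neg, map_neg, this.1, this.2, neg_zero]
      exact ⟨rfl, rfl⟩

/-! ### Morphisms are determined by their operators -/

-- The value of `op 0 w` on the vacuum at the empty word is `w` itself, so operator identities can
-- be read back as identities of endomorphisms.
variable {z} in
theorem op_injective {w w' : unit z ⟶ unit z} (h : op 0 w (vac z) = op 0 w' (vac z)) : w = w' := by
  have key : ∀ w : unit z ⟶ unit z, op 0 w (vac z) ([] ++ ([] ++ [])) = w := by
    intro w
    rw [op_apply (a := 0) w (vac z) (A := []) [] rfl, whisker, unit_tens]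
    have := tens_unit z w
    simp only [eqToHom_refl, Category.id_comp, Category.comp_id] at this
    rw [this]
    exact Category.id_comp w
  rw [← key w, h, key w']

theorem bubR_eq_zero {Z : List Bool} (h : Z.length % 2 = 1) : bubR z Z = 0 :=
  op_injective (by rw [op_bubR, (bub_odd z _ Z le_rfl h _ _).1, op_zero]; rfl)
theorem bubL_eq_zero {Z : List Bool} (h : Z.length % 2 = 1) : bubL z Z = 0 :=
  op_injective (by rw [op_bubL, (bub_odd z _ Z le_rfl h _ _).2, op_zero]; rfl)

theorem bubR_nil : bubR z [] = 0 := op_injective (by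
  rw [op_bubR, op_zero]
  change opE' z 0 (pr z up 0 _) = 0
  rw [(opQ_pr z 0 _).1, opE'_opQ])
theorem bubL_nil : bubL z [] = 0 := op_injective (by
  rw [op_bubL, op_zero]
  change opE z 0 (pr z up (0 + 1) _) = 0
  rw [(opQ'_pr z 0 _).2, opE_opQ'_self])

/-- All clockwise bubbles are, up to sign, alternating bubbles. -/
theorem exists_bubR_alt (Z : List Bool) : bubR z Z = 0 ∨ ∃ n, 0 < n ∧
    (bubR z Z = bubR z (alt true (2 * n)) ∨ bubR z Z = -bubR z (alt true (2 * n))) := by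
  by_cases hZ : Z.length % 2 = 1
  · exact Or.inl (bubR_eq_zero z hZ)
  obtain ⟨s, n, -, h2, h3⟩ := exists_opW_alt z Z
  obtain ⟨n, rfl⟩ : ∃ m, n = 2 * m := ⟨n / 2, by omega⟩
  have h3 : bubR z Z = bubR z (alt s (2 * n)) ∨ bubR z Z = -bubR z (alt s (2 * n)) := by
    rcases h3 with h3 | h3
    · exact Or.inl (op_injective (by rw [op_bubR, op_bubR, h3]))
    · refine Or.inr (op_injective ?_)
      rw [op_neg, LinearMap.neg_apply, op_bubR, op_bubR, h3, map_neg]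
  cases n with
  | zero =>
    have : alt s (2 * 0) = [] := rfl
    rw [this, bubR_nil, neg_zero, or_self] at h3
    exact Or.inl h3
  | succ n =>
    refine Or.inr ⟨n + 1, Nat.succ_pos n, ?_⟩
    cases s with
    | true => exact h3
    | false =>
      -- Rotating the top open token to the bottom moves it past an odd number of tokens, which
      -- gives the sign.
      have h4 : bubR z (alt false (2 * (n + 1))) = -bubR z (alt true (2 * (n + 1))) := by
        refine op_injective ?_
        have h5 : alt false (2 * (n + 1)) = false :: alt true (2 * n + 1) := rfl
        rw [op_neg, LinearMap.neg_apply, op_bubR, op_bubR, h5, bubR_cyclic, alt_length,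
          show [false] = [!true] from rfl, (alt_append true n).2, pow_succ, pow_mul, neg_one_sq,
          one_pow, one_mul]
        exact neg_one_smul k _
      rw [h4, neg_neg] at h3
      exact h3.symm

end

/-! ### Bubbles slide through strands -/

section
variable (z : k) (a : ℕ)

/-- A curl on an upward strand, with tokens. -/
def opK (Y : List Bool) (x : Vec z) : Vec z :=
  opE' z (a + 1) (opW z Y (a + 1) (opX z a (opQ z (a + 1) x)))

variable {x : Vec z} (hx : pr z up a x = x)

/-- Closed tokens pass the positive crossing exactly and leave the curl along the strand. -/
theorem opK_closed (Y : List Bool) (x : Vec z) :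
    opK z a (Y ++ [true]) x = opK z a Y (opU z true a x) := by
  rw [opK, opW_concat, ← opX_closed, ← far (opU z true) (opQ z) a (a + 1) (a + 1)]
  rfl

include hx

theorem opK_nil : opK z a [] x = x := by
  have h : opW z [] (a + 1) (opX z a (opQ z (a + 1) x)) = opX z a (opQ z (a + 1) x) :=
    (opX_pr z a _).2.1
  rw [opK, h, ← opL_opQ, opE'_opL, opE_opQ, hx]

theorem pr_cup : pr z up a (opQ z (a + 1) x) = opQ z (a + 1) x := by
  rw [← far (pr z up) (opQ z) a (a + 1) (a + 1), hx]

/-- The open token on this strand passes only the negative crossing. Using the skein relation before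
and after the slide leaves two terms in which the loop has come off as a bubble on the right. -/
theorem opK_open (Y : List Bool) : opK z a (Y ++ [false]) x =
    opK z a Y (opU z false a x) - z • op (a + 1) (bubR z Y) (opU z false a x) +
      z • op (a + 1) (bubR z (Y ++ [false])) x := by
  have h : opU z false (a + 1) (opX z a (opQ z (a + 1) x)) =
      opX z a (opQ z (a + 1) (opU z false a x)) - z • opQ z (a + 1) (opU z false a x) +
        z • opU z false (a + 1) (opQ z (a + 1) x) := by
    have h1 := opX_skein z a (opU z false a (opQ z (a + 1) x))
    have h2 := opX_skein z a (opQ z (a + 1) x)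
    rw [(opQ_pr z (a + 1) x).1, pr_cup z a hx] at h2
    rw [pr_comm, (opU_pr z a _ false).1, ← far (opU z false) (opQ z) a (a + 1) (a + 1),
      (opQ_pr z (a + 1) _).1, far (opU z false) (opQ z) a (a + 1) (a + 1)] at h1
    rw [h2, map_add, map_smul, ← opXn_open, far (opU z false) (opQ z) a (a + 1) (a + 1), h1,
      add_sub_cancel_right]
  rw [opK, opW_concat, h, op_bubR, op_bubR, opK]
  simp only [map_add, map_sub, map_smul, opW_concat]

/-- Moving tokens off a strand onto a bubble. -/
def opTh (Z Y : List Bool) (x : Vec z) : Vec z :=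
  opE' z (a + 1) (opW z Z (a + 1) (opXn z a (opW z Y a (opX z a (opQ z (a + 1) x)))))

omit hx in
theorem opTh_open (Z Y : List Bool) : opTh z a Z (false :: Y) x = opTh z a (Z ++ [false]) Y x := by
  rw [opTh, opTh, opW_concat, opW_cons, opXn_open]

omit hx in
theorem opW_opK (Y Z : List Bool) (x : Vec z) :
    opE' z (a + 1) (opW z Y (a + 1) (opW z Z a (opX z a (opQ z (a + 1) x)))) =
      ((-1 : k) ^ (Z.length * Y.length)) • opW z Z a (opK z a Y x) := by
  have h := LinearMap.congr_fun (IsLocal.swap (F := opW z Z) (G := opW z Y) inferInstance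
    inferInstance (a := a) (b := a + 1) (b' := a + 1) le_rfl rfl) (opX z a (opQ z (a + 1) x))
  rw [LinearMap.smul_apply, Module.End.mul_apply, Module.End.mul_apply] at h
  rw [h, map_smul, far (opW z Z) (opE' z) a (a + 1) (a + 1)]
  rfl

-- The closed token passes only the positive crossing. The two uses of the skein relation replace
-- the second crossing by an identity, which leaves curls below tokens on the strand.
omit hx in
theorem opTh_closed (Z Y : List Bool) : opTh z a Z (true :: Y) x =
    opTh z a (Z ++ [true]) Y x +
      z • ((-1 : k) ^ (Y.length * (Z ++ [true]).length)) • opW z Y a (opK z a (Z ++ [true]) x) -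
      z • ((-1 : k) ^ ((true :: Y).length * Z.length)) • opW z (true :: Y) a (opK z a Z x) := by
  rw [← opW_opK, ← opW_opK, opTh, opTh]
  obtain ⟨y, hy⟩ : ∃ y, y = opW z Y a (opX z a (opQ z (a + 1) x)) := ⟨_, rfl⟩
  have hy1 : pr z up a y = y := by rw [hy, pr_opW]
  have hy2 : pr z up (a + 1) y = y := by
    rw [hy, far (opW z Y) (pr z up) a (a + 1) (a + 1), (opX_pr z a _).2.1]
  have h : opXn z a (opU z true a y) =
      opU z true (a + 1) (opXn z a y) + z • opU z true (a + 1) y - z • opU z true a y := by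
    have h1 := opX_skein z a (opU z true a y)
    have h2 := opX_skein z a y
    rw [hy2, hy1] at h2
    rw [pr_comm, (opU_pr z a _ true).1, far (opU z true) (pr z up) a (a + 1) (a + 1), hy2] at h1
    rw [← map_smul, ← map_add, ← h2, ← opX_closed, h1, add_sub_cancel_right]
  rw [opW_cons, ← hy, h]
  simp only [map_add, map_sub, map_smul, opW_concat]

/-- With all tokens beyond the strand, the loop is pulled off to the left by a cap slide; with all
tokens on the near side it comes off to the right, since the crossings cancel. -/
theorem opTh_nil_left (Z : List Bool) : opTh z a [] Z x = op a (bubR z Z) x := by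
  have h : ∀ y, opW z [] (a + 1) (opXn z a y) = opXn z a y := fun y => (opXn_pr z a _).2.1
  rw [opTh, h, opE'_opXn, op_bubR, ← opL_opQ, far (opW z Z) (opSn z) a (a + 1) (a + 1), opSn_opL,
    far (opQ z) (pr z up) a a (a + 1 + 1), hx, (opQ_pr z a x).2]

theorem opTh_nil_right (Z : List Bool) : opTh z a Z [] x = op (a + 1) (bubR z Z) x := by
  have h : opW z [] a (opX z a (opQ z (a + 1) x)) = opX z a (opQ z (a + 1) x) := (opX_pr z a _).1
  rw [opTh, h, opXn_opX, (opQ_pr z (a + 1) x).1, pr_cup z a hx, op_bubR]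

omit hx in
theorem pr_opU_self (s : Bool) (x : Vec z) : pr z up a (opU z s a x) = opU z s a x :=
  (opU_pr z a x s).1

omit hx in
theorem opW_mem {M : Submodule k (Vec z)} (hU : ∀ s, ∀ x ∈ M, opU z s a x ∈ M)
    (hP : ∀ x ∈ M, pr z up a x ∈ M) (Z : List Bool) {x : Vec z} (hx : x ∈ M) : opW z Z a x ∈ M := by
  induction Z with
  | nil => exact hP x hx
  | cons s Z ih => exact hU s _ ih

/-- The difference of the two sides of a strand. -/
theorem opTh_sub_mem {M : Submodule k (Vec z)} (hU : ∀ s, ∀ x ∈ M, opU z s a x ∈ M)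
    (hP : ∀ x ∈ M, pr z up a x ∈ M) (Y : List Bool) (hxM : x ∈ M) : ∀ Z : List Bool,
    (∀ Z', Z'.length < (Z ++ Y).length → ∀ y ∈ M, pr z up a y = y → opK z a Z' y ∈ M) →
    opTh z a Z Y x - op (a + 1) (bubR z (Z ++ Y)) x ∈ M := by
  induction Y with
  | nil =>
    intro Z _
    rw [opTh_nil_right z a hx, List.append_nil, sub_self]
    exact zero_mem _
  | cons s Y ih =>
    intro Z h
    have h1 := ih (Z ++ [s])
    rw [List.append_assoc, List.singleton_append] at h1
    specialize h1 h
    cases s with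
    | false => rwa [opTh_open]
    | true =>
      have hZ : Z.length < (Z ++ true :: Y).length := by simp
      have h2 := h Z hZ _ hxM hx
      have h3 := h Z hZ _ (hU true _ hxM) (pr_opU_self z a true x)
      -- The slide of `Z ++ [true]` into the curl reduces this correction to a curl carrying only
      -- `Z`, which is covered by the hypothesis on shorter lists.
      rw [← opK_closed] at h3
      rw [opTh_closed, add_sub_assoc, add_sub_right_comm]
      refine add_mem h1 (sub_mem ?_ ?_)
      · exact M.smul_mem _ (M.smul_mem _ (opW_mem z a hU hP _ h3))
      · exact M.smul_mem _ (M.smul_mem _ (opW_mem z a hU hP _ h2))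

/-- Clockwise bubbles on the left of an upward strand move to the right. -/
theorem bubR_left_mem {M : Submodule k (Vec z)} (hU : ∀ s, ∀ x ∈ M, opU z s a x ∈ M)
    (hP : ∀ x ∈ M, pr z up a x ∈ M) (hR : ∀ Z, ∀ x ∈ M, op (a + 1) (bubR z Z) x ∈ M)
    (hxM : x ∈ M) (Z : List Bool) : op a (bubR z Z) x ∈ M := by
  -- Peeling tokens off a curl produces only bubbles on the right, which preserve `M` by hypothesis.
  have hK : ∀ Z, ∀ y ∈ M, pr z up a y = y → opK z a Z y ∈ M := by
    intro Z
    induction Z using List.reverseRecOn with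
    | nil => intro y hy hy'; rwa [opK_nil z a hy']
    | append_singleton Z s ih =>
      intro y hy hy'
      have h1 := ih _ (hU s y hy) (pr_opU_self z a s y)
      cases s with
      | true => rwa [opK_closed]
      | false =>
        rw [opK_open z a hy']
        exact add_mem (sub_mem h1 (M.smul_mem _ (hR _ _ (hU _ _ hy)))) (M.smul_mem _ (hR _ _ hy))
  have := opTh_sub_mem z a hx hU hP Z hxM [] fun Z' _ => hK Z'
  rw [opTh_nil_left z a hx, List.nil_append] at this
  have h := add_mem this (hR Z x hxM)
  rwa [sub_add_cancel] at h

/-- Clockwise bubbles on the right of an upward strand move to the left. -/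
theorem bubR_right_mem {M : Submodule k (Vec z)} (hU : ∀ s, ∀ x ∈ M, opU z s a x ∈ M)
    (hP : ∀ x ∈ M, pr z up a x ∈ M) (hR : ∀ Z, ∀ x ∈ M, op a (bubR z Z) x ∈ M)
    (hxM : x ∈ M) (Z : List Bool) : op (a + 1) (bubR z Z) x ∈ M := by
  -- Bubbles on the right are now the goal, and they also occur when curls are expanded. Only curls
  -- with fewer tokens than the bubble arise, so induction on the number of tokens applies.
  have key : ∀ n, ∀ Z : List Bool, Z.length ≤ n → ∀ x ∈ M, pr z up a x = x →
      op (a + 1) (bubR z Z) x ∈ M := by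
    intro n
    induction n with
    | zero =>
      intro Z hZ x _ _
      rw [List.length_eq_zero_iff.1 (Nat.le_zero.1 hZ), bubR_nil, op_zero]
      exact zero_mem _
    | succ n ih =>
      have hK : ∀ Z : List Bool, Z.length < n + 1 → ∀ y ∈ M, pr z up a y = y →
          opK z a Z y ∈ M := by
        intro Z
        induction Z using List.reverseRecOn with
        | nil => intro _ y hy hy'; rwa [opK_nil z a hy']
        | append_singleton Z s ih' =>
          intro hZ y hy hy'
          rw [List.length_append, List.length_singleton] at hZ
          have h1 := ih' (by omega) _ (hU s y hy) (pr_opU_self z a s y)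
          cases s with
          | true => rwa [opK_closed]
          | false =>
            rw [opK_open z a hy']
            refine add_mem (sub_mem h1 (M.smul_mem _ (ih _ (by omega) _ (hU _ _ hy)
              (pr_opU_self z a _ y)))) (M.smul_mem _ (ih _ ?_ _ hy hy'))
            rw [List.length_append, List.length_singleton]
            omega
      intro Z hZ x hxM hx
      have := opTh_sub_mem z a hx hU hP Z hxM [] fun Z' hZ' => hK Z' (by
        rw [List.nil_append] at hZ'; omega)
      rw [opTh_nil_left z a hx, List.nil_append] at this
      have h := sub_mem (hR Z x hxM) this
      rwa [sub_sub_cancel] at h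
  exact key _ Z le_rfl x hxM hx

end

/-! ### The algebra of bubbles -/

section
variable {z : k}

/-- The algebra generated by clockwise bubbles. -/
def bubAlg (z : k) : Subalgebra k (End (unit z)) := Algebra.adjoin k (Set.range (bubR z))

theorem op_bub_mul (a : ℕ) (w w' : End (unit z)) :
    (op a (w * w') : Module.End k (Vec z)) = op a w * op a w' := by
  rw [End.mul_def]
  exact op_comp a w' w

theorem op_algebraMap (a : ℕ) (r : k) :
    (op a (algebraMap k (End (unit z)) r) : Module.End k (Vec z)) = r • op a (𝟙 (unit z)) := by
  rw [Algebra.algebraMap_eq_smul_one]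
  exact op_smul a r (𝟙 (unit z))

/-- All bubbles can be moved if the generating ones can. -/
theorem bubAlg_mem {a : ℕ} {M : Submodule k (Vec z)} {p : Vec z → Prop}
    (hp : ∀ w ∈ bubAlg z, ∀ x, p x → p (op a w x)) (h1 : ∀ x, x ∈ M → p x → op a (𝟙 (unit z)) x ∈ M)
    (hR : ∀ Z x, x ∈ M → p x → op a (bubR z Z) x ∈ M) {w : End (unit z)} (hw : w ∈ bubAlg z) :
    ∀ x, x ∈ M → p x → op a w x ∈ M := by
  induction hw using Algebra.adjoin_induction with
  | mem w hw => obtain ⟨Z, rfl⟩ := hw; exact hR Z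
  | algebraMap r =>
    intro x hx hx'
    rw [op_algebraMap]
    exact M.smul_mem r (h1 x hx hx')
  | add w w' _ _ h h' =>
    intro x hx hx'
    have : (op a (w + w') : Module.End k (Vec z)) = op a w + op a w' := op_add a w w'
    rw [this]
    exact add_mem (h x hx hx') (h' x hx hx')
  | mul w w' _ hw' h h' =>
    intro x hx hx'
    rw [op_bub_mul]
    exact h _ (h' x hx hx') (hp _ hw' _ hx')

theorem tokens_tokWord (Z : List Bool) : (tokWord Z).tokens = Z.length := by
  induction Z with
  | nil => rfl
  | cons s Z ih =>
    rw [tokWord, Diag.tokens, ih, List.length_cons, Nat.add_comm]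
    cases s <;> rfl

/-- Bubbles with an odd number of tokens vanish, so bubbles commute with every local operator
without signs. -/
theorem bubAlg_even {w : End (unit z)} (hw : w ∈ bubAlg z) : w ∈ parityPart z [] [] 0 := by
  induction hw using Algebra.adjoin_induction with
  | mem w hw =>
    obtain ⟨Z, rfl⟩ := hw
    by_cases hZ : Z.length % 2 = 1
    · rw [bubR_eq_zero z hZ]
      exact zero_mem _
    · refine mor_mem_parityPart z _ ?_
      simp only [Diag.tokens, tokens_tokWord, Diag.rightCap, Diag.leftCap, Diag.negRight, Diag.leftCup,
        Gen.tokens]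
      omega
  | algebraMap r =>
    rw [Algebra.algebraMap_eq_smul_one]
    exact Submodule.smul_mem _ _ (id_mem_parityPart z [])
  | add w w' _ _ h h' => exact add_mem h h'
  | mul w w' _ _ h h' => exact comp_mem_parityPart (m := 0) (n := 0) h' h

theorem isLocal_bub {w : End (unit z)} (hw : w ∈ bubAlg z) :
    IsLocal (fun a => (op a w : Module.End k (Vec z))) 0 0 0 :=
  ⟨Submodule.subset_span ⟨[], [], w, rfl, rfl, bubAlg_even hw, rfl⟩⟩

theorem op_bub_far {F : ℕ → Module.End k (Vec z)} {p q n : ℕ} [IsLocal F p q n] {w : End (unit z)}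
    (hw : w ∈ bubAlg z) (a b : ℕ) (v : Vec z) :
    (b ≤ a → op b w (F a v) = F a (op b w v)) ∧
      (a + p ≤ b → op (b - p + q) w (F a v) = F a (op b w v)) := by
  have := isLocal_bub hw
  constructor
  · intro h
    exact (far (fun a => (op a w : Module.End k (Vec z))) F b a a v h rfl).symm
  · intro h
    exact far F (fun a => (op a w : Module.End k (Vec z))) a b _ v h (by omega)

theorem op_bub_tok {w : End (unit z)} (hw : w ∈ bubAlg z) (s : Bool) (a b : ℕ) :
    (op b w : Module.End k (Vec z)) * tok z s a = tok z s a * op b w := by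
  refine LinearMap.ext fun v => ?_
  rcases le_or_gt b a with h | h
  · exact (op_bub_far hw a b v).1 h
  · have := (op_bub_far (F := tok z s) hw a b v).2 h
    rwa [Nat.sub_add_cancel (by omega)] at this

theorem op_bub_pr {w : End (unit z)} (hw : w ∈ bubAlg z) (x : Arrow) (a b : ℕ) :
    (op b w : Module.End k (Vec z)) * pr z x a = pr z x a * op b w := by
  refine LinearMap.ext fun v => ?_
  rcases le_or_gt b a with h | h
  · exact (op_bub_far hw a b v).1 h
  · have := (op_bub_far (F := pr z x) hw a b v).2 h
    rwa [Nat.sub_add_cancel (by omega)] at this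

theorem op_bub_tokAlg {w : End (unit z)} (hw : w ∈ bubAlg z) (b : ℕ) {P : Set ℕ}
    {F : Module.End k (Vec z)} (hF : F ∈ tokAlg z P) : op b w * F = F * op b w := by
  induction hF using Algebra.adjoin_induction with
  | mem F hF =>
    rcases hF with ⟨s, p, -, rfl⟩ | ⟨x, p, -, rfl⟩
    · exact op_bub_tok hw s p b
    · exact op_bub_pr hw x p b
  | algebraMap r => exact (Algebra.commutes r _).symm
  | add F G _ _ hF hG => rw [mul_add, add_mul, hF, hG]
  | mul F G _ _ hF hG => rw [← mul_assoc, hF, mul_assoc, hG, mul_assoc]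

theorem op_one_apply_pr (x : Arrow) (a : ℕ) (v : Vec z) :
    op (a + 1) (𝟙 (unit z)) (pr z x a v) = pr z x a v := by
  funext W
  by_cases hW : a < W.length
  · exact op_id_apply _ (W.take (a + 1)) (W.drop (a + 1)) (by simp; omega) (by simp)
  · rw [pr_apply_of_ne v (by rw [List.getElem?_eq_none (by omega)]; simp),
      op_apply_eq_zero]
    rintro ⟨A, B, hA, rfl⟩
    simp at hW
    omega

theorem op_one_apply_pr_self (x : Arrow) (a : ℕ) (v : Vec z) :
    op a (𝟙 (unit z)) (pr z x a v) = pr z x a v := by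
  funext W
  by_cases hW : a ≤ W.length
  · exact op_id_apply _ (W.take a) (W.drop a) (by simp; omega) (by simp)
  · rw [pr_apply_of_ne v (by rw [List.getElem?_eq_none (by omega)]; simp),
      op_apply_eq_zero]
    rintro ⟨A, B, hA, rfl⟩
    simp at hW
    omega

theorem op_succ_prLen (w : unit z ⟶ unit z) (a : ℕ) (v : Vec z) :
    op (a + 1) w (prLen z a v) = op (a + 1) w v := by
  funext W
  refine op_congr w fun A B hA _ => ?_
  have ha : a < (A ++ ([] ++ B)).length := by simp; omega
  rw [prLen_apply, Pi.add_apply]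
  have h := List.getElem?_eq_getElem ha
  cases hx : (A ++ ([] ++ B))[a]
  · rw [hx] at h
    rw [pr_apply_of_get v h, pr_apply_of_ne v (by rw [h]; simp), add_zero]
  · rw [hx] at h
    rw [pr_apply_of_get v h, pr_apply_of_ne v (by rw [h]; simp), zero_add]

theorem tok_eq_opU (s : Bool) {a : ℕ} {x : Vec z} : opU z s a x = tok z s a (pr z up a x) :=
  (tok_pr_up z a x s).symm

/-- The submodule version of moving a bubble past a strand: the terms created on the way are tokens
on the strand and bubbles on its other side, all of which preserve `M`. -/
theorem bub_up_right {a : ℕ} {M : Submodule k (Vec z)} (hM : ∀ F ∈ tokAlg z {a}, ∀ x ∈ M, F x ∈ M)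
    (h : ∀ w ∈ bubAlg z, ∀ x ∈ M, op a w x ∈ M) {w : End (unit z)} (hw : w ∈ bubAlg z) :
    ∀ x ∈ M, pr z up a x = x → op (a + 1) w x ∈ M := by
  refine bubAlg_mem (p := fun x => pr z up a x = x) (fun w hw x hx => ?_) (fun x hx hx' => ?_)
    (fun Z x hx hx' => ?_) hw
  · have h := LinearMap.congr_fun (op_bub_pr hw up a (a + 1)) x
    rw [Module.End.mul_apply, Module.End.mul_apply, hx] at h
    exact h.symm
  · rw [← hx', op_one_apply_pr, hx']
    exact hx
  · refine bubR_right_mem z a hx' (fun s y hy => ?_) (fun y hy => ?_) (fun Z y hy => ?_) hx Z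
    · rw [tok_eq_opU]
      exact hM _ (tok_mem_tokAlg s rfl) _ (hM _ (pr_mem_tokAlg up rfl) _ hy)
    · exact hM _ (pr_mem_tokAlg up rfl) _ hy
    · exact h _ (Algebra.subset_adjoin ⟨Z, rfl⟩) y hy

theorem bub_up_left {a : ℕ} {M : Submodule k (Vec z)} (hM : ∀ F ∈ tokAlg z {a}, ∀ x ∈ M, F x ∈ M)
    (h : ∀ w ∈ bubAlg z, ∀ x ∈ M, op (a + 1) w x ∈ M) {w : End (unit z)} (hw : w ∈ bubAlg z) :
    ∀ x ∈ M, pr z up a x = x → op a w x ∈ M := by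
  refine bubAlg_mem (p := fun x => pr z up a x = x) (fun w hw x hx => ?_) (fun x hx hx' => ?_)
    (fun Z x hx hx' => ?_) hw
  · have h := LinearMap.congr_fun (op_bub_pr hw up a a) x
    rw [Module.End.mul_apply, Module.End.mul_apply, hx] at h
    exact h.symm
  · rw [← hx', op_one_apply_pr_self, hx']
    exact hx
  · refine bubR_left_mem z a hx' (fun s y hy => ?_) (fun y hy => ?_) (fun Z y hy => ?_) hx Z
    · rw [tok_eq_opU]
      exact hM _ (tok_mem_tokAlg s rfl) _ (hM _ (pr_mem_tokAlg up rfl) _ hy)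
    · exact hM _ (pr_mem_tokAlg up rfl) _ hy
    · exact h _ (Algebra.subset_adjoin ⟨Z, rfl⟩) y hy

/-- A downward strand is drawn as a zigzag whose middle segment points upwards, and the bubble
crosses that segment. -/
theorem bub_down_right {a : ℕ} {M : Submodule k (Vec z)}
    (hM : ∀ F ∈ tokAlg z Set.univ, ∀ x ∈ M, F x ∈ M)
    (h : ∀ w ∈ bubAlg z, ∀ x ∈ M, op a w x ∈ M) {w : End (unit z)} (hw : w ∈ bubAlg z)
    {x : Vec z} (hx : x ∈ M) (hx' : pr z down a x = x) : op (a + 1) w x ∈ M := by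
  -- The vectors that land in `M` once the zigzag is closed by a cap, whatever tokens the middle
  -- segment carries.
  let M' : Submodule k (Vec z) :=
    { carrier := {y | ∀ G ∈ tokAlg z {a + 1}, opn z a (G y) ∈ M}
      add_mem' := fun hy hy' G hG => by
        rw [map_add, map_add]; exact add_mem (hy G hG) (hy' G hG)
      zero_mem' := fun G _ => by rw [map_zero, map_zero]; exact zero_mem _
      smul_mem' := fun c y hy G hG => by
        rw [map_smul, map_smul]; exact M.smul_mem c (hy G hG) }
  have h1 : ∀ F ∈ tokAlg z {a + 1}, ∀ y ∈ M', F y ∈ M' := fun F hF y hy G hG =>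
    hy (G * F) (mul_mem hG hF)
  have h2 : ∀ w ∈ bubAlg z, ∀ y ∈ M', op (a + 1 + 1) w y ∈ M' := by
    -- A bubble to the right of the middle segment lies to the left of the strand once the cap is
    -- closed.
    intro w hw y hy G hG
    have e := LinearMap.congr_fun (op_bub_tokAlg hw (a + 1 + 1) hG) y
    rw [Module.End.mul_apply, Module.End.mul_apply] at e
    change opn z a (G (op (a + 1 + 1) w y)) ∈ M
    rw [← e]
    have := (op_bub_far (F := opn z) hw a (a + 2) (G y)).2 le_rfl
    rw [show a + 1 + 1 = a + 2 from rfl, ← this]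
    exact h w hw _ (hy G hG)
  have h3 : opQ z (a + 1) x ∈ M' := by
    -- Tokens on the middle segment pass over the cup to the outer leg, where they do not interfere
    -- with straightening the zigzag.
    intro G hG
    rw [← pr_up_opu]
    obtain ⟨F, hF, e⟩ := tokAlg_opu_left (a + 1) x
      (mul_mem hG (pr_mem_tokAlg up (Set.mem_singleton (a + 1))))
    have hF' : F ∈ tokAlg z {a, a + 1}ᶜ := tokAlg_mono (by
      rintro _ rfl
      simp
      omega) hF
    obtain ⟨F', hF', e'⟩ := exists_opn_comm a hF'
    rw [Module.End.mul_apply] at e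
    have e'' := LinearMap.congr_fun e' (opu z (a + 1) x)
    rw [Module.End.mul_apply, Module.End.mul_apply, opn_opu_succ] at e''
    rw [e, e'']
    exact hM _ hF' _ (hM _ (add_mem (pr_mem_tokAlg up (Set.mem_univ a))
      (pr_mem_tokAlg down (Set.mem_univ a))) _ hx)
  have h4 := bub_up_left h1 h2 hw _ h3 (opQ_pr z (a + 1) x).1 (pr z up (a + 1))
    (pr_mem_tokAlg up rfl)
  rw [opn_pr_succ_up, (op_bub_far (F := opQ z) hw (a + 1) (a + 1) x).1 le_rfl, opE_opQ'] at h4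
  have h5 := LinearMap.congr_fun (op_bub_pr hw down a (a + 1)) x
  rw [Module.End.mul_apply, Module.End.mul_apply, hx'] at h5
  rwa [h5]

/-- Bubbles move to the left. -/
theorem op_bub_mem {M : Submodule k (Vec z)} (hM : ∀ F ∈ tokAlg z Set.univ, ∀ x ∈ M, F x ∈ M)
    (h : ∀ w ∈ bubAlg z, ∀ x ∈ M, op 0 w x ∈ M) (a : ℕ) : ∀ w ∈ bubAlg z, ∀ x ∈ M,
    op a w x ∈ M := by
  induction a with
  | zero => exact h
  | succ a ih =>
    intro w hw x hx
    have hp : ∀ y, pr z y a x ∈ M := fun y => hM _ (pr_mem_tokAlg y (Set.mem_univ a)) x hx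
    rw [← op_succ_prLen, prLen_apply, map_add]
    exact add_mem (bub_up_right (fun F hF => hM F (tokAlg_mono (Set.subset_univ _) hF)) ih hw _
      (hp up) (pr_pr z a x up)) (bub_down_right hM ih hw (hp down) (pr_pr z a x down))

end

/-! ### The Grassmannian relation -/

section
variable (z : k)

/-- A counterclockwise bubble and a clockwise bubble joined by a crossing. -/
def curl (Y Z : List Bool) (a : ℕ) (v : Vec z) : Vec z :=
  opE z a (opW z Y (a + 1) (opSn z a (opW z Z a (opQ z a v))))

variable (a : ℕ) (v : Vec z)

theorem curl_nil_right (Y : List Bool) : curl z Y [] a v = op a (bubL z Y) v := by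
  rw [curl, op_bubL, opQ'_eq]
  change opE z a (opW z Y (a + 1) (opSn z a (pr z up a (opQ z a v)))) = _
  rw [(opQ_pr z a v).1]

theorem curl_nil_left (Z : List Bool) : curl z [] Z a v = op a (bubR z Z) v := by
  rw [curl, op_bubR, opE'_eq]
  change opE z a (pr z up (a + 1) _) = _
  rw [(opE_pr z a _).2]

theorem curl_closed (Y Z : List Bool) : curl z (Y ++ [true]) Z a v = curl z Y (true :: Z) a v := by
  rw [curl, curl, opW_concat, opW_cons, opSn_closed]

/-- The open token passes `opSp` and not `opSn`; the difference of the crossings splits the picture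
into a product of two bubbles. -/
theorem curl_open (Y Z : List Bool) : curl z (Y ++ [false]) Z a v =
    curl z Y (false :: Z) a v + z • op a (bubL z Y) (op a (bubR z (false :: Z)) v) -
      z • op a (bubL z (Y ++ [false])) (op a (bubR z Z) v) := by
  have h := opSp_open z a (opW z Z a (opQ z a v))
  rw [opSp_apply, opSp_apply, map_add, map_smul] at h
  simp only [curl, op_bubR, op_bubL, opW_concat, opW_cons]
  rw [eq_sub_iff_add_eq.2 h.symm]
  simp only [map_add, map_sub, map_smul]

/-- Tokens are moved one by one from the counterclockwise side of `curl` to the clockwise side. Each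
step leaves products in which the counterclockwise factor is shorter, so induction on the number of
tokens applies. -/
theorem bubL_mem (Z : List Bool) : bubL z Z ∈ bubAlg z := by
  induction hn : Z.length using Nat.strong_induction_on generalizing Z with
  | _ n ih =>
    subst hn
    have key : ∀ Y X : List Bool, Y.length + X.length = Z.length →
        ∃ w ∈ bubAlg z, curl z Y X 0 (vac z) = op 0 w (vac z) := by
      intro Y
      induction Y using List.reverseRecOn with
      | nil => exact fun X _ => ⟨_, Algebra.subset_adjoin ⟨X, rfl⟩, curl_nil_left z 0 _ X⟩
      | append_singleton Y s ih' =>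
        intro X hX
        rw [List.length_append, List.length_singleton] at hX
        have hX' : Y.length + (s :: X).length = Z.length := by rw [List.length_cons]; omega
        cases s with
        | true => rw [curl_closed]; exact ih' _ hX'
        | false =>
          obtain ⟨w, hw, e⟩ := ih' _ hX'
          have h1 : bubL z (Y ++ [false]) * bubR z X ∈ bubAlg z := by
            -- With `X` empty the counterclockwise factor is as long as `Z` and induction does not
            -- apply, but the other factor is then the zero bubble.
            cases X with
            | nil => rw [bubR_nil, mul_zero]; exact zero_mem _
            | cons t X =>
              refine mul_mem (ih _ ?_ _ rfl) (Algebra.subset_adjoin ⟨_, rfl⟩)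
              rw [List.length_append, List.length_singleton]
              rw [List.length_cons] at hX
              omega
          have h2 : bubL z Y * bubR z (false :: X) ∈ bubAlg z :=
            mul_mem (ih _ (by omega) _ rfl) (Algebra.subset_adjoin ⟨_, rfl⟩)
          refine ⟨w + z • (bubL z Y * bubR z (false :: X)) - z • (bubL z (Y ++ [false]) * bubR z X),
            sub_mem (add_mem hw (Subalgebra.smul_mem _ h2 z)) (Subalgebra.smul_mem _ h1 z), ?_⟩
          have e1 := op_sub (k := k) (z := z) 0
            (w + z • (bubL z Y * bubR z (false :: X)) : unit z ⟶ unit z)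
            (z • (bubL z (Y ++ [false]) * bubR z X))
          have e2 := op_add (k := k) (z := z) 0 w (z • (bubL z Y * bubR z (false :: X)))
          have e3 := op_smul (k := k) (z := z) 0 z (bubL z Y * bubR z (false :: X))
          have e4 := op_smul (k := k) (z := z) 0 z (bubL z (Y ++ [false]) * bubR z X)
          rw [curl_open, e]
          refine Eq.trans ?_ (LinearMap.congr_fun e1 (vac z)).symm
          rw [e2, e3, e4, op_bub_mul, op_bub_mul]
          rfl
    obtain ⟨w, hw, e⟩ := key Z [] rfl
    rw [curl_nil_right] at e
    rwa [op_injective e]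

/-- The clockwise bubble with a zebra of length `2 * n`. -/
def zebR (n : ℕ) : End (unit z) := bubR z (alt true (2 * n))
/-- The counterclockwise bubble with a zebra of length `2 * n`. -/
def zebL (n : ℕ) : End (unit z) := bubL z (alt true (2 * n))

theorem zebR_zero : zebR z 0 = 0 := bubR_nil z
theorem zebL_zero : zebL z 0 = 0 := bubL_nil z

/-- Two tokens are moved at once. Of the two products created by the open token, one contains a
bubble with an odd number of tokens and vanishes. -/
theorem curl_alt (i j : ℕ) : curl z (alt true (2 * (i + 1))) (alt true (2 * j)) a v =
    curl z (alt true (2 * i)) (alt true (2 * (j + 1))) a v -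
      z • op a (zebL z (i + 1) * zebR z j) v := by
  have h1 : bubL z (alt true (2 * i + 1)) = 0 := bubL_eq_zero z (by rw [alt_length]; omega)
  have h2 : alt true (2 * (j + 1)) = true :: false :: alt true (2 * j) := by
    rw [show 2 * (j + 1) = 2 * j + 1 + 1 by ring, alt, alt]; rfl
  have h3 : alt true (2 * i + 1) ++ [false] = alt true (2 * (i + 1)) := (alt_append true i).2
  rw [← h3, curl_open, h1, h3, ← (alt_append true i).1, curl_closed, h2, op_bub_mul]
  have h4 : (op a (0 : End (unit z)) : Module.End k (Vec z)) = 0 := op_zero a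
  rw [h4, LinearMap.zero_apply, smul_zero, add_zero]
  rfl

/-- Telescoping `curl_alt` connects the curl with all tokens on the counterclockwise side to the one
with all of them on the clockwise side. -/
theorem grassmannian (n : ℕ) :
    zebR z n = zebL z n + z • ∑ p ∈ Finset.HasAntidiagonal.antidiagonal n, zebL z p.1 * zebR z p.2 := by
  have key : ∀ i j, curl z (alt true (2 * i)) (alt true (2 * j)) 0 (vac z) =
      op 0 (zebR z (i + j) - z • ∑ l ∈ Finset.range (i + 1), zebL z l * zebR z (i + j - l) :
        unit z ⟶ unit z) (vac z) := by
    intro i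
    induction i with
    | zero =>
      intro j
      rw [zero_add, zero_add, Finset.sum_range_one, zebL_zero, zero_mul, smul_zero, sub_zero]
      exact curl_nil_left z 0 _ _
    | succ i ih =>
      intro j
      have e : ∀ w w' : End (unit z), op 0 (w - z • w' : unit z ⟶ unit z) (vac z) =
          op 0 w (vac z) - z • op 0 w' (vac z) := by
        intro w w'
        rw [op_sub, op_smul]
        rfl
      have e' : ∀ w w' : End (unit z), op 0 (w + w' : End (unit z)) (vac z) =
          op 0 w (vac z) + op 0 w' (vac z) := fun w w' => by
        have := op_add (k := k) (z := z) 0 w w'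
        exact LinearMap.congr_fun this _
      rw [curl_alt, ih, e, e, Finset.sum_range_succ _ (i + 1), e', smul_add,
        show i + 1 + j = i + (j + 1) by ring, show i + (j + 1) - (i + 1) = j by omega, sub_sub]
  have h := key n 0
  rw [show alt true (2 * 0) = [] from rfl, curl_nil_right, add_zero] at h
  have h' : zebL z n = _ := op_injective h
  rw [Finset.Nat.sum_antidiagonal_eq_sum_range_succ (fun i j => zebL z i * zebR z j)]
  exact (sub_eq_iff_eq_add.1 h'.symm)

/-! ### Zebra bubbles -/

/-- `Diag.alternating` is indexed by its bottom token and `alt` by its top one, and the two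
conventions name the closed token differently; the comparison therefore depends on the parity of the
length. -/
theorem op_alternating (b : Bool) (n : ℕ) (a : ℕ) (v : Vec z) :
    op a (mor z (Diag.alternating b (2 * n))) v = opW z (alt b (2 * n)) a v ∧
      op a (mor z (Diag.alternating (!b) (2 * n + 1))) v = opW z (alt b (2 * n + 1)) a v := by
  have key : ∀ n, (∀ v, op a (mor z (Diag.alternating b (2 * n))) v =
      opW z (alt b (2 * n)) a v) → ∀ v,
      op a (mor z (Diag.alternating (!b) (2 * n + 1))) v = opW z (alt b (2 * n + 1)) a v := by
    intro n h v
    rw [← (alt_append b n).1, opW_concat, ← h]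
    cases b <;> exact op_mor_comp z a v _ _
  have key' : ∀ n v, op a (mor z (Diag.alternating b (2 * n))) v =
      opW z (alt b (2 * n)) a v := by
    intro n
    induction n with
    | zero => exact fun v => by cases b <;> rfl
    | succ n ih =>
      intro v
      have h1 : alt b (2 * n + 1) ++ [!b] = alt b (2 * (n + 1)) := (alt_append b n).2
      rw [← h1, opW_concat, ← key n ih, show 2 * (n + 1) = 2 * n + 1 + 1 by ring]
      cases b <;> exact op_mor_comp z a v _ _
  exact ⟨key' n v, key n (key' n) v⟩

theorem zebraUp_two_mul (n : ℕ) : Diag.zebraUp (2 * n) = Diag.alternating true (2 * n) := by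
  rw [Diag.zebraUp, if_pos (by positivity)]
  congr 1

theorem mor_rightBubble (n : ℕ) : mor z (Diag.rightBubble (2 * n)) = zebR z n := by
  refine op_injective ?_
  rw [zebR, op_bubR, ← (op_alternating z true n _ _).1, Diag.rightBubble, op_mor_comp, op_mor_comp,
    op_mor_tensor, zebraUp_two_mul]
  change opE' z 0 (op 0 _ (pr z down (0 + 1) (opQ z 0 (vac z)))) = _
  rw [(opQ_pr z 0 (vac z)).2]

theorem mor_leftBubble (n : ℕ) : mor z (Diag.leftBubble (2 * n)) = zebL z n := by
  refine op_injective ?_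
  rw [zebL, op_bubL, ← (op_alternating z true n _ _).1, ← (opE_pr z 0 _).1, Diag.leftBubble,
    op_mor_comp, op_mor_comp, op_mor_tensor, zebraUp_two_mul]
  rfl

end

/-! ## Symmetric functions -/

namespace SymFun

variable (k)

theorem coeff_e (r : ℕ) (m : ℕ →₀ ℕ) : MvPowerSeries.coeff m (e k r : MvPowerSeries ℕ k) =
    open Classical in if m.degree = r ∧ ∀ i, m i ≤ 1 then 1 else 0 := rfl

theorem coeff_h (r : ℕ) (m : ℕ →₀ ℕ) : MvPowerSeries.coeff m (h k r : MvPowerSeries ℕ k) =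
    if m.degree = r then 1 else 0 := rfl

/-- Squarefree divisors of the monomial `m` correspond to subsets of its support, and the
alternating sum over the subsets of a nonempty set is zero. -/
theorem sum_squarefree {m : ℕ →₀ ℕ} (hm : m ≠ 0) :
    (∑ p ∈ Finset.HasAntidiagonal.antidiagonal m,
      open Classical in if ∀ i, p.1 i ≤ 1 then (-1 : k) ^ p.1.degree else 0) = 0 := by
  classical
  have hs := Finset.sum_powerset_neg_one_pow_card_of_nonempty (Finsupp.support_nonempty_iff.2 hm)
  have h0 : ∑ S ∈ m.support.powerset, (-1 : k) ^ S.card = 0 := by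
    exact_mod_cast congrArg (Int.cast : ℤ → k) hs
  rw [← Finset.sum_filter, ← h0]
  let ind : Finset ℕ → ℕ →₀ ℕ := fun S => Finsupp.indicator S fun _ _ => 1
  have hind : ∀ S i, ind S i = if i ∈ S then 1 else 0 := fun S i => by
    simp [ind, Finsupp.indicator_apply]
  have hsupp : ∀ S, (ind S).support = S := fun S => by
    ext i
    simp [hind]
  have hdeg : ∀ S, (ind S).degree = S.card := by
    intro S
    rw [Finsupp.degree_apply, hsupp, Finset.card_eq_sum_ones]
    exact Finset.sum_congr rfl fun i hi => by rw [hind, if_pos hi]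
  have hind' : ∀ x : ℕ →₀ ℕ, (∀ i, x i ≤ 1) → ind x.support = x := by
    intro x hx
    ext i
    rw [hind]
    have := hx i
    split_ifs with h <;> simp at h <;> omega
  refine Finset.sum_nbij' (fun p => p.1.support) (fun S => (ind S, m - ind S)) ?_ ?_ ?_ ?_ ?_
  · intro p hp
    rw [Finset.mem_filter, Finset.HasAntidiagonal.mem_antidiagonal] at hp
    rw [Finset.mem_powerset, ← hp.1]
    exact Finsupp.support_mono le_self_add
  · intro S hS
    rw [Finset.mem_powerset] at hS
    rw [Finset.mem_filter, Finset.HasAntidiagonal.mem_antidiagonal]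
    refine ⟨add_tsub_cancel_of_le fun i => ?_, fun i => ?_⟩
    · rw [hind]
      split_ifs with h
      · exact Nat.one_le_iff_ne_zero.2 (Finsupp.mem_support_iff.1 (hS h))
      · exact Nat.zero_le _
    · change ind S i ≤ 1
      rw [hind]
      split_ifs <;> omega
  · intro p hp
    rw [Finset.mem_filter, Finset.HasAntidiagonal.mem_antidiagonal] at hp
    have h1 := hind' p.1 hp.2
    refine Prod.ext h1 ?_
    change m - ind p.1.support = p.2
    rw [h1, ← hp.1, add_tsub_cancel_left]
  · intro S _
    exact hsupp S
  · intro p hp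
    rw [Finset.mem_filter] at hp
    rw [← hdeg, hind' p.1 hp.2]

theorem e_zero : e k 0 = 1 := by
  classical
  refine Subtype.ext (MvPowerSeries.ext fun m => ?_)
  rw [coeff_e]
  refine Eq.trans ?_ (MvPowerSeries.coeff_one (m)).symm
  refine if_congr ⟨fun h => (Finsupp.degree_eq_zero_iff m).1 h.1, ?_⟩ rfl rfl
  rintro rfl
  simp

theorem h_zero : h k 0 = 1 := by
  classical
  refine Subtype.ext (MvPowerSeries.ext fun m => ?_)
  rw [coeff_h]
  refine Eq.trans ?_ (MvPowerSeries.coeff_one (m)).symm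
  exact if_congr (Finsupp.degree_eq_zero_iff m) rfl rfl

/-- The relation between elementary and complete homogeneous symmetric functions. -/
theorem sum_e_h {n : ℕ} (hn : 0 < n) : ∑ p ∈ Finset.HasAntidiagonal.antidiagonal n,
    ((-1 : k) ^ p.1) • (e k p.1 * h k p.2) = 0 := by
  classical
  refine Subtype.ext (MvPowerSeries.ext fun m => ?_)
  have h1 : MvPowerSeries.coeff m (((∑ p ∈ Finset.HasAntidiagonal.antidiagonal n,
      ((-1 : k) ^ p.1) • (e k p.1 * h k p.2) : SymFun k)) : MvPowerSeries ℕ k) =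
      ∑ p ∈ Finset.HasAntidiagonal.antidiagonal n, (-1 : k) ^ p.1 *
        ∑ x ∈ Finset.HasAntidiagonal.antidiagonal m,
          (if x.1.degree = p.1 ∧ ∀ i, x.1 i ≤ 1 then 1 else 0) *
            (if x.2.degree = p.2 then 1 else 0) := by
    rw [AddSubmonoidClass.coe_finsetSum, map_sum]
    refine Finset.sum_congr rfl fun p _ => ?_
    refine (map_smul _ _ _).trans (congrArg ((-1 : k) ^ p.1 * ·) ?_)
    refine (MvPowerSeries.coeff_mul m _ _).trans (Finset.sum_congr rfl fun x _ => ?_)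
    rw [coeff_e, coeff_h]
  rw [h1]
  simp only [Finset.mul_sum]
  rw [Finset.sum_comm]
  have h2 : ∀ x ∈ Finset.HasAntidiagonal.antidiagonal m,
      ∑ p ∈ Finset.HasAntidiagonal.antidiagonal n, (-1 : k) ^ p.1 *
          ((if x.1.degree = p.1 ∧ ∀ i, x.1 i ≤ 1 then 1 else 0) *
            (if x.2.degree = p.2 then 1 else 0)) =
        if m.degree = n then (if ∀ i, x.1 i ≤ 1 then (-1 : k) ^ x.1.degree else 0) else 0 := by
    intro x hx
    rw [Finset.HasAntidiagonal.mem_antidiagonal] at hx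
    by_cases hm : m.degree = n
    · rw [if_pos hm, Finset.sum_eq_single (x.1.degree, x.2.degree)]
      · simp
      · intro p _ hp'
        by_cases h : x.1.degree = p.1
        · have : x.2.degree ≠ p.2 := fun h' => hp' (Prod.ext h.symm h'.symm)
          rw [if_neg this, mul_zero, mul_zero]
        · rw [if_neg fun h' => h h'.1, zero_mul, mul_zero]
      · intro h
        refine absurd ?_ h
        rw [Finset.HasAntidiagonal.mem_antidiagonal, ← hm, ← hx, map_add]
    · rw [if_neg hm]
      refine Finset.sum_eq_zero fun p hp => ?_
      rw [Finset.HasAntidiagonal.mem_antidiagonal] at hp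
      by_cases h : x.1.degree = p.1
      · have : x.2.degree ≠ p.2 := fun h' => hm (by rw [← hx, map_add, h, h', hp])
        rw [if_neg this, mul_zero, mul_zero]
      · rw [if_neg fun h' => h h'.1, zero_mul, mul_zero]
  rw [Finset.sum_congr rfl h2]
  by_cases hm : m.degree = n
  · simp only [if_pos hm]
    refine (sum_squarefree k (m := m) ?_).trans (map_zero _).symm
    rintro rfl
    rw [map_zero] at hm
    omega
  · simp only [if_neg hm, Finset.sum_const_zero]
    exact (map_zero _).symm

/-- Restriction to finitely many variables. -/
def restrict (n : ℕ) : SymFun k →ₐ[k] MvPowerSeries (Fin n) k :=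
  (MvPowerSeries.killCompl Fin.valEmbedding).comp (SymFun k).val

theorem coeff_restrict (n : ℕ) (f : SymFun k) (m : Fin n →₀ ℕ) :
    MvPowerSeries.coeff m (restrict k n f) =
      MvPowerSeries.coeff (m.embDomain Fin.valEmbedding) (f : MvPowerSeries ℕ k) :=
  MvPowerSeries.coeff_killCompl _ _

theorem restrict_e (n r : ℕ) :
    restrict k n (e k r) = (MvPolynomial.esymm (Fin n) k r : MvPolynomial (Fin n) k) := by
  classical
  ext m
  rw [coeff_restrict, coeff_e, MvPolynomial.coeff_coe, MvPolynomial.esymm_eq_sum_monomial,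
    MvPolynomial.coeff_sum]
  simp only [MvPolynomial.coeff_monomial]
  let s : Finset (Fin n) → Fin n →₀ ℕ := fun t => ∑ i ∈ t, Finsupp.single i 1
  have hs : ∀ t i, s t i = if i ∈ t then 1 else 0 := by
    intro t i
    simp [s, Finsupp.finsetSum_apply, Finsupp.single_apply]
  have hdeg : ∀ t, (s t).degree = t.card := by
    intro t
    rw [Finset.card_eq_sum_ones, map_sum]
    exact Finset.sum_congr rfl fun i _ => Finsupp.degree_single i 1
  have h1 : (m.embDomain Fin.valEmbedding).degree = m.degree := by
    rw [Finsupp.embDomain_eq_mapDomain, Finsupp.degree_mapDomain]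
  have h2 : (∀ i, m.embDomain Fin.valEmbedding i ≤ 1) ↔ ∀ i, m i ≤ 1 := by
    constructor
    · intro h i
      rw [← Finsupp.embDomain_apply_self Fin.valEmbedding m i]
      exact h _
    · intro h i
      by_cases hi : i ∈ Set.range (Fin.valEmbedding : Fin n ↪ ℕ)
      · obtain ⟨j, rfl⟩ := hi
        rw [Finsupp.embDomain_apply_self]
        exact h j
      · rw [Finsupp.embDomain_of_notMem_range _ _ _ hi]
        exact Nat.zero_le _
  rw [h1, h2]
  change _ = ∑ t ∈ Finset.powersetCard r Finset.univ, if s t = m then 1 else 0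
  split_ifs with h
  · have hm : s m.support = m := by
      ext i
      rw [hs]
      have := h.2 i
      split_ifs with h' <;> simp at h' <;> omega
    rw [Finset.sum_eq_single m.support, if_pos hm]
    · intro t _ ht
      rw [if_neg]
      rintro rfl
      refine ht ?_
      ext i
      rw [Finsupp.mem_support_iff, hs]
      simp
    · intro h'
      refine absurd ?_ h'
      rw [Finset.mem_powersetCard, ← hdeg, hm]
      exact ⟨Finset.subset_univ _, h.1⟩
  · refine (Finset.sum_eq_zero fun t ht => if_neg ?_).symm
    rintro rfl
    refine h ⟨(hdeg t).trans (Finset.mem_powersetCard.1 ht).2, fun i => ?_⟩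
    rw [hs]
    split_ifs <;> omega

/-- Polynomials in the elementary symmetric functions. -/
def ofPoly : MvPolynomial ℕ k →ₐ[k] SymFun k := MvPolynomial.aeval fun i => e k (i + 1)

theorem restrict_ofPoly (n : ℕ) (q : MvPolynomial (Fin n) k) :
    restrict k n (ofPoly k (MvPolynomial.rename Fin.val q)) =
      ((MvPolynomial.esymmAlgHom (Fin n) k n q).1 : MvPolynomial (Fin n) k) := by
  have h : ((restrict k n).comp (ofPoly k)).comp (MvPolynomial.rename Fin.val) =
      ((MvPolynomial.coeToMvPowerSeries.algHom k).comp
        (MvPolynomial.symmetricSubalgebra (Fin n) k).val).comp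
          (MvPolynomial.esymmAlgHom (Fin n) k n) := by
    refine MvPolynomial.algHom_ext fun i => ?_
    simp only [AlgHom.comp_apply, MvPolynomial.rename_X, ofPoly, MvPolynomial.aeval_X,
      MvPolynomial.esymmAlgHom, restrict_e]
    rfl
  exact DFunLike.congr_fun h q

/-- A polynomial relation involves finitely many `e i`. Restricted to enough variables, it
contradicts the algebraic independence of elementary symmetric polynomials. -/
theorem ofPoly_injective : Function.Injective (ofPoly k) := by
  rw [injective_iff_map_eq_zero]
  intro p hp
  -- The number of variables exceeds the largest occurring index, so every index is a value of
  -- `Fin.val`.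
  obtain ⟨q, hq⟩ := MvPolynomial.exists_rename_eq_of_vars_subset_range p
    (Fin.val : Fin (p.vars.sup id + 1) → ℕ) Fin.val_injective (fun i hi =>
      ⟨⟨i, Nat.lt_succ_of_le (Finset.le_sup (f := id) hi)⟩, rfl⟩)
  have h := restrict_ofPoly k _ q
  rw [hq, hp, map_zero] at h
  have h' : MvPolynomial.esymmAlgHom (Fin _) k _ q = 0 :=
    Subtype.ext (MvPolynomial.coe_injective _ _ (h.symm.trans MvPolynomial.coe_zero.symm))
  rw [← map_zero (MvPolynomial.esymmAlgHom (Fin _) k _)] at h'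
  rw [← hq, MvPolynomial.esymmAlgHom_fin_injective k le_rfl h', map_zero]

variable {k}

theorem coeff_perm (f : SymFun k) (σ : Equiv.Perm ℕ) (m : ℕ →₀ ℕ) :
    MvPowerSeries.coeff (m.embDomain σ.toEmbedding) (f : MvPowerSeries ℕ k) =
      MvPowerSeries.coeff m (f : MvPowerSeries ℕ k) := by
  have h := MvPowerSeries.coeff_embDomain_rename σ.toEmbedding (f : MvPowerSeries ℕ k) m
  rw [← h]
  exact congrArg (MvPowerSeries.coeff _) (f.2.2 σ).symm

theorem exists_perm (S : Finset ℕ) : ∃ σ : Equiv.Perm ℕ, ∀ i ∈ S, σ i < S.card := by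
  classical
  have e1 : S ≃ Finset.range S.card := Finset.equivOfCardEq (by rw [Finset.card_range])
  have i1 : Infinite {i // i ∉ S} := S.finite_toSet.infinite_compl.to_subtype
  have i2 : Infinite {i // i ∉ Finset.range S.card} :=
    (Finset.range S.card).finite_toSet.infinite_compl.to_subtype
  obtain ⟨e2⟩ : Nonempty ({i // i ∉ S} ≃ {i // i ∉ Finset.range S.card}) := inferInstance
  refine ⟨Equiv.subtypeCongr e1 e2, fun i hi => ?_⟩
  have h := (e1 ⟨i, hi⟩).2
  rw [Finset.mem_range] at h
  simpa [Equiv.subtypeCongr, hi] using h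

/-- A monomial of degree at most `n` involves at most `n` variables, and a permutation moves them to
the first `n`. -/
theorem eq_of_restrict {f g : SymFun k} {n : ℕ} (h : restrict k n f = restrict k n g)
    {m : ℕ →₀ ℕ} (hm : m.degree ≤ n) : MvPowerSeries.coeff m (f : MvPowerSeries ℕ k) =
      MvPowerSeries.coeff m (g : MvPowerSeries ℕ k) := by
  obtain ⟨σ, hσ⟩ := exists_perm m.support
  have hc : m.support.card ≤ n := by
    refine le_trans ?_ hm
    rw [Finsupp.degree_apply, Finset.card_eq_sum_ones]
    exact Finset.sum_le_sum fun i hi => Nat.one_le_iff_ne_zero.2 (Finsupp.mem_support_iff.1 hi)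
  let m' : Fin n →₀ ℕ := (m.embDomain σ.toEmbedding).comapDomain Fin.val Fin.val_injective.injOn
  have hm' : m'.embDomain Fin.valEmbedding = m.embDomain σ.toEmbedding := by
    ext i
    by_cases hi : i < n
    · exact Finsupp.embDomain_apply_self Fin.valEmbedding m' ⟨i, hi⟩
    · rw [Finsupp.embDomain_of_notMem_range _ _ _ fun ⟨j, hj⟩ => hi (hj ▸ j.2)]
      obtain ⟨j, rfl⟩ := σ.surjective i
      refine Eq.symm ((Finsupp.embDomain_apply_self σ.toEmbedding m j).trans ?_)
      by_contra hj
      exact hi ((hσ j (Finsupp.mem_support_iff.2 hj)).trans_le hc)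
  rw [← coeff_perm f σ, ← coeff_perm g σ, ← hm', ← coeff_restrict, ← coeff_restrict, h]

/-- The elementary symmetric functions are homogeneous, hence so is the image of a monomial in them.
-/
theorem exists_degree (u : ℕ →₀ ℕ) (a : k) : ∃ D, ∀ m : ℕ →₀ ℕ,
    MvPowerSeries.coeff m (ofPoly k (MvPolynomial.monomial u a) : MvPowerSeries ℕ k) ≠ 0 →
      m.degree = D := by
  classical
  refine MvPolynomial.induction_on_monomial (motive := fun p => ∃ D, ∀ m : ℕ →₀ ℕ,
    MvPowerSeries.coeff m (ofPoly k p : MvPowerSeries ℕ k) ≠ 0 → m.degree = D)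
    (fun a => ⟨0, fun m hm => ?_⟩) (fun p i ⟨D, hD⟩ => ⟨D + (i + 1), fun m hm => ?_⟩) u a
  · have : ofPoly k (MvPolynomial.C a) = algebraMap k _ a := (ofPoly k).commutes a
    rw [this] at hm
    have h := MvPowerSeries.coeff_C (R := k) m a
    by_contra h'
    refine hm (h.trans (if_neg ?_))
    rintro rfl
    exact h' (map_zero _)
  · rw [map_mul, ofPoly, MvPolynomial.aeval_X] at hm
    have h := (MvPowerSeries.coeff_mul m (ofPoly k p : MvPowerSeries ℕ k) (e k (i + 1)))
    obtain ⟨x, hx, hne⟩ := Finset.exists_ne_zero_of_sum_ne_zero (h ▸ hm)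
    rw [Finset.HasAntidiagonal.mem_antidiagonal] at hx
    rw [← hx, map_add, hD _ (left_ne_zero_of_mul hne)]
    have h2 := right_ne_zero_of_mul hne
    rw [coeff_e] at h2
    by_contra h3
    exact h2 (if_neg fun h4 => h3 (by rw [h4.1]))

/-- By homogeneity, cutting off high degrees amounts to dropping some monomials of the polynomial.
-/
theorem ofPoly_truncate (n : ℕ) (p : MvPolynomial ℕ k) : ∃ p', ∀ m : ℕ →₀ ℕ,
    MvPowerSeries.coeff m (ofPoly k p' : MvPowerSeries ℕ k) =
      if m.degree ≤ n then MvPowerSeries.coeff m (ofPoly k p : MvPowerSeries ℕ k) else 0 := by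
  induction p using MvPolynomial.induction_on' with
  | monomial u a =>
    obtain ⟨D, hD⟩ := exists_degree u a
    by_cases hn : D ≤ n
    · refine ⟨MvPolynomial.monomial u a, fun m => ?_⟩
      split_ifs with h
      · rfl
      · by_contra h'
        exact h ((hD m h').trans_le hn)
    · refine ⟨0, fun m => ?_⟩
      rw [map_zero]
      split_ifs with h
      · by_contra h'
        exact hn ((hD m (Ne.symm h')).symm.trans_le h)
      · exact map_zero _
  | add p q hp hq =>
    obtain ⟨p', hp⟩ := hp
    obtain ⟨q', hq⟩ := hq
    refine ⟨p' + q', fun m => ?_⟩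
    rw [map_add, map_add]
    refine (map_add (MvPowerSeries.coeff m) _ _).trans ?_
    rw [hp, hq]
    split_ifs
    · exact (map_add (MvPowerSeries.coeff m) _ _).symm
    · exact add_zero 0

theorem restrict_isSymmetric (f : SymFun k) (n : ℕ) {P : MvPolynomial (Fin n) k}
    (hP : (P : MvPowerSeries (Fin n) k) = restrict k n f) : P.IsSymmetric := by
  intro σ
  ext m
  obtain ⟨x, rfl⟩ : ∃ x, Finsupp.mapDomain σ x = m :=
    ⟨Finsupp.mapDomain σ.symm m, by rw [← Finsupp.mapDomain_comp]; simp⟩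
  rw [MvPolynomial.coeff_rename_mapDomain _ σ.injective, ← MvPolynomial.coeff_coe,
    ← MvPolynomial.coeff_coe, hP, coeff_restrict, coeff_restrict,
    ← coeff_perm f (σ.viaEmbedding Fin.valEmbedding)]
  congr 1
  simp only [Finsupp.embDomain_eq_mapDomain]
  rw [← Finsupp.mapDomain_comp, ← Finsupp.mapDomain_comp]
  exact congrArg (fun g => MvPowerSeries.coeff (Finsupp.mapDomain g x))
    (funext fun i => Equiv.Perm.viaEmbedding_apply σ Fin.valEmbedding i)

/-- For a degree bound `n` of `f`, the finite theorem in `n` variables gives a candidate polynomial.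
It agrees with `f` up to degree `n`, and its parts of higher degree are cut off. -/
theorem ofPoly_surjective : Function.Surjective (ofPoly k) := by
  intro f
  obtain ⟨n, hn⟩ := f.2.1
  have hP : ((MvPowerSeries.truncTotal (n + 1) (restrict k n f) : MvPolynomial (Fin n) k) :
      MvPowerSeries (Fin n) k) = restrict k n f := by
    ext m
    rw [MvPolynomial.coeff_coe]
    by_cases h : m.degree < n + 1
    · exact MvPowerSeries.coeff_truncTotal _ h
    · rw [MvPowerSeries.coeff_truncTotal_eq_zero _ (not_lt.1 h), coeff_restrict]
      by_contra h'
      have := hn _ (Ne.symm h')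
      rw [Finsupp.embDomain_eq_mapDomain, Finsupp.degree_mapDomain] at this
      omega
  obtain ⟨q, hq⟩ := MvPolynomial.esymmAlgHom_fin_surjective k le_rfl
    ⟨_, restrict_isSymmetric f n hP⟩
  obtain ⟨p', hp'⟩ := ofPoly_truncate n (MvPolynomial.rename Fin.val q)
  refine ⟨p', Subtype.ext (MvPowerSeries.ext fun m => ?_)⟩
  rw [hp']
  split_ifs with h
  · refine eq_of_restrict ?_ h
    rw [restrict_ofPoly, hq, hP]
  · by_contra h'
    exact h (hn m fun e => h' e.symm)

/-- Symmetric functions are polynomials in the elementary symmetric functions. -/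
def polyEquiv : MvPolynomial ℕ k ≃ₐ[k] SymFun k :=
  AlgEquiv.ofBijective (ofPoly k) ⟨ofPoly_injective k, ofPoly_surjective⟩

/-- Algebra homomorphisms out of the algebra of symmetric functions. -/
theorem exists_algHom {A : Type*} [Ring A] [Algebra k A] (hA : ∀ x y : A, x * y = y * x)
    (E : ℕ → A) : ∃ β : SymFun k →ₐ[k] A, ∀ r, β (e k (r + 1)) = E r := by
  -- Commutativity of `A` is only a hypothesis; its centre is a commutative ring, into which
  -- polynomials can be evaluated.
  have hc : ∀ x, x ∈ Subalgebra.center k A := fun x => Subalgebra.mem_center_iff.2 fun y => hA y x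
  let β : MvPolynomial ℕ k →ₐ[k] Subalgebra.center k A :=
    MvPolynomial.aeval fun i => ⟨E i, hc _⟩
  refine ⟨((Subalgebra.center k A).val.comp β).comp polyEquiv.symm.toAlgHom, fun r => ?_⟩
  have h : polyEquiv (MvPolynomial.X r) = e k (r + 1) := MvPolynomial.aeval_X _ r
  rw [← h]
  change (β (polyEquiv.symm (polyEquiv (MvPolynomial.X r)))).1 = E r
  rw [AlgEquiv.symm_apply_apply]
  exact congrArg Subtype.val (MvPolynomial.aeval_X _ r)

end SymFun

/-- Bubbles side by side are even, so they exchange heights freely. -/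
theorem bubAlg_comm {z : k} {x y : End (unit z)} (hx : x ∈ bubAlg z) (hy : y ∈ bubAlg z) :
    x * y = y * x := by
  have := isLocal_bub hx
  have := isLocal_bub hy
  refine op_injective ?_
  have h := far (fun a => op a x) (fun a => op a y) 0 0 0 (vac z)
  rw [op_bub_mul, op_bub_mul]
  exact h.symm

/-- The homomorphism from symmetric functions to bubbles. -/
theorem exists_symHom (z : k) : ∃ β : SymFun k →ₐ[k] End (unit z),
    (∀ r, 1 ≤ r → β (SymFun.e k r) = ((-1) ^ (r - 1) * z) • zebL z r) ∧
      ∀ r, 1 ≤ r → β (SymFun.h k r) = z • zebR z r := by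
  obtain ⟨β, hβ⟩ := SymFun.exists_algHom (k := k) (A := bubAlg z)
    (fun x y => Subtype.ext (bubAlg_comm x.2 y.2))
    (fun r => ((-1) ^ r * z) • ⟨zebL z (r + 1), bubL_mem z _⟩)
  have h1 : ∀ r, 1 ≤ r → (β (SymFun.e k r) : End (unit z)) =
      ((-1) ^ (r - 1) * z) • zebL z r := by
    intro r hr
    obtain ⟨r, rfl⟩ : ∃ s, r = s + 1 := ⟨r - 1, by omega⟩
    rw [hβ, Nat.add_sub_cancel]
    rfl
  let δ : ℕ → End (unit z) := fun i => if i = 0 then 1 else 0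
  -- The signs make `ε` the coefficients of the series inverse to that of the `h i`; in terms of
  -- bubbles they are `δ i - z • zebL z i`.
  let ε : ℕ → End (unit z) := fun i => ((-1 : k) ^ i) • (β (SymFun.e k i) : End (unit z))
  let η : ℕ → End (unit z) := fun i => (β (SymFun.h k i) : End (unit z))
  have hε0 : ε 0 = 1 := by
    simp only [ε, SymFun.e_zero, map_one, pow_zero, one_smul]
    rfl
  have hε : ∀ i, ε i = δ i - z • zebL z i := by
    intro i
    cases i with
    | zero => simp only [hε0, δ, if_pos, zebL_zero, smul_zero, sub_zero]
    | succ i =>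
      simp only [ε, δ]
      rw [h1 (i + 1) (Nat.succ_pos i), smul_smul, if_neg (Nat.succ_ne_zero i), zero_sub,
        Nat.add_sub_cancel, ← mul_assoc, ← pow_add, show i + 1 + i = 2 * i + 1 by ring, pow_succ,
        pow_mul, neg_one_sq, one_pow, one_mul, neg_one_mul]
      exact neg_smul z _
  have hs : ∀ n, 0 < n → ∑ p ∈ Finset.HasAntidiagonal.antidiagonal n, ε p.1 * η p.2 = 0 := by
    intro n hn
    have h := congrArg (fun x => (β x : End (unit z))) (SymFun.sum_e_h k hn)
    simp only [map_sum, map_smul, map_mul, map_zero] at h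
    rw [AddSubmonoidClass.coe_finsetSum] at h
    refine Eq.trans (Finset.sum_congr rfl fun p _ => ?_) h
    exact smul_mul_assoc _ _ _
  -- The Grassmannian relation: the series with coefficients `δ i + z • zebR z i` is another inverse
  -- of `ε`.
  have hs' : ∀ n, 0 < n → ∑ p ∈ Finset.HasAntidiagonal.antidiagonal n,
      ε p.1 * (δ p.2 + z • zebR z p.2) = 0 := by
    intro n hn
    have e1 : ∀ g : ℕ → End (unit z), ∑ p ∈ Finset.HasAntidiagonal.antidiagonal n,
        δ p.1 * g p.2 = g n := by
      intro g
      rw [Finset.sum_eq_single (0, n)]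
      · simp [δ]
      · intro p hp hne
        rw [Finset.HasAntidiagonal.mem_antidiagonal] at hp
        have : p.1 ≠ 0 := fun h => hne (Prod.ext h (by simp only; omega))
        simp [δ, this]
      · intro h
        exact absurd (Finset.HasAntidiagonal.mem_antidiagonal.2 (zero_add n)) h
    have e2 : ∀ g : ℕ → End (unit z), ∑ p ∈ Finset.HasAntidiagonal.antidiagonal n,
        g p.1 * δ p.2 = g n := by
      intro g
      rw [Finset.sum_eq_single (n, 0)]
      · simp [δ]
      · intro p hp hne
        rw [Finset.HasAntidiagonal.mem_antidiagonal] at hp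
        have : p.2 ≠ 0 := fun h => hne (Prod.ext (by simp only; omega) h)
        simp [δ, this]
      · intro h
        exact absurd (Finset.HasAntidiagonal.mem_antidiagonal.2 (add_zero n)) h
    simp only [hε, mul_add, Finset.sum_add_distrib]
    rw [e2 fun i => δ i - z • zebL z i]
    simp only [sub_mul, Finset.sum_sub_distrib]
    rw [e1 fun i => z • zebR z i, grassmannian]
    simp only [smul_mul_assoc, mul_smul_comm, ← Finset.smul_sum, smul_add]
    simp only [δ, if_neg hn.ne']
    abel
  -- Inverse series are unique since `ε 0 = 1`; the recursion compares the coefficients one degree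
  -- at a time.
  have hη : ∀ n, η n = δ n + z • zebR z n := by
    intro n
    induction n using Nat.strong_induction_on with
    | _ n ih =>
      rcases Nat.eq_zero_or_pos n with rfl | hn
      · simp only [η, δ, SymFun.h_zero, map_one, if_pos, zebR_zero, smul_zero, add_zero]
        rfl
      · have h := (hs n hn).trans (hs' n hn).symm
        rw [← sub_eq_zero, ← Finset.sum_sub_distrib, Finset.sum_eq_single (0, n)] at h
        · rw [← mul_sub, hε0, one_mul, sub_eq_zero] at h
          exact h
        · intro p hp hne
          rw [Finset.HasAntidiagonal.mem_antidiagonal] at hp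
          have : p.2 < n := by
            by_contra h'
            exact hne (Prod.ext (by simp only; omega) (by simp only; omega))
          rw [ih _ this, sub_self]
        · intro h
          exact absurd (Finset.HasAntidiagonal.mem_antidiagonal.2 (zero_add n)) h
  refine ⟨(bubAlg z).val.comp β, h1, fun r hr => (hη r).trans ?_⟩
  simp only [δ]
  rw [if_neg (by omega), zero_add]

/-- Dividing by `z` recovers the clockwise zebra bubbles from the `h r`, and every clockwise bubble
is zero or one of these up to sign. -/
theorem bubAlg_le_range {z : k} (hz : IsUnit z) {β : SymFun k →ₐ[k] End (unit z)}
    (hβ : ∀ r, 1 ≤ r → β (SymFun.h k r) = z • zebR z r) : bubAlg z ≤ β.range := by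
  have h : ∀ n, 0 < n → zebR z n ∈ β.range := by
    intro n hn
    obtain ⟨y, hy⟩ := hz.exists_left_inv
    refine ⟨y • SymFun.h k n, ?_⟩
    change β _ = _
    rw [map_smul, hβ n hn, smul_smul, hy, one_smul]
  refine Algebra.adjoin_le ?_
  rintro _ ⟨Z, rfl⟩
  rcases exists_bubR_alt z Z with h0 | ⟨n, hn, h1 | h1⟩
  · rw [h0]
    exact zero_mem _
  · rw [h1]
    exact h n hn
  · rw [h1]
    exact neg_mem (h n hn)

/-! ### Chords joining neighbouring points -/

namespace NilBrauer
variable {M : Type*} (S : NilBrauer M)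

/-- A chord that crosses both legs of a cup. -/
theorem bad_I_u {i m a : ℕ} (h : i ≤ a) (h' : a + 1 < i + m) (v : M) :
    S.Bad (S.I i m (S.u a v)) := by
  induction m with
  | zero => omega
  | succ m ih =>
    by_cases h2 : a + 1 < i + m
    · exact S.bad_T _ (ih h2)
    · obtain ⟨m, rfl⟩ : ∃ m', m = m' + 1 := ⟨m - 1, by omega⟩
      obtain rfl : a = i + m := by omega
      rw [I_succ, I_succ, ← S.u_I_of_gt le_rfl, show i + 1 + (m + 1) = i + m + 1 + 1 by omega,
        show i + 1 + m = i + m + 1 by omega, show i + m + 2 = i + m + 1 + 1 by omega,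
        ← S.cup_slide]
      exact S.bad_T_T _ _

/-- A chord joining neighbouring points can be drawn as a cup. -/
theorem cup_of_mate : ∀ {a b : ℕ} {ν : Code}, ν.Valid b → ν.mate a = a + 1 →
    (∃ ν' : Code, ν'.length + 1 = ν.length ∧ ν'.Valid 0 ∧ S.NF ν = S.u a (S.NF ν')) ∨
      S.Bad (S.NF ν)
  | a, _, [], _, h => absurd (show a = a + 1 from h) (by omega)
  | a, b, (i, m) :: ν, ⟨hb, hν⟩, h => by
    obtain ⟨h1, h2, h3⟩ := chordMate_spec i m (Code.mate ν)
    have hcup : ∀ {w : M}, S.Normal 0 ν.length w → S.I i m (S.NF ν) = S.u a w →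
        (∃ ν' : Code, ν'.length + 1 = ν.length + 1 ∧ ν'.Valid 0 ∧
          S.I i m (S.NF ν) = S.u a (S.NF ν')) ∨ S.Bad (S.I i m (S.NF ν)) := by
      rintro w (h | ⟨ν', h1, h2, rfl⟩) hw
      · exact Or.inr (hw ▸ S.bad_u a h)
      · exact Or.inl ⟨ν', by omega, h2, hw⟩
    change chordMate i m (Code.mate ν) a = a + 1 at h
    change (∃ ν' : Code, ν'.length + 1 = ν.length + 1 ∧ ν'.Valid 0 ∧
      S.I i m (S.NF ν) = S.u a (S.NF ν')) ∨ S.Bad (S.I i m (S.NF ν))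
    rcases eq_or_emb i m a with rfl | rfl | ⟨q, rfl⟩
    · rw [h1] at h
      obtain rfl : m = 0 := by omega
      exact Or.inl ⟨ν, rfl, hν.mono (Nat.zero_le _), rfl⟩
    · rw [h2] at h
      omega
    · rw [h3] at h
      have hq : Code.mate ν q = q + 1 := by
        unfold emb at h
        split_ifs at h <;> omega
      have hq' : emb i m q + 1 = emb i m (q + 1) := by rw [← hq, h]
      rcases cup_of_mate hν hq with ⟨ν', h4, h5, h6⟩ | h4
      · have hN : S.Normal 0 ν'.length (S.NF ν') := Or.inr ⟨ν', rfl, h5, rfl⟩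
        -- The points `q` and `q + 1` remain neighbours, so no end of the new chord lies between
        -- them: both are to its left, both inside, or both to its right.
        have h7 : q + 2 ≤ i ∨ i ≤ q ∧ q + 1 < i + m ∨ i + m ≤ q := by
          unfold emb at hq'
          split_ifs at hq' <;> omega
        rcases h7 with h7 | h7 | h7
        · obtain ⟨i, rfl⟩ : ∃ i', i = i' + 2 := ⟨i - 2, by omega⟩
          refine hcup (w := S.I i m (S.NF ν')) ?_ ?_
          · rw [← h4]
            exact hN.I i m
          · rw [h6, S.I_u_of_le (by omega), emb, if_pos (by omega)]
        · rw [h6]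
          exact Or.inr (S.bad_I_u h7.1 h7.2 _)
        · refine hcup (w := S.I i m (S.NF ν')) ?_ ?_
          · rw [← h4]
            exact hN.I i m
          · rw [h6, emb, if_neg (by omega), if_neg (by omega), S.u_I_of_gt h7]
      · exact Or.inr (S.bad_I h4)

end NilBrauer

theorem nf_sub_opu_mem {z : k} {ν : Code} (h : ν.Valid 0) {a : ℕ} (ha : ν.mate a = a + 1) :
    (∃ ν' : Code, ν'.length + 1 = ν.length ∧ ν'.cross = ν.cross ∧ ν'.Valid 0 ∧
      nf z ν - opu z a (nf z ν') ∈ Low z ν.cross) ∨ nf z ν ∈ Low z ν.cross := by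
  have := (nilBrauer z Unit).cup_of_mate h ha
  rw [PreDiagram.mk_nf] at this
  obtain ⟨h1, h2, h3⟩ := PreDiagram.nf_spec (z := z) (α := Unit) ν
  rw [← h1, ← h3]
  rcases this with ⟨ν', h4, h5, h6⟩ | h
  · rw [PreDiagram.mk_nf] at h6
    obtain ⟨h1', h2', h3'⟩ := PreDiagram.nf_spec (z := z) (α := Unit) ν'
    obtain ⟨h7, -, -, h8⟩ := Quotient.exact h6
    refine Or.inl ⟨ν', h4, ?_, h5, h3' ▸ h8⟩
    rw [← h1', h7]
    rfl
  · exact Or.inr h.1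

/-! ## Spanning -/

section
variable {z : k} {n : ℕ}

/-- The span of normal forms with at most `n` crossings, decorated with tokens and bubbles. -/
def NSpan (z : k) (n : ℕ) : Submodule k (Vec z) :=
  Submodule.span k {v | ∃ w ∈ bubAlg z, ∃ F ∈ tokAlg z Set.univ, ∃ ν : Code, ν.Valid 0 ∧
    ν.cross ≤ n ∧ v = op 0 w (F (nf z ν))}

theorem nSpan_mono {m : ℕ} (h : m ≤ n) : NSpan z m ≤ NSpan z n :=
  Submodule.span_mono fun _ ⟨w, hw, F, hF, ν, h1, h2, h3⟩ => ⟨w, hw, F, hF, ν, h1, h2.trans h, h3⟩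

theorem nSpan_map {m : ℕ} (G : Module.End k (Vec z)) (M : Submodule k (Vec z))
    (h : ∀ w ∈ bubAlg z, ∀ F ∈ tokAlg z Set.univ, ∀ ν : Code, ν.Valid 0 → ν.cross ≤ m →
      G (op 0 w (F (nf z ν))) ∈ M) {v : Vec z} (hv : v ∈ NSpan z m) : G v ∈ M := by
  have : NSpan z m ≤ M.comap G := Submodule.span_le.2 (by
    rintro _ ⟨w, hw, F, hF, ν, h1, h2, rfl⟩
    exact h w hw F hF ν h1 h2)
  exact this hv

theorem nSpan_bub {w : End (unit z)} (hw : w ∈ bubAlg z) {v : Vec z} (hv : v ∈ NSpan z n) :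
    op 0 w v ∈ NSpan z n := by
  refine nSpan_map (op 0 w) _ (fun w' hw' F hF ν h1 h2 => ?_) hv
  rw [← Module.End.mul_apply (op 0 w), ← op_bub_mul]
  exact Submodule.subset_span ⟨_, mul_mem hw hw', F, hF, ν, h1, h2, rfl⟩

theorem nSpan_tok {F : Module.End k (Vec z)} (hF : F ∈ tokAlg z Set.univ) {v : Vec z}
    (hv : v ∈ NSpan z n) : F v ∈ NSpan z n := by
  refine nSpan_map F _ (fun w hw F' hF' ν h1 h2 => ?_) hv
  have h := LinearMap.congr_fun (op_bub_tokAlg hw 0 hF) (F' (nf z ν))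
  rw [Module.End.mul_apply, Module.End.mul_apply] at h
  rw [← h]
  exact Submodule.subset_span ⟨w, hw, F * F', mul_mem hF hF', ν, h1, h2, rfl⟩

theorem nf_mem_nSpan {ν : Code} (hν : ν.Valid 0) (h : ν.cross ≤ n) : nf z ν ∈ NSpan z n := by
  have h1 : (op 0 (1 : End (unit z)) : Module.End k (Vec z)) (nf z ν) = nf z ν :=
    funext fun W => op_id_apply (P := []) _ [] W rfl rfl
  exact Submodule.subset_span ⟨1, one_mem _, 1, one_mem _, ν, hν, h, h1.symm⟩

/-- Tokens at one of two positions suffice if they can be moved there. -/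
theorem tokAlg_pair {p q : ℕ} (hpq : p ≠ q) {w : Vec z} (h1 : ∀ s, tok z s q w = tok z s p w)
    (h2 : ∀ x, pr z x q w = pr z x.dual p w) {G : Module.End k (Vec z)}
    (hG : G ∈ tokAlg z {p, q}) : ∃ F ∈ tokAlg z {p}, G w = F w := by
  let N : Submodule k (Vec z) := (Subalgebra.toSubmodule (tokAlg z {p})).map (LinearMap.applyₗ w)
  have hq : q ∉ ({p} : Set ℕ) := hpq.symm
  have hm : ∀ F ∈ tokAlg z {p}, F w ∈ N := fun F hF => ⟨F, hF, rfl⟩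
  have hN : ∀ x ∈ N, G x ∈ N := by
    induction hG using Algebra.adjoin_induction with
    | mem F hF =>
      rintro _ ⟨F', hF', rfl⟩
      change F (F' w) ∈ N
      rcases hF with ⟨s, r, (rfl | rfl), rfl⟩ | ⟨x, r, (rfl | rfl), rfl⟩
      · exact hm (_ * _) (mul_mem (tok_mem_tokAlg s rfl) hF')
      · obtain ⟨F'', hF'', e⟩ := exists_tok_comm s hq hF'
        have e := LinearMap.congr_fun e w
        rw [Module.End.mul_apply, Module.End.mul_apply, h1] at e
        rw [e]
        exact hm (_ * _) (mul_mem hF'' (tok_mem_tokAlg s rfl))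
      · exact hm (_ * _) (mul_mem (pr_mem_tokAlg x rfl) hF')
      · obtain ⟨F'', hF'', e⟩ := pr_comm_tokAlg x r hF'
        have e := LinearMap.congr_fun e w
        rw [Module.End.mul_apply, Module.End.mul_apply, h2] at e
        rw [e]
        exact hm (_ * _) (mul_mem hF'' (pr_mem_tokAlg _ rfl))
    | algebraMap r => exact fun x hx => N.smul_mem r hx
    | add F F' _ _ h h' => exact fun x hx => add_mem (h x hx) (h' x hx)
    | mul F F' _ _ h h' => exact fun x hx => h _ (h' x hx)
  obtain ⟨F, hF, e⟩ := hN w (hm 1 (one_mem _))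
  exact ⟨F, hF, e.symm⟩

/-- On an upward letter the projections act by one or zero, so only words in the two tokens remain.
-/
theorem tokAlg_up {p : ℕ} {w : Vec z} (hw : pr z up p w = w) {G : Module.End k (Vec z)}
    (hG : G ∈ tokAlg z {p}) : G w ∈ Submodule.span k (Set.range fun Z => opW z Z p w) := by
  let K := Submodule.span k (Set.range fun Z => opW z Z p w)
  have hN : ∀ x ∈ K, G x ∈ K := by
    induction hG using Algebra.adjoin_induction with
    | mem F hF =>
      intro x hx
      refine (Submodule.span_le (p := K.comap F)).2 ?_ hx
      rintro _ ⟨Z, rfl⟩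
      change F (opW z Z p w) ∈ K
      rw [← pr_opW]
      rcases hF with ⟨s, r, rfl, rfl⟩ | ⟨y, r, rfl, rfl⟩
      · rw [tok_pr_up]
        exact Submodule.subset_span ⟨s :: Z, rfl⟩
      · cases y with
        | up =>
          rw [pr_pr, pr_opW]
          exact Submodule.subset_span ⟨Z, rfl⟩
        | down =>
          rw [pr_pr_ne z _ _ (by simp)]
          exact zero_mem _
    | algebraMap r => exact fun x hx => K.smul_mem r hx
    | add F F' _ _ h h' => exact fun x hx => add_mem (h x hx) (h' x hx)
    | mul F F' _ _ h h' => exact fun x hx => h _ (h' x hx)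
  refine hN w (Submodule.subset_span ⟨[], hw⟩)

/-- A closed string with tokens. -/
theorem nSpan_opn_opu (a : ℕ) {v : Vec z} (hv : v ∈ NSpan z n) {G : Module.End k (Vec z)}
    (hG : G ∈ tokAlg z {a, a + 1}) : opn z a (G (opu z a v)) ∈ NSpan z n := by
  have hM : ∀ F ∈ tokAlg z Set.univ, ∀ x ∈ NSpan z n, F x ∈ NSpan z n :=
    fun F hF x hx => nSpan_tok hF hx
  have hB : ∀ w ∈ bubAlg z, op a w v ∈ NSpan z n := fun w hw =>
    op_bub_mem hM (fun w hw x hx => nSpan_bub hw hx) a w hw v hv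
  -- The loop has one upward leg in each orientation. All tokens are gathered there, after which
  -- closing the loop gives a bubble, which moves to the far left.
  have key : ∀ (p q : ℕ) (w : Vec z), p ≠ q → (∀ s, tok z s q w = tok z s p w) →
      (∀ x, pr z x q w = pr z x.dual p w) → pr z up p w = w → G ∈ tokAlg z {p, q} →
      (∀ Z, opn z a (opW z Z p w) ∈ NSpan z n) → opn z a (G w) ∈ NSpan z n := by
    intro p q w h1 h2 h3 h4 h5 h6
    obtain ⟨F, hF, e⟩ := tokAlg_pair h1 h2 h3 h5
    rw [e]
    refine (Submodule.span_le (p := (NSpan z n).comap (opn z a))).2 ?_ (tokAlg_up h4 hF)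
    rintro _ ⟨Z, rfl⟩
    exact h6 Z
  have h1 : ∀ y s, tok z s (a + 1) (pr z y a (opu z a v)) = tok z s a (pr z y a (opu z a v)) := by
    intro y s
    have e1 := LinearMap.congr_fun (tok_pr_comm (z := z) s y (a + 1) a) (opu z a v)
    have e2 := LinearMap.congr_fun (tok_pr_comm (z := z) s y a a) (opu z a v)
    rw [Module.End.mul_apply, Module.End.mul_apply] at e1 e2
    rw [e1, e2, tok_opu]
  have h2 : ∀ y x, pr z x (a + 1) (pr z y a (opu z a v)) =
      pr z x.dual a (pr z y a (opu z a v)) := by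
    intro y x
    rw [pr_comm, pr_comm (a := a) (b := a), pr_opu x.dual, Arrow.dual_dual]
  have h3 : opu z a v = opQ z a v + opQ' z a v := rfl
  rw [h3, map_add, map_add]
  refine add_mem ?_ ?_
  · refine key a (a + 1) _ (by omega) ?_ ?_ (opQ_pr z a v).1 hG fun Z => ?_
    · rw [← pr_up_opu]
      exact h1 up
    · rw [← pr_up_opu]
      exact h2 up
    · rw [← pr_opW, opn_pr_ud, ← op_bubR]
      exact hB _ (Algebra.subset_adjoin ⟨Z, rfl⟩)
  · refine key (a + 1) a _ (by omega) ?_ ?_ (opQ'_pr z a v).2 (by rwa [Set.pair_comm]) fun Z => ?_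
    · rw [← pr_down_opu]
      exact fun s => (h1 down s).symm
    · rw [← pr_down_opu]
      intro x
      rw [h2, Arrow.dual_dual]
    · rw [← pr_opW, opn_pr_succ_up, ← op_bubL]
      exact hB _ (bubL_mem z Z)

variable (hL : ∀ m ≤ n, Low z m ≤ NSpan z n)
include hL

/-- The hypothesis `hL` says that diagrams with fewer than `n` crossings are already spanned, so
equalities modulo lower terms suffice. -/
theorem nSpan_of_isNormal {l : ℕ} {v : Vec z} (h : IsNormal l v) (hl : l ≤ n) : v ∈ NSpan z n := by
  rcases h with h | ⟨ν, rfl, h2, h3⟩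
  · exact hL l hl h
  · rw [← sub_add_cancel v (nf z ν)]
    exact add_mem (hL _ hl h3) (nf_mem_nSpan h2 hl)

theorem nSpan_opT {m : ℕ} (hm : m + 1 ≤ n) (a : ℕ) {v : Vec z} (hv : v ∈ NSpan z m) :
    opT z a v ∈ NSpan z n := by
  refine nSpan_map (opT z a) _ (fun w hw F hF ν h1 h2 => ?_) hv
  rw [← (op_bub_far (F := opT z) hw a 0 _).1 (Nat.zero_le a)]
  refine nSpan_bub hw ?_
  obtain ⟨F', hF', h⟩ := exists_opT_comm a hF
  rw [← sub_add_cancel (opT z a (F (nf z ν))) (F' (opT z a (nf z ν)))]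
  exact add_mem (hL _ (by omega) (h _ _ (nf_mem ν)))
    (nSpan_tok hF' (nSpan_of_isNormal hL (isNormal_opT h1 a) (by omega)))

theorem nSpan_opu (a : ℕ) {v : Vec z} (hv : v ∈ NSpan z n) : opu z a v ∈ NSpan z n := by
  refine nSpan_map (opu z a) _ (fun w hw F hF ν h1 h2 => ?_) hv
  rw [← (op_bub_far (F := opu z) hw a 0 _).1 (Nat.zero_le a)]
  refine nSpan_bub hw ?_
  obtain ⟨F', hF', h⟩ := exists_opu_comm a hF
  have h := LinearMap.congr_fun h (nf z ν)
  rw [Module.End.mul_apply, Module.End.mul_apply] at h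
  rw [h]
  exact nSpan_tok hF' (nSpan_of_isNormal hL (isNormal_opu h1 a) h2)

/-- Tokens away from the cap pass it. If the cap closes a chord, the tokens on it become a bubble;
otherwise the tokens at the two capped ends slide to the other ends of their strings before the cap
is applied. -/
theorem nSpan_opn (a : ℕ) {v : Vec z} (hv : v ∈ NSpan z n) : opn z a v ∈ NSpan z n := by
  refine nSpan_map (opn z a) _ (fun w hw F hF ν h1 h2 => ?_) hv
  rw [← (op_bub_far (F := opn z) hw a 0 _).1 (Nat.zero_le a)]
  refine nSpan_bub hw ?_
  refine tokAlg_apply_induction (P := {a, a + 1}) ((NSpan z n).comap (opn z a)) (nf z ν)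
    (fun F hF G hG => ?_) hF
  obtain ⟨F', hF', h⟩ := exists_opn_comm a hF
  have h := LinearMap.congr_fun h (G (nf z ν))
  rw [Module.End.mul_apply, Module.End.mul_apply] at h
  change opn z a (F (G (nf z ν))) ∈ NSpan z n
  rw [h]
  refine nSpan_tok hF' ?_
  have hlow : ∀ {x : Vec z}, x ∈ Low z ν.cross → opn z a (G x) ∈ NSpan z n := fun hx =>
    hL _ h2 (low_opn a (low_tokAlg hG hx))
  by_cases hloop : ν.mate a = a + 1
  · rcases nf_sub_opu_mem (z := z) h1 hloop with ⟨ν', h3, h4, h5, h6⟩ | h3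
    · rw [← sub_add_cancel (nf z ν) (opu z a (nf z ν')), map_add, map_add]
      exact add_mem (hlow h6) (nSpan_opn_opu a (nf_mem_nSpan h5 (h4.trans_le h2)) hG)
    · exact hlow h3
  rcases inRange_or_nf_eq_zero (z := z) ν with hr | h0
  swap
  · exact hlow (h0 ▸ zero_mem _)
  -- Here the word has no letter at position `a + 1`, so there is nothing to cap.
  by_cases ha : 2 * ν.length < a + 2
  · have h3 : ∀ x, pr z x (a + 1) (G (nf z ν)) = 0 := by
      intro x
      obtain ⟨G', -, e⟩ := pr_comm_tokAlg x (a + 1) hG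
      have e := LinearMap.congr_fun e (nf z ν)
      rw [Module.End.mul_apply, Module.End.mul_apply,
        (nf_isLen ν).local_eq_zero (F := pr z x) (by omega), map_zero] at e
      exact e
    rw [← opn_prLen_succ, prLen_apply, h3, h3, add_zero, map_zero]
    exact zero_mem _
  have hs := hr.slides z
  have hm := hr.isMatching
  obtain ⟨h3, h4, h5⟩ := hm a (by omega)
  obtain ⟨h3', h4', h5'⟩ := hm (a + 1) (by omega)
  have h6 : ν.mate (a + 1) ≠ a := fun h => hloop (by rw [← h4', h])
  -- The mates of the two capped points are neither `a` nor `a + 1`, so the tokens leave the range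
  -- of the cap.
  obtain ⟨F, hF, h⟩ := tokAlg_transfer (l := ν.cross) (μ := ν.mate) (v := nf z ν) (P := {a, a + 1})
    (Q := {a, a + 1}ᶜ) (by rintro s p (rfl | rfl) <;> exact hs.tok s _ (by omega))
    (by rintro x p (rfl | rfl) <;> exact hs.pr x _ (by omega))
    (by
      rintro p (rfl | rfl)
      · simp [h5, hloop]
      · simp [h5', h6]) hG
  rw [← sub_add_cancel (G (nf z ν)) (F (nf z ν)), map_add]
  refine add_mem (hL _ h2 (low_opn a h)) ?_
  obtain ⟨F', hF', h'⟩ := exists_opn_comm a hF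
  have h' := LinearMap.congr_fun h' (nf z ν)
  rw [Module.End.mul_apply, Module.End.mul_apply] at h'
  rw [h']
  refine nSpan_tok hF' ?_
  rcases isNormal_opn (z := z) h1 a with h7 | ⟨ν', h7, h8, h9, h10⟩ | h7
  · exact nSpan_of_isNormal hL h7 h2
  · rw [← sub_add_cancel (nf z ν) (opu z a (nf z ν')), map_add]
    exact add_mem (hL _ h2 (low_opn a h10))
      (nSpan_opn_opu (G := 1) a (nf_mem_nSpan h9 (h8.trans_le h2)) (one_mem _))
  · exact hL _ h2 (low_opn a h7)

end

section
variable {z : k}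

/-- Only a crossing raises the degree and calls on monomials of lower degree; the other operations
stay within degree `m`. -/
theorem mon_mem_nSpan {m : ℕ} {v : Vec z} (h : Mon z m v) : (∀ i ≤ m, Low z i ≤ NSpan z m) →
    (∀ i < m, ∀ v, Mon z i v → v ∈ NSpan z i) → v ∈ NSpan z m := by
  induction h with
  | vac => exact fun _ _ => nf_mem_nSpan (ν := []) trivial le_rfl
  | opT a h _ => exact fun hL h' => nSpan_opT hL le_rfl a (h' _ (Nat.lt_succ_self _) _ h)
  | opu a _ ih => exact fun hL h' => nSpan_opu hL a (ih hL h')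
  | opn a _ ih => exact fun hL h' => nSpan_opn hL a (ih hL h')
  | tok s a _ ih => exact fun hL h' => nSpan_tok (tok_mem_tokAlg s (Set.mem_univ a)) (ih hL h')
  | pr x a _ ih => exact fun hL h' => nSpan_tok (pr_mem_tokAlg x (Set.mem_univ a)) (ih hL h')

/-- Every linear combination of diagrams is a linear combination of decorated normal forms. -/
theorem low_le_nSpan (n : ℕ) : Low z (n + 1) ≤ NSpan z n := by
  have key : ∀ m, ∀ v, Mon z m v → v ∈ NSpan z m := by
    intro m
    induction m using Nat.strong_induction_on with
    | _ m ih =>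
      intro v hv
      refine mon_mem_nSpan hv (fun i hi => Submodule.span_le.2 ?_) ih
      rintro x ⟨j, hj, hx⟩
      exact nSpan_mono (by omega) (ih j (by omega) x hx)
  refine Submodule.span_le.2 ?_
  rintro x ⟨j, hj, hx⟩
  exact nSpan_mono (by omega) (key j x hx)

end

/-! ## Bending the source of a morphism to the top -/

section
variable {z : k} {n : ℕ} {v : Vec z}

theorem op_zero_vac {W : Word} (f : unit z ⟶ obj z W) : op 0 f (vac z) W = f := by
  have h : W = [] ++ (W ++ []) := by simp
  refine eq_of_heq ((vec_heq (op 0 f (vac z)) h).trans ?_)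
  rw [op_apply (a := 0) f (vac z) (A := []) [] rfl, whisker, unit_tens]
  exact (heq_of_eq (Category.id_comp _)).trans (tens_unit_heq f)

theorem op_id_nil_succ (a : ℕ) (v : Vec z) : op (a + 1) (𝟙 (unit z)) v = prLen z a v := by
  funext W
  rw [prLen_apply]
  by_cases h : a < W.length
  · rw [op_id_apply (P := []) v (W.take (a + 1)) (W.drop (a + 1)) (by simp; omega) (by simp)]
    have h1 := List.getElem?_eq_getElem h
    cases h2 : W[a] <;> rw [h2] at h1
    · rw [Pi.add_apply, pr_apply_of_get _ h1, pr_apply_of_ne _ (by simp [h1]), add_zero]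
    · rw [Pi.add_apply, pr_apply_of_get _ h1, pr_apply_of_ne _ (by simp [h1]), zero_add]
  · have h1 : W[a]? = none := List.getElem?_eq_none (by omega)
    rw [Pi.add_apply, pr_apply_of_ne _ (by simp [h1]), pr_apply_of_ne _ (by simp [h1]), add_zero]
    refine op_apply_eq_zero _ _ ?_
    rintro ⟨A, B, hA, rfl⟩
    simp at h
    omega

theorem low_op_id (X : Word) (a : ℕ) (hv : v ∈ Low z n) : op a (mor z (.id X)) v ∈ Low z n := by
  induction X generalizing a with
  | nil =>
    cases a with
    | zero =>
      have : op 0 (mor z (.id [])) v = v := funext fun W => op_id_apply v [] W rfl rfl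
      rwa [this]
    | succ a => exact op_id_nil_succ a v ▸ low_prLen a hv
  | cons x X ih =>
    have h : op a (mor z (.id (x :: X))) v = pr z x a (op (a + 1) (mor z (.id X)) v) := by
      rw [pr, ← Module.End.mul_apply, ← op_tens a (b := a + 1) (mor z (.id [x])) (mor z (.id X)) rfl]
      exact congrArg (fun f => op a f v) (tens_id z [x] X).symm
    rw [h]
    exact low_pr x a (ih _)

theorem near_low {f g : Module.End k (Vec z)} (h : Near f g) (hv : v ∈ Low z n) :
    g v ∈ Low z (n + 1) := by
  obtain ⟨h1, h2⟩ := h n v hv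
  rw [← sub_sub_self (f v) (g v)]
  exact sub_mem h1 (low_mono (Nat.le_succ n) h2)

/-- Every generator is a monomial operator restricted to one orientation, up to lower terms. No
control of the resulting degree is needed. -/
theorem exists_op_mem_low {P Q : Word} (d : Diag P Q) : ∀ (n a : ℕ) (v : Vec z), v ∈ Low z n →
    ∃ m, op a (mor z d) v ∈ Low z m := by
  induction d with
  | gen g =>
    intro n a v hv
    cases g with
    | posUp => exact ⟨n + 1, low_opTc up up a hv⟩
    | negUp => exact ⟨n + 1, near_low (near_opTn up up a) hv⟩
    | negRight => exact ⟨n + 1, near_low (near_opTn up down a) hv⟩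
    | leftCap => exact ⟨n, low_opE a hv⟩
    | leftCup => exact ⟨n, low_opQ a hv⟩
    | closedTok => exact ⟨n, low_opU true a hv⟩
    | openTok => exact ⟨n, low_opU false a hv⟩
  | id X => exact fun n a v hv => ⟨n, low_op_id X a hv⟩
  | comp f g hf hg =>
    intro n a v hv
    obtain ⟨m, hm⟩ := hg n a v hv
    obtain ⟨m', hm'⟩ := hf m a _ hm
    exact ⟨m', by rwa [op_mor_comp]⟩
  | tensor f g hf hg =>
    intro n a v hv
    obtain ⟨m, hm⟩ := hg n _ v hv
    obtain ⟨m', hm'⟩ := hf m a _ hm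
    exact ⟨m', by rwa [op_mor_tensor]⟩

/-- All morphisms are linear combinations of monomials. -/
theorem exists_low_apply_eq {W : Word} (f : unit z ⟶ obj z W) : ∃ n, ∃ v ∈ Low z n, v W = f := by
  induction f using mor_induction with
  | h0 => exact ⟨0, 0, zero_mem _, rfl⟩
  | hadd f g hf hg =>
    obtain ⟨n, v, hv, rfl⟩ := hf
    obtain ⟨m, w, hw, rfl⟩ := hg
    exact ⟨max n m, v + w, add_mem (low_mono (le_max_left _ _) hv) (low_mono (le_max_right _ _) hw),
      rfl⟩
  | hsmul c d =>
    obtain ⟨n, hn⟩ := exists_op_mem_low d 1 0 (vac z) (Mon.vac.mem_low Nat.zero_lt_one)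
    exact ⟨n, c • op 0 (mor z d) (vac z), low_smul c hn, congrArg (c • ·) (op_zero_vac (mor z d))⟩

end

variable (z : k)

/-- Nested cups. -/
def cups : ℕ → Vec z
  | 0 => vac z
  | N + 1 => opu z N (cups N)

/-- The dual word. -/
def dualWord (X : Word) : Word := (X.map Arrow.dual).reverse

theorem dualWord_length (X : Word) : (dualWord X).length = X.length := by simp [dualWord]

theorem dualWord_cons (x : Arrow) (X : Word) : dualWord (x :: X) = dualWord X ++ [x.dual] := by
  simp [dualWord]

/-- Bend the source to the top left. -/
def bend (X Y : Word) : (obj z X ⟶ obj z Y) →ₗ[k] (unit z ⟶ obj z (dualWord X ++ Y)) where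
  toFun f := op X.length f (cups z X.length) (dualWord X ++ Y)
  map_add' f g := by rw [op_add]; rfl
  map_smul' c f := by rw [op_smul]; rfl

variable {z}

theorem opu_apply_of_get {a : ℕ} (v : Vec z) {W : Word} (x : Arrow) (h : W[a]? = some x) :
    opu z a v W = op a (Piece.eval z (.cup x)) v W := by
  rw [← pr_apply_of_get (opu z a v) h]
  cases x
  · rw [pr_up_opu]; rfl
  · rw [pr_down_opu]; rfl

theorem tens_comp_even {X Y X' Y' : Word} (f : obj z X ⟶ obj z Y) {g : obj z X' ⟶ obj z Y'}
    (hg : g ∈ parityPart z X' Y' 0) : tens z f (𝟙 _) ≫ tens z (𝟙 _) g = tens z f g := by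
  induction f using mor_induction with
  | h0 => simp only [zero_tens, Limits.zero_comp]
  | hadd a b ha hb => simp only [add_tens, Preadditive.add_comp, ha, hb]
  | hsmul c d =>
    have h := tens_comp_swap z (mor_mem_parityPart z d rfl) hg
    rw [mul_zero, pow_zero, one_smul] at h
    simp only [smul_tens, Linear.smul_comp, h]

theorem tens_even_comp {X Y X' Y' : Word} {f : obj z X ⟶ obj z Y} (g : obj z X' ⟶ obj z Y')
    (hf : f ∈ parityPart z X Y 0) : tens z f (𝟙 _) ≫ tens z (𝟙 _) g = tens z f g := by
  induction g using mor_induction with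
  | h0 => simp only [tens_zero, Limits.comp_zero]
  | hadd a b ha hb => simp only [tens_add, Preadditive.comp_add, ha, hb]
  | hsmul c d =>
    have h := tens_comp_swap z hf (mor_mem_parityPart z d rfl)
    rw [zero_mul, pow_zero, one_smul] at h
    simp only [tens_smul, Linear.comp_smul, h]

theorem zigzag_up_eq : (tens z (mor z .leftCup) (𝟙 (obj z [up])) :) ≫
    (tens z (𝟙 (obj z [up])) (mor z .leftCap) :) = 𝟙 (obj z [up]) := by
  have h := mor_eq_of_defRel z .zigzag_up
  rw [← mor_comp, ← tens_mor, ← tens_mor] at h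
  exact h

theorem zigzag_down_eq : (tens z (𝟙 (obj z [down])) (mor z .leftCup) :) ≫
    (tens z (mor z .leftCap) (𝟙 (obj z [down])) :) = 𝟙 (obj z [down]) := by
  have h := mor_eq_of_defRel z .zigzag_down
  rw [← mor_comp, ← tens_mor, ← tens_mor] at h
  exact h

/-- Applied to one leg of a left cup, the operator determines the bent morphism, and the left zigzag
recovers `f`. This allows an operator identity to be used as an identity of morphisms. -/
theorem op_injective_up {f : obj z [up] ⟶ obj z [up]} (h : op 0 f = 0) : f = 0 := by
  have h1 : op 0 (mor z .leftCup ≫ tens z f (𝟙 (obj z [down]))) (vac z) [up, down] = 0 := by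
    rw [op_comp, op_tens 0 f _ rfl, h, zero_mul, zero_mul]; rfl
  rw [op_zero_vac (W := [up, down])] at h1
  have h2 : tens z (mor z .leftCup ≫ tens z f (𝟙 (obj z [down]))) (𝟙 (obj z [up])) = 0 :=
    (congrArg (fun g => tens z g (𝟙 (obj z [up]))) h1).trans (zero_tens z _)
  rw [← tens_comp_id_right] at h2
  have h3 : tens z (tens z f (𝟙 (obj z [down]))) (𝟙 (obj z [up])) =
      tens z f (𝟙 (obj z [down, up])) :=
    (eq_of_heq (tens_assoc_heq f (𝟙 (obj z [down])) (𝟙 (obj z [up])))).trans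
      (congrArg (tens z f) (tens_id z [down] [up]))
  have hcap : mor z Diag.leftCap ∈ parityPart z _ _ 0 := mor_mem_parityPart z _ rfl
  have h4 := tens_comp_even f hcap
  have h5 := tens_comp_id_left z f (mor z .leftCap) (𝟙 (unit z))
  rw [Category.comp_id, ← h4, eq_of_heq (tens_unit_heq f)] at h5
  calc f = ((tens z (mor z .leftCup) (𝟙 (obj z [up])) :) ≫
        (tens z (𝟙 (obj z [up])) (mor z .leftCap) :)) ≫ f := by
          rw [zigzag_up_eq]; exact (Category.id_comp f).symm
    _ = (tens z (mor z .leftCup) (𝟙 (obj z [up])) :) ≫ (tens z f (𝟙 (obj z [down, up])) :) ≫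
        (tens z (𝟙 (obj z [up])) (mor z .leftCap) :) :=
          (Category.assoc _ _ _).trans (congrArg (_ ≫ ·) h5)
    _ = 0 := by
      rw [← h3]
      exact (Category.assoc _ _ _).symm.trans ((congrArg (· ≫ _) h2).trans Limits.zero_comp)

theorem zigzag_right_eq : (tens z (𝟙 (obj z [up])) (mor z .rightCup) :) ≫
    (tens z (mor z .rightCap) (𝟙 (obj z [up])) :) = 𝟙 (obj z [up]) := by
  rw [← sub_eq_zero]
  refine op_injective_up (LinearMap.ext fun v => ?_)
  have h1 := op_comp 0 (tens z (𝟙 (obj z [up])) (mor z .rightCup) :)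
    (tens z (mor z .rightCap) (𝟙 (obj z [up])) :)
  have h2 := op_tens 0 (b := 1) (𝟙 (obj z [up])) (mor z .rightCup) rfl
  have h3 := op_tens 0 (b := 2) (mor z .rightCap) (𝟙 (obj z [up])) rfl
  rw [h2, h3] at h1
  rw [op_sub, LinearMap.sub_apply]
  refine (congrArg (· - _) (LinearMap.congr_fun h1 v)).trans ?_
  change opE' z 0 (pr z up 2 (pr z up 0 (opQ' z 1 v))) - pr z up 0 v = 0
  rw [pr_comm, (opQ'_pr z 1 v).2, (opE'_pr z 0 _).1, opE'_opQ'_left, sub_self]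

/-- For either orientation this provides the cup that occurs in `opu` and a cap that undoes it. -/
theorem zigzag_piece (x : Arrow) : ∃ (c : unit z ⟶ obj z [x.dual, x])
    (d : obj z [x, x.dual] ⟶ unit z), d ∈ parityPart z _ _ 0 ∧
    (tens z (𝟙 (obj z [x])) c :) ≫ (tens z d (𝟙 (obj z [x])) :) = 𝟙 (obj z [x]) ∧
    ∀ a v (W : Word), W[a]? = some x.dual → opu z a v W = op a c v W := by
  cases x
  · exact ⟨mor z .rightCup, mor z .rightCap, mor_mem_parityPart z _ rfl, zigzag_right_eq,
      fun a v W hW => opu_apply_of_get v down hW⟩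
  · exact ⟨mor z .leftCup, mor z .leftCap, mor_mem_parityPart z _ rfl, zigzag_down_eq,
      fun a v W hW => opu_apply_of_get v up hW⟩

/-- Bending a single strand is injective. -/
theorem eq_zero_of_bend_one {x y : Arrow} {c : unit z ⟶ obj z [y, x]} {d : obj z [x, y] ⟶ unit z}
    (hd : d ∈ parityPart z _ _ 0)
    (h : (tens z (𝟙 (obj z [x])) c :) ≫ (tens z d (𝟙 (obj z [x])) :) = 𝟙 (obj z [x])) {X Y : Word}
    (f : obj z (x :: X) ⟶ obj z Y)
    (hf : (tens z c (𝟙 (obj z X)) :) ≫ (tens z (𝟙 (obj z [y])) f :) = 0) : f = 0 := by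
  have hxy : (tens z (𝟙 (obj z [x])) (tens z (𝟙 (obj z [y])) f :) :) =
      (tens z (𝟙 (obj z [x, y])) f :) :=
    (eq_of_heq (tens_assoc_heq (𝟙 (obj z [x])) (𝟙 (obj z [y])) f)).symm.trans
      (congrArg (tens z · f) (tens_id z [x] [y]))
  -- The cap `d` is even, so `f` can be pulled below it without a sign.
  have h1 : (tens z d (𝟙 (obj z (x :: X))) :) ≫ f =
      (tens z (𝟙 (obj z [x])) (tens z (𝟙 (obj z [y])) f :) :) ≫ (tens z d (𝟙 (obj z Y)) :) := by
    rw [hxy]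
    have h3 := tens_comp_id_right z (𝟙 (obj z [x, y])) d f
    rw [Category.id_comp] at h3
    have h4 := tens_even_comp f hd
    rw [unit_tens] at h4
    exact h4.trans h3.symm
  have h2 : (tens z (𝟙 (obj z [x])) (tens z c (𝟙 (obj z X)) :) :) ≫
      (tens z d (𝟙 (obj z (x :: X))) :) = 𝟙 (obj z (x :: X)) := by
    have h3 := eq_of_heq (tens_assoc_heq (𝟙 (obj z [x])) c (𝟙 (obj z X)))
    have h4 := eq_of_heq (tens_assoc_heq d (𝟙 (obj z [x])) (𝟙 (obj z X)))
    rw [tens_id] at h4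
    have h5 := tens_comp_id_right z (tens z (𝟙 (obj z [x])) c :) (tens z d (𝟙 (obj z [x])) :)
      (𝟙 (obj z X))
    rw [h] at h5
    exact (congrArg₂ (· ≫ ·) h3.symm h4.symm).trans (h5.trans (tens_id z [x] X))
  have h3 : (tens z (𝟙 (obj z [x])) (tens z c (𝟙 (obj z X)) :) :) ≫
      (tens z (𝟙 (obj z [x])) (tens z (𝟙 (obj z [y])) f :) :) = 0 := by
    have := tens_comp_id_left z (𝟙 (obj z [x])) (tens z c (𝟙 (obj z X)) :)
      (tens z (𝟙 (obj z [y])) f :)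
    exact this.trans ((congrArg (tens z (𝟙 (obj z [x]))) hf).trans (tens_zero z _))
  calc f = 𝟙 (obj z (x :: X)) ≫ f := (Category.id_comp f).symm
    _ = ((tens z (𝟙 (obj z [x])) (tens z c (𝟙 (obj z X)) :) :) ≫
          (tens z d (𝟙 (obj z (x :: X))) :)) ≫ f := congrArg (· ≫ f) h2.symm
    _ = (tens z (𝟙 (obj z [x])) (tens z c (𝟙 (obj z X)) :) :) ≫
          (tens z (𝟙 (obj z [x])) (tens z (𝟙 (obj z [y])) f :) :) ≫ (tens z d (𝟙 (obj z Y)) :) :=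
        (Category.assoc _ _ _).trans (congrArg (_ ≫ ·) h1)
    _ = 0 :=
        (Category.assoc _ _ _).symm.trans ((congrArg (· ≫ _) h3).trans Limits.zero_comp)

/-- Bending the whole source agrees with first bending its leftmost strand by `c` and then bending
the rest; at the given target word the unoriented cup `opu` acts as the oriented cup `c`. -/
theorem bend_cons (x : Arrow) {c : unit z ⟶ obj z [x.dual, x]}
    (hc : ∀ a v (W : Word), W[a]? = some x.dual → opu z a v W = op a c v W) {X Y : Word}
    (f : obj z (x :: X) ⟶ obj z Y) (hf : bend z (x :: X) Y f = 0) :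
    bend z X (x.dual :: Y)
      ((tens z c (𝟙 (obj z X)) :) ≫ (tens z (𝟙 (obj z [x.dual])) f :)) = 0 := by
  have hW : dualWord (x :: X) ++ Y = dualWord X ++ x.dual :: Y := by
    rw [dualWord_cons, List.append_assoc]; rfl
  have hl := dualWord_length X
  obtain ⟨v, hv⟩ : ∃ v, v = cups z X.length := ⟨_, rfl⟩
  have h1 : op (X.length + 1) f (opu z X.length v) (dualWord X ++ x.dual :: Y) = 0 := by
    rw [hv]
    exact eq_of_heq ((vec_heq _ hW.symm).trans ((heq_of_eq hf).trans (by rw [hW])))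
  have h2 := op_comp (z := z) X.length (tens z c (𝟙 (obj z X)) :) (tens z (𝟙 (obj z [x.dual])) f :)
  have h3 := op_tens (z := z) X.length (b := X.length + 1) (𝟙 (obj z [x.dual])) f rfl
  have h4 := op_tens (z := z) X.length (b := X.length) c (𝟙 (obj z X)) rfl
  rw [h3, h4] at h2
  refine (congrFun (LinearMap.congr_fun h2 _) _).trans ?_
  rw [← hv]
  change op X.length (𝟙 (obj z [x.dual])) (op (X.length + 1) f
    (op X.length c (op X.length (𝟙 (obj z X)) v))) (dualWord X ++ x.dual :: Y) = 0
  refine (op_id_apply (P := [x.dual]) _ (dualWord X) Y hl rfl).trans (Eq.trans ?_ h1)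
  refine op_congr f fun A B hA hW' => ?_
  obtain ⟨rfl, hB⟩ : A = dualWord X ++ [x.dual] ∧ Y ++ B = Y := by
    refine (List.append_inj (hW'.symm.trans ?_) ?_)
    · simp
    · simp [hA, hl]
  obtain rfl : B = [] := by simpa using hB
  rw [hc X.length v _ (by rw [← hl]; simp)]
  refine op_congr c fun A' B' hA' hW'' => ?_
  obtain ⟨rfl, hB⟩ : A' = dualWord X ∧ [x.dual, x] ++ B' = [x.dual, x] ++ X := by
    refine (List.append_inj (hW''.symm.trans ?_) ?_)
    · simp
    · simp [hA', hl]
  refine op_id_apply v (dualWord X) [] hl ?_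
  simpa using hB

/-- The strands are unbent one at a time, each by a zigzag. -/
theorem bend_injective (X Y : Word) : Function.Injective (bend z X Y) := by
  refine (injective_iff_map_eq_zero _).2 fun f hf => ?_
  induction X generalizing Y with
  | nil => exact (op_zero_vac f).symm.trans hf
  | cons x X ih =>
    obtain ⟨c, d, hd, h1, h2⟩ := zigzag_piece (z := z) x
    exact eq_zero_of_bend_one hd h1 f (ih _ _ (bend_cons x h2 f hf))

/-! ## String diagrams -/

section
variable (z : k) (α : Type)

/-- Nested cups. -/
def PreDiagram.nest : ℕ → PreDiagram z α
  | 0 => vac z α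
  | M + 1 => (nest M).u M

/-- Add a piece. -/
def Piece.pre : {P Q : Word} → Piece P Q → ℕ → PreDiagram z α → PreDiagram z α
  | _, _, .cross _ _, a, x => x.T a
  | _, _, .cup _, a, x => x.u a
  | _, _, .cap _, a, x => x.n a

/-- The unoriented diagram obtained by bending the source of a string diagram to the top left. -/
def StringDiagram.pre {X : Word} : {Y : Word} → StringDiagram X Y → PreDiagram z α
  | _, .id => PreDiagram.nest z α X.length
  | _, .layer t A p _ _ _ => p.pre z α (X.length + A.length) (pre t)

end

section
variable {z : k} {α : Type}

theorem PreDiagram.nest_spec (M : ℕ) : (nest z α M).deg = 0 ∧ (nest z α M).len = 2 * M ∧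
    (nest z α M).vec = cups z M := by
  induction M with
  | zero => exact ⟨rfl, rfl, rfl⟩
  | succ M ih =>
    obtain ⟨h1, h2, h3⟩ := ih
    refine ⟨h1, ?_, congrArg (opu z M) h3⟩
    change (nest z α M).len + 2 = _
    rw [h2]; push_cast; ring

theorem PreDiagram.nest_shadow (M : ℕ) (c : ℕ → α × Arrow) (A : Multiset (Sym2 α)) :
    (nest z α M).shadow c A ↔ A = 0 ∧ ∀ i < M, c (M + i) = flip (c (M - 1 - i)) := by
  induction M generalizing c with
  | zero => exact ⟨fun h => ⟨h, fun i hi => absurd hi (Nat.not_lt_zero i)⟩, fun h => h.1⟩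
  | succ M ih =>
    have h0 : (M : ℤ) ≤ (nest z α M).len := by rw [(nest_spec M).2.1]; omega
    have h1 : (nest z α (M + 1)).shadow c A ↔ (M : ℤ) ≤ (nest z α M).len ∧
      c (M + 1) = flip (c M) ∧ (nest z α M).shadow (c ∘ sk M) A := Iff.rfl
    rw [h1, ih]
    constructor
    · rintro ⟨-, h2, h3, h4⟩
      refine ⟨h3, fun i hi => ?_⟩
      cases i with
      | zero => exact h2
      | succ i =>
        have := h4 i (by omega)
        rw [Function.comp_apply, Function.comp_apply, sk_of_ge (by omega), sk_of_lt (by omega)]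
          at this
        rwa [show M + 1 + (i + 1) = M + i + 2 by omega,
          show M + 1 - 1 - (i + 1) = M - 1 - i by omega]
    · rintro ⟨h3, h4⟩
      refine ⟨h0, h4 0 (by omega), h3, fun i hi => ?_⟩
      have := h4 (i + 1) (by omega)
      rw [show M + 1 + (i + 1) = M + i + 2 by omega,
          show M + 1 - 1 - (i + 1) = M - 1 - i by omega] at this
      rwa [Function.comp_apply, Function.comp_apply, sk_of_ge (by omega), sk_of_lt (by omega)]

end

/-- The four corners of a piece are joined by strings. -/
def Piece.Link {β : Type} : {P Q : Word} → Piece P Q → β → β → β → β → Prop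
  | _, _, .cross _ _, x, x', y, y' => x = y' ∧ x' = y
  | _, _, .cup _, _, _, y, y' => y = y'
  | _, _, .cap _, x, y, _, _ => x = y

/-- The colours of the strings that cross. -/
def Piece.mark {β : Type} : {P Q : Word} → Piece P Q → β → Multiset β
  | _, _, .cross _ _, x => {x}
  | _, _, .cup _, _ => 0
  | _, _, .cap _, _ => 0

namespace StringDiagram
variable {X Y : Word} {β : Type}

/-- Colourings that are constant on strings. -/
def Const {X Y : Word} (t : StringDiagram X Y) (f : ℕ × ℕ → β) : Prop :=
  ∀ x y, t.Joined x y → f x = f y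

theorem Const.sameString {t : StringDiagram X Y} {f : ℕ × ℕ → β} (h : t.Const f) {x y : ℕ × ℕ}
    (hxy : t.SameString x y) : f x = f y := by
  induction hxy with
  | rel x y hxy => exact h x y hxy
  | refl => rfl
  | symm _ _ _ ih => exact ih.symm
  | trans _ _ _ _ _ ih ih' => exact ih.trans ih'

theorem segment_const (f : ℕ × ℕ → β) (n a b : ℕ) {P Q : Word} (p : Piece P Q) :
    (∀ x y, Segment n a p b x y → f x = f y) ↔ (∀ i < a, f (n, i) = f (n + 1, i)) ∧
      (∀ i < b, f (n, a + P.length + i) = f (n + 1, a + Q.length + i)) ∧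
      p.Link (f (n, a)) (f (n, a + 1)) (f (n + 1, a)) (f (n + 1, a + 1)) := by
  constructor
  · refine fun h => ⟨fun i hi => h _ _ (.left p b i hi), fun i hi => h _ _ (.right p b i hi), ?_⟩
    cases p with
    | cross c d => exact ⟨h _ _ (.cross_ne c d b), h _ _ (.cross_nw c d b)⟩
    | cup c => exact h _ _ (.cup c b)
    | cap c => exact h _ _ (.cap c b)
  · rintro ⟨h1, h2, h3⟩ x y h
    cases h with
    | left _ _ i hi => exact h1 i hi
    | right _ _ i hi => exact h2 i hi
    | cross_ne => exact h3.1
    | cross_nw => exact h3.2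
    | cup => exact h3
    | cap => exact h3

theorem const_layer {t : StringDiagram X Y} {Z A P Q B : Word} {p : Piece P Q} {hY hZ}
    {f : ℕ × ℕ → β} : (layer (Z := Z) t A p B hY hZ).Const f ↔ t.Const f ∧
      (∀ i < A.length, f (t.height, i) = f (t.height + 1, i)) ∧
      (∀ i < B.length, f (t.height, A.length + P.length + i) =
        f (t.height + 1, A.length + Q.length + i)) ∧
      p.Link (f (t.height, A.length)) (f (t.height, A.length + 1)) (f (t.height + 1, A.length))
        (f (t.height + 1, A.length + 1)) := by
  rw [← segment_const]
  exact ⟨fun h => ⟨fun x y hxy => h x y (Or.inl hxy), fun x y hxy => h x y (Or.inr hxy)⟩,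
    fun h x y hxy => hxy.elim (h.1 x y) (h.2 x y)⟩

theorem joined_le {t : StringDiagram X Y} {x y : ℕ × ℕ} (h : t.Joined x y) :
    x.1 ≤ t.height ∧ y.1 ≤ t.height := by
  induction t with
  | id => exact h.elim
  | layer t A p B hY hZ ih =>
    rcases h with h | h
    · exact ⟨(ih h).1.trans (Nat.le_succ _), (ih h).2.trans (Nat.le_succ _)⟩
    · cases h <;> simp [height]

theorem isPoint_le {t : StringDiagram X Y} {x : ℕ × ℕ} (h : t.IsPoint x) : x.1 ≤ t.height := by
  induction t with
  | id => exact h.1.le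
  | layer t A p B hY hZ ih =>
    rcases h with h | h
    · exact (ih h).trans (Nat.le_succ _)
    · exact h.1.le

theorem isPoint_top (t : StringDiagram X Y) {j : ℕ} (h : j < Y.length) : t.IsPoint (t.height, j) := by
  cases t with
  | id => exact ⟨rfl, h⟩
  | layer t A p B hY hZ => exact Or.inr ⟨rfl, h⟩

/-- The colouring `f`, extended to the next layer. -/
def extend (h : ℕ) (f : ℕ × ℕ → β) (g : ℕ → β) (x : ℕ × ℕ) : β := if x.1 ≤ h then f x else g x.2

theorem extend_le {h : ℕ} {f : ℕ × ℕ → β} {g : ℕ → β} {x : ℕ × ℕ} (hx : x.1 ≤ h) :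
    extend h f g x = f x := if_pos hx
theorem extend_self {h j : ℕ} {f : ℕ × ℕ → β} {g : ℕ → β} : extend h f g (h, j) = f (h, j) :=
  extend_le le_rfl
theorem extend_succ {h j : ℕ} {f : ℕ × ℕ → β} {g : ℕ → β} : extend h f g (h + 1, j) = g j :=
  if_neg (Nat.not_succ_le_self h)

theorem const_layer_extend {t : StringDiagram X Y} {Z A P Q B : Word} {p : Piece P Q} {hY hZ}
    {f : ℕ × ℕ → β} {g : ℕ → β} (hf : t.Const f)
    (h1 : ∀ i < A.length, f (t.height, i) = g i)
    (h2 : ∀ i < B.length, f (t.height, A.length + P.length + i) = g (A.length + Q.length + i))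
    (h3 : p.Link (f (t.height, A.length)) (f (t.height, A.length + 1)) (g A.length)
      (g (A.length + 1))) : (layer (Z := Z) t A p B hY hZ).Const (extend t.height f g) := by
  refine const_layer.2 ⟨fun x y hxy => ?_, fun i hi => ?_, fun i hi => ?_, ?_⟩
  · rw [extend_le (joined_le hxy).1, extend_le (joined_le hxy).2, hf x y hxy]
  · rw [extend_self, extend_succ, h1 i hi]
  · rw [extend_self, extend_succ, h2 i hi]
  · rwa [extend_self, extend_self, extend_succ, extend_succ]

/-- The colours of the pairs of strings that cross each other. -/
def crossings {X : Word} (f : ℕ × ℕ → β) : {Y : Word} → StringDiagram X Y → Multiset (Sym2 β)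
  | _, .id => 0
  | _, .layer t A p _ _ _ =>
    p.mark s(f (t.height, A.length), f (t.height, A.length + 1)) + crossings f t

/-- The colours of the endpoints after bending. -/
def colour {X Y : Word} (t : StringDiagram X Y) (f : ℕ × ℕ → β) (p : ℕ) : β :=
  if p < X.length then f (0, X.length - 1 - p) else f (t.height, p - X.length)

/-- The colours and the labels of the endpoints after bending. -/
def label {X Y : Word} (t : StringDiagram X Y) (f : ℕ × ℕ → β) (p : ℕ) : β × Arrow :=
  (t.colour f p, (dualWord X ++ Y).getD p up)

section label
variable {t : StringDiagram X Y} {A P Q B : Word} {p : Piece P Q}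
  {hY : Y = A ++ P ++ B} {f : ℕ × ℕ → β}

theorem label_of_lt {Z : Word} {hZ : Z = A ++ Q ++ B} (hf : (layer t A p B hY hZ).Const f)
    {i : ℕ} (hi : i < X.length + A.length) :
    (layer t A p B hY hZ).label f i = t.label f i := by
  have h := (const_layer.1 hf).2.1
  refine Prod.ext ?_ ?_
  · change (if _ then _ else _) = if _ then _ else _
    split_ifs
    · rfl
    · exact (h _ (by omega)).symm
  · subst hY hZ
    have := dualWord_length X
    simp only [label, List.getD_eq_getElem?_getD]
    rw [← List.append_assoc, ← List.append_assoc, ← List.append_assoc, ← List.append_assoc]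
    by_cases h5 : i < X.length
    · simp [List.getElem?_append, this, h5]
    · have h6 : i - X.length < A.length := by omega
      simp [List.getElem?_append, this, h5, h6]

theorem label_of_ge {Z : Word} {hZ : Z = A ++ Q ++ B} (hf : (layer t A p B hY hZ).Const f)
    {i : ℕ} (hi : i < B.length) :
    (layer t A p B hY hZ).label f (X.length + A.length + Q.length + i) =
      t.label f (X.length + A.length + P.length + i) := by
  have h := (const_layer.1 hf).2.2.1 i hi
  refine Prod.ext ?_ ?_
  · simp only [label, colour]
    rw [if_neg (by omega), if_neg (by omega),
      show X.length + A.length + P.length + i - X.length = A.length + P.length + i by omega,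
      show X.length + A.length + Q.length + i - X.length = A.length + Q.length + i by omega]
    exact h.symm
  · subst hY hZ
    have := dualWord_length X
    simp only [label, List.getD_eq_getElem?_getD]
    rw [List.getElem?_append_right (by omega), List.getElem?_append_right (by simp; omega),
      List.getElem?_append_right (by omega), List.getElem?_append_right (by simp; omega)]
    congr 2
    simp only [List.length_append]
    omega

theorem label_mid (hY : Y = A ++ P ++ B) {i : ℕ} (hi : i < P.length) :
    t.label f (X.length + A.length + i) = (f (t.height, A.length + i), P.getD i up) := by
  refine Prod.ext ?_ ?_
  · simp only [label, colour]
    rw [if_neg (by omega), show X.length + A.length + i - X.length = A.length + i by omega]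
  · subst hY
    have := dualWord_length X
    simp only [label, List.getD_eq_getElem?_getD]
    rw [List.getElem?_append_right (by omega), List.getElem?_append_left (by simp; omega),
      List.getElem?_append_right (by omega)]
    congr 2
    omega

end label

variable {z : k} {α : Type}

theorem pre_len (t : StringDiagram X Y) : (t.pre z α).len = X.length + Y.length := by
  induction t with
  | id => rw [pre, (PreDiagram.nest_spec _).2.1]; ring
  | layer t A p B hY hZ ih =>
    subst hY hZ
    cases p with
    | cross x y => exact ih.trans (by simp)
    | cup x =>
      refine (congrArg (· + 2) ih).trans ?_
      simp only [List.length_append, List.length_cons, List.length_nil]; push_cast; ring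
    | cap x =>
      refine (congrArg (· - 2) ih).trans ?_
      simp only [List.length_append, List.length_cons, List.length_nil]; push_cast; ring

/-- A colouring of the strings gives a colouring of the endpoints. -/
theorem shadow_label (t : StringDiagram X Y) {f : ℕ × ℕ → α} (hf : t.Const f)
    {c : ℕ → α × Arrow} (hc : ∀ p < X.length + Y.length, c p = t.label f p) :
    (t.pre z α).shadow c (t.crossings f) := by
  induction t generalizing c with
  | id =>
    refine (PreDiagram.nest_shadow _ _ _).2 ⟨rfl, fun i hi => ?_⟩
    rw [hc _ (by omega), hc _ (by omega)]
    refine Prod.ext ?_ ?_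
    · simp only [label, colour, flip]
      rw [if_neg (by omega), if_pos (by omega)]
      simp only [height]
      congr 2; omega
    · have := dualWord_length X
      simp only [label, flip, List.getD_eq_getElem?_getD]
      rw [List.getElem?_append_right (by omega), List.getElem?_append_left (by omega), dualWord,
        List.getElem?_reverse (by simp; omega), List.getElem?_map, List.length_map,
        show X.length - 1 - (X.length - 1 - i) = i by omega, List.length_reverse, List.length_map,
        Nat.add_sub_cancel_left, List.getElem?_eq_getElem hi]
      simp [Arrow.dual_dual]
  | layer t A p B hY hZ ih =>
    obtain ⟨h0, h1, h2, h3⟩ := const_layer.1 hf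
    have hlen := pre_len (z := z) (α := α) t
    have hY' := congrArg List.length hY
    have hZ' := congrArg List.length hZ
    simp only [List.length_append] at hY' hZ'
    have hm : ∀ i, _ → _ := fun i (hi : i < _) => label_mid (f := f) (t := t) hY hi
    have hm' : ∀ i, _ → _ := fun i (hi : i < _) =>
      label_mid (f := f) (t := layer t A p B hY hZ) hZ hi
    have hl : ∀ i < X.length + A.length, c i = t.label f i := fun i hi =>
      (hc i (by omega)).trans (label_of_lt hf hi)
    have hr := fun i hi => (hc _ (by omega)).trans (label_of_ge hf (i := i) hi)
    have hcm : ∀ i < _, c (X.length + A.length + i) = _ := fun i hi =>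
      (hc _ (by omega)).trans (hm' i hi)
    simp only [height] at hcm
    cases p with
    | cross x y =>
      have h4 := hcm 0 (by simp)
      have h5 := hcm 1 (by simp)
      have h6 := hm 0 (by simp)
      have h7 := hm 1 (by simp)
      simp only [add_zero] at h4 h6
      refine ⟨by simp at hY'; omega, t.crossings f, ?_, ih h0 fun i hi => ?_⟩
      · rw [h4, h5, ← h3.1, ← h3.2, Sym2.eq_swap]
        exact Multiset.singleton_add _ _
      · rw [Function.comp_apply]
        rcases (show i < X.length + A.length ∨ i = X.length + A.length ∨
          i = X.length + A.length + 1 ∨ X.length + A.length + 2 ≤ i by omega) with h | rfl | rfl | h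
        · rw [sw_of_lt h, hl i h]
        · rw [sw_left, h5, h6, ← h3.1]; rfl
        · rw [sw_right, h4, h7, ← h3.2]; rfl
        · rw [sw_of_gt (by omega)]
          obtain ⟨j, rfl⟩ := Nat.exists_eq_add_of_le h
          exact hr j (by simp at hY'; omega)
    | cup x =>
      have h4 := hcm 0 (by simp)
      have h5 := hcm 1 (by simp)
      simp only [add_zero] at h4
      have h8 : t.crossings f = (layer t A (.cup x) B hY hZ).crossings f := (zero_add _).symm
      refine ⟨by omega, ?_, h8 ▸ ih h0 fun i hi => ?_⟩
      · rw [h4, h5, ← h3]; rfl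
      · rw [Function.comp_apply]
        rcases lt_or_ge i (X.length + A.length) with h | h
        · rw [sk_of_lt h, hl i h]
        · rw [sk_of_ge h]
          obtain ⟨j, rfl⟩ := Nat.exists_eq_add_of_le h
          have := hr j (by simp at hY'; omega)
          rwa [List.length_cons, List.length_singleton, List.length_nil, add_zero,
            add_right_comm] at this
    | cap x =>
      have h6 := hm 0 (by simp)
      have h7 := hm 1 (by simp)
      simp only [add_zero] at h6
      have h8 : t.crossings f = (layer t A (.cap x) B hY hZ).crossings f := (zero_add _).symm
      refine ⟨by simp at hY'; omega, Shadow.ins c (X.length + A.length)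
        (t.label f (X.length + A.length)), (Shadow.ins_sk _ _ _).symm, ?_,
        h8 ▸ ih h0 fun i hi => ?_⟩
      · rw [Shadow.ins_succ, Shadow.ins_self]
      · rcases (show i < X.length + A.length ∨ i = X.length + A.length ∨
          i = X.length + A.length + 1 ∨ X.length + A.length + 2 ≤ i by omega) with h | rfl | rfl | h
        · rw [Shadow.ins_lt _ _ h, hl i h]
        · rw [Shadow.ins_self]
        · rw [Shadow.ins_succ, h6, h7, ← h3]; rfl
        · obtain ⟨j, rfl⟩ := Nat.exists_eq_add_of_le h
          rw [show X.length + A.length + 2 + j = X.length + A.length + j + 2 by omega,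
            Shadow.ins_gt _ _ (by omega), ← show X.length + A.length + 2 + j = X.length + A.length + j + 2 by omega]
          exact hr j (by simp at hY'; omega)

/-- Peeling off the top layer: a colouring above a piece comes from one below it that agrees on the
vertical strands and is linked through the piece. -/
theorem shadow_pre {P Q : Word} (p : Piece P Q) (a : ℕ) (x : PreDiagram z α) {c : ℕ → α × Arrow}
    {A : Multiset (Sym2 α)} (h : (p.pre z α a x).shadow c A) : ∃ c' A', x.shadow c' A' ∧
      (∀ i < a, c' i = c i) ∧ (∀ i, c' (a + P.length + i) = c (a + Q.length + i)) ∧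
      p.Link (c' a).1 (c' (a + 1)).1 (c a).1 (c (a + 1)).1 := by
  cases p with
  | cross y w =>
    obtain ⟨-, A', -, h⟩ := h
    refine ⟨_, A', h, fun i hi => congrArg c (sw_of_lt hi), fun i => congrArg c (sw_of_gt ?_), ?_⟩
    · simp; omega
    · simp only [Function.comp_apply, sw_left, sw_right]
      exact ⟨rfl, rfl⟩
  | cup y =>
    obtain ⟨-, h1, h⟩ := h
    refine ⟨_, A, h, fun i hi => congrArg c (sk_of_lt hi), fun i => congrArg c ?_, ?_⟩
    · rw [sk_of_ge (by simp)]; simp; omega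
    · rw [Piece.Link, h1]; rfl
  | cap y =>
    obtain ⟨-, c', rfl, h1, h⟩ := h
    refine ⟨c', A, h, fun i hi => congrArg c' (sk_of_lt hi).symm, fun i => congrArg c' ?_, ?_⟩
    · rw [sk_of_ge (by simp)]; simp; omega
    · rw [Piece.Link, h1]; rfl

/-- A colouring of the endpoints gives a colouring of the strings. -/
theorem exists_const (t : StringDiagram X Y) {c : ℕ → α × Arrow} {M : Multiset (Sym2 α)}
    (h : (t.pre z α).shadow c M) :
    ∃ f, t.Const f ∧ ∀ p < X.length + Y.length, (c p).1 = t.colour f p := by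
  induction t generalizing c M with
  | id =>
    obtain ⟨-, h⟩ := (PreDiagram.nest_shadow _ _ _).1 h
    refine ⟨fun x => (c (X.length + x.2)).1, fun _ _ h => h.elim, fun p hp => ?_⟩
    simp only [colour]
    split_ifs with h1
    · rw [h _ (by omega)]
      exact congrArg (fun i => (c i).1) (by omega)
    · exact congrArg (fun i => (c i).1) (by omega)
  | @layer Y Z P Q t A p B hY hZ ih =>
    obtain ⟨c', A', h1, h2, h3, h4⟩ := shadow_pre p _ _ h
    obtain ⟨f, hf, hc⟩ := ih h1
    have hY' := congrArg List.length hY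
    have hZ' := congrArg List.length hZ
    simp only [List.length_append] at hY' hZ'
    have hcol : ∀ i < Y.length, f (t.height, i) = (c' (X.length + i)).1 := by
      intro i hi
      rw [hc _ (by omega), colour, if_neg (by omega), Nat.add_sub_cancel_left]
    refine ⟨extend t.height f fun j => (c (X.length + j)).1,
      const_layer_extend hf (fun i hi => ?_) (fun i hi => ?_) ?_, fun i hi => ?_⟩
    · rw [hcol _ (by omega), h2 _ (by omega)]
    · rw [hcol _ (by omega)]
      have := h3 i
      simp only [← add_assoc] at this ⊢
      rw [this]
    · cases p with
      | cross x y =>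
        rw [hcol _ (by simp [hY]), hcol _ (by simp [hY])]
        exact h4
      | cup x => exact h4
      | cap x =>
        rw [Piece.Link, hcol _ (by simp [hY]), hcol _ (by simp [hY])]
        exact h4
    · simp only [colour]
      split_ifs with h5
      · rw [extend_le (Nat.zero_le _), ← h2 i (by omega), hc _ (by omega), colour, if_pos h5]
      · rw [height, extend_succ, Nat.add_sub_cancel' (by omega)]

end StringDiagram

/-! ## Reduced string diagrams -/

section
variable {α : Type} {N : ℕ} {μ : ℕ → ℕ}

/-- The colouring that marks one chord of a matching. -/
def markChord (μ : ℕ → ℕ) (c : ℕ → α × Arrow) (p q : ℕ) : Set (ℕ × ℕ) × Arrow :=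
  (open Classical in if q = p ∨ q = μ p then Set.univ else ∅, (c q).2)

theorem compat_markChord (hμ : IsMatching N μ) {c : ℕ → α × Arrow} (hc : Compat N μ c) {p : ℕ}
    (hp : p < N) : Compat N μ (markChord μ c p) := by
  intro q hq
  obtain ⟨h1, h2, h3⟩ := hμ q hq
  refine Prod.ext ?_ (show (c (μ q)).2 = (c q).2.dual by rw [hc q hq]; rfl)
  change (if _ then _ else _) = if _ then _ else _
  refine if_congr ?_ rfl rfl
  constructor
  · rintro (h | h)
    · exact Or.inr (by rw [← h, h2])
    · exact Or.inl (by rw [← h2, h, (hμ p hp).2.1])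
  · rintro (h | h)
    · exact Or.inr (by rw [h])
    · exact Or.inl (by rw [h, (hμ p hp).2.1])

theorem markChord_self {c : ℕ → α × Arrow} {p : ℕ} : (markChord μ c p p).1 = Set.univ :=
  if_pos (Or.inl rfl)
theorem markChord_mate {c : ℕ → α × Arrow} {p : ℕ} : (markChord μ c p (μ p)).1 = Set.univ :=
  if_pos (Or.inr rfl)
theorem markChord_of_ne {c : ℕ → α × Arrow} {p q : ℕ} (h : q ≠ p) (h' : q ≠ μ p) :
    (markChord μ c p q).1 = ∅ := if_neg (not_or.2 ⟨h, h'⟩)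

end

namespace NilBrauer
variable {z : k} {α : Type} {x : PreDiagram z α} {ν : Code}

theorem Normal.exists_code {l : ℕ} (h : (nilBrauer z α).Normal 0 l ⟦x⟧) (hx : ¬ x.Bad) :
    ∃ ν : Code, ν.Valid 0 ∧ ν.InRange ∧ (nilBrauer z α).NF ν = ⟦x⟧ := by
  rcases h with h | ⟨ν, -, h1, h2⟩
  · exact absurd h hx
  · rcases (nilBrauer z α).bad_or_inRange ν with h | h
    · rw [← h2] at h
      exact absurd h hx
    · exact ⟨ν, h1, h, h2.symm⟩

theorem nf_spec (h : (nilBrauer z α).NF ν = ⟦x⟧) : ν.cross = x.deg ∧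
    ((2 * ν.length : ℕ) : ℤ) = x.len ∧ (PreDiagram.nf z α ν).shadow = x.shadow ∧
    x.vec - nf z ν ∈ Low z x.deg := by
  rw [PreDiagram.mk_nf] at h
  obtain ⟨h1, h2, h3, h4⟩ := Quotient.exact h
  obtain ⟨h5, h6, h7⟩ := PreDiagram.nf_spec (z := z) (α := α) ν
  refine ⟨h5 ▸ h1, h6 ▸ h2, h3, ?_⟩
  rw [← h7, ← neg_sub, ← h1]
  exact neg_mem h4

end NilBrauer

theorem opT_apply_of_get {z : k} {x y : Arrow} {a : ℕ} {W : Word} (v : Vec z) (hy : W[a]? = some y)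
    (hx : W[a + 1]? = some x) : opT z a v W = opTc z x y a v W := by
  rw [← opT_pr z a v x y]
  have h := pr_opT x a (a + 1) (pr z y (a + 1) v)
  have h' := pr_opT y a a v
  rw [sw_right] at h
  rw [sw_left] at h'
  rw [← h, ← h', pr_apply_of_get _ hx, pr_apply_of_get _ hy]

theorem op_cross {z : k} (x y : Arrow) (a : ℕ) : op a (Piece.eval z (.cross x y)) = opTc z x y a := by
  cases x <;> cases y
  · rfl
  · refine (op_add a _ _).trans (congrArg (_ + ·) ((op_smul a z _).trans (congrArg (z • ·) ?_)))
    exact LinearMap.ext fun v => op_mor_comp z a v _ _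
  · rfl
  · rfl

theorem low_op_piece {z : k} {α : Type} {P Q : Word} (p : Piece P Q) (a : ℕ) (x : PreDiagram z α)
    {v : Vec z} (hv : v ∈ Low z x.deg) : op a (p.eval z) v ∈ Low z (p.pre z α a x).deg := by
  cases p with
  | cross x y => exact op_cross (z := z) x y a ▸ low_opTc x y a hv
  | cup x =>
    cases x
    · exact low_opQ a hv
    · exact low_opQ' a hv
  | cap x =>
    cases x
    · exact low_opE' a hv
    · exact low_opE a hv

theorem getElem?_replace {U P P' B : Word} (h : P.length = P'.length) {q : ℕ}
    (hq : q < U.length ∨ U.length + P.length ≤ q) :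
    (U ++ (P ++ B))[q]? = (U ++ (P' ++ B))[q]? := by
  rcases hq with hq | hq
  · rw [List.getElem?_append_left hq, List.getElem?_append_left hq]
  · rw [List.getElem?_append_right (by omega), List.getElem?_append_right (by omega),
      List.getElem?_append_right (by omega), List.getElem?_append_right (by omega), h]

namespace StringDiagram
variable {X Y : Word} {z : k}

/-- There are no closed strings. -/
def NoLoop (t : StringDiagram X Y) : Prop := ∀ g : ℕ × ℕ → Set (ℕ × ℕ), t.Const g →
  (∀ j < X.length, g (0, j) = ∅) → (∀ j < Y.length, g (t.height, j) = ∅) →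
  ∀ x, t.IsPoint x → g x = ∅

/-- A diagram without closed strings, in which strings cross at most once. -/
def Reduced (t : StringDiagram X Y) (f : ℕ × ℕ → Set (ℕ × ℕ)) : Prop :=
  t.Const f ∧ (t.crossings f).Nodup ∧ (∀ p ∈ t.crossings f, ¬ p.IsDiag) ∧ t.NoLoop

section
variable {t : StringDiagram X Y} {f : ℕ × ℕ → Set (ℕ × ℕ)} {A P Q B Z : Word} {p : Piece P Q}
  {hY : Y = A ++ P ++ B} {hZ : Z = A ++ Q ++ B}

/-- A colouring that is empty on the top and bottom of `t` extends by the empty set to the next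
layer, so the absence of closed strings passes to `t`. -/
theorem Reduced.of_layer (h : (layer t A p B hY hZ).Reduced f) : t.Reduced f := by
  obtain ⟨h1, h2, h3, h4⟩ := h
  have hY' := congrArg List.length hY
  have hZ' := congrArg List.length hZ
  simp only [List.length_append] at hY' hZ'
  refine ⟨(const_layer.1 h1).1, (Multiset.nodup_add.1 h2).2.1,
    fun p hp => h3 p (Multiset.mem_add.2 (Or.inr hp)), fun g hg hb ht x hx => ?_⟩
  have := h4 (extend t.height g fun _ => ∅)
    (const_layer_extend hg (fun i hi => ht _ (by omega)) (fun i hi => ht _ (by omega)) ?_)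
    (fun j hj => (extend_le (Nat.zero_le _)).trans (hb j hj)) (fun j hj => extend_succ) x (Or.inl hx)
  · rwa [extend_le (isPoint_le hx)] at this
  · cases p with
    | cross x y => exact ⟨ht _ (by simp [hY]), ht _ (by simp [hY])⟩
    | cup x => rfl
    | cap x => exact (ht _ (by simp [hY])).trans (ht _ (by simp [hY])).symm

theorem Reduced.not_bad (h : t.Reduced f) : ¬ (t.pre z (Set (ℕ × ℕ))).Bad := fun hb =>
  hb.2 _ _ (shadow_label t h.1 fun _ _ => rfl) ⟨h.2.1, h.2.2.1⟩

variable {ν : Code} (hν : ν.InRange) (hN : (nilBrauer z (Set (ℕ × ℕ))).NF ν = ⟦t.pre z _⟧)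
include hN

theorem code_length : 2 * ν.length = X.length + Y.length := by
  have := (NilBrauer.nf_spec hN).2.1
  rw [pre_len] at this
  exact_mod_cast this

include hν

theorem compat_iff (c : ℕ → Set (ℕ × ℕ) × Arrow) :
    (∃ A, (t.pre z _).shadow c A) ↔ Compat (X.length + Y.length) ν.mate c := by
  rw [← (NilBrauer.nf_spec hN).2.2.1, PreDiagram.shadow_nf z hν, code_length hN]

theorem Reduced.compat (h : t.Reduced f) : Compat (X.length + Y.length) ν.mate (t.label f) :=
  (compat_iff hν hN _).1 ⟨_, shadow_label t h.1 fun _ _ => rfl⟩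

theorem isMatching_code : IsMatching (X.length + Y.length) ν.mate := by
  have := hν.isMatching
  rwa [code_length hN] at this

/-- The chords of the code are the strings of the diagram: marking a chord gives a compatible
colouring of the endpoints, and every such colouring comes from one of the strings. -/
theorem Reduced.exists_mark (h : t.Reduced f) {p : ℕ} (hp : p < X.length + Y.length) :
    ∃ g : ℕ × ℕ → Set (ℕ × ℕ), t.Const g ∧ t.colour g p = Set.univ ∧
      t.colour g (ν.mate p) = Set.univ ∧
      ∀ q < X.length + Y.length, q ≠ p → q ≠ ν.mate p → t.colour g q = ∅ := by
  have h1 := compat_markChord (isMatching_code hν hN) (h.compat hν hN) hp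
  obtain ⟨A, hA⟩ := (compat_iff hν hN _).2 h1
  obtain ⟨g, hg, h2⟩ := exists_const t hA
  refine ⟨g, hg, ?_, ?_, fun q hq h3 h4 => ?_⟩
  · rw [← h2 p hp, markChord_self]
  · rw [← h2 _ (isMatching_code hν hN p hp).1, markChord_mate]
  · rw [← h2 q hq, markChord_of_ne h3 h4]

/-- If the cap joined two mates, marking their chord would give a nonempty colouring that is empty
at all endpoints, revealing a closed string. -/
theorem Reduced.mate_ne {x : Arrow} {hY : Y = A ++ [x, x.dual] ++ B} {hZ : Z = A ++ [] ++ B}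
    (h : (layer t A (.cap x) B hY hZ).Reduced f) :
    ν.mate (X.length + A.length) ≠ X.length + A.length + 1 := by
  intro hm
  have hY' := congrArg List.length hY
  have hZ' := congrArg List.length hZ
  simp only [List.length_append, List.length_cons, List.length_nil] at hY' hZ'
  obtain ⟨g, hg, h1, h2, h3⟩ := h.of_layer.exists_mark hν hN (p := X.length + A.length) (by omega)
  rw [hm] at h2 h3
  have hcol : ∀ i, t.colour g (X.length + i) = g (t.height, i) := fun i => by
    rw [colour, if_neg (by omega), Nat.add_sub_cancel_left]
  rw [add_assoc] at h2
  rw [hcol] at h1 h2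
  have := h.2.2.2 (extend t.height g fun _ => ∅)
    (const_layer_extend hg (fun i hi => ?_) (fun i hi => ?_) ?_)
    (fun j hj => (extend_le (Nat.zero_le _)).trans ?_) (fun j hj => extend_succ)
    (t.height, A.length) (Or.inl (t.isPoint_top (by omega)))
  · rw [extend_self, h1] at this
    exact Set.empty_ne_univ this.symm
  · rw [← hcol, h3 _ (by omega) (by omega) (by omega)]
  · rw [← hcol, h3 _ (by simp; omega) (by simp; omega) (by simp; omega)]
  · exact h1.trans h2.symm
  · have := h3 (X.length - 1 - j) (by omega) (by omega) (by omega)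
    rw [colour, if_pos (by omega)] at this
    rw [← this]
    congr 2; omega

/-- The capped end at position `X.length + A.length` has its mate elsewhere, and the word there
fixes its orientation. On the word with that end reversed the normal form vanishes, and so the cap
of the wrong orientation in `opn` sees nothing. -/
theorem Reduced.nf_apply {x : Arrow} {hY : Y = A ++ [x, x.dual] ++ B} {hZ : Z = A ++ [] ++ B}
    (h : (layer t A (.cap x) B hY hZ).Reduced f) (w : Arrow) :
    nf z ν (dualWord X ++ A ++ ([x.dual, w] ++ B)) = 0 := by
  have hm := isMatching_code hν hN
  have hc := congrArg Prod.snd (h.of_layer.compat hν hN (X.length + A.length) (by simp [hY]))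
  have hne := h.mate_ne hν hN
  obtain ⟨h1, h2, h3⟩ := hm (X.length + A.length) (by simp [hY])
  have hl := dualWord_length X
  have ha : (t.label f (X.length + A.length)).2 = x :=
    congrArg Prod.snd (label_mid (t := t) (f := f) hY (i := 0) (by simp))
  refine nf_apply_eq_zero hν (p := X.length + A.length) (x := x.dual) (y := x.dual) ?_ ?_
    (Arrow.dual_ne _).symm
  · rw [← hl]; simp
  · generalize ν.mate (X.length + A.length) = q at hc hne h1 h2 h3
    have hq : (dualWord X ++ Y)[q]? = some x.dual := by
      have h4 : (dualWord X ++ Y).getD q up = x.dual := hc.trans (congrArg Arrow.dual ha)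
      rw [List.getD_eq_getElem?_getD,
        List.getElem?_eq_getElem (by rw [List.length_append, hl]; exact h1)] at h4
      rw [List.getElem?_eq_getElem (by rw [List.length_append, hl]; exact h1)]
      exact congrArg some h4
    rw [← hq, hY]
    have := getElem?_replace (U := dualWord X ++ A) (P := [x.dual, w]) (P' := [x, x.dual]) (B := B)
      (q := q) rfl (by simp only [List.length_append, List.length_cons, List.length_nil, hl]; omega)
    rw [this]
    simp

end

theorem op_eval_layer (t : StringDiagram X Y) {P Q A B Z : Word} (p : Piece P Q)
    (hY : Y = A ++ P ++ B) (hZ : Z = A ++ Q ++ B) (v : Vec z) :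
    op X.length ((layer t A p B hY hZ).eval z) v (dualWord X ++ Z) =
      op (X.length + A.length) (p.eval z) (op X.length (t.eval z) v) (dualWord X ++ Z) := by
  subst hY hZ
  have hl := dualWord_length X
  have h1 : (layer t A p B rfl rfl).eval z =
      t.eval z ≫ tens z (tens z (𝟙 (obj z A)) (p.eval z)) (𝟙 (obj z B)) := by
    simp [eval]
  rw [h1, op_comp, op_tens X.length (b := X.length + (A ++ P).length) _ _ rfl,
    op_tens X.length (b := X.length + A.length) _ _ rfl, Module.End.mul_apply, Module.End.mul_apply,
    Module.End.mul_apply, op_id_apply _ (dualWord X) (Q ++ B) hl (by simp)]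
  refine op_congr _ fun A' B' hA' hW => ?_
  obtain ⟨rfl, hB⟩ : A' = dualWord X ++ A ∧ Q ++ B' = Q ++ B := by
    refine (List.append_inj (hW.symm.trans ?_) ?_)
    · simp
    · simp [hA', hl]
  obtain rfl : B' = B := by simpa using hB
  exact op_id_apply _ (dualWord X ++ A ++ P) [] (by simp [hl]) (by simp)

/-- Up to diagrams with fewer crossings, a reduced diagram is given by a code. -/
theorem Reduced.exists_code {t : StringDiagram X Y} {f : ℕ × ℕ → Set (ℕ × ℕ)} (h : t.Reduced f) :
    (∃ ν : Code, ν.Valid 0 ∧ ν.InRange ∧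
      (nilBrauer z (Set (ℕ × ℕ))).NF ν = ⟦t.pre z (Set (ℕ × ℕ))⟧) ∧
    ∃ e ∈ Low z (t.pre z (Set (ℕ × ℕ))).deg, bend z X Y (t.eval z) =
      (t.pre z (Set (ℕ × ℕ))).vec (dualWord X ++ Y) + e (dualWord X ++ Y) := by
  induction t with
  | id =>
    constructor
    · refine NilBrauer.Normal.exists_code (l := X.length) ?_ h.not_bad
      change NilBrauer.Normal _ 0 _ ⟦PreDiagram.nest z _ X.length⟧
      generalize X.length = M
      induction M with
      | zero => exact NilBrauer.normal_vac _
      | succ M ih => exact ih.u M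
    · refine ⟨0, zero_mem _, ?_⟩
      change op _ (𝟙 (obj z X)) _ _ = (PreDiagram.nest z _ X.length).vec _ + 0
      rw [add_zero, (PreDiagram.nest_spec _).2.2]
      exact op_id_apply _ _ [] (dualWord_length X) (by simp)
  | @layer Y Z P Q t A p B hY hZ ih =>
    obtain ⟨⟨ν, h1, h2, h3⟩, e, he, h4⟩ := ih h.of_layer
    have hY' := congrArg List.length hY
    have hl := dualWord_length X
    simp only [List.length_append] at hY'
    have h5 := low_op_piece p (X.length + A.length) (t.pre z (Set (ℕ × ℕ))) he
    have h6 : bend z X Z ((layer t A p B hY hZ).eval z) = op (X.length + A.length) (p.eval z)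
        (t.pre z (Set (ℕ × ℕ))).vec (dualWord X ++ Z) +
        op (X.length + A.length) (p.eval z) e (dualWord X ++ Z) := by
      refine (op_eval_layer t p hY hZ _).trans (Eq.trans ?_ (congrFun (map_add _ _ _) _))
      refine op_congr _ fun A' B' hA' hW => ?_
      subst hY hZ
      obtain ⟨rfl, hB⟩ : A' = dualWord X ++ A ∧ Q ++ B' = Q ++ B := by
        refine (List.append_inj (hW.symm.trans ?_) ?_)
        · simp
        · simp [hA', hl]
      obtain rfl : B' = B := by simpa using hB
      rw [show dualWord X ++ A ++ (P ++ B') = dualWord X ++ (A ++ P ++ B') by simp]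
      exact h4
    cases p with
    | cross x y =>
      refine ⟨NilBrauer.Normal.exists_code (l := ν.length) ?_ h.not_bad, _, h5, h6.trans ?_⟩
      · have := NilBrauer.normal_T (nilBrauer z (Set (ℕ × ℕ))) (X.length + A.length) h1
        rwa [h3] at this
      · rw [op_cross, ← opT_apply_of_get]
        · rfl
        · rw [hZ, ← hl]; simp
        · rw [hZ, ← hl, ← List.length_append, List.append_assoc, ← List.append_assoc,
            List.getElem?_append_right (Nat.le_succ _)]
          simp
    | cup x =>
      refine ⟨NilBrauer.Normal.exists_code (l := ν.length + 1) ?_ h.not_bad, _, h5, h6.trans ?_⟩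
      · have := NilBrauer.normal_u (nilBrauer z (Set (ℕ × ℕ))) (X.length + A.length) h1
          (Nat.zero_le _)
        rwa [h3] at this
      · rw [← opu_apply_of_get]
        · rfl
        · rw [hZ, ← hl]; simp
    | cap x =>
      constructor
      -- Of the three outcomes only a normal form is possible: a cup below the cap would close a
      -- string, and the diagram below is not bad.
      · rcases NilBrauer.normal_n (nilBrauer z (Set (ℕ × ℕ))) (X.length + A.length) h1 with
          h7 | ⟨ν', -, -, h7⟩ | h7
        · rw [h3] at h7
          exact NilBrauer.Normal.exists_code h7 h.not_bad
        · rw [h3, PreDiagram.mk_nf] at h7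
          obtain ⟨-, -, h8, -⟩ := Quotient.exact h7
          refine absurd ?_ (h.mate_ne h2 h3)
          simp only [List.length_cons, List.length_nil] at hY'
          obtain ⟨M, hM⟩ := (compat_iff h2 h3 _).2 (compat_markChord (isMatching_code h2 h3)
            (h.of_layer.compat h2 h3) (p := X.length + A.length) (by omega))
          rw [h8] at hM
          have h9 := congrArg Prod.fst hM.2.1
          by_contra h10
          rw [markChord_of_ne (by omega) (Ne.symm h10)] at h9
          exact Set.empty_ne_univ (h9.trans (markChord_self (c := t.label f)))
        · rw [h3] at h7
          exact absurd h7 h.of_layer.not_bad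
      -- The operator `opn` contains the caps of both orientations, the layer only one. The other
      -- cap `g` kills the normal form, so it only sees the lower-order difference between the
      -- diagram and its normal form.
      · have h7 : ∀ g : obj z [x.dual, x] ⟶ unit z,
            op (X.length + A.length) g (nf z ν) (dualWord X ++ Z) = 0 := by
          intro g
          rw [← show op (X.length + A.length) g (0 : Vec z) (dualWord X ++ Z) = 0 by
            rw [map_zero]; rfl]
          refine op_congr g fun A' B' hA' hW => ?_
          subst hZ
          obtain ⟨rfl, hB⟩ : A' = dualWord X ++ A ∧ [] ++ B' = [] ++ B := by
            refine (List.append_inj (hW.symm.trans ?_) ?_)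
            · simp
            · simp [hA', hl]
          obtain rfl : B' = B := hB
          exact h.nf_apply h2 h3 x
        obtain ⟨g, hg, hg'⟩ : ∃ g : obj z [x.dual, x] ⟶ unit z,
            (∀ a, opn z a = op a (Piece.eval z (.cap x)) + op a g) ∧
            ∀ a n v, v ∈ Low z n → op a g v ∈ Low z n := by
          cases x
          · exact ⟨mor z .leftCap, fun a => add_comm _ _, fun a n v hv => low_opE a hv⟩
          · exact ⟨mor z .rightCap, fun a => rfl, fun a n v hv => low_opE' a hv⟩
        refine ⟨_, sub_mem h5 (hg' (X.length + A.length) _ _ (NilBrauer.nf_spec h3).2.2.2),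
          h6.trans ?_⟩
        change _ = opn z (X.length + A.length) _ (dualWord X ++ Z) + _
        rw [hg, map_sub, LinearMap.add_apply, Pi.add_apply, Pi.sub_apply, Pi.sub_apply, h7]
        abel

theorem exists_of_mem_crossings {t : StringDiagram X Y} {β : Type} {f : ℕ × ℕ → β} {q : Sym2 β}
    (h : q ∈ t.crossings f) : ∃ i j, i < t.height ∧ t.CrossingAt (i, j) ∧
      q = s(f (i, j), f (i, j + 1)) := by
  induction t with
  | id => exact absurd h (Multiset.notMem_zero _)
  | layer t A p B hY hZ ih =>
    rcases Multiset.mem_add.1 h with h | h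
    · cases p with
      | cross x y =>
        exact ⟨_, _, Nat.lt_succ_self _, Or.inr ⟨trivial, rfl⟩, Multiset.mem_singleton.1 h⟩
      | cup x => exact absurd h (Multiset.notMem_zero _)
      | cap x => exact absurd h (Multiset.notMem_zero _)
    · obtain ⟨i, j, h1, h2, h3⟩ := ih h
      exact ⟨i, j, h1.trans (Nat.lt_succ_self _), Or.inl h2, h3⟩

theorem crossings_nodup {t : StringDiagram X Y} {β : Type} {f : ℕ × ℕ → β}
    (h : ∀ i j i' j', t.CrossingAt (i, j) → t.CrossingAt (i', j') → (i, j) ≠ (i', j') →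
      s(f (i, j), f (i, j + 1)) ≠ s(f (i', j'), f (i', j' + 1))) : (t.crossings f).Nodup := by
  induction t with
  | id => exact Multiset.nodup_zero
  | layer t A p B hY hZ ih =>
    have h1 := ih fun i j i' j' h1 h2 => h i j i' j' (Or.inl h1) (Or.inl h2)
    cases p with
    | cross x y =>
      refine Multiset.nodup_cons.2 ⟨fun h2 => ?_, h1⟩
      obtain ⟨i, j, h3, h4, h5⟩ := exists_of_mem_crossings h2
      refine h _ _ i j (Or.inr ⟨trivial, rfl⟩) (Or.inl h4) ?_ h5
      rintro ⟨⟩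
      exact lt_irrefl _ h3
    | cup x => exact (show Multiset.Nodup (0 + t.crossings f) by rwa [zero_add])
    | cap x => exact (show Multiset.Nodup (0 + t.crossings f) by rwa [zero_add])

variable {m : Matching X Y} {t : StringDiagram X Y}

/-- Each point is coloured by the set of points on its string. Two strings coincide exactly when
their colours do, so the conditions on strings become conditions on the crossing record. -/
theorem IsPositiveReducedLift.reduced (h : t.IsPositiveReducedLift m) :
    t.Reduced fun x => {y | t.SameString x y} := by
  have hs : ∀ x y, {w | t.SameString x w} = {w | t.SameString y w} ↔ t.SameString x y := by
    refine fun x y => ⟨fun h => ?_, fun h => Set.ext fun w => ?_⟩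
    · have : y ∈ {w | t.SameString y w} := .refl y
      rwa [← h] at this
    · exact ⟨fun h' => (h.symm _ _).trans _ _ _ h', fun h' => h.trans _ _ _ h'⟩
  refine ⟨fun x y hxy => (hs x y).2 (.rel _ _ hxy), crossings_nodup ?_, fun q hq hd => ?_, ?_⟩
  · intro i j i' j' h1 h2 h3 h4
    obtain ⟨h5, h6⟩ := h.no_double_crossing i j i' j' h1 h2 h3
    rcases Sym2.eq_iff.1 h4 with ⟨h7, h8⟩ | ⟨h7, h8⟩
    · exact h5 ⟨(hs _ _).1 h7, (hs _ _).1 h8⟩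
    · exact h6 ⟨(hs _ _).1 h7, (hs _ _).1 h8⟩
  · obtain ⟨i, j, -, h1, rfl⟩ := exists_of_mem_crossings hq
    exact h.no_self_crossing i j h1 ((hs _ _).1 hd)
  · intro g hg h1 h2 x hx
    obtain ⟨s, hs⟩ := h.no_closed x hx
    rw [← hg.sameString hs]
    rcases s with i | j
    · exact h1 _ i.1.2
    · exact h2 _ j.1.2

end StringDiagram

/-- The position of the start of a string after bending. -/
def sourcePos {X Y : Word} : Sources X Y → ℕ
  | .inl i => X.length - 1 - i.1
  | .inr j => X.length + j.1
/-- The position of the end of a string after bending. -/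
def targetPos {X Y : Word} : Targets X Y → ℕ
  | .inl i => X.length - 1 - i.1
  | .inr j => X.length + j.1

section
variable {X Y : Word}

theorem dualWord_getElem? {i : ℕ} (hi : i < X.length) :
    (dualWord X ++ Y)[X.length - 1 - i]? = some (X.get ⟨i, hi⟩).dual := by
  have := dualWord_length X
  rw [List.getElem?_append_left (by omega), dualWord, List.getElem?_reverse (by simp; omega),
    List.getElem?_map, List.length_map, show X.length - 1 - (X.length - 1 - i) = i by omega,
    List.getElem?_eq_getElem hi]
  rfl

theorem dualWord_append_getElem? {j : ℕ} (hj : j < Y.length) :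
    (dualWord X ++ Y)[X.length + j]? = some (Y.get ⟨j, hj⟩) := by
  have := dualWord_length X
  rw [List.getElem?_append_right (by omega), this, Nat.add_sub_cancel_left,
    List.getElem?_eq_getElem hj]
  rfl

theorem sourcePos_spec (s : Sources X Y) : (dualWord X ++ Y)[sourcePos s]? = some down := by
  rcases s with ⟨i, hi⟩ | ⟨j, hj⟩
  · exact (dualWord_getElem? i.2).trans (by rw [show X.get ⟨i, i.2⟩ = up from hi]; rfl)
  · exact (dualWord_append_getElem? j.2).trans (by rw [show Y.get ⟨j, j.2⟩ = down from hj])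

theorem targetPos_spec (s : Targets X Y) : (dualWord X ++ Y)[targetPos s]? = some up := by
  rcases s with ⟨i, hi⟩ | ⟨j, hj⟩
  · exact (dualWord_getElem? i.2).trans (by rw [show X.get ⟨i, i.2⟩ = down from hi]; rfl)
  · exact (dualWord_append_getElem? j.2).trans (by rw [show Y.get ⟨j, j.2⟩ = up from hj])

theorem exists_source {p : ℕ} (h : (dualWord X ++ Y)[p]? = some down) :
    ∃ s : Sources X Y, sourcePos s = p := by
  have hl := dualWord_length X
  have hp := (List.getElem?_eq_some_iff.1 h).1
  rw [List.length_append, hl] at hp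
  rcases lt_or_ge p X.length with h1 | h1
  · have h2 := dualWord_getElem? (X := X) (Y := Y) (i := X.length - 1 - p) (by omega)
    rw [show X.length - 1 - (X.length - 1 - p) = p by omega, h] at h2
    refine ⟨.inl ⟨⟨X.length - 1 - p, by omega⟩, ?_⟩, ?_⟩
    · have := congrArg Arrow.dual (Option.some.inj h2)
      rw [Arrow.dual_dual] at this
      exact this.symm
    · simp only [sourcePos]; omega
  · obtain ⟨j, rfl⟩ := Nat.exists_eq_add_of_le h1
    have h2 := dualWord_append_getElem? (X := X) (Y := Y) (j := j) (by omega)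
    rw [h] at h2
    exact ⟨.inr ⟨⟨j, by omega⟩, (Option.some.inj h2).symm⟩, rfl⟩

theorem exists_target {p : ℕ} (h : (dualWord X ++ Y)[p]? = some up) :
    ∃ s : Targets X Y, targetPos s = p := by
  have hl := dualWord_length X
  have hp := (List.getElem?_eq_some_iff.1 h).1
  rw [List.length_append, hl] at hp
  rcases lt_or_ge p X.length with h1 | h1
  · have h2 := dualWord_getElem? (X := X) (Y := Y) (i := X.length - 1 - p) (by omega)
    rw [show X.length - 1 - (X.length - 1 - p) = p by omega, h] at h2
    refine ⟨.inl ⟨⟨X.length - 1 - p, by omega⟩, ?_⟩, ?_⟩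
    · have := congrArg Arrow.dual (Option.some.inj h2)
      rw [Arrow.dual_dual] at this
      exact this.symm
    · simp only [targetPos]; omega
  · obtain ⟨j, rfl⟩ := Nat.exists_eq_add_of_le h1
    have h2 := dualWord_append_getElem? (X := X) (Y := Y) (j := j) (by omega)
    rw [h] at h2
    exact ⟨.inr ⟨⟨j, by omega⟩, (Option.some.inj h2).symm⟩, rfl⟩

theorem sourcePos_injective : Function.Injective (sourcePos (X := X) (Y := Y)) := by
  rintro (⟨⟨i, h1⟩, h2⟩ | ⟨⟨i, h1⟩, h2⟩) (⟨⟨j, h3⟩, h4⟩ | ⟨⟨j, h3⟩, h4⟩) h <;>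
    simp only [sourcePos] at h
  · obtain rfl : i = j := by omega
    rfl
  · omega
  · omega
  · obtain rfl : i = j := by omega
    rfl

theorem targetPos_injective : Function.Injective (targetPos (X := X) (Y := Y)) := by
  rintro (⟨⟨i, h1⟩, h2⟩ | ⟨⟨i, h1⟩, h2⟩) (⟨⟨j, h3⟩, h4⟩ | ⟨⟨j, h3⟩, h4⟩) h <;>
    simp only [targetPos] at h
  · obtain rfl : i = j := by omega
    rfl
  · omega
  · omega
  · obtain rfl : i = j := by omega
    rfl

open StringDiagram

theorem colour_sourcePos {β : Type} (t : StringDiagram X Y) (g : ℕ × ℕ → β) (s : Sources X Y) :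
    t.colour g (sourcePos s) = g (t.sourcePoint s) := by
  rcases s with i | j
  · have := i.1.2
    refine (if_pos (show sourcePos (.inl i) < X.length by simp only [sourcePos]; omega)).trans ?_
    simp only [sourcePos, sourcePoint]
    congr 2; omega
  · refine (if_neg (show ¬sourcePos (.inr j) < X.length by simp only [sourcePos]; omega)).trans ?_
    simp only [sourcePos, sourcePoint, Nat.add_sub_cancel_left]

theorem colour_targetPos {β : Type} (t : StringDiagram X Y) (g : ℕ × ℕ → β) (s : Targets X Y) :
    t.colour g (targetPos s) = g (t.targetPoint s) := by
  rcases s with i | j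
  · have := i.1.2
    refine (if_pos (show targetPos (.inl i) < X.length by simp only [targetPos]; omega)).trans ?_
    simp only [targetPos, targetPoint]
    congr 2; omega
  · refine (if_neg (show ¬targetPos (.inr j) < X.length by simp only [targetPos]; omega)).trans ?_
    simp only [targetPos, targetPoint, Nat.add_sub_cancel_left]

/-- Up to diagrams with fewer crossings, a reduced lift is given by a code for the matching. -/
theorem exists_code_of_lift {z : k} {m : Matching X Y} {t : StringDiagram X Y}
    (h : t.IsPositiveReducedLift m) : ∃ ν : Code, ν.Valid 0 ∧ ν.InRange ∧
      2 * ν.length = X.length + Y.length ∧ (∀ s, ν.mate (sourcePos s) = targetPos (m s)) ∧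
      ∃ e ∈ Low z ν.cross, bend z X Y (t.eval z) = nf z ν (dualWord X ++ Y) + e (dualWord X ++ Y) := by
  have hr := h.reduced
  obtain ⟨⟨ν, h1, h2, h3⟩, e, he, h4⟩ := hr.exists_code (z := z)
  obtain ⟨h5, -, -, h6⟩ := NilBrauer.nf_spec h3
  have hl := dualWord_length X
  refine ⟨ν, h1, h2, code_length h3, fun s => ?_, _, h5 ▸ add_mem h6 he, ?_⟩
  · have hs := sourcePos_spec s
    have ht := targetPos_spec (m s)
    have hs' := (List.getElem?_eq_some_iff.1 hs).1
    have ht' := (List.getElem?_eq_some_iff.1 ht).1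
    rw [List.length_append, hl] at hs' ht'
    -- Marking the chord of the code at the source of a string also marks the target of that string,
    -- so this target must be the mate.
    obtain ⟨g, hg, h7, -, h8⟩ := hr.exists_mark h2 h3 hs'
    by_contra h9
    have h10 := h8 _ ht' (fun h10 => by rw [h10, hs] at ht; cases ht) (Ne.symm h9)
    rw [colour_targetPos, ← hg.sameString (h.endpoints s), ← colour_sourcePos t g s, h7] at h10
    exact Set.empty_ne_univ h10.symm
  · rw [h4]
    simp only [Pi.add_apply, Pi.sub_apply]
    abel

end

/-! ### Zebras as operators -/

section
variable {z : k}

theorem exists_opW_zebraUp (m : ℤ) : ∃ Z, ∀ a (v : Vec z),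
    op a (mor z (Diag.zebraUp m)) v = opW z Z a v := by
  have h : ∀ b n, ∃ Z, ∀ a (v : Vec z),
      op a (mor z (Diag.alternating b n)) v = opW z Z a v := by
    intro b n
    rcases Nat.even_or_odd' n with ⟨i, rfl | rfl⟩
    · exact ⟨_, fun a v => (op_alternating z b i a v).1⟩
    · exact ⟨alt (!b) (2 * i + 1), fun a v => by
        simpa only [Bool.not_not] using (op_alternating z (!b) i a v).2⟩
  unfold Diag.zebraUp
  split_ifs <;> exact h _ _

theorem exists_zebraUp (s : Bool) (n : ℕ) : ∃ m : ℤ, ∀ a (v : Vec z),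
    op a (mor z (Diag.zebraUp m)) v = opW z (alt s n) a v := by
  have h : ∀ b n, ∃ m, Diag.zebraUp m = Diag.alternating b n := by
    rintro (_ | _) n
    · cases n with
      | zero => exact ⟨0, rfl⟩
      | succ n => exact ⟨-(n + 1 : ℕ), by rw [Diag.zebraUp, if_neg (by omega), Int.natAbs_neg]; rfl⟩
    · exact ⟨n, by rw [Diag.zebraUp, if_pos (by omega)]; rfl⟩
  rcases Nat.even_or_odd' n with ⟨i, rfl | rfl⟩
  · obtain ⟨m, hm⟩ := h s (2 * i)
    exact ⟨m, fun a v => hm ▸ (op_alternating z s i a v).1⟩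
  · obtain ⟨m, hm⟩ := h (!s) (2 * i + 1)
    exact ⟨m, fun a v => hm ▸ (op_alternating z s i a v).2⟩

/-- A zebra slides along a cup. -/
theorem op_zebraDown_opu (m : ℤ) (a : ℕ) (v : Vec z) :
    op (a + 1) (mor z (Diag.zebraDown m)) (opu z a v) =
      op a (mor z (Diag.zebraUp m)) (opu z a v) := by
  obtain ⟨Z, hZ⟩ := exists_opW_zebraUp (z := z) m
  -- A zebra on a downward strand annihilates the right cup, whose right leg points upwards.
  have h1 : op (a + 1) (mor z (Diag.zebraDown m)) (opu z a v) =
      op (a + 1) (mor z (Diag.zebraDown m)) (opQ z a v) := by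
    rw [← pr_in (i := 0) (x := down) (mor z (Diag.zebraDown m)) (opu z a v) rfl rfl, opu_apply,
      map_add, (opQ_pr z a v).2, ← (opQ'_pr z a v).2, pr_pr_ne z _ _ (by simp), add_zero]
  have h2 := op_rotate_one (z := z) (a + 1) (opQ z a v) (Diag.zebraUp m)
  rw [h1]
  refine h2.trans ?_
  have h3 : opQ z (a + 1 + 1) (opQ z a v) = opQ z a (opQ z a v) := far (opQ z) (opQ z) a a (a + 1 + 1) v
  have h4 : opW z Z (a + 1 + 1) (opQ z a (opQ z a v)) = opQ z a (opW z Z a (opQ z a v)) :=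
    far (opQ z) (opW z Z) a a (a + 1 + 1) _
  rw [hZ, hZ, h3, h4, opE_opQ, pr_opW, ← opW_pr z a (opu z a v), pr_up_opu]

/-! ### Products of zebras -/

variable (z) in
/-- Lists of tokens in one position, on an upward strand. -/
def zebraFactor (x : ℕ → Arrow) (Z : ℕ → List Bool) (p : ℕ) : Module.End k (Vec z) :=
  match x p with
  | up => opW z (Z p) p
  | down => pr z down p

variable (z) in
/-- Lists of tokens in several positions, on upward strands. -/
def zebraProd (x : ℕ → Arrow) (Z : ℕ → List Bool) (L : List ℕ) : Module.End k (Vec z) :=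
  (L.map (zebraFactor z x Z)).prod

variable {x : ℕ → Arrow} {Z Z' : ℕ → List Bool} {p q : ℕ} {L L' : List ℕ} {v : Vec z}

theorem zebraFactor_up (h : x p = up) : zebraFactor z x Z p = opW z (Z p) p := by
  rw [zebraFactor, h]

theorem zebraFactor_down (h : x p = down) : zebraFactor z x Z p = pr z down p := by
  rw [zebraFactor, h]

theorem zebraProd_cons : zebraProd z x Z (p :: L) v = zebraFactor z x Z p (zebraProd z x Z L v) := by
  rw [zebraProd, List.map_cons, List.prod_cons]; rfl

theorem zebraProd_append :
    zebraProd z x Z (L ++ L') v = zebraProd z x Z L (zebraProd z x Z L' v) := by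
  rw [zebraProd, List.map_append, List.prod_append]; rfl

theorem zebraProd_congr (h : ∀ p ∈ L, Z p = Z' p) : zebraProd z x Z L = zebraProd z x Z' L := by
  unfold zebraProd
  refine congrArg _ (List.map_congr_left fun p hp => ?_)
  simp only [zebraFactor, h p hp]

theorem zebraFactor_even {F : ℕ → Module.End k (Vec z)} {n m : ℕ} (hF : IsLocal F n m 0) {b b' : ℕ}
    (hp : p + 1 ≤ b) (hb : b' = b) :
    F b' (zebraFactor z x Z p v) = zebraFactor z x Z p (F b v) := by
  cases h : x p
  · rw [zebraFactor_up h]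
    exact far (opW z (Z p)) F p b b' v hp (by omega)
  · rw [zebraFactor_down h]
    exact far (pr z down) F p b b' v hp (by omega)

theorem zebraProd_even {F : ℕ → Module.End k (Vec z)} {n m : ℕ} (hF : IsLocal F n m 0) {b : ℕ}
    (hL : ∀ p ∈ L, p + 1 ≤ b) : F b (zebraProd z x Z L v) = zebraProd z x Z L (F b v) := by
  induction L with
  | nil => rfl
  | cons p L ih =>
    rw [zebraProd_cons, zebraProd_cons, zebraFactor_even hF (hL p List.mem_cons_self) rfl,
      ih fun p hp => hL p (List.mem_cons_of_mem _ hp)]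

/-- Tokens at different positions commute up to sign. -/
theorem tok_opW (s : Bool) (hpq : p ≠ q) (Y : List Bool) : ∃ c : k, ∀ v,
    tok z s q (opW z Y p v) = c • opW z Y p (tok z s q v) := by
  induction Y with
  | nil => exact ⟨1, fun v => (LinearMap.congr_fun (tok_pr_comm s up q p) v).trans (one_smul _ _).symm⟩
  | cons t Y ih =>
    obtain ⟨c, hc⟩ := ih
    refine ⟨-c, fun v => ?_⟩
    have h : tok z s q (opU z t p (opW z Y p v)) = -opU z t p (tok z s q (opW z Y p v)) := by
      rcases lt_or_gt_of_ne hpq with h | h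
      · exact far_odd (opU z t) (tok z s) p q q _
      · rw [far_odd (tok z s) (opU z t) q p p, neg_neg]
    rw [opW_cons, h, hc, map_smul, neg_smul]
    rfl

theorem tok_zebraFactor (s : Bool) (hpq : p ≠ q) : ∃ c : k, ∀ v,
    tok z s q (zebraFactor z x Z p v) = c • zebraFactor z x Z p (tok z s q v) := by
  cases h : x p
  · rw [zebraFactor_up h]; exact tok_opW s hpq (Z p)
  · rw [zebraFactor_down h]
    exact ⟨1, fun v => (LinearMap.congr_fun (tok_pr_comm s down q p) v).trans (one_smul _ _).symm⟩

theorem tok_zebraProd (s : Bool) (hL : L.Nodup) (hq : q ∈ L) (hx : x q = up) : ∃ c : k, ∀ v,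
    tok z s q (zebraProd z x Z L v) = c • zebraProd z x (Function.update Z q (s :: Z q)) L v := by
  induction L with
  | nil => cases hq
  | cons p L ih =>
    obtain ⟨hp, hL⟩ := List.nodup_cons.1 hL
    by_cases hpq : p = q
    · subst hpq
      refine ⟨1, fun v => ?_⟩
      rw [one_smul, zebraProd_cons, zebraProd_cons, zebraFactor_up hx, zebraFactor_up hx, ← pr_opW,
        tok_pr_up, Function.update_self, opW_cons,
        zebraProd_congr (Z := Function.update Z p (s :: Z p)) (Z' := Z) fun r hr =>
          Function.update_of_ne (by rintro rfl; exact hp hr) _ _]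
    · obtain ⟨c, hc⟩ := tok_zebraFactor (z := z) (x := x) (Z := Z) s hpq
      obtain ⟨d, hd⟩ := ih hL ((List.mem_cons.1 hq).resolve_left (Ne.symm hpq))
      refine ⟨c * d, fun v => ?_⟩
      have h : zebraFactor z x (Function.update Z q (s :: Z q)) p = zebraFactor z x Z p := by
        simp only [zebraFactor, Function.update_of_ne hpq]
      rw [zebraProd_cons, zebraProd_cons, hc, hd, h, map_smul, mul_smul]

theorem pr_zebraProd (y : Arrow) (hq : q ∈ L) (hx : x q = up) :
    pr z y q (zebraProd z x Z L v) = zebraProd z x Z L v ∨ pr z y q (zebraProd z x Z L v) = 0 := by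
  induction L with
  | nil => cases hq
  | cons p L ih =>
    rw [zebraProd_cons]
    by_cases hpq : p = q
    · subst hpq
      rw [zebraFactor_up hx]
      by_cases h : y = up
      · exact Or.inl (by rw [h, pr_opW])
      · exact Or.inr (by rw [← pr_opW, pr_pr_ne z p _ h])
    · have h : ∀ w, pr z y q (zebraFactor z x Z p w) = zebraFactor z x Z p (pr z y q w) := by
        intro w
        rcases lt_or_gt_of_ne hpq with h | h
        · exact zebraFactor_even inferInstance h rfl
        · cases h' : x p
          · rw [zebraFactor_up h']; exact (far (pr z y) (opW z (Z p)) q p p w).symm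
          · rw [zebraFactor_down h']; exact (far (pr z y) (pr z down) q p p w).symm
      rw [h]
      rcases ih ((List.mem_cons.1 hq).resolve_left (Ne.symm hpq)) with h1 | h1
      · exact Or.inl (by rw [h1])
      · exact Or.inr (by rw [h1, map_zero])

/-- Lists of tokens may be replaced by zebras. -/
theorem zebraProd_zebra (Z : ℕ → List Bool) : ∃ l : ℕ → ℤ, ∀ Z' : ℕ → List Bool,
    (∀ p a (v : Vec z), op a (mor z (Diag.zebraUp (l p))) v = opW z (Z' p) a v) →
    ∃ c : k, ∀ v, zebraProd z x Z L v = c • zebraProd z x Z' L v := by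
  have h1 : ∀ p, ∃ m : ℤ, ∃ c : k, ∀ a (v : Vec z),
      opW z (Z p) a v = c • op a (mor z (Diag.zebraUp m)) v := by
    intro p
    obtain ⟨s, n, -, -, h⟩ := exists_opW_alt z (Z p)
    obtain ⟨m, hm⟩ := exists_zebraUp (z := z) s n
    rcases h with h | h
    · exact ⟨m, 1, fun a v => by rw [one_smul, h, hm]⟩
    · exact ⟨m, -1, fun a v => by rw [neg_smul, one_smul, h, hm]⟩
  choose l c hl using h1
  refine ⟨l, fun Z' hZ' => ?_⟩
  induction L with
  | nil => exact ⟨1, fun v => (one_smul k _).symm⟩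
  | cons p L ih =>
    obtain ⟨d, hd⟩ := ih
    cases h : x p
    · refine ⟨c p * d, fun v => ?_⟩
      rw [zebraProd_cons, zebraProd_cons, hd, zebraFactor_up h, zebraFactor_up h, map_smul, hl, hZ',
        smul_comm, mul_smul]
    · refine ⟨d, fun v => ?_⟩
      rw [zebraProd_cons, zebraProd_cons, hd, zebraFactor_down h, zebraFactor_down h, map_smul]

theorem zebraProd_nil_apply {W : Word} (h : ∀ p ∈ L, W[p]? = some (x p)) (hZ : ∀ p, Z p = []) :
    zebraProd z x Z L v W = v W := by
  induction L with
  | nil => rfl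
  | cons p L ih =>
    have hp := h p List.mem_cons_self
    have h2 : ∀ y, x p = y → pr z y p (zebraProd z x Z L v) W = zebraProd z x Z L v W := fun y hy =>
      pr_apply_of_get _ (hy ▸ hp)
    rw [zebraProd_cons, ← ih fun p hp => h p (List.mem_cons_of_mem _ hp)]
    cases h' : x p
    · rw [zebraFactor_up h', hZ]; exact h2 _ (by rw [h'])
    · rw [zebraFactor_down h']; exact h2 _ (by rw [h'])

/-! ### Diagrams with zebras -/

theorem op_zebrasOnUp (Y : Word) : ∀ (a : ℕ) (l : ℕ → ℤ) (v : Vec z),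
    (∀ j (h : j < Y.length), x (a + j) = Y[j]) →
    (∀ j b (v : Vec z), op b (mor z (Diag.zebraUp (l j))) v = opW z (Z (a + j)) b v) →
    op a (mor z (Diag.zebrasOnUp Y l)) v =
      op (a + Y.length) (𝟙 (unit z)) (zebraProd z x Z (List.range' a Y.length) v) := by
  induction Y with
  | nil => exact fun _ _ _ _ _ => rfl
  | cons y Y ih =>
    intro a l v hx hZ
    have hy : x a = y := hx 0 (by simp)
    have h1 := ih (a + 1) (fun j => l (j + 1)) v
      (fun j h => by rw [add_assoc, add_comm 1 j]; exact hx (j + 1) (by simpa using h))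
      (fun j b v => by rw [add_assoc, add_comm 1 j]; exact hZ (j + 1) b v)
    have h2 : op a (mor z (Diag.zebrasOnUp (y :: Y) l)) v =
        zebraFactor z x Z a (op (a + 1) (mor z (Diag.zebrasOnUp Y fun j => l (j + 1))) v) := by
      cases y
      · rw [zebraFactor_up hy]
        exact (op_mor_tensor z a v _ _).trans (hZ 0 a _)
      · rw [zebraFactor_down hy]
        exact op_mor_tensor z a v _ _
    have h3 : IsLocal (fun b => op (z := z) b (𝟙 (unit z))) 0 0 0 :=
      .of_mor (.id []) rfl rfl rfl
    rw [h2, h1, List.length_cons, List.range'_succ, zebraProd_cons]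
    exact (zebraFactor_even (F := fun b => op (z := z) b (𝟙 (unit z))) h3 (by omega) (by omega)).symm

/-- Zebras on downward source strands slide along the nested cups to the bent ends, which point
upwards; nesting reverses their order. -/
theorem op_zebrasOnDown (X : Word) : ∀ (l : ℕ → ℤ),
    (∀ i (h : i < X.length), x (X.length - 1 - i) = X[i].dual) →
    (∀ i < X.length, ∀ b (v : Vec z), op b (mor z (Diag.zebraUp (l i))) v =
      opW z (Z (X.length - 1 - i)) b v) →
    op X.length (mor z (Diag.zebrasOnDown X l)) (cups z X.length) =
      zebraProd z x Z (List.range X.length).reverse (cups z X.length) := by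
  induction X with
  | nil => exact fun _ _ _ => funext fun W => op_id_apply (P := []) _ [] W rfl rfl
  | cons y X ih =>
    intro l hx hZ
    have hy : x X.length = y.dual := hx 0 (by simp)
    have h1 := ih (fun j => l (j + 1))
      (fun i h => by
        rw [show X.length - 1 - i = (y :: X).length - 1 - (i + 1) by rw [List.length_cons]; omega]
        exact hx (i + 1) (Nat.succ_lt_succ h))
      (fun i h => by
        rw [show X.length - 1 - i = (y :: X).length - 1 - (i + 1) by rw [List.length_cons]; omega]
        exact hZ (i + 1) (Nat.succ_lt_succ h))
    let N := X.length
    have h2 : op (N + 1 + 1) (mor z (Diag.zebrasOnDown X fun j => l (j + 1))) (opu z N (cups z N)) =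
        opu z N (op N (mor z (Diag.zebrasOnDown X fun j => l (j + 1))) (cups z N)) := by
      have : IsLocal (fun b => op (z := z) b (mor z (Diag.zebrasOnDown X fun j => l (j + 1)))) X.length
        X.length (Diag.zebrasOnDown X fun j => l (j + 1)).tokens := .of_mor _ rfl rfl rfl
      exact far (opu z) (fun b => op (z := z) b (mor z (Diag.zebrasOnDown X fun j => l (j + 1))))
        N N (N + 1 + 1) _
    have h3 : op (N + 1) (mor z (Diag.zebrasOnDown (y :: X) l)) (opu z N (cups z N)) =
        zebraFactor z x Z N (opu z N (op N (mor z (Diag.zebrasOnDown X fun j => l (j + 1)))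
          (cups z N))) := by
      cases y
      · rw [zebraFactor_down hy, ← h2]
        refine (op_mor_tensor z (N + 1) _ _ _).trans ?_
        change pr z up (N + 1) (op (N + 1 + 1) _ _) = _
        rw [h2, pr_down_opu, opu_apply, map_add, ← (opQ_pr z N _).2, pr_pr_ne z _ _ (by simp),
          zero_add, (opQ'_pr z N _).2]
      · rw [zebraFactor_up hy, ← h2]
        refine (op_mor_tensor z (N + 1) _ _ _).trans ?_
        change op (N + 1) _ (op (N + 1 + 1) _ _) = _
        rw [h2, op_zebraDown_opu]
        exact hZ 0 (Nat.succ_pos _) N _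
    rw [List.length_cons, List.range_succ, List.reverse_append, List.reverse_singleton,
      List.singleton_append, zebraProd_cons]
    refine h3.trans (congrArg _ ?_)
    rw [h1]
    exact zebraProd_even inferInstance fun p hp => List.mem_range.1 (List.mem_reverse.1 hp)

theorem Piece.eval_even {P Q : Word} (p : Piece P Q) : p.eval z ∈ parityPart z P Q 0 := by
  cases p with
  | cross x y =>
    cases x <;> cases y
    · exact mor_mem_parityPart z _ rfl
    · exact add_mem (mor_mem_parityPart z _ rfl) (Submodule.smul_mem _ z (mor_mem_parityPart z _ rfl))
    · exact mor_mem_parityPart z _ rfl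
    · exact mor_mem_parityPart z _ rfl
  | cup x => cases x <;> exact mor_mem_parityPart z _ rfl
  | cap x => cases x <;> exact mor_mem_parityPart z _ rfl

theorem StringDiagram.eval_even {X Y : Word} (t : StringDiagram X Y) :
    t.eval z ∈ parityPart z X Y 0 := by
  induction t with
  | id => exact id_mem_parityPart z X
  | layer t A p B hY hZ ih =>
    subst hY hZ
    have h := comp_mem_parityPart ih (tens_mem_parityPart (tens_mem_parityPart
      (id_mem_parityPart z A) (p.eval_even (z := z))) (id_mem_parityPart z B))
    simpa [StringDiagram.eval] using h

theorem op_id_self {u : Vec z} {W : Word} {a : ℕ} (h : a ≤ W.length) :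
    op a (𝟙 (unit z)) u W = u W :=
  op_id_apply (P := []) u (W.take a) (W.drop a) (by simp [h]) (by simp)

/-- After bending, the termini of strings are exactly the upward letters of `dualWord X ++ Y`. The
lower zebras pass the even morphism `t.eval z` without a sign, and the two rows become one product.
-/
theorem bend_zebra {X Y : Word} (t : StringDiagram X Y) {l l' : ℕ → ℤ}
    (hx : ∀ p (h : p < (dualWord X ++ Y).length), x p = (dualWord X ++ Y)[p])
    (hl : ∀ i < X.length, ∀ b (v : Vec z), op b (mor z (Diag.zebraUp (l i))) v =
      opW z (Z (X.length - 1 - i)) b v)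
    (hl' : ∀ j b (v : Vec z), op b (mor z (Diag.zebraUp (l' j))) v =
      opW z (Z (X.length + j)) b v) :
    bend z X Y (mor z (.zebrasOnDown X l) ≫ t.eval z ≫ mor z (.zebrasOnUp Y l')) =
      zebraProd z x Z (List.range' X.length Y.length ++ (List.range X.length).reverse)
        (op X.length (t.eval z) (cups z X.length)) (dualWord X ++ Y) := by
  have hlen := dualWord_length X
  have h1 := op_zebrasOnDown (z := z) (x := x) (Z := Z) X l (fun i h => by
    have h2 := dualWord_getElem? (X := X) (Y := Y) (i := i) h
    obtain ⟨h3, h4⟩ := List.getElem?_eq_some_iff.1 h2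
    rw [hx _ h3, h4]; rfl) hl
  have h2 := fun v => op_zebrasOnUp (z := z) (x := x) (Z := Z) Y X.length l' v (fun j h => by
    have h2 := dualWord_append_getElem? (X := X) (Y := Y) (j := j) h
    obtain ⟨h3, h4⟩ := List.getElem?_eq_some_iff.1 h2
    rw [hx _ h3, h4]; rfl) hl'
  have h3 : IsLocal (fun b => op (z := z) b (t.eval z)) X.length Y.length 0 :=
    ⟨Submodule.subset_span ⟨_, _, _, rfl, rfl, t.eval_even, rfl⟩⟩
  change op X.length _ (cups z X.length) _ = _
  rw [op_comp, op_comp, Module.End.mul_apply, Module.End.mul_apply, h1,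
    zebraProd_even (F := fun b => op (z := z) b (t.eval z)) h3 fun p hp => List.mem_range.1 (List.mem_reverse.1 hp),
    h2, op_id_self (by simp [hlen]), zebraProd_append]

end

/-! ### Spanning -/

section
variable {z : k} {X Y : Word}

/-- Endomorphisms of a letter preserve the word, so token operators can be evaluated at one fixed
word, ignoring all others. -/
theorem op_apply_eq_zero_of_endo {x : Arrow} (f : obj z [x] ⟶ obj z [x]) {u : Vec z} {W : Word}
    (a : ℕ) (hu : u W = 0) : op a f u W = 0 := by
  have h : op a f u W = op a f (0 : Vec z) W := op_congr f fun A B _ hW => by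
    rw [← hW, hu]; rfl
  rw [h, map_zero]; rfl

theorem tok_apply_eq_zero (s : Bool) (p : ℕ) {u : Vec z} {W : Word} (hu : u W = 0) :
    tok z s p u W = 0 := by
  rw [tok_apply, Pi.add_apply, opU, opN, op_apply_eq_zero_of_endo _ _ hu,
    op_apply_eq_zero_of_endo _ _ hu, add_zero]

theorem tokAlg_apply_eq_zero {P : Set ℕ} {F : Module.End k (Vec z)} (hF : F ∈ tokAlg z P) {W : Word} :
    ∀ {u : Vec z}, u W = 0 → F u W = 0 := by
  induction hF using Algebra.adjoin_induction with
  | mem F hF =>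
    intro u hu
    rcases hF with ⟨s, p, -, rfl⟩ | ⟨x, p, -, rfl⟩
    · exact tok_apply_eq_zero s p hu
    · exact op_apply_eq_zero_of_endo _ p hu
  | algebraMap r =>
    intro u hu
    change r • u W = 0
    rw [hu, smul_zero]
  | add F G _ _ h h' =>
    intro u hu
    change F u W + G u W = 0
    rw [h hu, h' hu, add_zero]
  | mul F G _ _ h h' => exact fun hu => h (h' hu)

theorem tok_apply_of_le (s : Bool) {p : ℕ} (u : Vec z) {W : Word} (h : W.length ≤ p) :
    tok z s p u W = 0 := by
  have h1 : ∀ {x : Arrow} (f : obj z [x] ⟶ obj z [x]), op p f u W = 0 := fun f =>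
    op_apply_eq_zero f u (by
      rintro ⟨A, B, rfl, rfl⟩
      simp at h)
  rw [tok_apply, Pi.add_apply, opU, opN, h1, h1, add_zero]

theorem op_eqMor {P P' Q Q' : Word} (hP : P = P') (hQ : Q' = Q) (f : obj z P' ⟶ obj z Q') (a : ℕ) :
    op a (eqMor z hP ≫ f ≫ eqMor z hQ) = op a f := by
  subst hP hQ
  simp

/-- Bubbles move past nested cups. -/
theorem op_bub_cups {w : End (unit z)} (hw : w ∈ bubAlg z) (N : ℕ) :
    op (N + N) w (cups z N) = op 0 w (cups z N) := by
  induction N with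
  | zero => rfl
  | succ N ih =>
    have h := (op_bub_far (F := opu z) hw N (N + N) (cups z N)).2 (by omega)
    have h' := (op_bub_far (F := opu z) hw N 0 (cups z N)).1 (by omega)
    rw [show N + 1 + (N + 1) = N + N - 0 + 2 by omega]
    exact h.trans ((congrArg _ ih).trans h'.symm)

theorem op_bub_comm {P Q : Word} {w : End (unit z)} (hw : w ∈ bubAlg z) (f : obj z P ⟶ obj z Q)
    (a : ℕ) (v : Vec z) : op a f (op 0 w v) = op 0 w (op a f v) := by
  induction f using mor_induction with
  | h0 => rw [op_zero]; exact (map_zero (op 0 w)).symm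
  | hadd f g hf hg =>
    simp only [op_add, LinearMap.add_apply, hf, hg, map_add]
  | hsmul c d =>
    have h := op_swap (a := 0) (b := a) (b' := a) (bubAlg_even hw) (mor_mem_parityPart z d rfl)
      (Nat.zero_le _) rfl
    have h := LinearMap.congr_fun h v
    rw [zero_mul, pow_zero, one_smul] at h
    simp only [op_smul, LinearMap.smul_apply, map_smul]
    exact congrArg (c • ·) h

/-- The action puts the bubble at the far right, next to the nested cups. It slides over them to the
far left without meeting a strand, where it matches the bubbles in `NSpan`. -/
theorem bend_act {w : End (unit z)} (hw : w ∈ bubAlg z) (g : obj z X ⟶ obj z Y) :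
    bend z X Y (act z g w) =
      op 0 w (op X.length g (cups z X.length)) (dualWord X ++ Y) := by
  change op X.length (act z g w) (cups z X.length) _ = _
  rw [act, op_eqMor, op_tens (b := X.length + X.length) _ _ _ rfl, Module.End.mul_apply, op_bub_cups hw,
    op_bub_comm hw]

variable (S : Submodule k (obj z X ⟶ obj z Y))

/-- The vectors given by bending morphisms in `S`. -/
def bendSubmodule : Submodule k (Vec z) :=
  (S.map (bend z X Y)).comap (LinearMap.proj (dualWord X ++ Y))

variable {S}

theorem mem_bendSubmodule_of_zero {u : Vec z} (h : u (dualWord X ++ Y) = 0) : u ∈ bendSubmodule S :=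
  ⟨0, zero_mem _, (map_zero _).trans h.symm⟩

theorem bendSubmodule_bub (hact : ∀ w ∈ bubAlg z, ∀ f ∈ S, act z f w ∈ S) {w : End (unit z)}
    (hw : w ∈ bubAlg z) {u : Vec z} (hu : u ∈ bendSubmodule S) : op 0 w u ∈ bendSubmodule S := by
  obtain ⟨g, hg, e⟩ := hu
  refine ⟨act z g w, hact w hw g hg, (bend_act hw g).trans ?_⟩
  refine op_congr (W := dualWord X ++ Y) w fun A B hA hW => ?_
  obtain rfl := List.eq_nil_of_length_eq_zero hA
  rw [← hW]
  exact e

/-- Decorating a diagram with tokens near the termini of its strings. -/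
theorem tokAlg_mem_bendSubmodule {t : StringDiagram X Y}
    (ht : ∀ l l' : ℕ → ℤ, mor z (.zebrasOnDown X l) ≫ t.eval z ≫ mor z (.zebrasOnUp Y l') ∈ S)
    {F : Module.End k (Vec z)}
    (hF : F ∈ tokAlg z {p | (dualWord X ++ Y)[p]? = some down}ᶜ) :
    F (op X.length (t.eval z) (cups z X.length)) ∈ bendSubmodule S := by
  have hlen := dualWord_length X
  set W := dualWord X ++ Y with hW
  set v := op X.length (t.eval z) (cups z X.length) with hv
  let x : ℕ → Arrow := fun p => W.getD p up
  let L := List.range' X.length Y.length ++ (List.range X.length).reverse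
  have hx : ∀ p (h : p < W.length), x p = W[p] := fun p h => List.getD_eq_getElem _ _ h
  have hL : ∀ p, p ∈ L ↔ p < W.length := by
    intro p
    simp only [L, hW, List.mem_append, List.mem_range'_1, List.mem_reverse, List.mem_range,
      List.length_append, hlen]
    omega
  have hnd : L.Nodup := by
    refine List.Nodup.append List.nodup_range' (List.nodup_reverse.2 List.nodup_range) fun p h h' => ?_
    have h1 := List.mem_range'_1.1 h
    have h2 := List.mem_range.1 (List.mem_reverse.1 h')
    omega
  -- Only the value at `W` is bent back, so vectors vanishing there are added to the span of
  -- products of token words; the sum is then stable under tokens at upward letters.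
  let K₀ : Submodule k (Vec z) := LinearMap.ker (LinearMap.proj (R := k) (φ := fun W => unit z ⟶ obj z W) W)
  let K := Submodule.span k (Set.range fun Z => zebraProd z x Z L v) ⊔ K₀
  have hK₀ : ∀ u : Vec z, u W = 0 → u ∈ K := fun u hu =>
    Submodule.mem_sup_right (LinearMap.mem_ker.2 hu)
  have hK : K ≤ bendSubmodule S := by
    refine sup_le (Submodule.span_le.2 ?_) fun u hu => mem_bendSubmodule_of_zero hu
    rintro _ ⟨Z, rfl⟩
    obtain ⟨l, hl⟩ := zebraProd_zebra (z := z) (x := x) (L := L) Z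
    choose Z' hZ' using fun p => exists_opW_zebraUp (z := z) (l p)
    obtain ⟨c, hc⟩ := hl Z' hZ'
    change zebraProd z x Z L v ∈ _
    rw [hc]
    refine Submodule.smul_mem _ c ⟨_, ht (fun i => l (X.length - 1 - i)) (fun j => l (X.length + j)), ?_⟩
    exact bend_zebra t hx (fun i _ => hZ' _) fun j => hZ' _
  have hv : v ∈ K := by
    have h : v - zebraProd z x (fun _ => []) L v ∈ K := hK₀ _ (by
      rw [Pi.sub_apply, zebraProd_nil_apply (fun p hp => ?_) fun _ => rfl, sub_self]
      rw [hx p ((hL p).1 hp), List.getElem?_eq_getElem])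
    have h' : zebraProd z x (fun _ => []) L v ∈ K :=
      le_sup_left (b := K₀) (Submodule.subset_span ⟨_, rfl⟩)
    simpa using add_mem h h'
  -- A generator at a position beyond the word vanishes at `W`; at any other allowed position the
  -- letter is upward and the generator acts on the products.
  have hgen : ∀ (G : Module.End k (Vec z)) (p : ℕ), (∀ u : Vec z, u W = 0 → G u W = 0) →
      (W.length ≤ p → ∀ u : Vec z, G u W = 0) →
      (p ∈ L → x p = up → ∀ Z, G (zebraProd z x Z L v) ∈ K) → W[p]? ≠ some down →
      ∀ u ∈ K, G u ∈ K := by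
    intro G p h1 h2 h3 hp
    have h4 : K ≤ K.comap G := by
      refine sup_le (Submodule.span_le.2 ?_) fun u hu => hK₀ _ (h1 u hu)
      rintro _ ⟨Z, rfl⟩
      rcases lt_or_ge p W.length with h | h
      · refine h3 ((hL p).2 h) ?_ Z
        rw [List.getElem?_eq_getElem h, ← hx p h] at hp
        cases h5 : x p
        · rfl
        · exact absurd (congrArg some h5) hp
      · exact hK₀ _ (h2 h _)
    exact fun u hu => h4 hu
  have hmem : ∀ Z, zebraProd z x Z L v ∈ K := fun Z =>
    le_sup_left (b := K₀) (Submodule.subset_span ⟨Z, rfl⟩)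
  have hKF : ∀ u ∈ K, F u ∈ K := by
    induction hF using Algebra.adjoin_induction with
    | mem G hG =>
      rcases hG with ⟨s, p, hp, rfl⟩ | ⟨y, p, hp, rfl⟩
      · refine hgen _ p (fun u => tok_apply_eq_zero s p) (fun h u => tok_apply_of_le s u h)
          (fun h h' Z => ?_) hp
        obtain ⟨c, hc⟩ := tok_zebraProd (z := z) (Z := Z) s hnd h h'
        rw [hc]
        exact K.smul_mem c (hmem _)
      · refine hgen _ p (fun u => op_apply_eq_zero_of_endo _ p) (fun h u => pr_apply_of_ne u ?_)
          (fun h h' Z => ?_) hp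
        · rw [List.getElem?_eq_none h]; simp
        · rcases pr_zebraProd (z := z) (Z := Z) (v := v) y h h' with h | h <;> rw [h]
          exacts [hmem _, zero_mem _]
    | algebraMap r => exact fun u hu => K.smul_mem r hu
    | add F G _ _ h h' => exact fun u hu => add_mem (h u hu) (h' u hu)
    | mul F G _ _ h h' => exact fun u hu => h _ (h' u hu)
  exact hK (hKF v hv)

/-- A code that is compatible with a word gives a matching. -/
theorem exists_matching {ν : Code} (hr : ν.InRange) (hlen : (dualWord X ++ Y).length = 2 * ν.length)
    (hc : ∀ p x, (dualWord X ++ Y)[p]? = some x → (dualWord X ++ Y)[ν.mate p]? = some x.dual) :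
    ∃ m : Matching X Y, ∀ s, ν.mate (sourcePos s) = targetPos (m s) := by
  have h1 : ∀ s : Sources X Y, ∃ s' : Targets X Y, targetPos s' = ν.mate (sourcePos s) := fun s =>
    exists_target (hc _ _ (sourcePos_spec s))
  choose m hm using h1
  have hlt : ∀ {p x}, (dualWord X ++ Y)[p]? = some x → p < 2 * ν.length := fun h =>
    hlen ▸ (List.getElem?_eq_some_iff.1 h).1
  have hinv : ∀ {p x}, (dualWord X ++ Y)[p]? = some x → ν.mate (ν.mate p) = p := fun h =>
    (hr.isMatching _ (hlt h)).2.1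
  refine ⟨Equiv.ofBijective m ⟨fun s s' h => ?_, fun s' => ?_⟩, fun s => (hm s).symm⟩
  · have h2 : ν.mate (sourcePos s) = ν.mate (sourcePos s') := by rw [← hm, h, hm]
    refine sourcePos_injective ?_
    rw [← hinv (sourcePos_spec s), h2, hinv (sourcePos_spec s')]
  · obtain ⟨s, hs⟩ := exists_source (hc _ _ (targetPos_spec s'))
    exact ⟨s, targetPos_injective (by rw [hm, hs, hinv (targetPos_spec s')])⟩

/-- Two codes that are compatible with a word and give the same matching are equal. -/
theorem code_eq_of_matching {ν ν' : Code} (hν : ν.Valid 0) (hν' : ν'.Valid 0) (hr : ν.InRange)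
    (hr' : ν'.InRange) (hlen : (dualWord X ++ Y).length = 2 * ν.length)
    (hlen' : (dualWord X ++ Y).length = 2 * ν'.length)
    {m : Matching X Y} (h : ∀ s, ν.mate (sourcePos s) = targetPos (m s))
    (h' : ∀ s, ν'.mate (sourcePos s) = targetPos (m s)) : ν = ν' := by
  refine Code.eq_of_mate_eq hν hν' hr hr' (by omega) fun p hp => ?_
  cases hx : (dualWord X ++ Y)[p]? with
  | none => exact absurd (List.getElem?_eq_none_iff.1 hx) (by omega)
  | some x =>
    cases x with
    | down =>
      obtain ⟨s, rfl⟩ := exists_source hx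
      rw [h, h']
    | up =>
      obtain ⟨s', rfl⟩ := exists_target hx
      obtain ⟨s, rfl⟩ := m.surjective s'
      have hs : sourcePos s < (dualWord X ++ Y).length :=
        (List.getElem?_eq_some_iff.1 (sourcePos_spec s)).1
      have e := (hr.isMatching _ (hlen ▸ hs)).2.1
      have e' := (hr'.isMatching _ (hlen' ▸ hs)).2.1
      rw [h] at e
      rw [h'] at e'
      rw [e, e']

variable {B : Matching X Y → StringDiagram X Y}

/-- Induction on the number of crossings. A normal form that does not vanish at the word in question
defines a matching, and the bent lift of this matching has the same normal form up to lower terms,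
so it may replace it. -/
theorem low_le_bendSubmodule (hB : ∀ m, (B m).IsPositiveReducedLift m) (hS : zebraSet z B ⊆ S)
    (hact : ∀ w ∈ bubAlg z, ∀ f ∈ S, act z f w ∈ S) (n : ℕ) : Low z n ≤ bendSubmodule S := by
  induction n with
  | zero => rw [low_zero]; exact bot_le
  | succ n ih =>
    refine (low_le_nSpan n).trans fun v hv => nSpan_map 1 _ (fun w hw F hF ν hν hn => ?_) hv
    refine bendSubmodule_bub hact hw ?_
    have hlow : Low z ν.cross ≤ bendSubmodule S := (low_mono hn).trans ih
    have hl := dualWord_length X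
    set W := dualWord X ++ Y with hW
    rcases inRange_or_nf_eq_zero (z := z) ν with hr | h0
    swap
    · rw [h0, map_zero]; exact zero_mem _
    by_cases hz : nf z ν W = 0
    · exact mem_bendSubmodule_of_zero (tokAlg_apply_eq_zero hF hz)
    have hlen : W.length = 2 * ν.length := by
      by_contra h
      exact hz (nf_isLen ν W h)
    have hc : ∀ p x, W[p]? = some x → W[ν.mate p]? = some x.dual := by
      intro p x hx
      have hp := (hr.isMatching p (hlen ▸ (List.getElem?_eq_some_iff.1 hx).1)).1
      rw [← hlen] at hp
      by_contra h
      refine hz (nf_apply_eq_zero hr hx (List.getElem?_eq_getElem hp) fun h' => h ?_)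
      rw [List.getElem?_eq_getElem hp, h']
    obtain ⟨m, hm⟩ := exists_matching hr hlen hc
    obtain ⟨ν', h1, h2, h3, h4, e, he, h5⟩ := exists_code_of_lift (z := z) (hB m)
    have hlen' : W.length = 2 * ν'.length := by rw [h3, hW, List.length_append, hl]
    obtain rfl := code_eq_of_matching hν h1 hr h2 hlen hlen' hm h4
    -- Tokens at source ends are separated from those at termini, so that the former can be slid
    -- along their strings while the latter stay.
    refine tokAlg_apply_induction (P := {p | W[p]? = some down}) _ _ (fun F hF G hG => ?_) hF
    have hlt : ∀ {p}, W[p]? = some down → p < 2 * ν.length := fun h =>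
      hlen ▸ (List.getElem?_eq_some_iff.1 h).1
    obtain ⟨F', hF', h6⟩ := tokAlg_transfer (Q := {p | W[p]? = some down}ᶜ) (v := nf z ν) (μ := ν.mate)
      (fun s p hp => (hr.slides z).tok s p (hlt hp)) (fun x p hp => (hr.slides z).pr x p (hlt hp))
      (fun p hp => ⟨fun h => h hp, fun h => by
        have h' := hc p down hp
        cases (show W[ν.mate p]? = some down from h).symm.trans h'⟩) hG
    have hFF := mul_mem hF hF'
    have key : F (F' (nf z ν)) ∈ bendSubmodule S := by
      let v := op X.length ((B m).eval z) (cups z X.length)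
      have a1 : F (F' v) ∈ bendSubmodule S :=
        tokAlg_mem_bendSubmodule (fun l l' => hS ⟨m, l, l', rfl⟩) hFF
      have a2 : F (F' e) ∈ bendSubmodule S := hlow (low_tokAlg hFF he)
      -- The vectors need only agree at the word `W`, and token operators respect this.
      have a3 : F (F' (nf z ν + e - v)) ∈ bendSubmodule S := by
        refine mem_bendSubmodule_of_zero (tokAlg_apply_eq_zero hFF ?_)
        exact sub_eq_zero.2 h5.symm
      have h7 : F (F' (nf z ν)) = F (F' v) - F (F' e) + F (F' (nf z ν + e - v)) := by
        simp only [map_add, map_sub]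
        abel
      exact h7 ▸ add_mem (sub_mem a1 a2) a3
    have := add_mem key (hlow (low_tokAlg hF h6))
    rwa [map_sub, add_sub_cancel] at this

/-- Every bent morphism is the value at its word of a vector in some `Low z n`; injectivity of
bending returns the morphism itself to `S`. -/
theorem eq_top_of_zebraSet_subset (hB : ∀ m, (B m).IsPositiveReducedLift m) (hS : zebraSet z B ⊆ S)
    (hact : ∀ w ∈ bubAlg z, ∀ f ∈ S, act z f w ∈ S) : S = ⊤ := by
  refine eq_top_iff.2 fun f _ => ?_
  obtain ⟨n, v, hv, h⟩ := exists_low_apply_eq (bend z X Y f)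
  obtain ⟨g, hg, e⟩ := low_le_bendSubmodule hB hS hact n hv
  exact bend_injective X Y (e.trans h) ▸ hg

theorem span_zebraSet (hz : IsUnit z) {β : SymFun k →ₐ[k] End (unit z)}
    (hβ : ∀ r, 1 ≤ r → β (SymFun.h k r) = z • zebR z r)
    (hB : ∀ m, (B m).IsPositiveReducedLift m) :
    let _ := rightSymModule β X Y
    Submodule.span (SymFun k)ᵐᵒᵖ (zebraSet z B) = ⊤ := by
  let _ := rightSymModule β X Y
  let T := Submodule.span (SymFun k)ᵐᵒᵖ (zebraSet z B)
  -- The span over symmetric functions is regarded as a `k`-submodule. It is stable under all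
  -- bubbles because the bubble algebra lies in the image of `β`.
  let S : Submodule k (obj z X ⟶ obj z Y) :=
    { carrier := T
      add_mem' := T.add_mem
      zero_mem' := T.zero_mem
      smul_mem' := fun c f hf => by
        have h := T.smul_mem (MulOpposite.op (algebraMap k (SymFun k) c)) hf
        have h1 : MulOpposite.op (algebraMap k (SymFun k) c) • f = c • f := by
          change act z f (β (algebraMap k (SymFun k) c)) = c • f
          rw [β.commutes, Algebra.algebraMap_eq_smul_one, act]
          refine (congrArg (fun t => _ ≫ t ≫ _) (tens_smul z c f (𝟙 (unit z)))).trans ?_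
          rw [Linear.smul_comp, Linear.comp_smul, tens_unit]
        exact h1 ▸ h }
  have hS : S = ⊤ := eq_top_of_zebraSet_subset hB Submodule.subset_span fun w hw f hf => by
    obtain ⟨b, rfl⟩ := bubAlg_le_range hz hβ hw
    exact T.smul_mem (MulOpposite.op b) hf
  refine eq_top_iff.2 fun f _ => ?_
  have : f ∈ S := hS ▸ trivial
  exact this

end

end QuantumIsomeric

end

/-! ### The proposition -/

open QuantumIsomeric QuantumIsomeric.AQ CategoryTheory in
theorem mainTheorem10 {k : Type*} [CommRing k] (hk : ringChar k ≠ 2) (z : k) (hz : IsUnit z) :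
    ∃ β : SymFun k →ₐ[k] End (unit z),
      (∀ r : ℕ, 1 ≤ r →
        β (SymFun.e k r) = ((-1) ^ (r - 1) * z) • mor z (Diag.leftBubble (2 * r))) ∧
      (∀ r : ℕ, 1 ≤ r → β (SymFun.h k r) = z • mor z (Diag.rightBubble (2 * r))) ∧
      ∀ (X Y : Word) (B : Matching X Y → StringDiagram X Y),
        (∀ m, (B m).IsPositiveReducedLift m) →
        letI := rightSymModule β X Y
        Submodule.span (SymFun k)ᵐᵒᵖ (zebraSet z B) = ⊤ := by
  obtain ⟨β, he, hh⟩ := exists_symHom z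
  refine ⟨β, fun r hr => ?_, fun r hr => ?_, fun X Y B hB => span_zebraSet hz hh hB⟩
  · rw [mor_leftBubble, he r hr]
  · rw [mor_rightBubble, hh r hr]
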